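/- **Model.** Terms are built from IP addresses, strings, $\top$, $\bot$, $\Diamond$, nonces and placeholder variables by sequences $\langle t_1,\dots,t_k\rangle$, projections $\pi_i$, public keys $\mathsf{pub}(k)$, asymmetric and symmetric encryption and decryption $\mathsf{enc_a},\mathsf{dec_a},\mathsf{enc_s},\mathsf{dec_s}$, signatures $\mathsf{sig}$ and $\mathsf{checksig}$, modulo the congruence $\equiv$ generated by $\mathsf{dec_a}(\mathsf{enc_a}(x,\mathsf{pub}(y)),y)=x$, $\mathsf{dec_s}(\mathsf{enc_s}(x,y),y)=x$, $\mathsf{checksig}(\mathsf{sig}(x,y),x,\mathsf{pub}(y))=\top$, $\pi_i(\langle t_1,\dots,t_k\rangle)=t_i$ for $1\le i\le k$, and $=\Diamond$ otherwise. $d_\emptyset(M)$ is the set of terms that are, modulo $\equiv$, built by these symbols from the elements of $M$ and from constants other than nonces. A system is a family of processes, each with a set of addresses, a term as its state, and a nondeterministic relation; in a processing step, one waiting event $\langle a,f,m\rangle$ (receiver, sender, message) is delivered to a process that listens to $a$; the process changes its state and emits finitely many events, where fresh nonces replace the placeholders in the output. A run $\rho$ is a finite or infinite sequence of configurations $(S^j,E^j,N^j)$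 (states, waiting events, unused nonces) connected by processing steps, starting from the initial states, an initial sequence $E^0$ that contains for every address infinitely many trigger messages and nothing else, and an initial sequence $N^0$ of pairwise different nonces that are neither keys nor secrets. **SPRESSO web system for authentication analysis.** The processes are: one network attacker, which listens to all addresses, emits arbitrary messages derivable from its knowledge under arbitrary sender addresses, and is the DNS server that browsers and RPs use; web browsers (windows, documents, scripts and an attacker script that outputs anything derivable from its input, cookies, local and session storage, redirects, `XMLHttpRequest`, `postMessage`, Strict Transport Security, HTTP and HTTPS); relying parties (RPs), identity providers (IdPs) and forwarders (FWDs), which run the SPRESSO single sign-on protocol over HTTPS. Each domain belongs to at most one process, with its own private SSL key, initially known only to that process; all parties know all public SSL keys. Each RP $r$ has a fixed domain $s_0(r).\mathsf{FWDDomain}$ of a forwarder; each IdP has its own private signing key. There is a finite set of identities (email addresses) $i=\langle name, domain\rangle$; each identity is owned by exactly one browser; its governor is the process to which its domain belongs; the secrets of the identities are pairwise different and are different from all keys. Each browser initially knows its own identities and, for each domain of these, the secret of one of its own identities of that domain, which it gives only to scripts of the HTTPS origin of that domain; an IdP initially knows the secrets of the identities that it governs; the attacker knows no secrets. An RP, IdP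 or FWD becomes corrupted (dishonest) when it receives a corrupt message; a browser becomes fully corrupted by a full-corrupt message, or close-corrupted by a close-corrupt message, in which case its windows, session cookies, session storage, secrets and pending requests are deleted first. From then on these processes send arbitrary messages derivable from their state. A process is honest in $S^j$ if it is not corrupted in $S^j$. The protocol: the RP page's script sends an identity $i$ of the browser to the RP in a startLogin request; the RP fetches the public signature key of the IdP of $i$'s domain over HTTPS, unless it is already cached, and creates a login session with a login session token, a tag $\mathsf{enc_s}(\langle \text{RP domain}, \text{nonce}\rangle,\text{tagKey})$ and a key $\text{iaKey}$; the browser is redirected to the IdP's login dialog, which obtains from the IdP, using the secret (or a session cookie), the identity assertion $\mathsf{sig}(\langle tag,i,\mathsf{FWDDomain}\rangle, k_{\mathrm{sign}})$ and encrypts it with $\text{iaKey}$; the page of the FWD, embedded in that dialog, forwards the ciphertext by `postMessage` to the RP's origin that it obtained by decrypting the tag; the RP's script posts it to the RP, which checks the Origin header of the request, the login session and the signature, and, if all checks succeed, deletes the login session, creates a *service token* $\langle n,i\rangle$ with a fresh nonce $n$, records it in $\mathsf{serviceTokens}$ and returns it in its HTTPS response. The message upon whose receipt $r$ creates $\langle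 n,i\rangle$ is *the request corresponding to $\langle n,i\rangle$*. **Theorem.** Every SPRESSO web system for authentication analysis is secure with respect to authentication: for every run $\rho$ of the system, every configuration $(S^j,E^j,N^j)$ in $\rho$, every RP $r$ that is honest in $S^j$ and for which $s_0(r).\mathsf{FWDDomain}$ is a domain of an FWD that is honest in $S^j$, and every service token $\langle n,i\rangle$ (with $i$ an identity) recorded in $S^j(r).\mathsf{serviceTokens}$, the following holds. (A) If $\langle n,i\rangle\in d_\emptyset(S^j(\mathsf{attacker}))$, i.e. if the attacker can derive the token, then the browser owning $i$ is fully corrupted in $S^j$, or the governor of $i$ is not an IdP that is honest in $S^j$. (B) If the request corresponding to $\langle n,i\rangle$ was sent by a browser $b$ that is honest in $S^j$, then $b$ owns $i$. -/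

import Mathlib

/-! # Terms, equational theory, derivability, Dolev-Yao processes and runs -/

namespace Spresso

/-- The named string constants of the model (pairwise different ASCII strings). -/
inductive Kw : Type
  -- message tags
  | trigger | corrupt | fullcorrupt | closecorrupt
  | httpReq | httpResp | dnsResolve | dnsResolved | url
  -- protocols and methods
  | http | https | get | post | head | connect | traceMethod | trackMethod
  -- script commands and window names
  | href | iframe | form | setScript | setScriptState | xhr | back | forward | close | postMessage
  | blank | self
  -- headers and status codes
  | hOrigin | hSetCookie | hCookie | hLocation | hReferer | hSts
  | s200 | s303 | s307
  -- string representations of scripts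
  | attScript | scriptRp | scriptRpRedir | scriptIdp | scriptFwd
  -- dictionary keys
  | tagKey | loginSessionToken | fwdDomain | email | tag | iaKey | eia | signkey | password
  | sessionid
  -- script states and the message `ready`
  | start | expectStartLoginResponse | expectFWDReady | expectEIA | expectServiceToken
  | expectIA | done | expectTagKey | ready
  -- paths
  | pRoot | pStartLogin | pRedir | pLogin | pWkInfo | pWkLogin | pSign

/-- The set of strings: the named constants and a countable supply of further strings. -/
inductive Str : Type
  | kw (k : Kw)
  | other (n : ℕ)

/-- Variables: `nu n` are the placeholders of processes, `lam n` those of scripts. -/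
inductive Var : Type
  | nu (n : ℕ)
  | lam (n : ℕ)

/-- Terms over the signature, the nonces and the placeholders. IP addresses and nonces are
represented by natural numbers (in separate constructors). -/
inductive Term : Type
  | addr (a : ℕ)
  | str (s : Str)
  | top
  | bot
  | undef
  | nonce (n : ℕ)
  | var (v : Var)
  | pub (k : Term)
  | enca (x k : Term)
  | deca (x k : Term)
  | encs (x k : Term)
  | decs (x k : Term)
  | sig (x k : Term)
  | checksig (s x k : Term)
  | seq (ts : List Term)
  | proj (i : ℕ) (t : Term)

/-- The congruence induced by the equational theory. -/
inductive Term.Equiv : Term → Term → Prop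
  | refl (t) : Term.Equiv t t
  | symm {t u} : Term.Equiv t u → Term.Equiv u t
  | trans {t u v} : Term.Equiv t u → Term.Equiv u v → Term.Equiv t v
  | deca_enca (x y) : Term.Equiv (.deca (.enca x (.pub y)) y) x
  | decs_encs (x y) : Term.Equiv (.decs (.encs x y) y) x
  | checksig_sig (x y) : Term.Equiv (.checksig (.sig x y) x (.pub y)) .top
  | proj_in {ts : List Term} {i : ℕ} {t} : ts[i]? = some t →
      Term.Equiv (.proj (i + 1) (.seq ts)) t
  | proj_out {ts : List Term} {i : ℕ} : i = 0 ∨ ts.length < i →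
      Term.Equiv (.proj i (.seq ts)) .undef
  | pub {k k'} : Term.Equiv k k' → Term.Equiv (.pub k) (.pub k')
  | enca {x x' k k'} : Term.Equiv x x' → Term.Equiv k k' → Term.Equiv (.enca x k) (.enca x' k')
  | deca {x x' k k'} : Term.Equiv x x' → Term.Equiv k k' → Term.Equiv (.deca x k) (.deca x' k')
  | encs {x x' k k'} : Term.Equiv x x' → Term.Equiv k k' → Term.Equiv (.encs x k) (.encs x' k')
  | decs {x x' k k'} : Term.Equiv x x' → Term.Equiv k k' → Term.Equiv (.decs x k) (.decs x' k')
  | sig {x x' k k'} : Term.Equiv x x' → Term.Equiv k k' → Term.Equiv (.sig x k) (.sig x' k')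
  | checksig {s s' x x' k k'} : Term.Equiv s s' → Term.Equiv x x' → Term.Equiv k k' →
      Term.Equiv (.checksig s x k) (.checksig s' x' k')
  | seq {l r : List Term} {t t'} : Term.Equiv t t' →
      Term.Equiv (.seq (l ++ t :: r)) (.seq (l ++ t' :: r))
  | proj {i t t'} : Term.Equiv t t' → Term.Equiv (.proj i t) (.proj i t')

infix:50 " ≈ₜ " => Term.Equiv

noncomputable section
open Classical

/-! ### Normal forms -/

/-- Root reduction of `deca x k`, for `x` and `k` in normal form. -/
def redDeca (x k : Term) : Term :=
  match x with
  | .enca y (.pub k') => if k' = k then y else .deca x k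
  | _ => .deca x k

def redDecs (x k : Term) : Term :=
  match x with
  | .encs y k' => if k' = k then y else .decs x k
  | _ => .decs x k

def redChecksig (s x k : Term) : Term :=
  match s with
  | .sig y k' => if y = x ∧ k = .pub k' then .top else .checksig s x k
  | _ => .checksig s x k

def redProj (i : ℕ) (t : Term) : Term :=
  match t with
  | .seq ts => if i = 0 then .undef else ts.getD (i - 1) .undef
  | _ => .proj i t

mutual
/-- The normal form of a term. -/
def Term.nf : Term → Term
  | .addr a => .addr a
  | .str s => .str s
  | .top => .top
  | .bot => .bot
  | .undef => .undef
  | .nonce n => .nonce n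
  | .var v => .var v
  | .pub k => .pub k.nf
  | .enca x k => .enca x.nf k.nf
  | .deca x k => redDeca x.nf k.nf
  | .encs x k => .encs x.nf k.nf
  | .decs x k => redDecs x.nf k.nf
  | .sig x k => .sig x.nf k.nf
  | .checksig s x k => redChecksig s.nf x.nf k.nf
  | .seq ts => .seq (Term.nfList ts)
  | .proj i t => redProj i t.nf
def Term.nfList : List Term → List Term
  | [] => []
  | t :: ts => t.nf :: Term.nfList ts
end

theorem nfList_eq_map (ts : List Term) : Term.nfList ts = ts.map Term.nf := by
  induction ts with
  | nil => rfl
  | cons t ts ih => simp [Term.nfList, ih]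

theorem Equiv.nf_eq {t u : Term} (h : t ≈ₜ u) : t.nf = u.nf := by
  induction h with
  | refl => rfl
  | symm _ ih => exact ih.symm
  | trans _ _ h1 h2 => exact h1.trans h2
  | deca_enca x y => simp [Term.nf, redDeca]
  | decs_encs x y => simp [Term.nf, redDecs]
  | checksig_sig x y => simp [Term.nf, redChecksig]
  | proj_in h => simp [Term.nf, redProj, nfList_eq_map, h]
  | proj_out h =>
    rcases h with h | h
    · simp [Term.nf, redProj, h]
    · have h1 : _ := List.getElem?_eq_none (Nat.le_sub_one_of_lt h)
      simp [Term.nf, redProj, nfList_eq_map, h1]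
  | seq _ ih => simp [Term.nf, nfList_eq_map, ih]
  | pub _ ih => simp [Term.nf, ih]
  | proj _ ih => simp [Term.nf, ih]
  | checksig _ _ _ h1 h2 h3 => simp [Term.nf, h1, h2, h3]
  | enca _ _ h1 h2 => simp [Term.nf, h1, h2]
  | deca _ _ h1 h2 => simp [Term.nf, h1, h2]
  | encs _ _ h1 h2 => simp [Term.nf, h1, h2]
  | decs _ _ h1 h2 => simp [Term.nf, h1, h2]
  | sig _ _ h1 h2 => simp [Term.nf, h1, h2]

theorem redDeca_equiv (x k : Term) : .deca x k ≈ₜ redDeca x k := by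
  unfold redDeca
  split
  · split_ifs with h
    · subst h; exact .deca_enca _ _
    · exact .refl _
  · exact .refl _

theorem redDecs_equiv (x k : Term) : .decs x k ≈ₜ redDecs x k := by
  unfold redDecs
  split
  · split_ifs with h
    · subst h; exact .decs_encs _ _
    · exact .refl _
  · exact .refl _

theorem redChecksig_equiv (s x k : Term) : .checksig s x k ≈ₜ redChecksig s x k := by
  unfold redChecksig
  split
  · split_ifs with h
    · obtain ⟨rfl, rfl⟩ := h; exact .checksig_sig _ _
    · exact .refl _
  · exact .refl _

theorem redProj_equiv (i : ℕ) (t : Term) : .proj i t ≈ₜ redProj i t := by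
  unfold redProj
  split
  · rename_i ts
    split_ifs with h
    · exact .proj_out (.inl h)
    · obtain ⟨j, rfl⟩ := Nat.exists_eq_succ_of_ne_zero h
      simp only [Nat.succ_eq_add_one, Nat.add_sub_cancel, List.getD_eq_getElem?_getD]
      cases hj : ts[j]? with
      | some u => exact .proj_in hj
      | none => exact .proj_out (.inr (Nat.lt_succ_of_le (List.getElem?_eq_none_iff.1 hj)))
  · exact .refl _

mutual
theorem equiv_nf : ∀ t : Term, t ≈ₜ t.nf
  | .addr _ => .refl _
  | .str _ => .refl _
  | .top => .refl _
  | .bot => .refl _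
  | .undef => .refl _
  | .nonce _ => .refl _
  | .var _ => .refl _
  | .pub k => .pub (equiv_nf k)
  | .enca x k => .enca (equiv_nf x) (equiv_nf k)
  | .deca x k => .trans (.deca (equiv_nf x) (equiv_nf k)) (redDeca_equiv _ _)
  | .encs x k => .encs (equiv_nf x) (equiv_nf k)
  | .decs x k => .trans (.decs (equiv_nf x) (equiv_nf k)) (redDecs_equiv _ _)
  | .sig x k => .sig (equiv_nf x) (equiv_nf k)
  | .checksig s x k =>
    .trans (.checksig (equiv_nf s) (equiv_nf x) (equiv_nf k)) (redChecksig_equiv _ _ _)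
  | .seq ts => equiv_nfList ts []
  | .proj _ t => .trans (.proj (equiv_nf t)) (redProj_equiv _ _)
theorem equiv_nfList : ∀ ts l : List Term, .seq (l ++ ts) ≈ₜ .seq (l ++ Term.nfList ts)
  | [], _ => .refl _
  | t :: ts, l => by
    refine .trans (.seq (l := l) (r := ts) (equiv_nf t)) ?_
    have h := equiv_nfList ts (l ++ [t.nf])
    simpa [Term.nfList] using h
end

/-- Equality modulo the equational theory is equality of normal forms. -/
theorem equiv_iff_nf {t u : Term} : t ≈ₜ u ↔ t.nf = u.nf :=
  ⟨Equiv.nf_eq, fun h => .trans (equiv_nf t) (h ▸ (equiv_nf u).symm)⟩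

/-! ### Substitution, derivability -/

mutual
def Term.subst (σ : Var → Term) : Term → Term
  | .addr a => .addr a
  | .str s => .str s
  | .top => .top
  | .bot => .bot
  | .undef => .undef
  | .nonce n => .nonce n
  | .var v => σ v
  | .pub k => .pub (k.subst σ)
  | .enca x k => .enca (x.subst σ) (k.subst σ)
  | .deca x k => .deca (x.subst σ) (k.subst σ)
  | .encs x k => .encs (x.subst σ) (k.subst σ)
  | .decs x k => .decs (x.subst σ) (k.subst σ)
  | .sig x k => .sig (x.subst σ) (k.subst σ)
  | .checksig s x k => .checksig (s.subst σ) (x.subst σ) (k.subst σ)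
  | .seq ts => .seq (Term.substList σ ts)
  | .proj i t => .proj i (t.subst σ)
def Term.substList (σ : Var → Term) : List Term → List Term
  | [] => []
  | t :: ts => t.subst σ :: Term.substList σ ts
end

mutual
/-- The indices of the placeholders `nu n` occurring in a term. -/
def Term.nus : Term → Finset ℕ
  | .addr _ => ∅
  | .str _ => ∅
  | .top => ∅
  | .bot => ∅
  | .undef => ∅
  | .nonce _ => ∅
  | .var (.nu n) => {n}
  | .var (.lam _) => ∅
  | .pub k => k.nus
  | .enca x k => x.nus ∪ k.nus
  | .deca x k => x.nus ∪ k.nus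
  | .encs x k => x.nus ∪ k.nus
  | .decs x k => x.nus ∪ k.nus
  | .sig x k => x.nus ∪ k.nus
  | .checksig s x k => s.nus ∪ x.nus ∪ k.nus
  | .seq ts => Term.nusList ts
  | .proj _ t => t.nus
def Term.nusList : List Term → Finset ℕ
  | [] => ∅
  | t :: ts => t.nus ∪ Term.nusList ts
end

/-- The instances `τ[m₁/x₁, …, mₖ/xₖ]` with `mᵢ ∈ M` of terms `τ` that contain no nonces and
only the variables `x₁, …, xₖ` and those in `V`. -/
inductive Built (V : Set Var) (M : Set Term) : Term → Prop
  | mem {t} : t ∈ M → Built V M t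
  | var {v} : v ∈ V → Built V M (.var v)
  | addr (a) : Built V M (.addr a)
  | str (s) : Built V M (.str s)
  | top : Built V M .top
  | bot : Built V M .bot
  | undef : Built V M .undef
  | pub {k} : Built V M k → Built V M (.pub k)
  | enca {x k} : Built V M x → Built V M k → Built V M (.enca x k)
  | deca {x k} : Built V M x → Built V M k → Built V M (.deca x k)
  | encs {x k} : Built V M x → Built V M k → Built V M (.encs x k)
  | decs {x k} : Built V M x → Built V M k → Built V M (.decs x k)
  | sig {x k} : Built V M x → Built V M k → Built V M (.sig x k)
  | checksig {s x k} : Built V M s → Built V M x → Built V M k → Built V M (.checksig s x k)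
  | seq {ts : List Term} : (∀ t ∈ ts, Built V M t) → Built V M (.seq ts)
  | proj {t} (i) : Built V M t → Built V M (.proj i t)

/-- `derivable V M` is the set `d_V(M)` of terms derivable from `M` with placeholders `V`. -/
def derivable (V : Set Var) (M : Set Term) : Set Term := {m | ∃ t, Built V M t ∧ m ≈ₜ t}

def Vprocess : Set Var := Set.range Var.nu
def Vscript : Set Var := Set.range Var.lam

/-! ### Atomic processes, configurations, processing steps, runs -/

/-- An atomic process: the addresses it listens to, its relation (input event, old state,
sequence of output events, new state) and its initial state. -/
structure AtomicProc where
  addrs : Set ℕ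
  rel : Term → Term → List Term → Term → Prop
  init : Term

/-- A configuration: states, sequence of waiting events, sequence of unused nonces. -/
structure Config (P : Type*) where
  S : P → Term
  E : ℕ → Term
  N : ℕ → ℕ

/-- `l` followed by the infinite sequence `g`. -/
def prepend (l : List Term) (g : ℕ → Term) : ℕ → Term := fun n => l.getD n (g (n - l.length))

/-- The infinite sequence `g` without its entry at position `k`. -/
def removeAt (g : ℕ → Term) (k : ℕ) : ℕ → Term := fun n => if n < k then g n else g (n + 1)

/-- Replaces the placeholders with indices in `V`, in increasing order, by the first `|V|` nonces
of the sequence `N`. -/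
def freshSubst (V : Finset ℕ) (N : ℕ → ℕ) : Var → Term
  | .nu v => .nonce (N (V.filter (· < v)).card)
  | .lam n => .var (.lam n)

/-- A processing step in which `p` receives `ein` and outputs `eout`. -/
def Step {P : Type*} (sys : P → AtomicProc) (c c' : Config P) (p : P) (ein : Term)
    (eout : List Term) : Prop :=
  ∃ (k a f : ℕ) (m : Term) (Eν : List Term) (sν : Term),
    c.E k = ein ∧ ein = .seq [.addr a, .addr f, m] ∧ a ∈ (sys p).addrs ∧
    (sys p).rel ein (c.S p) Eν sν ∧
    let V := sν.nus ∪ Term.nusList Eν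
    let σ := freshSubst V c.N
    eout = Eν.map (Term.subst σ) ∧
    c'.S p = sν.subst σ ∧ (∀ q, q ≠ p → c'.S q = c.S q) ∧
    c'.E = prepend eout (removeAt c.E k) ∧
    c'.N = fun n => c.N (n + V.card)

/-- A finite or infinite run initiated by `E0`: the configurations `conf 0, conf 1, …` up to index
`len` (which may be `⊤`), with the data of the processing steps between them. The initial
sequence of nonces consists of pairwise different nonces from the set `fresh`. -/
structure Run {P : Type*} (sys : P → AtomicProc) (E0 : ℕ → Term) (fresh : Set ℕ) where
  len : ℕ∞
  conf : ℕ → Config P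
  proc : ℕ → P
  ein : ℕ → Term
  eout : ℕ → List Term
  init_S : ∀ p, (conf 0).S p = (sys p).init
  init_E : (conf 0).E = E0
  init_N : Function.Injective (conf 0).N ∧ ∀ n, (conf 0).N n ∈ fresh
  step : ∀ i : ℕ, ((i + 1 : ℕ) : ℕ∞) ≤ len →
    Step sys (conf i) (conf (i + 1)) (proc i) (ein i) (eout i)

/-- The relation of an attacker process that may use all sender addresses. -/
def attackerRel (e s : Term) (E : List Term) (s' : Term) : Prop :=
  s' = .seq [e, .seq E, s] ∧
  ∀ x ∈ E, ∃ (a f : ℕ) (m : Term), x = .seq [.addr a, .addr f, m] ∧ m ∈ derivable Vprocess {e, s}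

/-! # Message formats and operations on terms -/

/-- The string constant `k` as a term. -/
abbrev K (k : Kw) : Term := .str (.kw k)
abbrev ν (n : ℕ) : Term := .var (.nu n)

/-- Pointers: sequences of positions, counted from 1. -/
abbrev Ptr := List ℕ

/-- `get t p` is the (normal form of the) subterm `t.p` of `t` at the pointer `p`. -/
def get : Term → Ptr → Term
  | t, [] => t.nf
  | t, i :: p => get (.proj i t) p

/-- Replaces the subterm at the pointer `p` by `v` (no effect if there is no such position). -/
def setAt : Term → Ptr → Term → Term
  | _, [], v => v
  | t, i :: p, v =>
    match t.nf with
    | .seq ts => if i = 0 then .seq ts else .seq (ts.modify (i - 1) fun u => setAt u p v)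
    | u => u

/-- The elements of a sequence term (no elements if the term is not a sequence). -/
def items (t : Term) : List Term :=
  match t.nf with
  | .seq ts => ts
  | _ => []

/-- `x ∈ t` for a sequence term `t`, modulo the equational theory. -/
def Mem (x t : Term) : Prop := ∃ y ∈ items t, y ≈ₜ x

/-- The valid positions in a sequence term. -/
def IsIndex (i : ℕ) (t : Term) : Prop := 1 ≤ i ∧ i ≤ (items t).length

/-- Appends `v` to the sequence at position `p`. -/
def appendAt (t : Term) (p : Ptr) (v : Term) : Term := setAt t p (.seq (items (get t p) ++ [v]))

/-- `e` is a dictionary element `⟨k, v⟩` for some value `v`. -/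
def HasKey (k e : Term) : Prop := ∃ v, e ≈ₜ .seq [k, v]

/-- `k ∈ z` for a dictionary `z`. -/
def dictMem (z k : Term) : Prop := ∃ e ∈ items z, HasKey k e

/-- `z[k]`; the empty sequence if `k ∉ z`. -/
def dictGet (z k : Term) : Term :=
  match (items z).find? (fun e => HasKey k e) with
  | some e => get e [2]
  | none => .seq []

/-- The dictionary `z` after `z[k] := v`. -/
def dictSet (z k v : Term) : Term :=
  if dictMem z k then .seq ((items z).map fun e => if HasKey k e then .seq [k, v] else e)
  else .seq (items z ++ [.seq [k, v]])

/-- The dictionary `z - k`. -/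
def dictDel (z k : Term) : Term := .seq ((items z).filter fun e => ¬ HasKey k e)

/-- HTTP requests. The components of a request are, in this order: tag (1), nonce (2), method (3),
host (4), path (5), parameters (6), headers (7), body (8). -/
def httpRequest (nonce method host path parameters headers body : Term) : Term :=
  .seq [K .httpReq, nonce, method, host, path, parameters, headers, body]

/-- HTTP responses: tag (1), nonce (2), status (3), headers (4), body (5). -/
def httpResponse (nonce status headers body : Term) : Term :=
  .seq [K .httpResp, nonce, status, headers, body]

/-- URLs: tag (1), protocol (2), host (3), path (4), parameters (5). -/
def urlTerm (protocol host path parameters : Term) : Term :=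
  .seq [K .url, protocol, host, path, parameters]

/-- DNS responses `⟨DNSResolved, domain, result, nonce⟩`. -/
def IsDNSResponse (domains : Finset Str) (m : Term) : Prop :=
  ∃ d ∈ domains, ∃ a n : ℕ, m ≈ₜ .seq [K .dnsResolved, .str d, .addr a, .nonce n]

/-- Cookies `⟨name, ⟨value, secure, session, httpOnly⟩⟩`. -/
def IsCookie (c : Term) : Prop :=
  ∃ name value secure session httpOnly : Term,
    c ≈ₜ .seq [name, .seq [value, secure, session, httpOnly]] ∧
    (secure = .top ∨ secure = .bot) ∧ (session = .top ∨ session = .bot) ∧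
    (httpOnly = .top ∨ httpOnly = .bot)

/-- The output of an algorithm: a sequence of (proto)events and a new state. A nondeterministic
algorithm is modelled by the set of its possible outputs. -/
abbrev Out := List Term × Term

/-- The origin `⟨host, protocol⟩` of a document. -/
def docOrigin (d : Term) : Term := .seq [get d [2, 3], get d [2, 2]]

/-! # Scripts

A script receives a term `⟨tree, docnonce, scriptstate, scriptinputs, cookies, localStorage,
sessionStorage, ids, secret⟩` and outputs a term `⟨state, cookies, localStorage, sessionStorage,
command⟩`. -/

/-- The subwindows of a document or of a limited document `⟨nonce, subwindows⟩`. -/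
def docSubwindows (d : Term) : Term := if (items d).length = 2 then get d [2] else get d [7]

/-- The windows, on all levels, of a (cleaned) window tree. -/
inductive TreeWindow (tree : Term) : Term → Prop
  | top {w} : w ∈ items tree → TreeWindow tree w
  | sub {w d w'} : TreeWindow tree w → d ∈ items (get w [2]) →
      w' ∈ items (docSubwindows d) → TreeWindow tree w'

/-- In `tree`, the window `w` contains the document `d`, which has the nonce `n`. -/
def TreeDoc (tree n w d : Term) : Prop :=
  TreeWindow tree w ∧ d ∈ items (get w [2]) ∧ get d [1] ≈ₜ n

/-- Some element of `A`, or `x` if there is none. -/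
def orElse (A : Set Term) (x : Term) : Set Term := {y | y ∈ A ∨ (A = ∅ ∧ y = x)}

def scrGetOrigin (tree n : Term) : Set Term :=
  orElse {o | ∃ w d, TreeDoc tree n w d ∧ o = docOrigin d} .undef

def scrGetParameters (tree n : Term) : Set Term :=
  orElse {o | ∃ w d, TreeDoc tree n w d ∧ o = get d [2, 5]} .undef

def scrSubwindows (tree n : Term) : Set Term :=
  orElse {o | ∃ w d, TreeDoc tree n w d ∧ o = docSubwindows d} (.seq [])

/-- The nonce of the document whose subwindows contain the window of the document `n`. -/
def scrParentWindow (tree n : Term) : Set Term :=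
  orElse {o | ∃ w d w' d', TreeDoc tree n w d ∧ TreeWindow tree w' ∧ d' ∈ items (get w' [2]) ∧
    w ∈ items (docSubwindows d') ∧ o = get d' [1]} n

/-- The nonce of the document in some window opened by the window of the document `n`, and `n` if
there is no such window or no document in it. -/
def scrAuxWindow (tree n : Term) : Set Term :=
  orElse {o | ∃ w d w', TreeDoc tree n w d ∧ TreeWindow tree w' ∧ get w' [3] ≈ₜ get w [1] ∧
    ((∃ d' ∈ items (get w' [2]), o = get d' [1]) ∨ (items (get w' [2]) = [] ∧ o = n))} n

/-- The nonce of the opener of the window of the document `n`. -/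
def scrOpenerWindow (tree n : Term) : Set Term :=
  orElse {o | ∃ w d, TreeDoc tree n w d ∧ o = get w [3]} .undef

/-- The first script input that matches a pattern, `bot` if there is none. -/
def chooseInput (scriptinputs : Term) (pattern : Term → Prop) : Term :=
  ((items scriptinputs).find? fun t => pattern t).getD .bot

/-- Output of an honest script with input `i`: new script state, unchanged data, command. -/
def scriptOut (i s' command : Term) : Term :=
  .seq [s', get i [5], get i [6], get i [7], command]

/-- The attacker script outputs everything that is derivable from its input. -/
def scriptAtt (i : Term) : Set Term := derivable Vscript {i}

/-- Initial state of `scriptRp`. The components of its states are: q (1), loginSessionToken (2),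
refXHR (3), tagKey (4), FWDDomain (5), email (6). -/
def initStateRp : Term := .seq [K .start, .bot, .bot, .bot, .bot, .bot]

/-- The script of the index page of an RP. -/
def scriptRp (i : Term) : Set Term :=
  let tree := get i [1]
  let docnonce := get i [2]
  let s := get i [3]
  let scriptinputs := get i [4]
  let ids := get i [8]
  let lam1 : Term := .var (.lam 1)
  {o | ∃ origin ∈ scrGetOrigin tree docnonce,
    let rpUrl := fun path params => urlTerm (K .https) (get origin [1]) (K path) params
    if get s [1] ≈ₜ K .start then
      ∃ email ∈ items ids,
        let s := setAt (setAt s [6] email) [3] lam1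
        o = scriptOut i (setAt s [1] (K .expectStartLoginResponse))
          (.seq [K .xhr, rpUrl .pStartLogin (.seq []), K .post, email, lam1])
    else if get s [1] ≈ₜ K .expectStartLoginResponse then
      let input := chooseInput scriptinputs fun t => ∃ x, t ≈ₜ .seq [K .xhr, x, get s [3]]
      if input ≈ₜ .bot then o = scriptOut i s (.seq [])
      else
        let body := get input [2]
        let token := dictGet body (K .loginSessionToken)
        let s := setAt s [2] token
        let s := setAt s [4] (dictGet body (K .tagKey))
        let s := setAt s [5] (dictGet body (K .fwdDomain))
        o = scriptOut i (setAt s [1] (K .expectFWDReady))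
          (.seq [K .href, rpUrl .pRedir (.seq [.seq [K .loginSessionToken, token]]),
            K .blank, .bot])
    else if get s [1] ≈ₜ K .expectFWDReady then
      ∃ aux ∈ scrAuxWindow tree docnonce, ∃ subs ∈ scrSubwindows tree aux,
        let fwdWindow := get subs [1, 1]
        let fwdOrigin := Term.seq [get s [5], K .https]
        let input := chooseInput scriptinputs fun t =>
          t ≈ₜ .seq [K .postMessage, fwdWindow, fwdOrigin, K .ready]
        if input ≈ₜ .bot then o = scriptOut i s (.seq [])
        else o = scriptOut i (setAt s [1] (K .expectEIA))
          (.seq [K .postMessage, fwdWindow, .seq [K .tagKey, get s [4]], fwdOrigin])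
    else if get s [1] ≈ₜ K .expectEIA then
      ∃ aux ∈ scrAuxWindow tree docnonce, ∃ subs ∈ scrSubwindows tree aux,
        let fwdWindow := get subs [1, 1]
        let fwdOrigin := Term.seq [get s [5], K .https]
        let input := chooseInput scriptinputs fun t =>
          ∃ x, t ≈ₜ .seq [K .postMessage, fwdWindow, fwdOrigin, .seq [K .eia, x]]
        if input ≈ₜ .bot then o = scriptOut i s (.seq [])
        else
          let body := Term.seq [.seq [K .eia, get input [4, 2]],
            .seq [K .loginSessionToken, get s [2]]]
          let s := setAt s [3] lam1
          o = scriptOut i (setAt s [1] (K .expectServiceToken))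
            (.seq [K .xhr, rpUrl .pLogin (.seq []), K .post, body, lam1])
    else o = scriptOut i s (.seq [])}

/-- The script of the redirection page of an RP; its state is the URL to redirect to. -/
def scriptRpRedir (i : Term) : Set Term :=
  {scriptOut i (get i [3]) (.seq [K .href, get i [3], .bot, .top])}

/-- The login dialog script of an IdP; the first component of its state is q. -/
def scriptIdp (i : Term) : Set Term :=
  let tree := get i [1]
  let docnonce := get i [2]
  let s := get i [3]
  let scriptinputs := get i [4]
  let secret := get i [9]
  {o | ∃ origin ∈ scrGetOrigin tree docnonce, ∃ params ∈ scrGetParameters tree docnonce,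
    let fwdDomain := dictGet params (K .fwdDomain)
    let tag := dictGet params (K .tag)
    if get s [1] ≈ₜ K .start then
      let body := Term.seq [.seq [K .email, dictGet params (K .email)],
        .seq [K .password, secret], .seq [K .tag, tag], .seq [K .fwdDomain, fwdDomain]]
      o = scriptOut i (setAt s [1] (K .expectIA))
        (.seq [K .xhr, urlTerm (K .https) (get origin [1]) (K .pSign) (.seq []), K .post, body,
          .bot])
    else if get s [1] ≈ₜ K .expectIA then
      let input := chooseInput scriptinputs fun t => ∃ x y, t ≈ₜ .seq [K .xhr, x, y]
      if input ≈ₜ .bot then o = scriptOut i s (.seq [])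
      else
        let eia := Term.encs (get input [2]) (dictGet params (K .iaKey))
        o = scriptOut i (setAt s [1] (K .done))
          (.seq [K .iframe, urlTerm (K .https) fwdDomain (K .pRoot)
            (.seq [.seq [K .tag, tag], .seq [K .eia, eia]]), K .self])
    else o = scriptOut i s (.seq [])}

/-- The script of a forwarder; its state is q. -/
def scriptFwd (i : Term) : Set Term :=
  let tree := get i [1]
  let docnonce := get i [2]
  let s := get i [3]
  let scriptinputs := get i [4]
  {o | ∃ parent ∈ scrParentWindow tree docnonce, ∃ target ∈ scrOpenerWindow tree parent,
    ∃ params ∈ scrGetParameters tree docnonce,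
    if s ≈ₜ K .start then
      o = scriptOut i (K .expectTagKey) (.seq [K .postMessage, target, K .ready, .bot])
    else if s ≈ₜ K .expectTagKey then
      let input := chooseInput scriptinputs fun t =>
        ∃ x y, t ≈ₜ .seq [K .postMessage, target, x, .seq [K .tagKey, y]]
      if input ≈ₜ .bot then o = scriptOut i s (.seq [])
      else
        let rpOrigin := Term.seq
          [get (.decs (dictGet params (K .tag)) (get input [4, 2])) [1], K .https]
        o = scriptOut i (K .done)
          (.seq [K .postMessage, target, .seq [K .eia, dictGet params (K .eia)], rpOrigin])
    else o = scriptOut i s (.seq [])}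

/-- `IsScript t R`: the term `t` is the string representation of the script with relation `R`. -/
inductive IsScript : Term → (Term → Set Term) → Prop
  | att : IsScript (K .attScript) scriptAtt
  | rp : IsScript (K .scriptRp) scriptRp
  | rpRedir : IsScript (K .scriptRpRedir) scriptRpRedir
  | idp : IsScript (K .scriptIdp) scriptIdp
  | fwd : IsScript (K .scriptFwd) scriptFwd

/-! # Web browsers

Browser states have the components windows (1), ids (2), secrets (3), cookies (4),
localStorage (5), sessionStorage (6), keyMapping (7), sts (8), DNSaddress (9), pendingDNS (10),
pendingRequests (11), isCorrupted (12). Windows are terms `⟨nonce, documents, opener⟩`, documents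
are terms `⟨nonce, location, referrer, script, scriptstate, scriptinputs, subwindows, active⟩`. -/

/-- `IsActiveDoc s w d`: `d` points to the active document of the window at `w`. -/
def IsActiveDoc (s : Term) (w d : Ptr) : Prop :=
  ∃ j, IsIndex j (get s (w ++ [2])) ∧ d = w ++ [2, j] ∧ get s (d ++ [8]) ≈ₜ .top

/-- The active document of the window at `w`; the empty sequence if there is none. -/
def activeDoc (s : Term) (w : Ptr) : Term :=
  ((items (get s (w ++ [2]))).find? fun d => get d [8] ≈ₜ .top).getD (.seq [])

/-- The pointers to the windows in the window list, and, recursively, in the active documents. -/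
inductive Subwindows (s : Term) : Ptr → Prop
  | top {i} : IsIndex i (get s [1]) → Subwindows s [1, i]
  | sub {w d i} : Subwindows s w → IsActiveDoc s w d → IsIndex i (get s (d ++ [7])) →
      Subwindows s (d ++ [7, i])

/-- The window at `w` is a subwindow of the active document of the window at `w'`. -/
def ChildOf (s : Term) (w w' : Ptr) : Prop :=
  Mem (get s w) (get (activeDoc s w') [7])

def SameOrigin (s : Term) (w w' : Ptr) : Prop :=
  docOrigin (activeDoc s w) ≈ₜ docOrigin (activeDoc s w')

/-- The windows that the active document of the window at `w` is allowed to navigate. -/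
inductive Navigable (s : Term) (w : Ptr) : Ptr → Prop
  | same {w'} : Subwindows s w' → SameOrigin s w' w → Navigable s w w'
  | ancestor {w'} : Subwindows s w' → Relation.TransGen (ChildOf s) w w' →
      (¬ ∃ w'', Subwindows s w'' ∧ ChildOf s w' w'') → Navigable s w w'
  | descendant {w' p} : Subwindows s w' → Subwindows s p →
      Relation.TransGen (ChildOf s) w' p → SameOrigin s p w → Navigable s w w'
  | opener {w' p} : Subwindows s w' → Subwindows s p → get s (w' ++ [3]) ≈ₜ get s (p ++ [1]) →
      Navigable s w p → Navigable s w w'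

mutual
/-- Removes all inactive documents and replaces the documents whose origin is not `o` by limited
documents, on all levels. -/
def cleanWindows (o : Term) : List Term → List Term
  | [] => []
  | .seq [n, .seq docs, op] :: ws => .seq [n, .seq (cleanDocs o docs), op] :: cleanWindows o ws
  | w :: ws => w :: cleanWindows o ws
def cleanDocs (o : Term) : List Term → List Term
  | [] => []
  | .seq [n, loc, ref, script, state, inputs, .seq subs, active] :: ds =>
    let d := Term.seq [n, loc, ref, script, state, inputs, .seq (cleanWindows o subs), active]
    if active ≈ₜ .top then
      (if docOrigin d ≈ₜ o then d else .seq [n, .seq (cleanWindows o subs)]) :: cleanDocs o ds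
    else cleanDocs o ds
  | _ :: ds => cleanDocs o ds
end

/-- The window tree of the browser state `s` as visible to the document `d`. -/
def clean (s d : Term) : Term := .seq (cleanWindows (docOrigin d) (items (get s [1])))

/-- Merges the cookies output by a script into the existing cookies. -/
def cookieMerge (oldcookies newcookies : Term) : Term :=
  let new := (items newcookies).filter fun c => ¬ get c [2, 4] ≈ₜ .top
  -- of several new cookies with the same name, only the rightmost is kept
  let new := new.foldr (fun c acc => if ∃ c' ∈ acc, get c' [1] ≈ₜ get c [1] then acc else c :: acc) []
  let old := items oldcookies
  .seq ((old.map fun c =>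
      match new.find? (fun c' => get c' [1] ≈ₜ get c [1]) with
      | some c' => if get c [2, 4] ≈ₜ .bot then c' else c
      | none => c) ++
    new.filter fun c => ¬ ∃ c' ∈ old, get c' [1] ≈ₜ get c [1])

/-- Adds a cookie received in a response. -/
def addCookie (oldcookies c : Term) : Term :=
  .seq (((items oldcookies).filter fun c' => ¬ get c' [1] ≈ₜ get c [1]) ++ [c])

/-- Determines the window that is navigated (and, for a new window, the new state). -/
def getNavigableWindow (w : Ptr) (window noreferrer s : Term) : Set (Ptr × Term) :=
  if window ≈ₜ K .blank then
    {([1, (items (get s [1])).length + 1],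
      appendAt s [1] (.seq [ν 9, .seq [], if noreferrer ≈ₜ .bot then get s (w ++ [1]) else .bot]))}
  else if ∃ w', Navigable s w w' ∧ get s (w' ++ [1]) ≈ₜ window then
    {x | Navigable s w x.1 ∧ get s (x.1 ++ [1]) ≈ₜ window ∧ x.2 = s}
  else {(w, s)}

/-- Determines a same-origin window. -/
def getWindow (w : Ptr) (window s : Term) : Set Ptr :=
  if ∃ w', Subwindows s w' ∧ get s (w' ++ [1]) ≈ₜ window then
    {x | ∃ w', Subwindows s w' ∧ get s (w' ++ [1]) ≈ₜ window ∧
      x = if SameOrigin s w' w then w' else w}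
  else {w}

/-- Cancels the pending requests of the window with nonce `n`. -/
def cancelNav (n s : Term) : Term :=
  let s := setAt s [11] (.seq ((items (get s [11])).filter fun e =>
    ¬ ∃ req key f, e ≈ₜ .seq [n, req, key, f]))
  setAt s [10] (.seq ((items (get s [10])).filter fun e =>
    ¬ ∃ x message protocol, e ≈ₜ .seq [x, .seq [n, message, protocol]]))

/-- Adds headers to a request, stores it and starts the DNS resolution. -/
def send (a reference message protocol origin referrer s : Term) : Set Out :=
  let host := get message [4]
  let protocol := if Mem host (get s [8]) then K .https else protocol
  let cookies := Term.seq (((items (dictGet (get s [4]) host)).filter fun c =>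
    get c [2, 2] ≈ₜ .top → protocol ≈ₜ K .https).map fun c => .seq [get c [1], get c [2, 1]])
  let message := setAt message [7] (dictSet (get message [7]) (K .hCookie) cookies)
  let message := if origin ≈ₜ .bot then message else
    setAt message [7] (dictSet (get message [7]) (K .hOrigin) origin)
  let message := if referrer ≈ₜ .bot then message else
    setAt message [7] (dictSet (get message [7]) (K .hReferer) referrer)
  let s' := setAt s [10]
    (dictSet (get s [10]) (ν 8) (.seq [reference, message, protocol]))
  {([.seq [get s [9], a, .seq [K .dnsResolve, host, ν 8]]], s')}

/-- Deactivates the document at position `i` of the window at `w`, makes the document at position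
`j` active, and cancels the pending requests of the window; used for moving back and forward. -/
def moveActive (s : Term) (w : Ptr) (i j : ℕ) : Term :=
  cancelNav (get s (w ++ [1]))
    (setAt (setAt s (w ++ [2, i, 8]) .bot) (w ++ [2, j, 8]) .top)

/-- Interprets the command `cmd` output by the script in the document at `d` (of the window at
`w`). -/
def runCommand (a : Term) (w d : Ptr) (s cmd : Term) : Set Out :=
  let location := get s (d ++ [2])
  let origin := docOrigin (get s d)
  match cmd.nf with
  | .seq [.str (.kw .href), url, window, noreferrer] =>
    {o | ∃ x ∈ getNavigableWindow w window noreferrer s,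
      let n := get x.2 (x.1 ++ [1])
      let req := httpRequest (ν 4) (K .get) (get url [3]) (get url [4]) (get url [5]) (.seq [])
        (.seq [])
      o ∈ send a n req (get url [2]) .bot (if noreferrer ≈ₜ .bot then location else .bot)
        (cancelNav n x.2)}
  | .seq [.str (.kw .iframe), url, window] =>
    {o | ∃ w' ∈ getWindow w window s, ∃ d', IsActiveDoc s w' d' ∧
      let req := httpRequest (ν 4) (K .get) (get url [3]) (get url [4]) (get url [5]) (.seq [])
        (.seq [])
      o ∈ send a (ν 5) req (get url [2]) .bot (get s (d' ++ [2]))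
        (appendAt s (d' ++ [7]) (.seq [ν 5, .seq [], .bot]))}
  | .seq [.str (.kw .form), url, method, data, window] =>
    if ¬ (method ≈ₜ K .get ∨ method ≈ₜ K .post) then {([], s)}
    else {o | ∃ x ∈ getNavigableWindow w window .bot s,
      let n := get x.2 (x.1 ++ [1])
      let isGet := method ≈ₜ K .get
      let req := httpRequest (ν 4) method (get url [3]) (get url [4])
        (if isGet then data else get url [5]) (.seq []) (if isGet then .seq [] else data)
      o ∈ send a n req (get url [2]) (if isGet then .bot else origin) location (cancelNav n x.2)}
  | .seq [.str (.kw .setScript), window, script] =>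
    {o | ∃ w' ∈ getWindow w window s, ∃ d', IsActiveDoc s w' d' ∧
      o = ([], setAt s (d' ++ [4]) script)}
  | .seq [.str (.kw .setScriptState), window, scriptstate] =>
    {o | ∃ w' ∈ getWindow w window s, ∃ d', IsActiveDoc s w' d' ∧
      o = ([], setAt s (d' ++ [5]) scriptstate)}
  | .seq [.str (.kw .xhr), url, method, data, xhrreference] =>
    if (method ≈ₜ K .connect ∨ method ≈ₜ K .traceMethod ∨ method ≈ₜ K .trackMethod) ∧
        ¬ (xhrreference ≈ₜ .bot ∨ ∃ n, xhrreference ≈ₜ .nonce n) then {([], s)}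
    else if ¬ get url [3] ≈ₜ get origin [1] ∨ ¬ get url [2] ≈ₜ get origin [2] then {([], s)}
    else
      let noData := method ≈ₜ K .get ∨ method ≈ₜ K .head
      let req := httpRequest (ν 4) method (get url [3]) (get url [4]) (get url [5]) (.seq [])
        (if noData then .seq [] else data)
      send a (.seq [get s (d ++ [1]), xhrreference]) req (get url [2])
        (if noData then .bot else origin) location s
  | .seq [.str (.kw .back), window] =>
    {o | ∃ x ∈ getNavigableWindow w window .bot s,
      if ∃ j, 1 < j ∧ IsActiveDoc x.2 x.1 (x.1 ++ [2, j]) then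
        ∃ j, 1 < j ∧ IsActiveDoc x.2 x.1 (x.1 ++ [2, j]) ∧
          o = ([], moveActive x.2 x.1 j (j - 1))
      else o = ([], x.2)}
  | .seq [.str (.kw .forward), window] =>
    {o | ∃ x ∈ getNavigableWindow w window .bot s,
      if ∃ j, IsActiveDoc x.2 x.1 (x.1 ++ [2, j]) ∧
          IsIndex (j + 1) (get x.2 (x.1 ++ [2])) then
        ∃ j, IsActiveDoc x.2 x.1 (x.1 ++ [2, j]) ∧ IsIndex (j + 1) (get x.2 (x.1 ++ [2])) ∧
          o = ([], moveActive x.2 x.1 j (j + 1))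
      else o = ([], x.2)}
  | .seq [.str (.kw .close), window] =>
    {o | ∃ x ∈ getNavigableWindow w window .bot s, ∃ p i, x.1 = p ++ [i] ∧
      o = ([], setAt x.2 p (.seq ((items (get x.2 p)).eraseIdx (i - 1))))}
  | .seq [.str (.kw .postMessage), window, message, targetOrigin] =>
    {o | ∃ w', Subwindows s w' ∧ get s (w' ++ [1]) ≈ₜ window ∧
      if ∃ d', IsActiveDoc s w' d' ∧
          (targetOrigin ≈ₜ .bot ∨ docOrigin (get s d') ≈ₜ targetOrigin) then
        ∃ d', IsActiveDoc s w' d' ∧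
          (targetOrigin ≈ₜ .bot ∨ docOrigin (get s d') ≈ₜ targetOrigin) ∧
          o = ([], appendAt s (d' ++ [6])
            (.seq [K .postMessage, get s (w ++ [1]), origin, message]))
      else o = ([], s)}
  | _ => {([], s)}

/-- The placeholders `λ₁, λ₂, …` of scripts are replaced by `ν₁₀, ν₁₁, …`. -/
def lamToNu : Var → Term
  | .nu n => .var (.nu n)
  | .lam n => .var (.nu (n + 9))

/-- Executes the script of the document at `d`, which is the active document of the window at
`w`. -/
def runScript (a : Term) (w d : Ptr) (s : Term) : Set Out :=
  let doc := get s d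
  let origin := docOrigin doc
  let host := get origin [1]
  let protocol := get origin [2]
  let cookies := Term.seq (((items (dictGet (get s [4]) host)).filter fun c =>
    get c [2, 4] ≈ₜ .bot ∧ (get c [2, 2] ≈ₜ .top → protocol ≈ₜ K .https)).map
      fun c => .seq [get c [1], get c [2, 1]])
  -- the key of the session storage: the origin and the nonce of the top-level window
  let sessionKey := Term.seq [origin, get s (w.take 2 ++ [1])]
  let input := Term.seq [clean s doc, get doc [1], get doc [5], get doc [6], cookies,
    dictGet (get s [5]) origin, dictGet (get s [6]) sessionKey, get s [2],
    dictGet (get s [3]) origin]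
  {o | ∃ R out state' cookies' localStorage' sessionStorage' command,
    IsScript (get doc [4]) R ∧ out ∈ R input ∧
    (out.subst lamToNu).nf =
      .seq [state', .seq cookies', localStorage', sessionStorage', command] ∧
    (∀ c ∈ cookies', IsCookie c) ∧
    let s := setAt s [4]
      (dictSet (get s [4]) host (cookieMerge (dictGet (get s [4]) host) (.seq cookies')))
    let s := setAt s [5] (dictSet (get s [5]) origin localStorage')
    let s := setAt s [6] (dictSet (get s [6]) sessionKey sessionStorage')
    let s := setAt s (d ++ [5]) state'
    o ∈ runCommand a w d s command}

/-- Processes a (decrypted) HTTP response; `s₀` is the state at the beginning of the step. -/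
def processResponse (a response reference request protocol s₀ s : Term) : Set Out :=
  let respHeaders := get response [4]
  let reqHeaders := get request [7]
  let host := get request [4]
  {o | ∃ cs : List Term, cs.Perm (items (dictGet respHeaders (K .hSetCookie))) ∧
    let s := cs.foldl (fun s c => if IsCookie c then
      setAt s [4] (dictSet (get s [4]) host (addCookie (dictGet (get s [4]) host) c)) else s) s
    let s := if dictMem respHeaders (K .hSts) ∧ protocol ≈ₜ K .https then appendAt s [8] host
      else s
    let referrer := if dictMem reqHeaders (K .hReferer) then dictGet reqHeaders (K .hReferer)
      else .bot
    let status := get response [3]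
    if dictMem respHeaders (K .hLocation) ∧ (status ≈ₜ K .s303 ∨ status ≈ₜ K .s307) then
      let url := dictGet respHeaders (K .hLocation)
      let method := get request [3]
      let origin := if dictMem reqHeaders (K .hOrigin) then
        .seq [dictGet reqHeaders (K .hOrigin), .seq [host, protocol]] else .bot
      let toGet := status ≈ₜ K .s303 ∧ ¬ (method ≈ₜ K .get ∨ method ≈ₜ K .head)
      -- requests by `XMLHttpRequest` are not redirected
      if ¬ ∃ w, Subwindows s w ∧ get s (w ++ [1]) ≈ₜ reference then o = ([], s₀)
      else
        let req := httpRequest (ν 6) (if toGet then K .get else method) (get url [3])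
          (get url [4]) (get url [5]) (.seq []) (if toGet then .seq [] else get request [8])
        o ∈ send a reference req (get url [2]) origin referrer s
    else if ∃ w, Subwindows s w ∧ get s (w ++ [1]) ≈ₜ reference then
      ∃ w, Subwindows s w ∧ get s (w ++ [1]) ≈ₜ reference ∧
        let location := urlTerm protocol host (get request [5]) (get request [6])
        if ¬ ∃ x y, get response [5] ≈ₜ .seq [x, y] then o = ([], s)
        else
          let doc := Term.seq [ν 7, location, referrer, get response [5, 1],
            get response [5, 2], .seq [], .seq [], .top]
          if items (get s (w ++ [2])) = [] then o = ([], setAt s (w ++ [2]) (.seq [doc]))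
          else ∃ i, IsActiveDoc s w (w ++ [2, i]) ∧
            let s := setAt s (w ++ [2, i, 8]) .bot
            o = ([], setAt s (w ++ [2]) (.seq ((items (get s (w ++ [2]))).take i ++ [doc])))
    else if ∃ w d, Subwindows s w ∧ IsActiveDoc s w d ∧
        get s (d ++ [1]) ≈ₜ .proj 1 reference then
      ∃ w d, Subwindows s w ∧ IsActiveDoc s w d ∧ get s (d ++ [1]) ≈ₜ .proj 1 reference ∧
        o = ([], appendAt s (d ++ [6])
          (.seq [K .xhr, get response [5], get reference [2]]))
    else o = ([], s)}

/-- The output of a corrupted process with (new) state `s'` upon a message sent to `a`: any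
message derivable from `s'`, sent to any address. -/
def corruptOut (a s' : Term) : Set Out :=
  {o | ∃ (m' : Term) (a' : ℕ), m' ∈ derivable Vprocess {s'} ∧
    o = ([.seq [.addr a', a, m']], s')}

/-- The reaction of a browser to a trigger message. -/
def browserTrigger (domains : Finset Str) (a s : Term) : Set Out :=
  -- run some script
  {o | if ∃ w, Subwindows s w ∧ items (get s (w ++ [2])) ≠ [] then
      ∃ w d, Subwindows s w ∧ items (get s (w ++ [2])) ≠ [] ∧ IsActiveDoc s w d ∧
        o ∈ runScript a w d s
    else o = ([], s)} ∪
  -- send a request to some URL in a new window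
  {o | ∃ protocol host path, ∃ params : List (Str × Str),
    (protocol = K .http ∨ protocol = K .https) ∧ host ∈ domains ∧ (params.map Prod.fst).Nodup ∧
    let req := httpRequest (ν 2) (K .get) (.str host) (.str path)
      (.seq (params.map fun x => .seq [.str x.1, .str x.2])) (.seq []) (.seq [])
    o ∈ send a (ν 1) req protocol .bot .bot (appendAt s [1] (.seq [ν 1, .seq [], .bot]))} ∪
  -- reload some document
  {o | if ∃ w, Subwindows s w ∧ items (get s (w ++ [2])) ≠ [] then
      ∃ w d, Subwindows s w ∧ items (get s (w ++ [2])) ≠ [] ∧ IsActiveDoc s w d ∧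
        let url := get s (d ++ [2])
        let n := get s (w ++ [1])
        let req := httpRequest (ν 2) (K .get) (get url [3]) (get url [4]) (get url [5]) (.seq [])
          (.seq [])
        o ∈ send a n req (get url [2]) .bot (get s (d ++ [3])) (cancelNav n s)
    else o = ([], s)}

/-- The state of a browser after it was closed and then taken over. -/
def closeCorrupt (s : Term) : Term :=
  let s := setAt s [3] (.seq [])
  let s := setAt s [1] (.seq [])
  let s := setAt s [10] (.seq [])
  let s := setAt s [11] (.seq [])
  let s := setAt s [6] (.seq [])
  let s := setAt s [4] (.seq ((items (get s [4])).map fun e =>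
    .seq [get e [1], .seq ((items (get e [2])).filter fun c => get c [2, 3] ≈ₜ .bot)]))
  setAt s [12] (K .closecorrupt)

/-- `e` is an entry `⟨reference, request, key, f⟩` of the pending requests of the state component
`pending` that was sent encrypted, and `m` is an encrypted HTTP response under its key. -/
def MatchesEncrypted (pending m f e : Term) : Prop :=
  ∃ reference request key, e = .seq [reference, request, key, f.nf] ∧ e ∈ items pending ∧
    key ≠ .bot ∧ .proj 1 (.decs m key) ≈ₜ K .httpResp

/-- `e` is an entry of the pending requests that was sent in plain, with response `m`. -/
def MatchesPlain (pending m f e : Term) : Prop :=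
  ∃ reference request, e = .seq [reference, request, .bot, f.nf] ∧ e ∈ items pending ∧
    .proj 1 m ≈ₜ K .httpResp ∧ get m [2] ≈ₜ get request [2]

/-- The sequence `t` without (the first occurrence of) the element `e`. -/
def removeElem (t e : Term) : Term := .seq ((items t).erase e)

/-- The relation of a web browser, for an event `⟨a, f, m⟩` and a state `s`. -/
def browserAlg (domains : Finset Str) (a f m s : Term) : Set Out :=
  if ¬ get s [12] ≈ₜ .bot then corruptOut a (setAt s [11] (.seq [m, get s [11]]))
  else if m ≈ₜ K .trigger then browserTrigger domains a s
  else if m ≈ₜ K .fullcorrupt then {([], setAt s [12] (K .fullcorrupt))}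
  else if m ≈ₜ K .closecorrupt then {([], closeCorrupt s)}
  else if ∃ e, MatchesEncrypted (get s [11]) m f e then
    {o | ∃ e, MatchesEncrypted (get s [11]) m f e ∧
      let m' := get (.decs m (get e [3])) []
      if ¬ get m' [2] ≈ₜ get e [2, 2] then o = ([], s)
      else o ∈ processResponse a m' (get e [1]) (get e [2]) (K .https) s
        (setAt s [11] (removeElem (get s [11]) e))}
  else if ∃ e, MatchesPlain (get s [11]) m f e then
    {o | ∃ e, MatchesPlain (get s [11]) m f e ∧
      o ∈ processResponse a (get m []) (get e [1]) (get e [2]) (K .http) s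
        (setAt s [11] (removeElem (get s [11]) e))}
  else if IsDNSResponse domains m then
    let domain := get m [2]
    let result := get m [3]
    let n := get m [4]
    let pending := dictGet (get s [10]) n
    let message := get pending [2]
    if ¬ dictMem (get s [10]) n ∨ ¬ domain ≈ₜ get message [4] then {([], s)}
    else
      let s' := setAt s [10] (dictDel (get s [10]) n)
      if get pending [3] ≈ₜ K .https then
        {([.seq [result, a, .enca (.seq [message, ν 3]) (dictGet (get s [7]) (get message [4]))]],
          appendAt s' [11] (.seq [get pending [1], message, ν 3, result]))}
      else
        {([.seq [result, a, message]],
          appendAt s' [11] (.seq [get pending [1], message, .bot, result]))}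
  else {([], s)}

/-- The relation of an atomic process given by an algorithm with inputs `a`, `f`, `m`, `s`. -/
def relOf (alg : Term → Term → Term → Term → Set Out) (e s : Term) (E : List Term)
    (s' : Term) : Prop :=
  ∃ a f m, e = .seq [a, f, m] ∧ (E, s') ∈ alg a f m s

/-! # Identities, relying parties, identity providers, forwarders -/

/-- Identities (email addresses). -/
structure Identity where
  name : Str
  domain : Str

def Identity.term (i : Identity) : Term := .seq [.str i.name, .str i.domain]

/-- `m` is an encrypted HTTP request `⟨⟨HTTPReq, n, method, inDomain, …⟩, k⟩` for a domain
`inDomain` that is listed, with its private key, in `sslkeys`. -/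
def HttpsRequest (sslkeys m inDomain k n method path parameters headers body : Term) : Prop :=
  ∃ k', .seq [inDomain, k'] ∈ items sslkeys ∧
    (Term.deca m k').nf =
      .seq [httpRequest n method inDomain path parameters headers body, k]

/-- An HTTP response with status 200 to the request with nonce `n`, encrypted with `k`. -/
def okResponse (k n headers body : Term) : Term :=
  .encs (httpResponse n (K .s200) headers body) k

/-! States of relying parties have the components DNSAddress (1), FWDDomain (2), keyMapping (3),
sslkeys (4), pendingDNS (5), pendingRequests (6), loginSessions (7), serviceTokens (8),
wkCache (9), corrupt (10). Login session records are `⟨email, rpNonce, iaKey, tag⟩`. -/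

/-- Creates a login session and answers a startLogin request. -/
def sendStartLoginResponse (a f k n email inDomain s : Term) : Set Out :=
  let rpNonce := ν 1
  let tagKey := ν 2
  let iaKey := ν 3
  let loginSessionToken := ν 4
  let tag := Term.encs (.seq [inDomain, rpNonce]) tagKey
  let s' := setAt s [7] (dictSet (get s [7]) loginSessionToken
    (.seq [email, rpNonce, iaKey, tag]))
  let body := Term.seq [.seq [K .tagKey, tagKey], .seq [K .loginSessionToken, loginSessionToken],
    .seq [K .fwdDomain, get s [2]]]
  {([.seq [f, a, okResponse k n (.seq []) body]], s')}

/-- The answer of an RP to an HTTPS request. -/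
def rpRequest (ids : Finset Identity) (a f inDomain k n method path parameters headers body s :
    Term) : Set Out :=
  if path ≈ₜ K .pRoot then
    {([.seq [f, a, okResponse k n (.seq []) (.seq [K .scriptRp, initStateRp])]], s)}
  else if path ≈ₜ K .pStartLogin ∧ method ≈ₜ K .post then
    if ¬ ∃ i ∈ ids, body ≈ₜ i.term then {([], s)}
    else
      let domain := get body [2]
      if dictMem (get s [9]) domain then sendStartLoginResponse a f k n body inDomain s
      else
        let message := httpRequest (ν 6) (K .get) domain (K .pWkInfo) (.seq []) (.seq []) (.seq [])
        {([.seq [get s [1], a, .seq [K .dnsResolve, domain, ν 6]]],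
          setAt s [5] (dictSet (get s [5]) (ν 6)
            (.seq [.seq [a, f, k, n, body, inDomain], message])))}
  else if path ≈ₜ K .pRedir ∧ method ≈ₜ K .get then
    let loginSession := dictGet (get s [7]) (dictGet parameters (K .loginSessionToken))
    if loginSession ≈ₜ .seq [] then {([], s)}
    else
      let params := Term.seq [.seq [K .email, get loginSession [1]],
        .seq [K .tag, get loginSession [4]], .seq [K .iaKey, get loginSession [3]],
        .seq [K .fwdDomain, get s [2]]]
      let url := urlTerm (K .https) (get loginSession [1, 2]) (K .pWkLogin) params
      {([.seq [f, a, okResponse k n (.seq []) (.seq [K .scriptRpRedir, url])]], s)}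
  else if path ≈ₜ K .pLogin ∧ method ≈ₜ K .post then
    let token := dictGet body (K .loginSessionToken)
    let loginSession := dictGet (get s [7]) token
    if ¬ dictGet headers (K .hOrigin) ≈ₜ .seq [inDomain, K .https] ∨ token ≈ₜ .seq [] ∨
        loginSession ≈ₜ .seq [] then {([], s)}
    else
      let ia := Term.decs (dictGet body (K .eia)) (get loginSession [3])
      let e := Term.seq [get loginSession [4], get loginSession [1], get s [2]]
      let verifyKey := dictGet (dictGet (get s [9]) (get loginSession [1, 2])) (K .signkey)
      if ¬ .checksig ia e verifyKey ≈ₜ .top then {([], s)}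
      else
        let serviceToken := Term.seq [ν 7, get loginSession [1]]
        let s' := setAt s [7] (dictDel (get s [7]) token)
        {([.seq [f, a, okResponse k n (.seq []) serviceToken]], appendAt s' [8] serviceToken)}
  else {([], s)}

/-- The relation of a relying party. -/
def rpAlg (domains : Finset Str) (ids : Finset Identity) (a f m s : Term) : Set Out :=
  if ¬ get s [10] ≈ₜ .bot ∨ m ≈ₜ K .corrupt then
    corruptOut a (setAt s [10] (.seq [.seq [a, f, m], get s [10]]))
  else if ∃ e, MatchesEncrypted (get s [6]) m f e then
    {o | ∃ e, MatchesEncrypted (get s [6]) m f e ∧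
      let m' := get (.decs m (get e [3])) []
      if ¬ get m' [2] ≈ₜ get e [2, 2] then o = ([], s)
      else if ¬ ∃ a' f' k n email inDomain, get e [1] = .seq [a', f', k, n, email, inDomain] then
        o = ([], s)
      else
        let s' := setAt s [6] (removeElem (get s [6]) e)
        let s' := setAt s' [9] (dictSet (get s' [9]) (get e [2, 4]) (get m' [5]))
        o ∈ sendStartLoginResponse (get e [1, 1]) (get e [1, 2]) (get e [1, 3]) (get e [1, 4])
          (get e [1, 5]) (get e [1, 6]) s'}
  else if IsDNSResponse domains m then
    let domain := get m [2]
    let result := get m [3]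
    let n := get m [4]
    let pending := dictGet (get s [5]) n
    let message := get pending [2]
    if ¬ dictMem (get s [5]) n ∨ ¬ domain ≈ₜ get message [4] then {([], s)}
    else
      let s' := appendAt s [6] (.seq [get pending [1], message, ν 5, result])
      {([.seq [result, a, .enca (.seq [message, ν 5]) (dictGet (get s [3]) (get message [4]))]],
        setAt s' [5] (dictDel (get s [5]) n))}
  else
    {o | if ∃ inDomain k n method path parameters headers body,
        HttpsRequest (get s [4]) m inDomain k n method path parameters headers body then
      ∃ inDomain k n method path parameters headers body,
        HttpsRequest (get s [4]) m inDomain k n method path parameters headers body ∧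
        o ∈ rpRequest ids a f inDomain k n method path parameters headers body s
    else o = ([], s)}

/-- The answer of an IdP to an HTTPS request. States of IdPs have the components sslkeys (1),
users (2), signkey (3), sessions (4), corrupt (5). -/
def idpRequest (a f k n method path headers body s : Term) : Set Out :=
  let session := dictGet (dictGet headers (K .hCookie)) (K .sessionid)
  let loggedInAs := dictGet (get s [4]) session
  if path ≈ₜ K .pWkInfo then
    {([.seq [f, a, okResponse k n (.seq [])
      (.seq [.seq [K .signkey, .pub (get s [3])]])]], s)}
  else if path ≈ₜ K .pWkLogin then
    {([.seq [f, a, okResponse k n (.seq [])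
      (.seq [K .scriptIdp, .seq [K .start, loggedInAs, .seq []]])]], s)}
  else if path ≈ₜ K .pSign ∧ method ≈ₜ K .post then
    let email := dictGet body (K .email)
    if ¬ email ≈ₜ loggedInAs ∧ ¬ dictGet body (K .password) ≈ₜ dictGet (get s [2]) email then
      {([], s)}
    else
      let ia := Term.sig (.seq [dictGet body (K .tag), email, dictGet body (K .fwdDomain)])
        (get s [3])
      let setCookie := Term.seq [K .hSetCookie,
        .seq [.seq [K .sessionid, .seq [ν 8, .top, .top, .top]]]]
      {([.seq [f, a, okResponse k n (.seq [setCookie]) ia]],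
        setAt s [4] (dictSet (get s [4]) (ν 8) email))}
  else {([], s)}

/-- The relation of an identity provider. -/
def idpAlg (a f m s : Term) : Set Out :=
  if ¬ get s [5] ≈ₜ .bot ∨ m ≈ₜ K .corrupt then
    corruptOut a (setAt s [5] (.seq [.seq [a, f, m], get s [5]]))
  else
    {o | if ∃ inDomain k n method path parameters headers body,
        HttpsRequest (get s [1]) m inDomain k n method path parameters headers body then
      ∃ inDomain k n method path parameters headers body,
        HttpsRequest (get s [1]) m inDomain k n method path parameters headers body ∧
        o ∈ idpRequest a f k n method path headers body s
    else o = ([], s)}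

/-- The relation of a forwarder; its states are `⟨sslkeys, corrupt⟩`. -/
def fwdAlg (a f m s : Term) : Set Out :=
  if ¬ get s [2] ≈ₜ .bot ∨ m ≈ₜ K .corrupt then
    corruptOut a (setAt s [2] (.seq [.seq [a, f, m], get s [2]]))
  else
    {o | if ∃ inDomain k n method path parameters headers body,
        HttpsRequest (get s [1]) m inDomain k n method path parameters headers body then
      ∃ inDomain k n method path parameters headers body,
        HttpsRequest (get s [1]) m inDomain k n method path parameters headers body ∧
        o = ([.seq [f, a, okResponse k n (.seq []) (.seq [K .scriptFwd, K .start])]], s)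
    else o = ([], s)}

/-! # SPRESSO web systems for authentication analysis -/

/-- The processes of the system. -/
inductive Party (B RP IDP FWD : Type*)
  | attacker
  | browser (b : B)
  | rp (r : RP)
  | idp (y : IDP)
  | fwd (g : FWD)

/-- The data of a SPRESSO web system for authentication analysis with browsers `B`, relying parties
`RP`, identity providers `IDP`, forwarders `FWD` and one network attacker. -/
structure AuthSystem (B RP IDP FWD : Type*) where
  /-- The set of all domains. -/
  domains : Finset Str
  /-- The domains of the processes. -/
  dom : Party B RP IDP FWD → Finset Str
  dom_subset : ∀ p, dom p ⊆ domains
  dom_disjoint : ∀ p q, p ≠ q → Disjoint (dom p) (dom q)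
  dom_browser : ∀ b, dom (.browser b) = ∅
  /-- The addresses of the processes. -/
  addr : Party B RP IDP FWD → Finset ℕ
  addr_disjoint : ∀ p q, p ≠ q → p ≠ .attacker → q ≠ .attacker → Disjoint (addr p) (addr q)
  /-- The finite set of identities. -/
  ids : Finset Identity
  governed : ∀ i ∈ ids, ∃ p, i.domain ∈ dom p
  /-- The private SSL keys of the domains, the signing keys of the IdPs and the secrets of the
  identities; the set of all secrets is the image of `ids` under `secret`. -/
  sslkey : Str → ℕ
  signkey : IDP → ℕ
  secret : Identity → ℕ
  sslkey_inj : Set.InjOn sslkey domains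
  signkey_inj : Function.Injective signkey
  secret_inj : Set.InjOn secret ids
  ssl_ne_sign : ∀ d ∈ domains, ∀ y, sslkey d ≠ signkey y
  ssl_ne_secret : ∀ d ∈ domains, ∀ i ∈ ids, sslkey d ≠ secret i
  sign_ne_secret : ∀ y, ∀ i ∈ ids, signkey y ≠ secret i
  /-- The browser that owns an identity (and the secret of this identity). -/
  owner : {i // i ∈ ids} → B
  /-- The identity with domain `d` of the browser `b` whose secret is stored in `b`. -/
  stored : B → Str → Identity
  stored_spec : ∀ i : {i // i ∈ ids}, ∃ i' : {i // i ∈ ids}, owner i' = owner i ∧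
    (i' : Identity).domain = (i : Identity).domain ∧ stored (owner i) (i : Identity).domain = i'
  /-- The forwarder domains chosen by the RPs. -/
  fwdDomain : RP → Str
  fwdDomain_mem : ∀ r, fwdDomain r ∈ domains
  /-- The addresses of the DNS server used by browsers and RPs, which is the attacker. -/
  dnsBrowser : B → ℕ
  dnsRP : RP → ℕ
  dnsBrowser_mem : ∀ b, dnsBrowser b ∈ addr .attacker
  dnsRP_mem : ∀ r, dnsRP r ∈ addr .attacker
  /-- The initial sequence of waiting events: trigger events only, infinitely many of them for
  every address. -/
  E0 : ℕ → Term
  E0_trigger : ∀ n, ∃ a : ℕ, E0 n = .seq [.addr a, .addr a, K .trigger]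
  E0_infinite : ∀ a : ℕ, {n | E0 n = .seq [.addr a, .addr a, K .trigger]}.Infinite

namespace AuthSystem

variable {B RP IDP FWD : Type*} (W : AuthSystem B RP IDP FWD)

/-- The nonces that are neither keys nor secrets. -/
def freshNonces : Set ℕ :=
  {n | (∀ d ∈ W.domains, n ≠ W.sslkey d) ∧ (∀ y, n ≠ W.signkey y) ∧ ∀ i ∈ W.ids, n ≠ W.secret i}

/-- The domains in `D` with their private keys. -/
def sslkeys (D : Finset Str) : Term :=
  .seq (D.toList.map fun d => .seq [.str d, .nonce (W.sslkey d)])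

/-- All domains with their public keys. -/
def keyMapping : Term :=
  .seq (W.domains.toList.map fun d => .seq [.str d, .pub (.nonce (W.sslkey d))])

/-- The identities owned by a browser. -/
def idsOf (b : B) : Finset Identity := (W.ids.attach.filter fun i => W.owner i = b).image (·.1)

def browserInit (b : B) : Term :=
  let secretDomains := (W.idsOf b).image Identity.domain
  .seq [.seq [], .seq ((W.idsOf b).toList.map Identity.term),
    .seq (secretDomains.toList.map fun d =>
      .seq [.seq [.str d, K .https], .nonce (W.secret (W.stored b d))]),
    .seq [], .seq [], .seq [], W.keyMapping, .seq [], .addr (W.dnsBrowser b), .seq [], .seq [],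
    .bot]

def rpInit (r : RP) : Term :=
  .seq [.addr (W.dnsRP r), .str (W.fwdDomain r), W.keyMapping, W.sslkeys (W.dom (.rp r)), .seq [],
    .seq [], .seq [], .seq [], .seq [], .bot]

def idpInit (y : IDP) : Term :=
  let governedIds := W.ids.filter fun i => i.domain ∈ W.dom (.idp y)
  .seq [W.sslkeys (W.dom (.idp y)),
    .seq (governedIds.toList.map fun i => .seq [i.term, .nonce (W.secret i)]),
    .nonce (W.signkey y), .seq [], .bot]

def fwdInit (g : FWD) : Term := .seq [W.sslkeys (W.dom (.fwd g)), .bot]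

/-- The attacker knows its domains with their private keys, all public SSL keys and all public
signing keys. -/
def attackerInit [Fintype IDP] : Term :=
  .seq [W.sslkeys (W.dom .attacker), W.keyMapping,
    .seq ((Finset.univ : Finset IDP).toList.map fun y => .pub (.nonce (W.signkey y)))]

/-- The system of atomic processes. The attacker listens to all addresses. -/
def system [Fintype IDP] : Party B RP IDP FWD → AtomicProc
  | .attacker => ⟨Set.univ, attackerRel, W.attackerInit⟩
  | .browser b => ⟨W.addr (.browser b), relOf (browserAlg W.domains), W.browserInit b⟩
  | .rp r => ⟨W.addr (.rp r), relOf (rpAlg W.domains W.ids), W.rpInit r⟩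
  | .idp y => ⟨W.addr (.idp y), relOf idpAlg, W.idpInit y⟩
  | .fwd g => ⟨W.addr (.fwd g), relOf fwdAlg, W.fwdInit g⟩

end AuthSystem

/-! ### The notions in the security properties, for a configuration `c` -/

section Security

variable {B RP IDP FWD : Type*}

def HonestRP (c : Config (Party B RP IDP FWD)) (r : RP) : Prop := get (c.S (.rp r)) [10] ≈ₜ .bot
def HonestIDP (c : Config (Party B RP IDP FWD)) (y : IDP) : Prop := get (c.S (.idp y)) [5] ≈ₜ .bot
def HonestFWD (c : Config (Party B RP IDP FWD)) (g : FWD) : Prop := get (c.S (.fwd g)) [2] ≈ₜ .bot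
def HonestBrowser (c : Config (Party B RP IDP FWD)) (b : B) : Prop :=
  get (c.S (.browser b)) [12] ≈ₜ .bot
def FullyCorrupted (c : Config (Party B RP IDP FWD)) (b : B) : Prop :=
  get (c.S (.browser b)) [12] ≈ₜ K .fullcorrupt

/-- The service token `t` is recorded in the state of the RP `r`. -/
def HasToken (c : Config (Party B RP IDP FWD)) (r : RP) (t : Term) : Prop :=
  Mem t (get (c.S (.rp r)) [8])

/-- In the `l`-th processing step, `r` receives the message `m` and, as a result, creates and
records the service token `t`; so `m` is the request corresponding to `t`. -/
def Run.CreatesToken {sys : Party B RP IDP FWD → AtomicProc} {E0 : ℕ → Term} {fresh : Set ℕ}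
    (ρ : Run sys E0 fresh) (l : ℕ) (r : RP) (m t : Term) : Prop :=
  ρ.proc l = .rp r ∧ (∃ a f, ρ.ein l = .seq [a, f, m]) ∧
    ¬ HasToken (ρ.conf l) r t ∧ HasToken (ρ.conf (l + 1)) r t

/-- In some processing step before the `l`-th one, the browser `b` sends the message `m`. -/
def Run.SentBefore {sys : Party B RP IDP FWD → AtomicProc} {E0 : ℕ → Term} {fresh : Set ℕ}
    (ρ : Run sys E0 fresh) (l : ℕ) (b : B) (m : Term) : Prop :=
  ∃ l' < l, ρ.proc l' = .browser b ∧ ∃ a f m', .seq [a, f, m'] ∈ ρ.eout l' ∧ m' ≈ₜ m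

end Security

end

end Spresso

namespace Spresso
noncomputable section
open Classical
open List (map_cons map_nil forall_mem_cons not_mem_nil mem_singleton mem_cons mem_map mem_append
  mem_of_getElem?)
open Set (mem_singleton_iff mem_ofPred_eq)

section

/-! # Substitution, variables and normal forms -/

theorem map_eq_self_iff {α} {f : α → α} {l : List α} : l.map f = l ↔ ∀ x ∈ l, f x = x := by
  induction l with
  | nil => simp
  | cons a l ih => simp [ih]

theorem Term.ind {P : Term → Prop} (addr : ∀ a, P (.addr a)) (str : ∀ s, P (.str s))
    (top : P .top) (bot : P .bot) (undef : P .undef) (nonce : ∀ n, P (.nonce n))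
    (var : ∀ v, P (.var v)) (pub : ∀ k, P k → P (.pub k))
    (enca : ∀ x k, P x → P k → P (.enca x k)) (deca : ∀ x k, P x → P k → P (.deca x k))
    (encs : ∀ x k, P x → P k → P (.encs x k)) (decs : ∀ x k, P x → P k → P (.decs x k))
    (sig : ∀ x k, P x → P k → P (.sig x k))
    (checksig : ∀ s x k, P s → P x → P k → P (.checksig s x k))
    (seq : ∀ ts : List Term, (∀ t ∈ ts, P t) → P (.seq ts))
    (proj : ∀ i t, P t → P (.proj i t)) (t : Term) : P t := by
  refine Term.rec (motive_1 := P) (motive_2 := fun ts => ∀ t ∈ ts, P t) addr str top bot undef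
    nonce var pub enca deca encs decs sig checksig seq proj ?_ ?_ t
  · simp
  · intro t ts h1 h2 u hu
    rcases mem_cons.1 hu with rfl | hu
    · exact h1
    · exact h2 u hu

theorem substList_eq_map (σ : Var → Term) (ts : List Term) :
    Term.substList σ ts = ts.map (Term.subst σ) := by
  induction ts with
  | nil => rfl
  | cons t ts ih => simp [Term.substList, ih]

theorem Equiv.subst (σ : Var → Term) {t u : Term} (h : t ≈ₜ u) : t.subst σ ≈ₜ u.subst σ := by
  induction h with
  | refl => exact .refl _
  | symm _ ih => exact ih.symm
  | trans _ _ h1 h2 => exact h1.trans h2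
  | deca_enca x y => exact .deca_enca _ _
  | decs_encs x y => exact .decs_encs _ _
  | checksig_sig x y => exact .checksig_sig _ _
  | @proj_in ts i t h =>
    simp only [Term.subst, substList_eq_map]
    exact .proj_in (by simp [h])
  | proj_out h =>
    simp only [Term.subst, substList_eq_map]
    exact .proj_out (by simpa using h)
  | seq _ ih =>
    simp only [Term.subst, substList_eq_map, List.map_append, map_cons]
    exact .seq ih
  | pub _ ih => exact .pub ih
  | proj _ ih => exact .proj ih
  | checksig _ _ _ h1 h2 h3 => exact .checksig h1 h2 h3
  | enca _ _ h1 h2 => exact .enca h1 h2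
  | deca _ _ h1 h2 => exact .deca h1 h2
  | encs _ _ h1 h2 => exact .encs h1 h2
  | decs _ _ h1 h2 => exact .decs h1 h2
  | sig _ _ h1 h2 => exact .sig h1 h2

@[simp] theorem nf_nf (t : Term) : t.nf.nf = t.nf := (Equiv.nf_eq (equiv_nf t)).symm

theorem nf_seq (ts : List Term) : (Term.seq ts).nf = .seq (ts.map Term.nf) := by
  rw [Term.nf, nfList_eq_map]

theorem nf_of_mem {t : Term} {ts : List Term} (h : t.nf = .seq ts) {u : Term} (hu : u ∈ ts) :
    u.nf = u := by
  have h1 : _ := nf_nf t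
  rw [h, nf_seq] at h1
  have h2 : ts.map Term.nf = ts := by simpa using h1
  exact (map_eq_self_iff (f := Term.nf) (l := ts)).1 h2 u hu

mutual
/-- The variable `v` occurs in a term. -/
def VarIn (v : Var) : Term → Prop
  | .var w => v = w
  | .pub t | .proj _ t => VarIn v t
  | .enca x k | .deca x k | .encs x k | .decs x k | .sig x k => VarIn v x ∨ VarIn v k
  | .checksig s x k => VarIn v s ∨ VarIn v x ∨ VarIn v k
  | .seq ts => VarInList v ts
  | .addr _ | .str _ | .top | .bot | .undef | .nonce _ => False

/-- The variable `v` occurs in one of the terms. -/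
def VarInList (v : Var) : List Term → Prop
  | [] => False
  | t :: ts => VarIn v t ∨ VarInList v ts
end

@[simp] theorem varInList_iff {v ts} : VarInList v ts ↔ ∃ t ∈ ts, VarIn v t := by
  induction ts with
  | nil => simp [VarInList]
  | cons t ts ih => simp [VarInList, ih]

theorem varIn_seq {v ts} : VarIn v (.seq ts) ↔ ∃ t ∈ ts, VarIn v t := varInList_iff

attribute [simp] VarIn

theorem mem_nusList {k : ℕ} {ts : List Term} : k ∈ Term.nusList ts ↔ ∃ t ∈ ts, k ∈ t.nus := by
  induction ts with
  | nil => simp [Term.nusList]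
  | cons t ts ih => simp [Term.nusList, ih]

theorem mem_nus {k : ℕ} {t : Term} : k ∈ t.nus ↔ VarIn (.nu k) t := by
  induction t using Term.ind with
  | var v => cases v <;> simp [Term.nus]
  | seq ts ih =>
    simp only [Term.nus, mem_nusList, varIn_seq]
    exact ⟨fun ⟨t, h, h'⟩ => ⟨t, h, (ih t h).1 h'⟩, fun ⟨t, h, h'⟩ => ⟨t, h, (ih t h).2 h'⟩⟩
  | checksig s x k h1 h2 h3 => simp [Term.nus, h1, h2, h3]
  | _ => simp_all [Term.nus]

theorem subst_congr {σ τ : Var → Term} {t : Term} (h : ∀ v, VarIn v t → σ v = τ v) :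
    t.subst σ = t.subst τ := by
  induction t using Term.ind with
  | seq ts ih =>
    simp only [Term.subst, substList_eq_map, Term.seq.injEq, List.map_inj_left]
    exact fun t ht => ih t ht fun v hv => h v (varIn_seq.2 ⟨t, ht, hv⟩)
  | _ => simp_all [Term.subst]

theorem subst_var (t : Term) : t.subst .var = t := by
  induction t using Term.ind with
  | seq ts ih =>
    simp only [Term.subst, substList_eq_map, Term.seq.injEq]
    exact (map_eq_self_iff (f := Term.subst .var) (l := ts)).2 ih
  | _ => simp_all [Term.subst]

theorem subst_eq_self {σ : Var → Term} {t : Term} (h : ∀ v, VarIn v t → σ v = .var v) :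
    t.subst σ = t := (subst_congr h).trans (subst_var t)

theorem varIn_subst {σ : Var → Term} {w : Var} {t : Term} :
    VarIn w (t.subst σ) ↔ ∃ v, VarIn v t ∧ VarIn w (σ v) := by
  induction t using Term.ind with
  | var v => simp [Term.subst]
  | seq ts ih =>
    simp only [Term.subst, substList_eq_map, varIn_seq, mem_map]
    constructor
    · rintro ⟨_, ⟨t, ht, rfl⟩, h⟩
      obtain ⟨v, h1, h2⟩ := (ih t ht).1 h
      exact ⟨v, ⟨t, ht, h1⟩, h2⟩
    · rintro ⟨v, ⟨t, ht, h1⟩, h2⟩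
      exact ⟨_, ⟨t, ht, rfl⟩, (ih t ht).2 ⟨v, h1, h2⟩⟩
  | checksig s x k h1 h2 h3 => simp only [Term.subst, VarIn, h1, h2, h3]; grind
  | enca x k h1 h2 | deca x k h1 h2 | encs x k h1 h2 | decs x k h1 h2 | sig x k h1 h2 =>
    simp only [Term.subst, VarIn, h1, h2]; grind
  | _ => simp_all [Term.subst]

theorem varIn_redDeca {v x k} (h : VarIn v (redDeca x k)) : VarIn v (.deca x k) := by
  unfold redDeca at h
  split at h
  · split_ifs at h <;> simp_all
  · exact h

theorem varIn_redDecs {v x k} (h : VarIn v (redDecs x k)) : VarIn v (.decs x k) := by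
  unfold redDecs at h
  split at h
  · split_ifs at h <;> simp_all
  · exact h

theorem varIn_redChecksig {v s x k} (h : VarIn v (redChecksig s x k)) :
    VarIn v (.checksig s x k) := by
  unfold redChecksig at h
  split at h
  · split_ifs at h
    · simp at h
    · exact h
  · exact h

theorem varIn_redProj {v i t} (h : VarIn v (redProj i t)) : VarIn v (.proj i t) := by
  unfold redProj at h
  split at h
  · rename_i ts
    split_ifs at h
    · simp at h
    · rw [List.getD_eq_getElem?_getD] at h
      cases hj : ts[i - 1]? with
      | none => simp [hj] at h
      | some u =>
        rw [hj] at h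
        rw [VarIn, varIn_seq]
        exact ⟨u, mem_of_getElem? hj, h⟩
  · exact h

theorem varIn_nf {v : Var} {t : Term} (h : VarIn v t.nf) : VarIn v t := by
  induction t using Term.ind with
  | seq ts ih =>
    simp only [nf_seq, varIn_seq, mem_map] at h ⊢
    obtain ⟨_, ⟨t, ht, rfl⟩, h⟩ := h
    exact ⟨t, ht, ih t ht h⟩
  | deca x k h1 h2 => exact (varIn_redDeca h).imp h1 h2
  | decs x k h1 h2 => exact (varIn_redDecs h).imp h1 h2
  | checksig s x k h1 h2 h3 => exact (varIn_redChecksig h).imp h1 (Or.imp h2 h3)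
  | proj i t ih => exact ih (varIn_redProj h)
  | enca x k h1 h2 | encs x k h1 h2 | sig x k h1 h2 => exact Or.imp h1 h2 h
  | pub k ih => exact ih h
  | _ => exact h

/-- Substitution followed by normalization. -/
def ren (σ : Var → Term) (t : Term) : Term := (t.subst σ).nf

section Ren
variable (σ : Var → Term)

theorem ren_nf (t : Term) : ren σ t.nf = ren σ t :=
  Equiv.nf_eq (Equiv.subst σ (equiv_nf t).symm)

@[simp] theorem nf_ren (t : Term) : (ren σ t).nf = ren σ t := nf_nf _
@[simp] theorem ren_addr (a) : ren σ (.addr a) = .addr a := rfl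
@[simp] theorem ren_str (a) : ren σ (.str a) = .str a := rfl
@[simp] theorem ren_top : ren σ .top = .top := rfl
@[simp] theorem ren_bot : ren σ .bot = .bot := rfl
@[simp] theorem ren_undef : ren σ .undef = .undef := rfl
@[simp] theorem ren_nonce (n) : ren σ (.nonce n) = .nonce n := rfl
@[simp] theorem ren_pub (k) : ren σ (.pub k) = .pub (ren σ k) := rfl
@[simp] theorem ren_enca (x k) : ren σ (.enca x k) = .enca (ren σ x) (ren σ k) := rfl
@[simp] theorem ren_encs (x k) : ren σ (.encs x k) = .encs (ren σ x) (ren σ k) := rfl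
@[simp] theorem ren_sig (x k) : ren σ (.sig x k) = .sig (ren σ x) (ren σ k) := rfl
@[simp] theorem ren_deca (x k) : ren σ (.deca x k) = redDeca (ren σ x) (ren σ k) := rfl
@[simp] theorem ren_decs (x k) : ren σ (.decs x k) = redDecs (ren σ x) (ren σ k) := rfl
@[simp] theorem ren_checksig (s x k) :
    ren σ (.checksig s x k) = redChecksig (ren σ s) (ren σ x) (ren σ k) := rfl
@[simp] theorem ren_seq (ts) : ren σ (.seq ts) = .seq (ts.map (ren σ)) := by
  simp [ren, Term.subst, substList_eq_map, nf_seq]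
@[simp] theorem ren_proj (i t) : ren σ (.proj i t) = redProj i (ren σ t) := rfl

theorem varIn_ren {w : Var} {t : Term} (h : VarIn w (ren σ t)) :
    ∃ v, VarIn v t.nf ∧ VarIn w (σ v) := by
  rw [← ren_nf] at h
  exact varIn_subst.1 (varIn_nf h)

end Ren

/-- No variables occur in the normal form. -/
def Closed (t : Term) : Prop := ∀ v, ¬ VarIn v t.nf

theorem Closed.ren_eq {t : Term} (h : Closed t) (σ : Var → Term) : ren σ t = t.nf := by
  rw [← ren_nf, ren, subst_eq_self fun v hv => (h v hv).elim, nf_nf]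

/-! # Positions, dictionaries -/

theorem get_nil (t : Term) : get t [] = t.nf := rfl
theorem get_cons (t : Term) (i : ℕ) (p : Ptr) : get t (i :: p) = get (.proj i t) p := rfl

theorem get_congr {t u : Term} (h : t.nf = u.nf) (p : Ptr) : get t p = get u p := by
  induction p generalizing t u with
  | nil => exact h
  | cons i p ih => exact ih (by simp [Term.nf, h])

@[simp] theorem get_nf (t : Term) (p : Ptr) : get t.nf p = get t p := get_congr (nf_nf t) p

@[simp] theorem nf_get (t : Term) (p : Ptr) : (get t p).nf = get t p := by
  induction p generalizing t with
  | nil => exact nf_nf t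
  | cons i p ih => exact ih _

theorem get_append (t : Term) (p q : Ptr) : get t (p ++ q) = get (get t p) q := by
  induction p generalizing t with
  | nil => simp [get_nil]
  | cons i p ih => exact ih _

theorem get_seq {t : Term} {ts : List Term} (h : t.nf = .seq ts) {i : ℕ} (p : Ptr) :
    get t ((i + 1) :: p) = get (ts.getD i .undef) p := by
  rw [get_cons]
  apply get_congr
  simp only [Term.nf, h, redProj, Nat.succ_ne_zero, if_false, Nat.add_sub_cancel]
  by_cases hi : i < ts.length
  · simp only [List.getD_eq_getElem?_getD, List.getElem?_eq_getElem hi, Option.getD_some]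
    exact (nf_of_mem h (List.getElem_mem hi)).symm
  · simp [List.getD_eq_getElem?_getD, List.getElem?_eq_none (Nat.not_lt.1 hi), Term.nf]

theorem get_seq_some {t : Term} {ts : List Term} (h : t.nf = .seq ts) {i : ℕ} {u : Term}
    (hu : ts[i]? = some u) (p : Ptr) : get t ((i + 1) :: p) = get u p := by
  rw [get_seq h, List.getD_eq_getElem?_getD, hu, Option.getD_some]

theorem items_congr {t u : Term} (h : t.nf = u.nf) : items t = items u := by
  unfold items; rw [h]

theorem items_of_nf {t : Term} {ts : List Term} (h : t.nf = .seq ts) : items t = ts := by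
  unfold items; rw [h]

theorem items_seq (ts : List Term) : items (.seq ts) = ts.map Term.nf := items_of_nf (nf_seq ts)

@[simp] theorem items_nf (t : Term) : items t.nf = items t := items_congr (nf_nf t)

theorem nf_of_mem_items {t u : Term} (h : u ∈ items t) : u.nf = u := by
  unfold items at h
  split at h
  · exact nf_of_mem (by assumption) h
  · simp at h

theorem map_nf_items (t : Term) : (items t).map Term.nf = items t :=
  (map_eq_self_iff (f := Term.nf)).2 fun _ h => nf_of_mem_items h

theorem map_nf_of_nf {t : Term} {ts : List Term} (h : t.nf = .seq ts) : ts.map Term.nf = ts :=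
  (map_eq_self_iff (f := Term.nf)).2 fun _ h' => nf_of_mem h h'

theorem setAt_nil (t v : Term) : setAt t [] v = v := by unfold setAt; rfl

theorem setAt_cons {t : Term} {ts : List Term} (h : t.nf = .seq ts) (i : ℕ) (p : Ptr) (v : Term) :
    setAt t ((i + 1) :: p) v = .seq (ts.modify i fun u => setAt u p v) := by
  rw [setAt]; simp [h]

theorem setAt_congr {t u : Term} (h : t.nf = u.nf) {p : Ptr} (hp : p ≠ []) (v : Term) :
    setAt t p v = setAt u p v := by
  cases p with
  | nil => exact absurd rfl hp
  | cons i p => unfold setAt; rw [h]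

theorem nf_setAt_cons {t : Term} {ts : List Term} (h : t.nf = .seq ts) (i : ℕ) (p : Ptr)
    (v : Term) :
    (setAt t ((i + 1) :: p) v).nf = .seq (ts.modify i fun u => (setAt u p v).nf) := by
  rw [setAt_cons h, nf_seq]
  congr 1
  apply List.ext_getElem?
  intro j
  rw [List.getElem?_map, List.getElem?_modify, List.getElem?_modify]
  cases hj : ts[j]? with
  | none => simp
  | some u =>
    have : u.nf = u := nf_of_mem h (mem_of_getElem? hj)
    by_cases h' : i = j <;> simp [h', this]

theorem hasKey_iff {k e : Term} : HasKey k e ↔ ∃ v, e.nf = .seq [k.nf, v] := by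
  constructor
  · rintro ⟨v, h⟩
    exact ⟨v.nf, by rw [equiv_iff_nf.1 h]; simp [nf_seq]⟩
  · rintro ⟨v, h⟩
    have hv : v.nf = v := nf_of_mem h (by simp)
    exact ⟨v, equiv_iff_nf.2 (by rw [h]; simp [nf_seq, hv])⟩

theorem dictGet_of_mem {z k : Term} (h : dictMem z k) :
    ∃ e ∈ items z, dictGet z k = get e [2] := by
  obtain ⟨e, he, hk⟩ := h
  unfold dictGet
  cases hf : (items z).find? fun e => HasKey k e with
  | none => exact absurd hk (by simpa using List.find?_eq_none.1 hf e he)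
  | some e' => exact ⟨e', List.mem_of_find?_eq_some hf, rfl⟩

theorem dictGet_mem {z k v : Term} (h : dictGet z k = v) :
    v = .seq [] ∨ ∃ e ∈ items z, e = .seq [k.nf, v] := by
  unfold dictGet at h
  split at h
  · rename_i e he
    right
    have h1 : _ := List.find?_some he
    have h2 : _ := List.mem_of_find?_eq_some he
    obtain ⟨w, hw⟩ := hasKey_iff.1 (by simpa using h1)
    rw [nf_of_mem_items h2] at hw
    refine ⟨e, h2, ?_⟩
    have hw' : e.nf = .seq [k.nf, w] := by rw [nf_of_mem_items h2, hw]
    have hwn : w.nf = w := nf_of_mem hw' (by simp)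
    rw [get_seq hw'] at h
    simp [get_nil, hwn] at h
    rw [hw, h]
  · exact .inl h.symm

@[simp] theorem nf_dictGet (z k : Term) : (dictGet z k).nf = dictGet z k := by
  unfold dictGet
  split
  · simp
  · simp [nf_seq]

theorem dictGet_congr {z z' k k' : Term} (h : z.nf = z'.nf) (h' : k.nf = k'.nf) :
    dictGet z k = dictGet z' k' := by
  unfold dictGet
  rw [items_congr h]
  have : (fun e => HasKey k e) = fun e => HasKey k' e := by
    funext e; simp [hasKey_iff, h']
  simp only [this]

theorem dictGet_nil (k : Term) : dictGet (.seq []) k = .seq [] := by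
  simp [dictGet, items_seq]

theorem dictGet_cons (e k : Term) (ts : List Term) :
    dictGet (.seq (e :: ts)) k = if HasKey k e then get e [2] else dictGet (.seq ts) k := by
  have h1 : HasKey k e.nf ↔ HasKey k e := by simp [hasKey_iff]
  simp only [dictGet, items_seq, map_cons, List.find?_cons]
  by_cases h : HasKey k e
  · simp [h1, h]
  · simp [h1, h]

theorem hasKey_pair {k a b : Term} : HasKey k (.seq [a, b]) ↔ a.nf = k.nf := by
  simp [hasKey_iff, nf_seq]

theorem get_pair_two (a b : Term) : get (.seq [a, b]) [2] = b.nf := by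
  rw [get_seq (nf_seq _)]; simp [get_nil]

end

/-! # Predicates closed under derivation -/

theorem all_cons {α} {p : α → Prop} {a b : α} {l : List α} :
    (∀ x ∈ a :: b :: l, p x) ↔ p a ∧ ∀ x ∈ b :: l, p x := forall_mem_cons

theorem all_one {α} {p : α → Prop} {a : α} : (∀ x ∈ [a], p x) ↔ p a := List.forall_mem_singleton

/-- All elements of an explicit list satisfy a predicate. -/
@[reducible] def All (P : Term → Prop) : List Term → Prop
  | [] => True
  | [a] => P a
  | a :: b :: l => P a ∧ All P (b :: l)

theorem All.mem {P : Term → Prop} : ∀ {l : List Term}, All P l → ∀ x ∈ l, P x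
  | [], _ => by simp
  | [a], h => all_one.2 h
  | _ :: _ :: _, h => all_cons.2 ⟨h.1, All.mem h.2⟩

/-- Predicates on terms modulo the equational theory that are closed under all symbols. -/
structure DY (P : Term → Prop) : Prop where
  congr : ∀ {t u}, t.nf = u.nf → P t → P u
  addr : ∀ a, P (.addr a)
  str : ∀ a, P (.str a)
  top : P .top
  bot : P .bot
  undef : P .undef
  pub : ∀ {k}, P k → P (.pub k)
  enca : ∀ {x k}, P x → P k → P (.enca x k)
  deca : ∀ {x k}, P x → P k → P (.deca x k)
  encs : ∀ {x k}, P x → P k → P (.encs x k)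
  decs : ∀ {x k}, P x → P k → P (.decs x k)
  sig : ∀ {x k}, P x → P k → P (.sig x k)
  checksig : ∀ {s x k}, P s → P x → P k → P (.checksig s x k)
  seq : ∀ {ts : List Term}, (∀ t ∈ ts, P t) → P (.seq ts)
  proj : ∀ {t} (i), P t → P (.proj i t)

namespace DY
variable {P : Term → Prop} (h : DY P)
include h

theorem nf_iff {t : Term} : P t.nf ↔ P t := ⟨h.congr (nf_nf t), h.congr (nf_nf t).symm⟩

theorem of_seq {ts : List Term} (hs : P (.seq ts)) {u : Term} (hu : u ∈ ts) : P u := by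
  obtain ⟨i, hi, rfl⟩ := List.getElem_of_mem hu
  refine h.congr ?_ (h.proj (i + 1) hs)
  exact Equiv.nf_eq (.proj_in (by simp [hi]))

theorem list {ts : List Term} (hl : All P ts) : P (.seq ts) := h.seq hl.mem

theorem nil : P (.seq []) := h.list trivial

theorem kw (k : Kw) : P (K k) := h.str _

theorem event {a b c : Term} (ha : P a) (hb : P b) (hc : P c) : P (.seq [a, b, c]) :=
  h.list ⟨ha, hb, hc⟩

theorem one {a b c : Term} (ha : P a) (hb : P b) (hc : P c) :
    ∀ x ∈ [Term.seq [a, b, c]], P x := all_one.2 (h.event ha hb hc)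

theorem seq_iff {ts : List Term} : P (.seq ts) ↔ ∀ t ∈ ts, P t := ⟨fun hs _ => h.of_seq hs, h.seq⟩

theorem get {t : Term} (ht : P t) (p : Ptr) : P (get t p) := by
  induction p generalizing t with
  | nil => exact h.nf_iff.2 ht
  | cons i p ih => exact ih (h.proj i ht)

theorem items {t : Term} (ht : P t) {u : Term} (hu : u ∈ items t) : P u := by
  unfold Spresso.items at hu
  split at hu
  · rename_i ts hts
    exact h.of_seq (hts ▸ h.nf_iff.2 ht) hu
  · simp at hu

theorem setAt {t v : Term} (ht : P t) (hv : P v) (p : Ptr) : P (setAt t p v) := by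
  induction p generalizing t with
  | nil => rwa [setAt_nil]
  | cons i p ih =>
    have ht' := h.nf_iff.2 ht
    unfold Spresso.setAt
    split
    · rename_i ts hts
      rw [hts] at ht'
      split_ifs
      · exact ht'
      · refine h.seq fun u hu => ?_
        rw [List.mem_iff_getElem?] at hu
        obtain ⟨j, hj⟩ := hu
        rw [List.getElem?_modify] at hj
        cases hj' : ts[j]? with
        | none => simp [hj'] at hj
        | some w =>
          have hw : P w := h.of_seq ht' (mem_of_getElem? hj')
          rw [hj'] at hj
          simp only [Option.map_eq_map, Option.map_some, Option.some.injEq] at hj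
          split_ifs at hj
          · exact hj ▸ ih hw
          · exact hj ▸ hw
    · exact ht'

theorem appendAt {t v : Term} (ht : P t) (hv : P v) (p : Ptr) : P (appendAt t p v) := by
  refine h.setAt ht (h.seq fun u hu => ?_) p
  rcases mem_append.1 hu with hu | hu
  · exact h.items (h.get ht p) hu
  · rwa [mem_singleton.1 hu]

theorem dictGet {z : Term} (hz : P z) (k : Term) : P (dictGet z k) := by
  unfold Spresso.dictGet
  split
  · rename_i e he
    exact h.get (h.items hz (List.mem_of_find?_eq_some he)) _
  · exact h.seq (by simp)

theorem pair {a b : Term} (ha : P a) (hb : P b) : P (.seq [a, b]) :=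
  h.seq (by simp [ha, hb])

theorem dictSet {z k v : Term} (hz : P z) (hk : P k) (hv : P v) : P (dictSet z k v) := by
  unfold Spresso.dictSet
  split_ifs
  · refine h.seq fun u hu => ?_
    obtain ⟨e, he, rfl⟩ := mem_map.1 hu
    split_ifs
    · exact h.pair hk hv
    · exact h.items hz he
  · refine h.seq fun u hu => ?_
    rcases mem_append.1 hu with hu | hu
    · exact h.items hz hu
    · rw [mem_singleton.1 hu]; exact h.pair hk hv

theorem dictDel {z : Term} (hz : P z) (k : Term) : P (dictDel z k) :=
  h.seq fun _ hu => h.items hz (List.mem_filter.1 hu).1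

theorem removeElem {z : Term} (hz : P z) (e : Term) : P (removeElem z e) :=
  h.seq fun _ hu => h.items hz (List.mem_of_mem_erase hu)

theorem filter {z : Term} (hz : P z) (q : Term → Bool) :
    P (.seq ((Spresso.items z).filter q)) :=
  h.seq fun _ hu => h.items hz (List.mem_filter.1 hu).1

theorem docOrigin {d : Term} (hd : P d) : P (docOrigin d) := h.pair (h.get hd _) (h.get hd _)

theorem cookiePairs {z : Term} (hz : P z) (q : Term → Bool) :
    P (.seq (((Spresso.items z).filter q).map fun c => .seq [Spresso.get c [1], Spresso.get c [2, 1]])) := by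
  refine h.seq fun u hu => ?_
  obtain ⟨c, hc, rfl⟩ := mem_map.1 hu
  have := h.items hz (List.mem_filter.1 hc).1
  exact h.pair (h.get this _) (h.get this _)

theorem addCookie {z c : Term} (hz : P z) (hc : P c) : P (addCookie z c) := by
  refine h.seq fun u hu => ?_
  rcases mem_append.1 hu with hu | hu
  · exact h.items hz (List.mem_filter.1 hu).1
  · rwa [mem_singleton.1 hu]

theorem cancelNav {s : Term} (hs : P s) (n : Term) : P (cancelNav n s) := by
  have h1 := h.setAt hs (h.filter (h.get hs [11]) (fun e => ¬ ∃ req key f, e ≈ₜ .seq [n, req, key, f])) [11]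
  exact h.setAt h1 (h.filter (h.get h1 [10]) _) _

theorem docSubwindows {d : Term} (hd : P d) : P (docSubwindows d) := by
  unfold Spresso.docSubwindows
  split_ifs <;> exact h.get hd _

theorem treeWindow {t w : Term} (ht : P t) (hw : TreeWindow t w) : P w := by
  induction hw with
  | top hw => exact h.items ht hw
  | sub _ hd hw ih => exact h.items (h.docSubwindows (h.items (h.get ih _) hd)) hw

theorem treeDoc {t n w d : Term} (ht : P t) (hw : TreeDoc t n w d) : P d :=
  h.items (h.get (h.treeWindow ht hw.1) _) hw.2.1

omit h in
theorem orElse {A : Set Term} {x o : Term} (ho : o ∈ orElse A x) (hA : ∀ a ∈ A, P a) (hx : P x) :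
    P o := by
  rcases ho with ho | ⟨_, rfl⟩
  · exact hA _ ho
  · exact hx

theorem scrGetOrigin {t n o : Term} (ht : P t) (ho : o ∈ scrGetOrigin t n) : P o :=
  DY.orElse ho (by rintro a ⟨w, d, hd, rfl⟩; exact h.docOrigin (h.treeDoc ht hd)) h.undef

theorem scrGetParameters {t n o : Term} (ht : P t) (ho : o ∈ scrGetParameters t n) : P o :=
  DY.orElse ho (by rintro a ⟨w, d, hd, rfl⟩; exact h.get (h.treeDoc ht hd) _) h.undef

theorem scrSubwindows {t n o : Term} (ht : P t) (ho : o ∈ scrSubwindows t n) : P o :=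
  DY.orElse ho (by rintro a ⟨w, d, hd, rfl⟩; exact h.docSubwindows (h.treeDoc ht hd))
    (h.seq (by simp))

theorem scrOpenerWindow {t n o : Term} (ht : P t) (ho : o ∈ scrOpenerWindow t n) : P o :=
  DY.orElse ho (by
    rintro a ⟨w, d, hd, rfl⟩
    exact h.get (h.treeWindow ht hd.1) _) h.undef

theorem chooseInput {z : Term} (hz : P z) (p : Term → Prop) : P (chooseInput z p) := by
  unfold Spresso.chooseInput
  cases hf : (Spresso.items z).find? fun t => decide (p t) with
  | none => exact h.bot
  | some u => exact h.items hz (List.mem_of_find?_eq_some hf)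

theorem scriptOut {i s c : Term} (hi : P i) (hs : P s) (hc : P c) : P (scriptOut i s c) :=
  h.seq (by simp [hs, hc, h.get hi])

theorem urlTerm {a b c d : Term} (ha : P a) (hb : P b) (hc : P c) (hd : P d) :
    P (urlTerm a b c d) := h.seq (by simp [*, h.str])

theorem built {V : Set Var} {M : Set Term} (hV : ∀ v ∈ V, P (.var v)) (hM : ∀ t ∈ M, P t)
    {t : Term} (ht : Built V M t) : P t := by
  induction ht with
  | mem ht => exact hM _ ht
  | var hv => exact hV _ hv
  | addr a => exact h.addr a
  | str s => exact h.str s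
  | top => exact h.top
  | bot => exact h.bot
  | undef => exact h.undef
  | pub _ ih => exact h.pub ih
  | enca _ _ h1 h2 => exact h.enca h1 h2
  | deca _ _ h1 h2 => exact h.deca h1 h2
  | encs _ _ h1 h2 => exact h.encs h1 h2
  | decs _ _ h1 h2 => exact h.decs h1 h2
  | sig _ _ h1 h2 => exact h.sig h1 h2
  | checksig _ _ _ h1 h2 h3 => exact h.checksig h1 h2 h3
  | seq _ ih => exact h.seq ih
  | proj i _ ih => exact h.proj i ih

theorem derivable {V : Set Var} {M : Set Term} (hV : ∀ v ∈ V, P (.var v)) (hM : ∀ t ∈ M, P t)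
    {t : Term} (ht : t ∈ derivable V M) : P t := by
  obtain ⟨u, hu, e⟩ := ht
  exact h.congr (Equiv.nf_eq e.symm) (h.built hV hM hu)

end DY

namespace DY
variable {P : Term → Prop} (h : DY P)
include h

theorem script {t : Term} {R : Term → Set Term} (hl : ∀ n, P (.var (.lam n)))
    (hR : IsScript t R) {i o : Term} (hi : P i) (ho : o ∈ R i) : P o := by
  have hK : ∀ k, P (K k) := fun k => h.str _
  have hg : ∀ p, P (Spresso.get i p) := h.get hi
  have hnil : P (.seq []) := h.seq (by simp)
  cases hR with
  | att => exact h.derivable (by rintro _ ⟨n, rfl⟩; exact hl n) (by rintro _ rfl; exact hi) ho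
  | rp =>
    obtain ⟨origin, horigin, ho⟩ := ho
    dsimp only at ho
    have hor : P origin := h.scrGetOrigin (hg _) horigin
    have hin : ∀ p, P (Spresso.chooseInput (Spresso.get i [4]) p) := h.chooseInput (hg _)
    split_ifs at ho with h1 h2 h3 h4 h5
    · obtain ⟨email, hem, rfl⟩ := ho
      have hem := h.items (hg _) hem
      refine h.scriptOut hi (h.setAt (h.setAt (h.setAt (hg _) hem _) (hl _) _) (hK _) _) ?_
      exact h.seq (by simp [hK, hem, hl, h.urlTerm, hnil, h.get hor])
    · subst ho; exact h.scriptOut hi (hg _) hnil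
    · subst ho
      have hb : ∀ k, P (Spresso.dictGet (Spresso.get (Spresso.chooseInput (Spresso.get i [4])
        fun t => ∃ x, t ≈ₜ .seq [K .xhr, x, Spresso.get (Spresso.get i [3]) [3]]) [2]) k) :=
        h.dictGet (h.get (hin _) _)
      refine h.scriptOut hi (h.setAt (h.setAt (h.setAt (h.setAt (hg _) (hb _) _) (hb _) _)
        (hb _) _) (hK _) _) ?_
      refine h.seq ?_
      have := h.pair (hK .loginSessionToken) (hb (K .loginSessionToken))
      have := h.seq (ts := [_]) (by simpa using this)
      simp [hK, h.bot, h.urlTerm, h.get hor, this]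
    · obtain ⟨aux, haux, subs, hsubs, ho⟩ := ho
      have hsubs := h.scrSubwindows (hg _) hsubs
      split_ifs at ho
      · subst ho; exact h.scriptOut hi (hg _) hnil
      · subst ho
        refine h.scriptOut hi (h.setAt (hg _) (hK _) _) (h.seq ?_)
        simp [hK, h.get hsubs, h.seq_iff, h.get (hg _)]
    · obtain ⟨aux, haux, subs, hsubs, ho⟩ := ho
      have hsubs := h.scrSubwindows (hg _) hsubs
      split_ifs at ho
      · subst ho; exact h.scriptOut hi (hg _) hnil
      · subst ho
        refine h.scriptOut hi (h.setAt (h.setAt (hg _) (hl _) _) (hK _) _) (h.seq ?_)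
        simp [hK, h.get (hin _), h.seq_iff, h.get (hg _), h.urlTerm, hl, h.get hor]
    · subst ho; exact h.scriptOut hi (hg _) hnil
  | rpRedir =>
    rw [ho]
    exact h.scriptOut hi (hg _) (h.seq (by simp [hK, hg, h.bot, h.top]))
  | idp =>
    obtain ⟨origin, horigin, params, hparams, ho⟩ := ho
    dsimp only at ho
    have hor : P origin := h.scrGetOrigin (hg _) horigin
    have hpa : ∀ k, P (Spresso.dictGet params k) := h.dictGet (h.scrGetParameters (hg _) hparams)
    have hin : ∀ p, P (Spresso.chooseInput (Spresso.get i [4]) p) := h.chooseInput (hg _)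
    split_ifs at ho
    · subst ho
      refine h.scriptOut hi (h.setAt (hg _) (hK _) _) (h.seq ?_)
      simp [hK, h.seq_iff, h.urlTerm, h.get hor, hpa, hg, h.bot]
    · subst ho; exact h.scriptOut hi (hg _) hnil
    · subst ho
      refine h.scriptOut hi (h.setAt (hg _) (hK _) _) (h.seq ?_)
      simp [hK, h.seq_iff, h.urlTerm, hpa, h.encs, h.get (hin _)]
    · subst ho; exact h.scriptOut hi (hg _) hnil
  | fwd =>
    obtain ⟨parent, hparent, target, htarget, params, hparams, ho⟩ := ho
    dsimp only at ho
    have htg : P target := h.scrOpenerWindow (hg _) htarget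
    have hpa : ∀ k, P (Spresso.dictGet params k) := h.dictGet (h.scrGetParameters (hg _) hparams)
    have hin : ∀ p, P (Spresso.chooseInput (Spresso.get i [4]) p) := h.chooseInput (hg _)
    split_ifs at ho
    · subst ho; exact h.scriptOut hi (hK _) (h.seq (by simp [hK, htg, h.bot]))
    · subst ho; exact h.scriptOut hi (hg _) hnil
    · subst ho
      refine h.scriptOut hi (hK _) (h.seq ?_)
      simp [hK, h.seq_iff, htg, hpa, h.get (h.decs (hpa _) (h.get (hin _) _))]
    · subst ho; exact h.scriptOut hi (hg _) hnil

theorem subst {σ : Var → Term} : DY fun t => P (t.subst σ) where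
  congr he ht := h.congr (Equiv.nf_eq (Equiv.subst σ (equiv_iff_nf.2 he))) ht
  addr := h.addr
  str := h.str
  top := h.top
  bot := h.bot
  undef := h.undef
  pub := h.pub
  enca := h.enca
  deca := h.deca
  encs := h.encs
  decs := h.decs
  sig := h.sig
  checksig := h.checksig
  seq ht := by
    simp only [Term.subst, substList_eq_map]
    exact h.seq (by simpa using ht)
  proj i ht := h.proj i ht

theorem clean_aux (o : Term) :
    (∀ l : List Term, (∀ t ∈ l, P t) → ∀ t ∈ cleanWindows o l, P t) ∧
    (∀ l : List Term, (∀ t ∈ l, P t) → ∀ t ∈ cleanDocs o l, P t) := by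
  refine cleanWindows.mutual_induct o (motive1 := fun l => (∀ t ∈ l, P t) → ∀ t ∈ cleanWindows o l, P t)
    (motive2 := fun l => (∀ t ∈ l, P t) → ∀ t ∈ cleanDocs o l, P t) ?_ ?_ ?_ ?_ ?_ ?_ ?_
  · intro _; simp [cleanWindows]
  · intro n docs op ws h1 h2 hl
    simp only [forall_mem_cons] at hl
    rw [cleanWindows]
    simp only [forall_mem_cons]
    have hw := h.seq_iff.1 hl.1
    simp only [forall_mem_cons] at hw
    exact ⟨h.seq (by simp [hw.1, hw.2.2.1, h.seq (h1 (h.seq_iff.1 hw.2.1))]), h2 hl.2⟩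
  · intro w ws hn h2 hl
    simp only [forall_mem_cons] at hl
    rw [cleanWindows]
    · simp only [forall_mem_cons]
      exact ⟨hl.1, h2 hl.2⟩
    · exact hn
  · intro _; simp [cleanDocs]
  · intro n loc ref script state inputs subs active ds ha h1 h2 hl
    simp only [forall_mem_cons] at hl
    rw [cleanDocs]
    have hd := h.seq_iff.1 hl.1
    simp only [forall_mem_cons] at hd
    have hs : P (.seq (cleanWindows o subs)) := h.seq (h1 (h.seq_iff.1 hd.2.2.2.2.2.2.1))
    simp only [ha, if_true, forall_mem_cons]
    refine ⟨?_, h2 hl.2⟩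
    split_ifs <;> exact h.seq (by simp [hd, hs])
  · intro n loc ref script state inputs subs active ds ha h1 h2 hl
    simp only [forall_mem_cons] at hl
    rw [cleanDocs]
    simp only [ha, if_false]
    exact h2 hl.2
  · intro d ds hn h2 hl
    simp only [forall_mem_cons] at hl
    rw [cleanDocs]
    · exact h2 hl.2
    · exact hn

theorem clean {s : Term} (hs : P s) (d : Term) : P (clean s d) :=
  h.seq ((h.clean_aux _).1 _ fun _ hu => h.items (h.get hs _) hu)

omit h in
theorem foldr_cookies {l : List Term} (q : Term → List Term → Prop)
    [∀ c acc, Decidable (q c acc)] (hl : ∀ t ∈ l, P t) :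
    ∀ t ∈ l.foldr (fun c acc => if q c acc then acc else c :: acc) [], P t := by
  induction l with
  | nil => simp
  | cons a l ih =>
    simp only [forall_mem_cons, List.foldr_cons] at hl ⊢
    split_ifs
    · exact ih hl.2
    · simp only [forall_mem_cons]; exact ⟨hl.1, ih hl.2⟩

theorem cookieMerge {a b : Term} (ha : P a) (hb : P b) : P (cookieMerge a b) := by
  unfold Spresso.cookieMerge
  have hn : ∀ t ∈ ((Spresso.items b).filter fun c => ¬ Spresso.get c [2, 4] ≈ₜ .top), P t :=
    fun _ hu => h.items hb (List.mem_filter.1 hu).1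
  have hn := foldr_cookies (fun c acc => ∃ c' ∈ acc, Spresso.get c' [1] ≈ₜ Spresso.get c [1]) hn
  refine h.seq fun u hu => ?_
  rcases mem_append.1 hu with hu | hu
  · obtain ⟨c, hc, rfl⟩ := mem_map.1 hu
    split
    · rename_i c' hf
      split_ifs
      · exact hn _ (List.mem_of_find?_eq_some hf)
      · exact h.items ha hc
    · exact h.items ha hc
  · exact hn _ (List.mem_filter.1 hu).1

end DY

/-- The effective protocol of a request, after Strict Transport Security. -/
def sendProto (s host proto : Term) : Term := if Mem host (get s [8]) then K .https else proto

/-- The cookies attached to a request. -/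
def sendCookies (s host proto : Term) : Term :=
  .seq (((items (dictGet (get s [4]) host)).filter fun c =>
    get c [2, 2] ≈ₜ .top → sendProto s host proto ≈ₜ K .https).map
      fun c => .seq [get c [1], get c [2, 1]])

/-- Adds a header with a value different from `bot`. -/
def addHdr (m : Term) (k : Kw) (v : Term) : Term :=
  if v ≈ₜ .bot then m else setAt m [7] (dictSet (get m [7]) (K k) v)

/-- The request with the headers added by the browser. -/
def sendMsg (s msg proto origin referrer : Term) : Term :=
  addHdr (addHdr (setAt msg [7] (dictSet (get msg [7]) (K .hCookie)
    (sendCookies s (get msg [4]) proto))) .hOrigin origin) .hReferer referrer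

theorem send_eq (a ref msg proto origin referrer s : Term) :
    send a ref msg proto origin referrer s =
      {([.seq [get s [9], a, .seq [K .dnsResolve, get msg [4], ν 8]]],
        setAt s [10] (dictSet (get s [10]) (ν 8) (.seq [ref, sendMsg s msg proto origin referrer,
          sendProto s (get msg [4]) proto])))} := rfl

/-- Stores the cookies of a response. -/
def storeCookies (host : Term) (cs : List Term) (s : Term) : Term :=
  cs.foldl (fun s c => if IsCookie c then
    setAt s [4] (dictSet (get s [4]) host (addCookie (dictGet (get s [4]) host) c)) else s) s

/-- Records a Strict Transport Security header. -/
def storeSts (resp host proto s : Term) : Term :=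
  if dictMem (get resp [4]) (K .hSts) ∧ proto ≈ₜ K .https then appendAt s [8] host else s

/-- The referrer taken over from a request. -/
def reqReferrer (req : Term) : Term :=
  if dictMem (get req [7]) (K .hReferer) then dictGet (get req [7]) (K .hReferer) else .bot

/-- The origin of a redirected request. -/
def reqOrigin (req proto : Term) : Term :=
  if dictMem (get req [7]) (K .hOrigin) then
    .seq [dictGet (get req [7]) (K .hOrigin), .seq [get req [4], proto]] else .bot

/-- The document created from a response. -/
def respDoc (resp req proto : Term) : Term :=
  .seq [ν 7, urlTerm proto (get req [4]) (get req [5]) (get req [6]), reqReferrer req,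
    get resp [5, 1], get resp [5, 2], .seq [], .seq [], .top]

/-- The reaction to a response after its cookies and headers have been stored. -/
def respond (a resp ref req proto s₀ s : Term) : Set Out :=
  {o | if dictMem (get resp [4]) (K .hLocation) ∧
        (get resp [3] ≈ₜ K .s303 ∨ get resp [3] ≈ₜ K .s307) then
      if ¬ ∃ w, Subwindows s w ∧ get s (w ++ [1]) ≈ₜ ref then o = ([], s₀)
      else o ∈ send a ref (httpRequest (ν 6)
          (if get resp [3] ≈ₜ K .s303 ∧ ¬ (get req [3] ≈ₜ K .get ∨ get req [3] ≈ₜ K .head) then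
            K .get else get req [3])
          (get (dictGet (get resp [4]) (K .hLocation)) [3])
          (get (dictGet (get resp [4]) (K .hLocation)) [4])
          (get (dictGet (get resp [4]) (K .hLocation)) [5]) (.seq [])
          (if get resp [3] ≈ₜ K .s303 ∧ ¬ (get req [3] ≈ₜ K .get ∨ get req [3] ≈ₜ K .head) then
            .seq [] else get req [8]))
          (get (dictGet (get resp [4]) (K .hLocation)) [2]) (reqOrigin req proto)
          (reqReferrer req) s
    else if ∃ w, Subwindows s w ∧ get s (w ++ [1]) ≈ₜ ref then
      ∃ w, Subwindows s w ∧ get s (w ++ [1]) ≈ₜ ref ∧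
        if ¬ ∃ x y, get resp [5] ≈ₜ .seq [x, y] then o = ([], s)
        else if items (get s (w ++ [2])) = [] then
          o = ([], setAt s (w ++ [2]) (.seq [respDoc resp req proto]))
        else ∃ i, IsActiveDoc s w (w ++ [2, i]) ∧
          o = ([], setAt (setAt s (w ++ [2, i, 8]) .bot) (w ++ [2])
            (.seq ((items (get (setAt s (w ++ [2, i, 8]) .bot) (w ++ [2]))).take i ++
              [respDoc resp req proto])))
    else if ∃ w d, Subwindows s w ∧ IsActiveDoc s w d ∧
        get s (d ++ [1]) ≈ₜ .proj 1 ref then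
      ∃ w d, Subwindows s w ∧ IsActiveDoc s w d ∧ get s (d ++ [1]) ≈ₜ .proj 1 ref ∧
        o = ([], appendAt s (d ++ [6]) (.seq [K .xhr, get resp [5], get ref [2]]))
    else o = ([], s)}

theorem processResponse_cases {a resp ref req proto s₀ s : Term} {o : Out}
    (ho : o ∈ processResponse a resp ref req proto s₀ s) :
    ∃ cs : List Term, cs.Perm (items (dictGet (get resp [4]) (K .hSetCookie))) ∧
      ∃ s', s' = storeSts resp (get req [4]) proto (storeCookies (get req [4]) cs s) ∧
      ((dictMem (get resp [4]) (K .hLocation) ∧ (o = ([], s₀) ∨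
          (∃ w, Subwindows s' w ∧ get s' (w ++ [1]) ≈ₜ ref) ∧ ∃ meth body,
            (meth = K .get ∨ meth = get req [3]) ∧ (body = .seq [] ∨ body = get req [8]) ∧
            o ∈ send a ref (httpRequest (ν 6) meth
              (get (dictGet (get resp [4]) (K .hLocation)) [3])
              (get (dictGet (get resp [4]) (K .hLocation)) [4])
              (get (dictGet (get resp [4]) (K .hLocation)) [5]) (.seq []) body)
              (get (dictGet (get resp [4]) (K .hLocation)) [2]) (reqOrigin req proto)
              (reqReferrer req) s')) ∨
        (∃ w, Subwindows s' w ∧ get s' (w ++ [1]) ≈ₜ ref ∧ (o = ([], s') ∨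
          (∃ x y, get resp [5] ≈ₜ .seq [x, y]) ∧
            (items (get s' (w ++ [2])) = [] ∧
              o = ([], setAt s' (w ++ [2]) (.seq [respDoc resp req proto])) ∨
            ∃ i, IsActiveDoc s' w (w ++ [2, i]) ∧
              o = ([], setAt (setAt s' (w ++ [2, i, 8]) .bot) (w ++ [2])
                (.seq ((items (get (setAt s' (w ++ [2, i, 8]) .bot) (w ++ [2]))).take i ++
                  [respDoc resp req proto])))))) ∨
        (∃ w d, Subwindows s' w ∧ IsActiveDoc s' w d ∧ get s' (d ++ [1]) ≈ₜ .proj 1 ref ∧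
          o = ([], appendAt s' (d ++ [6]) (.seq [K .xhr, get resp [5], get ref [2]]))) ∨
        o = ([], s')) := by
  obtain ⟨cs, hcs, ho⟩ := ho
  refine ⟨cs, hcs, _, rfl, ?_⟩
  change o ∈ respond a resp ref req proto s₀
    (storeSts resp (get req [4]) proto (storeCookies (get req [4]) cs s)) at ho
  generalize storeSts resp (get req [4]) proto (storeCookies (get req [4]) cs s) = s' at ho ⊢
  rw [respond, mem_ofPred_eq] at ho
  by_cases c1 : dictMem (get resp [4]) (K .hLocation) ∧
    (get resp [3] ≈ₜ K .s303 ∨ get resp [3] ≈ₜ K .s307)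
  · rw [if_pos c1] at ho
    left
    refine ⟨c1.1, ?_⟩
    by_cases c2 : ¬ ∃ w, Subwindows s' w ∧ get s' (w ++ [1]) ≈ₜ ref
    · rw [if_pos c2] at ho; exact .inl ho
    · rw [if_neg c2] at ho
      exact .inr ⟨not_not.1 c2, _, _, ite_eq_or_eq _ _ _, ite_eq_or_eq _ _ _, ho⟩
  rw [if_neg c1] at ho
  right
  by_cases c2 : ∃ w, Subwindows s' w ∧ get s' (w ++ [1]) ≈ₜ ref
  · rw [if_pos c2] at ho
    left
    obtain ⟨w, hw, hn, ho⟩ := ho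
    refine ⟨w, hw, hn, ?_⟩
    by_cases c3 : ¬ ∃ x y, get resp [5] ≈ₜ .seq [x, y]
    · rw [if_pos c3] at ho; exact .inl ho
    · rw [if_neg c3] at ho
      refine .inr ⟨not_not.1 c3, ?_⟩
      by_cases c4 : items (get s' (w ++ [2])) = []
      · rw [if_pos c4] at ho; exact .inl ⟨c4, ho⟩
      · rw [if_neg c4] at ho; exact .inr ho
  rw [if_neg c2] at ho
  right
  by_cases c3 : ∃ w d, Subwindows s' w ∧ IsActiveDoc s' w d ∧ get s' (d ++ [1]) ≈ₜ .proj 1 ref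
  · rw [if_pos c3] at ho; exact .inl ho
  · rw [if_neg c3] at ho; exact .inr ho

/-- All parts of an output satisfy `P`. -/
def OutP (P : Term → Prop) (o : Out) : Prop := (∀ x ∈ o.1, P x) ∧ P o.2

namespace DY
variable {P : Term → Prop} (h : DY P)
include h

theorem httpRequest {a b c d e f g : Term} (ha : P a) (hb : P b) (hc : P c) (hd : P d) (he : P e)
    (hf : P f) (hg : P g) : P (httpRequest a b c d e f g) := h.seq (by simp [*, h.str])

theorem okResponse {k n a b : Term} (hk : P k) (hn : P n) (ha : P a) (hb : P b) :
    P (okResponse k n a b) := h.encs (h.seq (by simp [*, h.str])) hk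

omit h in
theorem noOut {s : Term} (hs : P s) : OutP P ([], s) := ⟨by simp, hs⟩

variable (hν : ∀ k, P (ν k))
include hν

theorem navigable {w : Ptr} {window nr s : Term} (hs : P s) {x : Ptr × Term}
    (hx : x ∈ getNavigableWindow w window nr s) : P x.2 := by
  unfold getNavigableWindow at hx
  split_ifs at hx
  · rw [hx]
    refine h.appendAt hs (h.seq ?_) _
    simp [hν, h.seq_iff, h.get hs]
  · rw [hx]
    refine h.appendAt hs (h.seq ?_) _
    simp [hν, h.seq_iff, h.bot]
  · exact hx.2.2 ▸ hs
  · rw [hx]; exact hs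

theorem send {a ref msg proto origin referrer s : Term} (ha : P a)
    (hr : P ref) (hm : P msg) (hp : P proto) (ho : P origin) (hf : P referrer) (hs : P s)
    {o : Out} (hx : o ∈ send a ref msg proto origin referrer s) : OutP P o := by
  rw [send_eq, mem_singleton_iff] at hx
  subst hx
  have hadd : ∀ {m v : Term} {k}, P m → P v → P (addHdr m k v) := by
    intro m v k hm hv
    unfold addHdr
    split_ifs
    · exact hm
    · exact h.setAt hm (h.dictSet (h.get hm _) (h.kw _) hv) _
  have h1 : P (sendMsg s msg proto origin referrer) :=
    hadd (hadd (h.setAt hm (h.dictSet (h.get hm [7]) (h.kw .hCookie)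
      (h.cookiePairs (h.dictGet (h.get hs _) _) _)) [7]) ho) hf
  have h2 : P (sendProto s (Spresso.get msg [4]) proto) := by
    unfold sendProto
    split_ifs
    · exact h.kw _
    · exact hp
  refine ⟨by simp [h.seq_iff, h.get hs, ha, h.get hm, hν, h.kw], ?_⟩
  exact h.setAt hs (h.dictSet (h.get hs _) (hν _) (h.seq (by simp [hr, h1, h2]))) _

omit hν in
theorem moveActive {s : Term} (hs : P s) (w : Ptr) (i j : ℕ) : P (moveActive s w i j) :=
  h.cancelNav (h.setAt (h.setAt hs h.bot _) h.top _) _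

omit h hν in
theorem ite {c : Prop} [Decidable c] {x y : Term} (hx : P x) (hy : P y) :
    P (if c then x else y) := by split_ifs <;> assumption

theorem runCommand {a s cmd : Term} {w d : Ptr} (ha : P a) (hs : P s)
    (hc : P cmd) {o : Out} (ho : o ∈ runCommand a w d s cmd) : OutP P o := by
  have hg := h.get hs
  have hc' := h.nf_iff.2 hc
  unfold Spresso.runCommand at ho
  dsimp only at ho
  split at ho <;> (try rename_i heq; rw [heq, h.seq_iff] at hc'; simp only [forall_mem_cons] at hc')
  · obtain ⟨x, hx, ho⟩ := ho
    have hx := h.navigable hν hs hx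
    exact h.send hν ha (h.get hx _) (h.httpRequest (hν _) (h.kw _) (h.get hc'.2.1 _)
      (h.get hc'.2.1 _) (h.get hc'.2.1 _) h.nil h.nil) (h.get hc'.2.1 _) h.bot
      (DY.ite (hg _) h.bot) (h.cancelNav hx _) ho
  · obtain ⟨w', hw', d', hd', ho⟩ := ho
    exact h.send hν ha (hν _) (h.httpRequest (hν _) (h.kw _) (h.get hc'.2.1 _)
      (h.get hc'.2.1 _) (h.get hc'.2.1 _) h.nil h.nil) (h.get hc'.2.1 _) h.bot (hg _)
      (h.appendAt hs (h.seq (by simp [hν, h.nil, h.bot])) _) ho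
  · rename_i url method data window
    by_cases hm : ¬ (method ≈ₜ K .get ∨ method ≈ₜ K .post)
    · rw [if_pos hm] at ho
      rw [ho]; exact DY.noOut hs
    · rw [if_neg hm] at ho
      obtain ⟨x, hx, ho⟩ := ho
      have hx := h.navigable hν hs hx
      exact h.send hν ha (h.get hx _) (h.httpRequest (hν _) hc'.2.2.1 (h.get hc'.2.1 _)
        (h.get hc'.2.1 _) (DY.ite hc'.2.2.2.1 (h.get hc'.2.1 _)) h.nil (DY.ite h.nil hc'.2.2.2.1))
        (h.get hc'.2.1 _) (DY.ite h.bot (h.docOrigin (hg _))) (hg _) (h.cancelNav hx _) ho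
  · obtain ⟨w', hw', d', hd', rfl⟩ := ho
    exact DY.noOut (h.setAt hs hc'.2.2.1 _)
  · obtain ⟨w', hw', d', hd', rfl⟩ := ho
    exact DY.noOut (h.setAt hs hc'.2.2.1 _)
  · split_ifs at ho
    · exact ho ▸ DY.noOut hs
    · exact ho ▸ DY.noOut hs
    all_goals
      refine h.send hν ha (h.pair (hg _) hc'.2.2.2.2.1) (h.httpRequest (hν _) hc'.2.2.1
        (h.get hc'.2.1 _) (h.get hc'.2.1 _) (h.get hc'.2.1 _) h.nil ?_)
        (h.get hc'.2.1 _) ?_ (hg _) hs ho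
      · first | exact h.nil | exact hc'.2.2.2.1
      · first | exact h.bot | exact h.docOrigin (hg _)
  · obtain ⟨x, hx, ho⟩ := ho
    have hx := h.navigable hν hs hx
    split_ifs at ho
    · obtain ⟨j, _, _, rfl⟩ := ho
      exact DY.noOut (h.moveActive hx _ _ _)
    · exact ho ▸ DY.noOut hx
  · obtain ⟨x, hx, ho⟩ := ho
    have hx := h.navigable hν hs hx
    split_ifs at ho
    · obtain ⟨j, _, _, rfl⟩ := ho
      exact DY.noOut (h.moveActive hx _ _ _)
    · exact ho ▸ DY.noOut hx
  · obtain ⟨x, hx, p, i, _, rfl⟩ := ho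
    have hx := h.navigable hν hs hx
    exact DY.noOut (h.setAt hx (h.seq fun u hu => DY.items h (h.get hx _) (List.mem_of_mem_eraseIdx hu)) _)
  · obtain ⟨w', _, _, ho⟩ := ho
    split_ifs at ho
    · obtain ⟨d', _, _, rfl⟩ := ho
      exact DY.noOut (h.appendAt hs (h.seq (by simp [h.kw, hg, hc', h.docOrigin])) _)
    · exact ho ▸ DY.noOut hs
  · exact ho ▸ DY.noOut hs

theorem runScript {a s : Term} {w d : Ptr}
    (hNL : ∀ t, P t → ∀ n, ¬ VarIn (.lam n) t.nf) (ha : P a) (hs : P s)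
    {o : Out} (ho : o ∈ runScript a w d s) : OutP P o := by
  have hg := h.get hs
  obtain ⟨R, out, state', cookies', ls', ss', cmd, hR, hout, heq, _, ho⟩ := ho
  have hP := (h.subst (σ := lamToNu)).script (fun n => hν _) hR (i := _) ?_ hout
  · have hP := h.nf_iff.2 hP
    rw [heq, h.seq_iff] at hP
    simp only [forall_mem_cons] at hP
    refine h.runCommand hν ha ?_ hP.2.2.2.2.1 ho
    have h1 := h.setAt hs (h.dictSet (hg [4]) (h.get (h.docOrigin (hg d)) [1])
      (h.cookieMerge (h.dictGet (hg [4]) (Spresso.get (Spresso.docOrigin (Spresso.get s d)) [1])) hP.2.1)) [4]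
    have h2 := h.setAt h1 (h.dictSet (h.get h1 [5]) (h.docOrigin (hg d)) hP.2.2.1) [5]
    exact h.setAt (h.setAt h2 (h.dictSet (h.get h2 [6]) (h.pair (h.docOrigin (hg d)) (hg _))
      hP.2.2.2.1) [6]) hP.1 _
  · have hin : ∀ {t}, P t → P (t.subst lamToNu) := fun {t} ht => by
      have h2 : t.nf.subst lamToNu = t.nf := subst_eq_self fun v hv => by
        cases v with
        | nu => rfl
        | lam n => exact (hNL t ht n hv).elim
      refine h.congr ?_ ht
      have h3 : _ := ren_nf lamToNu t
      unfold ren at h3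
      rw [← h3, h2, nf_nf]
    refine hin (h.seq ?_)
    simp only [forall_mem_cons, hg, h.clean hs, h.get (hg _), h.dictGet (hg _), true_and]
    simpa using h.cookiePairs (h.dictGet (hg _) _) _

omit hν in
theorem storeCookies {host s : Term} {cs : List Term} (hh : P host) (hcs : ∀ c ∈ cs, P c)
    (hs : P s) : P (storeCookies host cs s) := by
  unfold Spresso.storeCookies
  induction cs generalizing s with
  | nil => exact hs
  | cons c l ih =>
    simp only [forall_mem_cons] at hcs
    rw [List.foldl_cons]
    refine ih hcs.2 ?_
    split_ifs
    · exact h.setAt hs (h.dictSet (h.get hs _) hh (h.addCookie (h.dictGet (h.get hs _) _) hcs.1)) _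
    · exact hs

omit hν in
theorem storeSts {resp host proto s : Term} (hh : P host) (hs : P s) :
    P (storeSts resp host proto s) := DY.ite (h.appendAt hs hh _) hs

omit hν in
theorem reqReferrer {req : Term} (hq : P req) : P (reqReferrer req) :=
  DY.ite (h.dictGet (h.get hq _) _) h.bot

omit hν in
theorem reqOrigin {req proto : Term} (hq : P req) (hp : P proto) : P (reqOrigin req proto) :=
  DY.ite (h.pair (h.dictGet (h.get hq _) _) (h.pair (h.get hq _) hp)) h.bot

theorem respDoc {resp req proto : Term} (hr : P resp) (hq : P req)
    (hp : P proto) : P (respDoc resp req proto) :=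
  h.seq (by simp [hν, h.urlTerm hp (h.get hq _) (h.get hq _) (h.get hq _), h.reqReferrer hq,
    h.get hr, h.seq_iff, h.top])

theorem processResponse {a resp ref req proto s₀ s : Term} (ha : P a)
    (hp : P resp) (hr : P ref) (hq : P req) (hpr : P proto) (hs₀ : P s₀) (hs : P s) {o : Out}
    (ho : o ∈ processResponse a resp ref req proto s₀ s) : OutP P o := by
  obtain ⟨cs, hcs, s', rfl, ho⟩ := processResponse_cases ho
  have h2 := h.storeSts (resp := resp) (proto := proto) (h.get hq [4])
    (h.storeCookies (h.get hq [4]) (cs := cs)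
      (fun c hc => DY.items h (h.dictGet (h.get hp _) _) (hcs.mem_iff.1 hc)) hs)
  revert ho
  generalize Spresso.storeSts resp _ _ _ = s2 at h2 ⊢
  intro ho
  rcases ho with ⟨_, rfl | ⟨_, me, bd, hme, hbd, ho⟩⟩ | ⟨w, _, _, ho⟩ | ⟨w, d, _, _, _, rfl⟩ | rfl
  · exact DY.noOut hs₀
  · have hu := h.dictGet (h.get hp [4]) (K .hLocation)
    have hme : P me := by rcases hme with rfl | rfl; exacts [h.kw _, h.get hq _]
    have hbd : P bd := by rcases hbd with rfl | rfl; exacts [h.nil, h.get hq _]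
    exact h.send hν ha hr (h.httpRequest (hν _) hme (h.get hu _) (h.get hu _) (h.get hu _)
      h.nil hbd) (h.get hu _) (h.reqOrigin hq hpr) (h.reqReferrer hq) h2 ho
  · have hdoc := h.respDoc hν hp hq hpr
    rcases ho with rfl | ⟨_, ⟨_, rfl⟩ | ⟨i, _, rfl⟩⟩
    · exact DY.noOut h2
    · exact DY.noOut (h.setAt h2 (h.seq (by simpa using hdoc)) _)
    · have h3 := h.setAt h2 h.bot (w ++ [2, i, 8])
      refine DY.noOut (h.setAt h3 (h.seq fun u hu => ?_) _)
      rcases mem_append.1 hu with hu | hu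
      · exact DY.items h (h.get h3 _) (List.mem_of_mem_take hu)
      · rwa [mem_singleton.1 hu]
  · exact DY.noOut (h.appendAt h2 (h.seq (by simp [h.kw, h.get hp, h.get hr])) _)
  · exact DY.noOut h2

theorem corruptOut {a s : Term} (ha : P a) (hs : P s) {o : Out}
    (ho : o ∈ corruptOut a s) : OutP P o := by
  obtain ⟨m', a', hm, rfl⟩ := ho
  have := h.derivable (by rintro _ ⟨n, rfl⟩; exact hν n) (by rintro _ rfl; exact hs) hm
  exact ⟨h.one (h.addr _) ha this, hs⟩

omit hν in
theorem closeCorrupt {s : Term} (hs : P s) : P (closeCorrupt s) := by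
  have h1 := h.setAt (h.setAt (h.setAt (h.setAt (h.setAt hs h.nil [3]) h.nil [1]) h.nil [10]) h.nil
    [11]) h.nil [6]
  refine h.setAt (h.setAt h1 (h.seq fun u hu => ?_) _) (h.str _) _
  obtain ⟨e, he, rfl⟩ := mem_map.1 hu
  have he := DY.items h (h.get h1 _) he
  exact h.pair (h.get he _) (h.filter (h.get he _) _)

theorem browserTrigger {D : Finset Str} {a s : Term}
    (hNL : ∀ t, P t → ∀ n, ¬ VarIn (.lam n) t.nf) (ha : P a) (hs : P s)
    {o : Out} (ho : o ∈ browserTrigger D a s) : OutP P o := by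
  have hg := h.get hs
  rcases ho with (ho | ho) | ho
  · rw [mem_ofPred_eq] at ho
    split_ifs at ho
    · obtain ⟨w, d, _, _, _, ho⟩ := ho
      exact h.runScript hν hNL ha hs ho
    · exact ho ▸ DY.noOut hs
  · obtain ⟨pr, host, path, params, hpr, _, _, ho⟩ := ho
    refine h.send hν ha (hν _) (h.httpRequest (hν _) (h.kw _) (h.str _) (h.str _)
      (h.seq fun u hu => ?_) h.nil h.nil) ?_ h.bot h.bot (h.appendAt hs (h.seq ?_) _) ho
    · obtain ⟨x, _, rfl⟩ := mem_map.1 hu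
      exact h.pair (h.str _) (h.str _)
    · rcases hpr with rfl | rfl <;> exact h.kw _
    · simp [hν, h.nil, h.bot]
  · rw [mem_ofPred_eq] at ho
    split_ifs at ho
    · obtain ⟨w, d, _, _, _, ho⟩ := ho
      exact h.send hν ha (hg _) (h.httpRequest (hν _) (h.kw _) (h.get (hg _) _) (h.get (hg _) _)
        (h.get (hg _) _) h.nil h.nil) (h.get (hg _) _) h.bot (hg _) (h.cancelNav hs _) ho
    · exact ho ▸ DY.noOut hs

theorem browserAlg {D : Finset Str} {a f m s : Term}
    (hNL : ∀ t, P t → ∀ n, ¬ VarIn (.lam n) t.nf) (ha : P a) (hm : P m) (hs : P s)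
    {o : Out} (ho : o ∈ browserAlg D a f m s) : OutP P o := by
  have hg := h.get hs
  unfold Spresso.browserAlg at ho
  dsimp only at ho
  split_ifs at ho
  · exact h.browserTrigger hν hNL ha hs ho
  · exact ho ▸ DY.noOut (h.setAt hs (h.kw _) _)
  · exact ho ▸ DY.noOut (h.closeCorrupt hs)
  · obtain ⟨e, he, ho⟩ := ho
    obtain ⟨_, _, _, _, hmem, _⟩ := he
    have hme := DY.items h (hg _) hmem
    split_ifs at ho
    · exact h.processResponse hν ha (h.get (h.decs hm (h.get hme _)) _) (h.get hme _)
        (h.get hme _) (h.kw _) hs (h.setAt hs (h.removeElem (hg _) _) _) ho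
    · exact ho ▸ DY.noOut hs
  · obtain ⟨e, he, ho⟩ := ho
    obtain ⟨_, _, _, hmem, _⟩ := he
    have hme := DY.items h (hg _) hmem
    exact h.processResponse hν ha (h.get hm _) (h.get hme _)
        (h.get hme _) (h.kw _) hs (h.setAt hs (h.removeElem (hg _) _) _) ho
  · exact ho ▸ DY.noOut hs
  · rw [ho]
    have hpd := h.dictGet (hg [10]) (Spresso.get m [4])
    refine ⟨h.one (h.get hm _) ha
      (h.enca (h.pair (h.get hpd _) (hν _)) (h.dictGet (hg _) _)), ?_⟩
    · refine h.appendAt (h.setAt hs (h.dictDel (hg _) _) _) (h.seq ?_) _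
      simp [h.get hpd, hν, h.get hm]
  · rw [ho]
    have hpd := h.dictGet (hg [10]) (Spresso.get m [4])
    refine ⟨h.one (h.get hm _) ha (h.get hpd _), ?_⟩
    · refine h.appendAt (h.setAt hs (h.dictDel (hg _) _) _) (h.seq ?_) _
      simp [h.get hpd, h.bot, h.get hm]
  · exact ho ▸ DY.noOut hs
  · exact h.corruptOut hν ha (h.setAt hs (h.pair hm (hg _)) _) ho

omit hν in
theorem httpsRequest {keys m inD k n me pa par hd bd : Term} (hk : P keys) (hm : P m)
    (hr : HttpsRequest keys m inD k n me pa par hd bd) :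
    P inD ∧ P k ∧ P n ∧ P me ∧ P pa ∧ P par ∧ P hd ∧ P bd := by
  obtain ⟨k', hmem, heq⟩ := hr
  have hk' := h.seq_iff.1 (DY.items h hk hmem)
  have hx := h.nf_iff.2 (h.deca hm (hk' k' (by simp)))
  rw [heq, h.seq_iff] at hx
  simp only [forall_mem_cons] at hx
  have hx2 := h.seq_iff.1 hx.1
  simp only [forall_mem_cons] at hx2
  tauto

theorem sendStartLoginResponse {a f k n email inD s : Term} (ha : P a)
    (hf : P f) (hk : P k) (hn : P n) (he : P email) (hi : P inD) (hs : P s) {o : Out}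
    (ho : o ∈ sendStartLoginResponse a f k n email inD s) : OutP P o := by
  unfold Spresso.sendStartLoginResponse at ho
  dsimp only at ho
  rw [ho]
  have hb : P (.seq [.seq [K .tagKey, ν 2], .seq [K .loginSessionToken, ν 4],
    .seq [K .fwdDomain, Spresso.get s [2]]]) := h.seq (by simp [h.seq_iff, h.kw, hν, h.get hs])
  refine ⟨h.one hf ha (h.okResponse hk hn h.nil hb), ?_⟩
  · refine h.setAt hs (h.dictSet (h.get hs _) (hν _) (h.seq ?_)) _
    simp [he, hν, h.encs, h.seq_iff, hi]

theorem rpRequest {ids : Finset Identity} {a f inD k n me pa par hd bd s : Term}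
    (ha : P a) (hf : P f) (hr : P inD ∧ P k ∧ P n ∧ P me ∧ P pa ∧ P par ∧ P hd ∧ P bd)
    (hs : P s) {o : Out} (ho : o ∈ rpRequest ids a f inD k n me pa par hd bd s) : OutP P o := by
  have hg := h.get hs
  obtain ⟨hi, hk, hn, hme, hpa, hpar, hhd, hbd⟩ := hr
  have hone {b} (hb : P b) := h.one hf ha (h.okResponse hk hn h.nil hb)
  unfold Spresso.rpRequest at ho
  dsimp only at ho
  split_ifs at ho
  · rw [ho]
    exact ⟨hone (h.pair (h.kw _) (h.seq (by simp [h.kw, h.bot]))), hs⟩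
  · exact h.sendStartLoginResponse hν ha hf hk hn hbd hi hs ho
  · rw [ho]
    refine ⟨?_, ?_⟩
    · simp [h.seq_iff, hg, ha, h.kw, h.get hbd, hν]
    · refine h.setAt hs (h.dictSet (hg _) (hν _) (h.pair (h.seq ?_) ?_)) _
      · simp [*]
      · exact h.httpRequest (hν _) (h.kw _) (h.get hbd _) (h.kw _) h.nil h.nil h.nil
  · exact ho ▸ DY.noOut hs
  · exact ho ▸ DY.noOut hs
  · rw [ho]
    have hls := h.dictGet (hg [7]) (Spresso.dictGet par (K .loginSessionToken))
    refine ⟨hone (h.pair (h.kw _) (h.urlTerm (h.kw _) (h.get hls _) (h.kw _) (h.seq ?_))), hs⟩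
    simp [h.seq_iff, h.kw, h.get hls, hg]
  · exact ho ▸ DY.noOut hs
  · rw [ho]
    have hls := h.dictGet (hg [7]) (Spresso.dictGet bd (K .loginSessionToken))
    have ht := h.pair (hν 7) (h.get hls [1])
    exact ⟨hone ht, h.appendAt (h.setAt hs (h.dictDel (hg _) _) _) ht _⟩
  · exact ho ▸ DY.noOut hs
  · exact ho ▸ DY.noOut hs

theorem rpAlg {D : Finset Str} {ids : Finset Identity} {a f m s : Term}
    (ha : P a) (hf : P f) (hm : P m) (hs : P s)
    {o : Out} (ho : o ∈ rpAlg D ids a f m s) : OutP P o := by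
  have hg := h.get hs
  unfold Spresso.rpAlg at ho
  dsimp only at ho
  split_ifs at ho
  · exact h.corruptOut hν ha (h.setAt hs (h.pair (h.seq (by simp [*])) (hg _)) _) ho
  · obtain ⟨e, he, ho⟩ := ho
    obtain ⟨_, _, _, _, hmem, _⟩ := he
    have hme := DY.items h (hg _) hmem
    split_ifs at ho
    · have h1 := h.setAt hs (h.removeElem (hg [6]) e) [6]
      exact h.sendStartLoginResponse hν (h.get hme _) (h.get hme _) (h.get hme _) (h.get hme _)
        (h.get hme _) (h.get hme _) (h.setAt h1 (h.dictSet (h.get h1 _) (h.get hme _)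
        (h.get (h.get (h.decs hm (h.get hme _)) _) _)) _) ho
    · exact ho ▸ DY.noOut hs
    · exact ho ▸ DY.noOut hs
  · exact ho ▸ DY.noOut hs
  · rw [ho]
    have hpd := h.dictGet (hg [5]) (Spresso.get m [4])
    have h1 := h.appendAt hs (v := .seq [Spresso.get (Spresso.dictGet (Spresso.get s [5])
      (Spresso.get m [4])) [1], Spresso.get (Spresso.dictGet (Spresso.get s [5])
      (Spresso.get m [4])) [2], ν 5, Spresso.get m [3]])
      (h.seq (by simp [h.get hpd, hν, h.get hm])) [6]
    exact ⟨h.one (h.get hm _) ha (h.enca (h.pair (h.get hpd _) (hν _)) (h.dictGet (hg _) _)),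
      h.setAt h1 (h.dictDel (hg _) _) _⟩
  · obtain ⟨_, _, _, _, _, _, _, _, hr, ho⟩ := ho
    exact h.rpRequest hν ha hf (h.httpsRequest (hg _) hm hr) hs ho
  · exact ho ▸ DY.noOut hs

theorem idpRequest {a f k n me pa hd bd s : Term} (ha : P a) (hf : P f)
    (hk : P k) (hn : P n) (hbd : P bd)
    (hs : P s) {o : Out} (ho : o ∈ idpRequest a f k n me pa hd bd s) : OutP P o := by
  have hg := h.get hs
  have hone {c b} (hc : P c) (hb : P b) := h.one hf ha (h.okResponse hk hn hc hb)
  have hd : ∀ k, P (Spresso.dictGet bd k) := h.dictGet hbd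
  unfold Spresso.idpRequest at ho
  dsimp only at ho
  split_ifs at ho
  · rw [ho]
    exact ⟨hone h.nil (h.seq (by simp [h.seq_iff, h.kw, h.pub, hg])), hs⟩
  · rw [ho]
    exact ⟨hone h.nil (h.pair (h.kw _) (h.seq (by simp [h.kw, h.nil, h.dictGet (hg _)]))), hs⟩
  · exact ho ▸ DY.noOut hs
  · rw [ho]
    refine ⟨hone ?_ ?_, h.setAt hs (h.dictSet (hg _) (hν _) (hd _)) _⟩
    · simp [h.seq_iff, h.kw, hν, h.top]
    · exact h.sig (h.seq (by simp [hd])) (hg _)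
  · exact ho ▸ DY.noOut hs

theorem idpAlg {a f m s : Term} (ha : P a) (hf : P f) (hm : P m) (hs : P s)
    {o : Out} (ho : o ∈ idpAlg a f m s) : OutP P o := by
  have hg := h.get hs
  unfold Spresso.idpAlg at ho
  split_ifs at ho
  · exact h.corruptOut hν ha (h.setAt hs (h.pair (h.seq (by simp [*])) (hg _)) _) ho
  · obtain ⟨_, _, _, _, _, _, _, _, hr, ho⟩ := ho
    have hr := h.httpsRequest (hg _) hm hr
    exact h.idpRequest hν ha hf hr.2.1 hr.2.2.1 hr.2.2.2.2.2.2.2 hs ho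
  · exact ho ▸ DY.noOut hs

theorem fwdAlg {a f m s : Term} (ha : P a) (hf : P f) (hm : P m) (hs : P s)
    {o : Out} (ho : o ∈ fwdAlg a f m s) : OutP P o := by
  have hg := h.get hs
  unfold Spresso.fwdAlg at ho
  split_ifs at ho
  · exact h.corruptOut hν ha (h.setAt hs (h.pair (h.seq (by simp [*])) (hg _)) _) ho
  · obtain ⟨_, _, _, _, _, _, _, _, hr, rfl⟩ := ho
    have hr := h.httpsRequest (hg _) hm hr
    exact ⟨h.one hf ha (h.okResponse hr.2.1 hr.2.2.1 h.nil (h.pair (h.kw _) (h.kw _))), hs⟩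
  · exact ho ▸ DY.noOut hs

theorem attackerRel {e s : Term} {E : List Term} {s' : Term} (he : P e)
    (hs : P s) (hr : attackerRel e s E s') : OutP P (E, s') := by
  have hE : ∀ x ∈ E, P x := by
    intro x hx
    obtain ⟨a, f, m, rfl, hm⟩ := hr.2 x hx
    have := h.derivable (by rintro _ ⟨n, rfl⟩; exact hν n) (by simp [he, hs]) hm
    exact h.seq (by simp [h.addr, this])
  exact ⟨hE, hr.1 ▸ h.seq (by simp [he, hs, h.seq hE])⟩

end DY

/-! # Roles of names, and terms that may be known to the adversary -/

/-- Classes of hosts: those of the honest relying party, identity provider and forwarder under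
consideration, and all others. -/
inductive Cls
  | rp | idp | fwd | other

/-- The static data of the analysis: classes of hosts, SSL keys, the signing key of the identity
provider, the forwarder domain of the relying party, the identities of the browser, and the
identity whose service tokens are to be protected. -/
structure Env where
  cls : Str → Cls
  ssl : Str → ℕ
  sk : ℕ
  fd : Str
  own : Str → Str → Prop
  me : Str → Str → Prop
  /-- Nonces that are known to everyone. -/
  pubs : ℕ → Prop
  /-- Constant components of the state of the browser. -/
  ids : Term
  sec : Term
  km : Term
  da : Term

/-- Requests to a host. -/
structure Req where
  n : Term
  meth : Term
  host : Str
  path : Term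
  par : Term
  hdr : Term
  body : Term

def Req.term (q : Req) : Term := httpRequest q.n q.meth (.str q.host) q.path q.par q.hdr q.body

/-- Locations of documents. -/
structure Loc where
  https : Bool
  host : Str
  path : Term
  par : Term

def Loc.proto (L : Loc) : Term := if L.https then K .https else K .http
def Loc.term (L : Loc) : Term := urlTerm L.proto (.str L.host) L.path L.par
def Loc.cls (E : Env) (L : Loc) : Cls := if L.https then E.cls L.host else .other
def Loc.origin (L : Loc) : Term := .seq [.str L.host, L.proto]

/-- Roles of names: public, private, session key of a request (with the reference under which its
response is processed), login session token for an identity, document nonce. -/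
inductive Role
  | pub
  | priv
  | key (ref : Term) (q : Req)
  | lst (em : Term)
  | doc (L : Loc)

def Role.Known : Role → Prop
  | .priv => False
  | .key _ _ => False
  | _ => True

/-- An assignment of roles to nonces and placeholders. -/
structure Ghost where
  n : ℕ → Option Role
  v : Var → Option Role

def Ghost.role (G : Ghost) : Term → Option Role
  | .nonce n => G.n n
  | .var v => G.v v
  | _ => none

def Ghost.Named (G : Ghost) (t : Term) : Prop := ∃ ρ, G.role t = some ρ
def Ghost.Known (G : Ghost) (t : Term) : Prop := ∃ ρ, G.role t = some ρ ∧ ρ.Known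

/-- The content of the signatures that the identity provider issues only for the relying party. -/
def ProtSig (E : Env) (x : Term) : Prop :=
  ∃ d u κ a c, x = .seq [.encs (.seq [.str d, u]) κ, .seq [.str a, .str c], .str E.fd] ∧
    E.cls d = .rp ∧ E.me a c

/-- Headers and body of the responses of honest servers; the last argument lists the parts that
are required to be known. -/
inductive Resp (E : Env) (G : Ghost) (q : Req) : Term → Term → List Term → Prop
  | rpRoot : E.cls q.host = .rp → q.path = K .pRoot →
      Resp E G q (.seq []) (.seq [K .scriptRp, initStateRp]) []
  | rpStart {tk l f} : E.cls q.host = .rp → q.path = K .pStartLogin →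
      G.role l = some (.lst q.body) →
      Resp E G q (.seq []) (.seq [.seq [K .tagKey, tk], .seq [K .loginSessionToken, l],
        .seq [K .fwdDomain, f]]) [tk, f]
  | rpRedir {u} : E.cls q.host = .rp → q.path = K .pRedir →
      Resp E G q (.seq []) (.seq [K .scriptRpRedir, u]) [u]
  | rpLogin {n a c} : E.cls q.host = .rp → q.path = K .pLogin → G.Named n →
      Resp E G q (.seq []) (.seq [n, .seq [.str a, .str c]]) []
  | idpInfo : E.cls q.host = .idp → q.path = K .pWkInfo →
      Resp E G q (.seq []) (.seq [.seq [K .signkey, .pub (.nonce E.sk)]]) []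
  | idpLogin {st} : E.cls q.host = .idp → q.path = K .pWkLogin →
      Resp E G q (.seq []) (.seq [K .scriptIdp, st]) []
  | idpSign {v} : E.cls q.host = .idp → q.path = K .pSign → G.Named v →
      Resp E G q (.seq [.seq [K .hSetCookie,
          .seq [.seq [K .sessionid, .seq [v, .top, .top, .top]]]]])
        (.sig (.seq [dictGet q.body (K .tag), dictGet q.body (K .email),
          dictGet q.body (K .fwdDomain)]) (.nonce E.sk)) []
  | fwd : E.cls q.host = .fwd → Resp E G q (.seq []) (.seq [K .scriptFwd, K .start]) []

/-- Terms in normal form without variables. -/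
def CN (t : Term) : Prop := t.nf = t ∧ ∀ v, ¬ VarIn v t

/-- Terms (in normal form) that may be known to the adversary. -/
inductive SafeN (E : Env) (G : Ghost) : Term → Prop
  | name {a} : G.Known a → SafeN E G a
  | addr (a) : SafeN E G (.addr a)
  | str (a) : SafeN E G (.str a)
  | top : SafeN E G .top
  | bot : SafeN E G .bot
  | undef : SafeN E G .undef
  | pubn (n) : SafeN E G (.pub (.nonce n))
  | pub {k} : SafeN E G k → SafeN E G (.pub k)
  | enca {x k} : SafeN E G x → SafeN E G k → SafeN E G (.enca x k)
  | deca {x k} : SafeN E G x → SafeN E G k → SafeN E G (.deca x k)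
  | encs {x k} : SafeN E G x → SafeN E G k → SafeN E G (.encs x k)
  | decs {x k} : SafeN E G x → SafeN E G k → SafeN E G (.decs x k)
  | sig {x k} : SafeN E G x → SafeN E G k → SafeN E G (.sig x k)
  | checksig {s x k} : SafeN E G s → SafeN E G x → SafeN E G k → SafeN E G (.checksig s x k)
  | seq {ts : List Term} : (∀ t ∈ ts, SafeN E G t) → SafeN E G (.seq ts)
  | proj {i t} : SafeN E G t → SafeN E G (.proj i t)
  | req {κ ref q} : G.role κ = some (.key ref q) →
      SafeN E G (.enca (.seq [q.term, κ]) (.pub (.nonce (E.ssl q.host))))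
  | resp {κ ref q hd bd parts} : G.role κ = some (.key ref q) → Resp E G q hd bd parts →
      (∀ p ∈ parts, SafeN E G p) → SafeN E G (.encs (httpResponse q.n (K .s200) hd bd) κ)
  | sigY {x} : SafeN E G x → CN x → ¬ ProtSig E x → SafeN E G (.sig x (.nonce E.sk))

def Safe (E : Env) (G : Ghost) (t : Term) : Prop := SafeN E G t.nf

/-- Closedness of the requests stored in roles, and the roles of the static keys. -/
structure GStat (E : Env) (G : Ghost) : Prop where
  ssl : ∀ h, E.cls h ≠ .other → G.n (E.ssl h) = some .priv
  key : ∀ a ref q, G.role a = some (.key ref q) → E.cls q.host ≠ .other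

variable {E : Env} {G G' : Ghost}

theorem Ghost.Known.named {a : Term} (h : G.Known a) : G.Named a := h.imp fun _ h => h.1

theorem Ghost.known_of_role {a : Term} {ρ : Role} (h : G.role a = some ρ) (hρ : ρ.Known) :
    G.Known a := ⟨ρ, h, hρ⟩

theorem Ghost.not_known {a : Term} {ρ : Role} (h : G.role a = some ρ) (hρ : ¬ ρ.Known) :
    ¬ G.Known a := by
  rintro ⟨ρ', h', hk⟩
  rw [h] at h'
  cases h'
  exact hρ hk

theorem Ghost.Named.cases {a : Term} (h : G.Named a) : (∃ n, a = .nonce n) ∨ ∃ v, a = .var v := by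
  obtain ⟨ρ, h⟩ := h
  cases a <;> simp [Ghost.role] at h ⊢

theorem Ghost.Named.nf {a : Term} (h : G.Named a) : a.nf = a := by
  rcases h.cases with ⟨n, rfl⟩ | ⟨v, rfl⟩ <;> rfl

theorem CN.ren_eq {t : Term} (h : CN t) (σ : Var → Term) : ren σ t = t := by
  have : Closed t := by intro v; rw [h.1]; exact h.2 v
  rw [this.ren_eq, h.1]

theorem cn_seq {ts : List Term} : CN (.seq ts) ↔ ∀ t ∈ ts, CN t := by
  simp only [CN, nf_seq, Term.seq.injEq, varIn_seq, map_eq_self_iff]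
  grind

theorem Closed.cn {t : Term} (h : Closed t) : CN t.nf := ⟨nf_nf t, h⟩
theorem CN.closed {t : Term} (h : CN t) : Closed t := by intro v; rw [h.1]; exact h.2 v

theorem SafeN.known {a : Term} (h : SafeN E G a) (ha : G.Named a) : G.Known a := by
  rcases ha.cases with ⟨n, rfl⟩ | ⟨v, rfl⟩ <;> (cases h; assumption)

theorem not_safeN {a : Term} {ρ : Role} (h : G.role a = some ρ) (hρ : ¬ ρ.Known) :
    ¬ SafeN E G a := fun hs => G.not_known h hρ (hs.known ⟨_, h⟩)

theorem not_safe {a : Term} {ρ : Role} (h : G.role a = some ρ) (hρ : ¬ ρ.Known) :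
    ¬ Safe E G a := by
  have := Ghost.Named.nf (G := G) ⟨ρ, h⟩
  unfold Safe
  rw [this]
  exact not_safeN h hρ

theorem Ghost.Known.safe {a : Term} (h : G.Known a) : Safe E G a := by
  unfold Safe
  rw [h.named.nf]
  exact .name h

theorem SafeN.of_seq {ts : List Term} (h : SafeN E G (.seq ts)) : ∀ t ∈ ts, SafeN E G t := by
  cases h with
  | name h => obtain ⟨_, h, _⟩ := h; simp [Ghost.role] at h
  | seq h => exact h

theorem SafeN.of_enca {x k : Term} (h : SafeN E G (.enca x k)) :
    (SafeN E G x ∧ SafeN E G k) ∨ ∃ κ ref q, G.role κ = some (.key ref q) ∧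
      x = .seq [q.term, κ] ∧ k = .pub (.nonce (E.ssl q.host)) := by
  cases h with
  | name h => obtain ⟨_, h, _⟩ := h; simp [Ghost.role] at h
  | enca h1 h2 => exact .inl ⟨h1, h2⟩
  | req h => exact .inr ⟨_, _, _, h, rfl, rfl⟩

theorem SafeN.of_encs {x k : Term} (h : SafeN E G (.encs x k)) :
    (SafeN E G x ∧ SafeN E G k) ∨ ∃ ref q hd bd parts, G.role k = some (.key ref q) ∧
      Resp E G q hd bd parts ∧ (∀ p ∈ parts, SafeN E G p) ∧
      x = httpResponse q.n (K .s200) hd bd := by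
  cases h with
  | name h => obtain ⟨_, h, _⟩ := h; simp [Ghost.role] at h
  | encs h1 h2 => exact .inl ⟨h1, h2⟩
  | resp h1 h2 h3 => exact .inr ⟨_, _, _, _, _, h1, h2, h3, rfl⟩

theorem SafeN.of_sig {x k : Term} (h : SafeN E G (.sig x k)) :
    SafeN E G x ∧ (SafeN E G k ∨ ¬ ProtSig E x) := by
  cases h with
  | name h => obtain ⟨_, h, _⟩ := h; simp [Ghost.role] at h
  | sig h1 h2 => exact ⟨h1, .inl h2⟩
  | sigY h1 _ h3 => exact ⟨h1, .inr h3⟩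

theorem GStat.dy (hG : GStat E G) : DY (Safe E G) where
  congr he ht := by unfold Safe at *; rwa [← he]
  addr := .addr
  str := .str
  top := .top
  bot := .bot
  undef := .undef
  pub h := .pub h
  enca h1 h2 := .enca h1 h2
  encs h1 h2 := .encs h1 h2
  sig h1 h2 := .sig h1 h2
  seq h := by
    unfold Safe
    rw [nf_seq]
    exact .seq (by simpa [Safe] using h)
  deca {x k} h1 h2 := by
    unfold Safe at *
    rw [Term.nf]
    unfold redDeca
    split
    · rename_i y k' hy
      split_ifs with hk
      · rw [hy] at h1
        rcases h1.of_enca with h | ⟨κ, ref, q, hκ, _, hk'⟩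
        · exact h.1
        · simp only [Term.pub.injEq] at hk'
          rw [← hk, hk'] at h2
          exact absurd h2 (not_safeN (hG.ssl _ (hG.key _ _ _ hκ)) id)
      · exact .deca h1 h2
    · exact .deca h1 h2
  decs {x k} h1 h2 := by
    unfold Safe at *
    rw [Term.nf]
    unfold redDecs
    split
    · rename_i y k' hy
      split_ifs with hk
      · rw [hy] at h1
        rcases h1.of_encs with h | ⟨ref, q, hd, bd, parts, hκ, _⟩
        · exact h.1
        · rw [← hk] at h2
          exact absurd h2 (not_safeN hκ id)
      · exact .decs h1 h2
    · exact .decs h1 h2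
  checksig {s x k} h1 h2 h3 := by
    unfold Safe at *
    rw [Term.nf]
    unfold redChecksig
    split
    · split_ifs
      · exact .top
      · exact .checksig h1 h2 h3
    · exact .checksig h1 h2 h3
  proj {t} i h := by
    unfold Safe at *
    rw [Term.nf]
    unfold redProj
    split
    · rename_i ts hts
      split_ifs
      · exact .undef
      · rw [hts] at h
        rw [List.getD_eq_getElem?_getD]
        cases hj : ts[i - 1]? with
        | none => exact .undef
        | some u => exact h.of_seq u (mem_of_getElem? hj)
    · exact .proj h

/-! ### Renaming -/

/-- The substitution `σ` maps names to names with the same roles. -/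
def Compat (G : Ghost) (σ : Var → Term) (G' : Ghost) : Prop :=
  ∀ a ρ, G.role a = some ρ → G'.role (ren σ a) = some ρ

/-- The terms stored in a role have no variables. -/
def Role.Closed : Role → Prop
  | .key ref q => CN ref ∧ CN q.term
  | .lst i => CN i
  | .doc L => CN L.path ∧ CN L.par
  | _ => True

def Ghost.Closed (G : Ghost) : Prop := ∀ a ρ, G.role a = some ρ → ρ.Closed

variable {σ : Var → Term}

theorem Compat.named (h : Compat G σ G') {a : Term} (ha : G.Named a) : G'.Named (ren σ a) :=
  ha.imp fun _ => h _ _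

theorem Compat.known (h : Compat G σ G') {a : Term} (ha : G.Known a) : G'.Known (ren σ a) :=
  ha.imp fun _ h' => ⟨h _ _ h'.1, h'.2⟩

theorem Req.cn {q : Req} (h : CN q.term) : CN q.n ∧ CN q.meth ∧ CN q.path ∧ CN q.par ∧ CN q.hdr ∧
    CN q.body := by
  simp only [Req.term, httpRequest, cn_seq, forall_mem_cons] at h
  tauto

theorem CN.dictGet {z : Term} (hz : CN z) (k : Term) : CN (dictGet z k) := by
  rcases dictGet_mem (z := z) (k := k) rfl with h | ⟨e, he, h⟩
  · rw [h, cn_seq]; simp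
  · have h1 : CN (.seq (items z)) := by
      unfold items
      split
      · rename_i ts hts; rwa [← hts, hz.1]
      · rw [cn_seq]; simp
    rw [cn_seq] at h1
    have := h1 e he
    rw [h, cn_seq] at this
    exact this _ (by simp)

theorem Resp.ren (hc : Compat G σ G') {q : Req} (hq : CN q.term) {hd bd : Term}
    {parts : List Term} (h : Resp E G q hd bd parts) :
    Resp E G' q (ren σ hd) (ren σ bd) (parts.map (ren σ)) := by
  have hb := (Req.cn hq).2.2.2.2.2
  cases h with
  | rpRoot h1 h2 => simpa [initStateRp] using Resp.rpRoot (G := G') h1 h2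
  | rpStart h1 h2 h3 => simpa using Resp.rpStart h1 h2 (hc _ _ h3)
  | rpRedir h1 h2 => simpa using Resp.rpRedir h1 h2
  | rpLogin h1 h2 h3 => simpa using Resp.rpLogin h1 h2 (hc.named h3)
  | idpInfo h1 h2 => simpa using Resp.idpInfo h1 h2
  | idpLogin h1 h2 => simpa using Resp.idpLogin h1 h2
  | idpSign h1 h2 h3 =>
    simpa [(hb.dictGet _).ren_eq] using Resp.idpSign h1 h2 (hc.named h3)
  | fwd h1 => simpa using Resp.fwd h1

theorem SafeN.ren (hG : GStat E G') (hcl : G.Closed) (hc : Compat G σ G') {t : Term}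
    (h : SafeN E G t) : SafeN E G' (ren σ t) := by
  have hd := hG.dy
  have key : ∀ t, SafeN E G' (Spresso.ren σ t) ↔ Safe E G' (t.subst σ) := fun t => Iff.rfl
  induction h with
  | name h => exact .name (hc.known h)
  | addr a => exact .addr a
  | str a => exact .str a
  | top => exact .top
  | bot => exact .bot
  | undef => exact .undef
  | pubn n => exact .pubn n
  | pub _ ih => exact hd.pub ih
  | enca _ _ h1 h2 => exact hd.enca h1 h2
  | deca _ _ h1 h2 => exact hd.deca h1 h2
  | encs _ _ h1 h2 => exact hd.encs h1 h2
  | decs _ _ h1 h2 => exact hd.decs h1 h2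
  | sig _ _ h1 h2 => exact hd.sig h1 h2
  | checksig _ _ _ h1 h2 h3 => exact hd.checksig h1 h2 h3
  | seq _ ih => rw [ren_seq]; exact .seq (by simpa using ih)
  | proj _ ih => exact hd.proj _ ih
  | req h =>
    have h1 := (hcl _ _ h).2.ren_eq σ
    simp only [ren_enca, ren_seq, map_cons, map_nil, ren_pub, ren_nonce]
    erw [h1]
    exact SafeN.req (hc _ _ h)
  | resp h h2 _ ih =>
    have h1 := hcl _ _ h
    have := SafeN.resp (E := E) (hc _ _ h) (h2.ren hc h1.2) (by simpa using ih)
    rw [← (Req.cn h1.2).1.ren_eq σ] at this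
    simpa [httpResponse] using this
  | sigY _ h2 h3 ih =>
    rw [h2.ren_eq] at ih
    simpa [h2.ren_eq] using SafeN.sigY ih h2 h3

theorem Safe.ren (hG : GStat E G') (hcl : G.Closed) (hc : Compat G σ G') {t : Term}
    (h : Safe E G t) : Safe E G' (ren σ t) := by
  have := SafeN.ren hG hcl hc h
  unfold Safe
  rwa [ren_nf, ← nf_ren] at this

variable {s : Term}

/-! # The invariant of the browser -/

/-- The values that the script of the relying party may hold as a login session token. -/
def LstOK (E : Env) (G : Ghost) (t : Term) : Prop :=
  (∃ a c, G.role t = some (.lst (.seq [.str a, .str c])) ∧ E.own a c) ∨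
    (∃ x, t = .str x) ∨ t = .bot ∨ t = .seq []

/-- Values of origin headers that the relying party does not accept. -/
def OriginOpen (E : Env) (o : Term) : Prop :=
  ∃ x y, o = .seq [x, y] ∧
    ((∃ ts, y = .seq ts) ∨ y = K .http ∨ y = K .https ∧ ∃ h, x = .str h ∧ E.cls h ≠ .rp)

def HdrOpen (E : Env) (hd : Term) : Prop :=
  ∃ l, hd = .seq l ∧ ∀ e ∈ l, ∃ k v, e = .seq [K k, v] ∧ (k = .hOrigin → OriginOpen E v)

/-- Parameters of the requests sent to the forwarder. -/
def FwdOK (E : Env) (G : Ghost) (par : Term) : Prop :=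
  Safe E G par ∨ ∃ d u κ x, par = .seq [.seq [K .tag, .encs (.seq [.str d, u]) κ],
    .seq [K .eia, x]] ∧ E.cls d = .rp

/-- The requests sent by honest parties to honest servers, with their references. -/
inductive ReqOK (E : Env) (G : Ghost) (ref : Term) (q : Req) : Prop
  | rpWin : E.cls q.host = .rp → G.Named ref → Safe E G q.path → Safe E G q.par →
      HdrOpen E q.hdr → ReqOK E G ref q
  | rpStart {dn x L a c} : E.cls q.host = .rp → ref = .seq [dn, x] → G.role dn = some (.doc L) →
      L.cls E = .rp → q.path = K .pStartLogin → q.body = .seq [.str a, .str c] → E.own a c →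
      ReqOK E G ref q
  | rpLogin {dn x L y t} : E.cls q.host = .rp → ref = .seq [dn, x] → G.role dn = some (.doc L) →
      L.cls E = .rp → q.path = K .pLogin →
      q.body = .seq [.seq [K .eia, y], .seq [K .loginSessionToken, t]] → LstOK E G t →
      ReqOK E G ref q
  | idpWin : E.cls q.host = .idp → G.Named ref → Safe E G q.path → Safe E G q.par →
      ReqOK E G ref q
  | idpSign {dn x L em pw T F} : E.cls q.host = .idp → ref = .seq [dn, x] →
      G.role dn = some (.doc L) → L.cls E = .idp → q.path = K .pSign →
      q.body = .seq [.seq [K .email, em], .seq [K .password, pw], .seq [K .tag, T],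
        .seq [K .fwdDomain, F]] → Safe E G em → Safe E G T → Safe E G F →
      (F = .seq [] ∨ T = dictGet L.par (K .tag) ∧ F = dictGet L.par (K .fwdDomain)) →
      ReqOK E G ref q
  | idpInfo : E.cls q.host = .idp → ref = .bot → q.path = K .pWkInfo → ReqOK E G ref q
  | fwdWin : E.cls q.host = .fwd → G.Named ref → FwdOK E G q.par → ReqOK E G ref q

def LocOK (E : Env) (G : Ghost) (L : Loc) : Prop :=
  (L.cls E ≠ .fwd → Safe E G L.path ∧ Safe E G L.par) ∧ (L.cls E = .fwd → FwdOK E G L.par)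

def RoleOK (E : Env) (G : Ghost) : Role → Prop
  | .key ref q => ReqOK E G ref q
  | .doc L => LocOK E G L
  | _ => True

/-- Well-formedness of role assignments. -/
structure GWF (E : Env) (G : Ghost) : Prop extends GStat E G where
  closed : G.Closed
  ok : ∀ a ρ, G.role a = some ρ → RoleOK E G ρ
  sk : (∃ h, E.cls h = .idp) → G.n E.sk = some .priv
  pubs : ∀ n, E.pubs n → G.n n = some .pub

/-- The responses to the requests of the script of the relying party. -/
def RpBody (E : Env) (G : Ghost) (bd : Term) : Prop :=
  (∃ tk l f, bd = .seq [.seq [K .tagKey, tk], .seq [K .loginSessionToken, l],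
    .seq [K .fwdDomain, f]] ∧ Safe E G tk ∧ LstOK E G l) ∨
  ∃ n a c, bd = .seq [n, .seq [.str a, .str c]] ∧ G.Named n

def RpInput (E : Env) (G : Ghost) (i : Term) : Prop :=
  (∃ x y z, i = .seq [K .postMessage, x, y, z]) ∨ ∃ bd x, i = .seq [K .xhr, bd, x] ∧ RpBody E G bd

/-- The location `L` belongs to a login dialog for the relying party. -/
def ProtLoc (E : Env) (L : Loc) : Prop :=
  ∃ f d u κ, dictGet L.par (K .fwdDomain) = .str f ∧ E.cls f = .fwd ∧
    dictGet L.par (K .tag) = .encs (.seq [.str d, u]) κ ∧ E.cls d = .rp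

def IdpInput (E : Env) (G : Ghost) (L : Loc) (i : Term) : Prop :=
  (∃ x y z, i = .seq [K .postMessage, x, y, z]) ∨
    ∃ bd x, i = .seq [K .xhr, bd, x] ∧ (Safe E G bd ∨ ProtLoc E L)

/-- Referrer, script, script state and inputs of a document with location `L`. -/
inductive DocOK (E : Env) (G : Ghost) (L : Loc) (rf sc st : Term) (ins : List Term) : Prop
  | other : L.cls E = .other → Safe E G rf → Safe E G sc → Safe E G st → (∀ i ∈ ins, Safe E G i) →
      DocOK E G L rf sc st ins
  | rp {q t x tk f em} : L.cls E = .rp → sc = K .scriptRp → st = .seq [q, t, x, tk, f, em] →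
      LstOK E G t → Safe E G tk → (∀ i ∈ ins, RpInput E G i) → DocOK E G L rf sc st ins
  | rpRedir : L.cls E = .rp → sc = K .scriptRpRedir → Safe E G st → (∀ i ∈ ins, RpInput E G i) →
      DocOK E G L rf sc st ins
  | rpDead : L.cls E = .rp → G.Named sc → (∀ i ∈ ins, RpInput E G i) → DocOK E G L rf sc st ins
  | idp : L.cls E = .idp → sc = K .scriptIdp → (∀ i ∈ ins, IdpInput E G L i) →
      DocOK E G L rf sc st ins
  | fwd : L.cls E = .fwd → sc = K .scriptFwd → DocOK E G L rf sc st ins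

/-- At most one of the documents is active. -/
def UniqueAct (docs : List Term) : Prop :=
  ∀ (i j : ℕ) (d d' : Term), docs[i]? = some d → docs[j]? = some d' → get d [8] = .top → get d' [8] = .top → i = j

/-- Windows (`true`) and documents (`false`). -/
inductive TreeOK (E : Env) (G : Ghost) : Bool → Term → Prop
  | win {n docs op} : G.Known n → Safe E G op → (∀ d ∈ docs, TreeOK E G false d) →
      UniqueAct docs → TreeOK E G true (.seq [n, .seq docs, op])
  | doc {n L rf sc st ins subs act} : G.role n = some (.doc L) → DocOK E G L rf sc st ins →
      (∀ w ∈ subs, TreeOK E G true w) → act = .top ∨ act = .bot →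
      TreeOK E G false (.seq [n, L.term, rf, sc, st, .seq ins, .seq subs, act])

def CookieOK (E : Env) (G : Ghost) (h : Str) (c : Term) : Prop :=
  Safe E G c ∨ E.cls h = .idp ∧
    ∃ v, c = .seq [K .sessionid, .seq [v, .top, .top, .top]] ∧ G.Named v

def CookiesOK (E : Env) (G : Ghost) (e : Term) : Prop :=
  ∃ h cs, e = .seq [.str h, .seq cs] ∧ ∀ c ∈ cs, CookieOK E G h c

/-- References of requests by `XMLHttpRequest` of adversarial documents to the host `h`. -/
def XhrRef (E : Env) (G : Ghost) (ref : Term) (h : Str) (plain : Prop) : Prop :=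
  ∃ dn x L, ref = .seq [dn, x] ∧ Safe E G x ∧ G.role dn = some (.doc L) ∧ L.cls E = .other ∧
    L.host = h ∧ (plain ∨ E.cls h = .other)

/-- Entries of the list of requests that wait for name resolution. -/
inductive Pending (E : Env) (G : Ghost) (ref M proto : Term) : Prop
  | bad {n me h pa par hd bd} : M = httpRequest n me h pa par hd bd →
      (∃ ts, h = .seq ts) → Pending E G ref M proto
  | win {n me h pa par hd bd} : M = httpRequest n me h pa par hd bd → Safe E G M →
      G.Known ref → HdrOpen E hd → Pending E G ref M proto
  | xhr {n me h pa par hd bd} : M = httpRequest n me (.str h) pa par hd bd → Safe E G M →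
      XhrRef E G ref h (proto = K .http) → Pending E G ref M proto
  | prot {q : Req} : M = q.term → proto = K .https → E.cls q.host ≠ .other → ReqOK E G ref q →
      Pending E G ref M proto

/-- Entries of the list of requests that wait for a response. -/
inductive Sent (E : Env) (G : Ghost) (ref M key : Term) : Prop
  | adv {n me h pa par hd bd} : M = httpRequest n me (.str h) pa par hd bd → Safe E G M →
      G.Known ref ∨ XhrRef E G ref h (key = .bot) → key = .bot ∨ G.Known key ∧ E.cls h = .other →
      Sent E G ref M key
  | prot {q : Req} : M = q.term → G.role key = some (.key ref q) → Sent E G ref M key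

/-- The invariant of the `k`-th component of the state of the browser. -/
def BComp (E : Env) (G : Ghost) (k : ℕ) (t : Term) : Prop :=
  match k with
  | 1 => ∃ ws, t = .seq ws ∧ ∀ w ∈ ws, TreeOK E G true w
  | 2 => t = E.ids
  | 3 => t = E.sec
  | 4 => ∃ l, t = .seq l ∧ ∀ e ∈ l, CookiesOK E G e
  | 5 => Safe E G t
  | 6 => Safe E G t
  | 7 => t = E.km
  | 8 => ∃ l, t = .seq l ∧ ∀ e ∈ l, ∃ h, e = .str h ∧ E.cls h = .other
  | 9 => t = E.da
  | 10 => ∃ l, t = .seq l ∧ ∀ e ∈ l, ∃ k ref M proto,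
      e = .seq [k, .seq [ref, M, proto]] ∧ Pending E G ref M proto
  | 11 => ∃ l, t = .seq l ∧ ∀ e ∈ l, ∃ ref M key a,
      e = .seq [ref, M, key, a] ∧ Sent E G ref M key
  | 12 => t = .bot
  | _ => False

/-- The term `t` is a sequence of length `n` whose components satisfy `C`. -/
def Comps (n : ℕ) (C : ℕ → Term → Prop) (t : Term) : Prop :=
  ∃ ts, t.nf = .seq ts ∧ ts.length = n ∧ ∀ k u, ts[k]? = some u → C (k + 1) u

abbrev BInv (E : Env) (G : Ghost) : Term → Prop := Comps 12 (BComp E G)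

/-! ### Components -/

section Comps
variable {n : ℕ} {C : ℕ → Term → Prop} {s : Term}

theorem get_one {ts : List Term} (h : s.nf = .seq ts) {k : ℕ} {u : Term} (hu : ts[k]? = some u) :
    get s [k + 1] = u := by
  rw [get_seq_some h hu, get_nil, nf_of_mem h (mem_of_getElem? hu)]

theorem Comps.get (h : Comps n C s) {k : ℕ} (hk : k < n) : C (k + 1) (get s [k + 1]) := by
  obtain ⟨ts, h1, rfl, h2⟩ := h
  have hu := List.getElem?_eq_getElem hk
  rw [get_one h1 hu]
  exact h2 _ _ hu

theorem Comps.set (h : Comps n C s) {k : ℕ} {v : Term} {p : Ptr}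
    (hv : C (k + 1) (Spresso.setAt (Spresso.get s [k + 1]) p v).nf) :
    Comps n C (setAt s ((k + 1) :: p) v) := by
  obtain ⟨ts, h1, rfl, h2⟩ := h
  refine ⟨_, nf_setAt_cons h1 k p v, by simp, fun j u hj => ?_⟩
  rw [List.getElem?_modify] at hj
  cases hj' : ts[j]? with
  | none => simp [hj'] at hj
  | some w =>
    rw [hj'] at hj
    by_cases hkj : k = j
    · subst hkj
      simp only [if_true, Option.map_eq_map, Option.map_some, Option.some.injEq] at hj
      rw [get_one h1 hj'] at hv
      exact hj ▸ hv
    · simp only [hkj, if_false, Option.map_eq_map, Option.map_some, Option.some.injEq] at hj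
      exact hj ▸ h2 _ _ hj'

theorem Comps.imp {C' : ℕ → Term → Prop} (h : Comps n C s) (σ : Var → Term)
    (hC : ∀ k u, C k u → C' k (ren σ u)) : Comps n C' (ren σ s) := by
  obtain ⟨ts, h1, h2, h3⟩ := h
  refine ⟨ts.map (ren σ), ?_, by simpa using h2, ?_⟩
  · rw [nf_ren, ← ren_nf, h1, ren_seq]
  · intro k u hu
    rw [List.getElem?_map] at hu
    cases hk : ts[k]? with
    | none => simp [hk] at hu
    | some w =>
      rw [hk] at hu
      simp only [Option.map_some, Option.some.injEq] at hu
      exact hu ▸ hC _ _ (h3 _ _ hk)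

end Comps

/-! ### Renaming -/

/-- Admissible renamings. -/
structure Tr (E : Env) (G : Ghost) (σ : Var → Term) (G' : Ghost) : Prop where
  stat : GStat E G'
  closed : G.Closed
  compat : Compat G σ G'

/-- The constant components have no variables. -/
structure EnvClosed (E : Env) : Prop where
  ids : CN E.ids
  sec : CN E.sec
  km : CN E.km
  da : CN E.da

namespace Tr
variable (h : Tr E G σ G')
include h

theorem safe {t : Term} (ht : Safe E G t) : Safe E G' (ren σ t) := ht.ren h.stat h.closed h.compat

theorem lstOK {t : Term} (ht : LstOK E G t) : LstOK E G' (ren σ t) := by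
  rcases ht with ⟨a, c, h1, h2⟩ | ⟨x, rfl⟩ | rfl | rfl
  · exact .inl ⟨a, c, h.compat _ _ h1, h2⟩
  · exact .inr (.inl ⟨x, rfl⟩)
  · exact .inr (.inr (.inl rfl))
  · exact .inr (.inr (.inr (by simp)))

omit h in
theorem originOpen {o : Term} (ho : OriginOpen E o) : OriginOpen E (ren σ o) := by
  obtain ⟨x, y, rfl, ⟨ts, rfl⟩ | rfl | ⟨rfl, k, rfl, hk⟩⟩ := ho
  · exact ⟨ren σ x, ren σ (.seq ts), by simp, .inl ⟨ts.map (ren σ), by simp⟩⟩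
  · exact ⟨ren σ x, K .http, by simp, .inr (.inl rfl)⟩
  · exact ⟨.str k, K .https, by simp, .inr (.inr ⟨rfl, k, rfl, hk⟩)⟩

omit h in
theorem hdrOpen {hd : Term} (hh : HdrOpen E hd) : HdrOpen E (ren σ hd) := by
  obtain ⟨l, rfl, hl⟩ := hh
  refine ⟨_, ren_seq σ l, ?_⟩
  simp only [mem_map, forall_exists_index, and_imp, forall_apply_eq_imp_iff₂]
  intro e he
  obtain ⟨k, v, rfl, hk⟩ := hl e he
  exact ⟨k, ren σ v, by simp, fun h' => originOpen (hk h')⟩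

theorem fwdOK {par : Term} (hp : FwdOK E G par) : FwdOK E G' (ren σ par) := by
  rcases hp with hp | ⟨d, u, κ, x, rfl, hd⟩
  · exact .inl (h.safe hp)
  · exact .inr ⟨d, ren σ u, ren σ κ, ren σ x, by simp, hd⟩

theorem doc {n : Term} {L : Loc} (hn : G.role n = some (.doc L)) :
    G'.role (ren σ n) = some (.doc L) := h.compat _ _ hn

theorem par {n : Term} {L : Loc} (hn : G.role n = some (.doc L)) : CN L.par :=
  (h.closed _ _ hn).2

end Tr

/-- The request with renamed components. -/
def Req.ren (σ : Var → Term) (q : Req) : Req :=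
  ⟨Spresso.ren σ q.n, Spresso.ren σ q.meth, q.host, Spresso.ren σ q.path, Spresso.ren σ q.par,
    Spresso.ren σ q.hdr, Spresso.ren σ q.body⟩

@[simp] theorem ren_req (q : Req) : ren σ q.term = (q.ren σ).term := by
  simp [Req.term, Req.ren, httpRequest]

theorem Req.term_inj {q q' : Req} (h : q.term = q'.term) : q = q' := by
  cases q; cases q'
  simp [Req.term, httpRequest] at h
  simp [h]

namespace Tr
variable (h : Tr E G σ G')
include h

theorem reqOK {ref : Term} {q : Req} (hq : ReqOK E G ref q) :
    ReqOK E G' (ren σ ref) (q.ren σ) := by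
  cases hq with
  | rpWin h1 h2 h3 h4 h5 =>
    exact .rpWin h1 (h.compat.named h2) (h.safe h3) (h.safe h4) (hdrOpen h5)
  | rpStart h1 h2 h3 h4 h5 h6 h7 =>
    exact .rpStart h1 (by simp only [h2, ren_seq, map_cons, map_nil]; try rfl) (h.doc h3) h4 (by simp [Req.ren, h5])
      (by simp only [Req.ren, h6, ren_seq, map_cons, map_nil, ren_str]; try rfl) h7
  | rpLogin h1 h2 h3 h4 h5 h6 h7 =>
    exact .rpLogin h1 (by simp only [h2, ren_seq, map_cons, map_nil]; try rfl) (h.doc h3) h4 (by simp [Req.ren, h5])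
      (by simp only [Req.ren, h6, ren_seq, map_cons, map_nil, ren_str]; try rfl) (h.lstOK h7)
  | idpWin h1 h2 h3 h4 => exact .idpWin h1 (h.compat.named h2) (h.safe h3) (h.safe h4)
  | idpSign h1 h2 h3 h4 h5 h6 h7 h8 h9 h10 =>
    have := h.par h3
    refine .idpSign h1 (by simp only [h2, ren_seq, map_cons, map_nil]; try rfl) (h.doc h3) h4 (by simp [Req.ren, h5])
      (by simp only [Req.ren, h6, ren_seq, map_cons, map_nil, ren_str]; try rfl) (h.safe h7) (h.safe h8) (h.safe h9) ?_
    rcases h10 with rfl | ⟨rfl, rfl⟩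
    · exact .inl (by simp)
    · exact .inr ⟨(this.dictGet _).ren_eq _, (this.dictGet _).ren_eq _⟩
  | idpInfo h1 h2 h3 => exact .idpInfo h1 (by simp [h2]) (by simp [Req.ren, h3])
  | fwdWin h1 h2 h3 => exact .fwdWin h1 (h.compat.named h2) (h.fwdOK h3)

theorem locOK {L : Loc} (hn : CN L.path ∧ CN L.par) (hL : LocOK E G L) : LocOK E G' L := by
  obtain ⟨c1, c2⟩ := hn
  have h1 := c1.ren_eq σ
  have h2 := c2.ren_eq σ
  refine ⟨fun hc => ?_, fun hc => ?_⟩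
  · have := hL.1 hc
    exact ⟨h1 ▸ h.safe this.1, h2 ▸ h.safe this.2⟩
  · exact h2 ▸ h.fwdOK (hL.2 hc)

theorem roleOK {ρ : Role} (ha : ρ.Closed) (hρ : RoleOK E G ρ) : RoleOK E G' ρ := by
  cases ρ with
  | key ref q =>
    obtain ⟨c1, c2⟩ := ha
    have := h.reqOK hρ
    rw [c1.ren_eq] at this
    have hq : q.ren σ = q := Req.term_inj (by rw [← ren_req, c2.ren_eq])
    rwa [hq] at this
  | doc L => exact h.locOK ha hρ
  | _ => trivial

theorem rpBody {bd : Term} (hb : RpBody E G bd) : RpBody E G' (ren σ bd) := by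
  rcases hb with ⟨tk, l, f, rfl, h1, h2⟩ | ⟨n, a, c, rfl, hn⟩
  · exact .inl ⟨ren σ tk, ren σ l, ren σ f, by simp, h.safe h1, h.lstOK h2⟩
  · exact .inr ⟨ren σ n, a, c, by simp, h.compat.named hn⟩

theorem rpInput {i : Term} (hi : RpInput E G i) : RpInput E G' (ren σ i) := by
  rcases hi with ⟨x, y, z, rfl⟩ | ⟨bd, x, rfl, hb⟩
  · exact .inl ⟨ren σ x, ren σ y, ren σ z, by simp⟩
  · exact .inr ⟨ren σ bd, ren σ x, by simp, h.rpBody hb⟩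

theorem idpInput {L : Loc} {i : Term} (hi : IdpInput E G L i) : IdpInput E G' L (ren σ i) := by
  rcases hi with ⟨x, y, z, rfl⟩ | ⟨bd, x, rfl, hb⟩
  · exact .inl ⟨ren σ x, ren σ y, ren σ z, by simp⟩
  · exact .inr ⟨ren σ bd, ren σ x, by simp, hb.imp_left h.safe⟩

omit h in
theorem forall_map {P Q : Term → Prop} {l : List Term} (hl : ∀ t ∈ l, P t)
    (hPQ : ∀ t, P t → Q (ren σ t)) : ∀ t ∈ l.map (ren σ), Q t := by
  simpa using fun t ht => hPQ t (hl t ht)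

theorem docOK {L : Loc} {rf sc st : Term} {ins : List Term} (hd : DocOK E G L rf sc st ins) :
    DocOK E G' L (ren σ rf) (ren σ sc) (ren σ st) (ins.map (ren σ)) := by
  cases hd with
  | other h1 h2 h3 h4 h5 =>
    exact .other h1 (h.safe h2) (h.safe h3) (h.safe h4) (forall_map h5 fun _ => h.safe)
  | rp h1 h2 h3 h4 h5 h6 =>
    exact .rp h1 (by simp [h2]) (by rw [h3, ren_seq]; rfl)
      (h.lstOK h4) (h.safe h5) (forall_map h6 fun _ => h.rpInput)
  | rpRedir h1 h2 h3 h4 =>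
    exact .rpRedir h1 (by simp [h2]) (h.safe h3) (forall_map h4 fun _ => h.rpInput)
  | rpDead h1 h2 h3 => exact .rpDead h1 (h.compat.named h2) (forall_map h3 fun _ => h.rpInput)
  | idp h1 h2 h3 => exact .idp h1 (by simp [h2]) (forall_map h3 fun _ => h.idpInput)
  | fwd h1 h2 => exact .fwd h1 (by simp [h2])

end Tr

@[simp] theorem get_doc_active (n l rf sc st ins subs act : Term) :
    get (.seq [n, l, rf, sc, st, ins, subs, act]) [8] = act.nf := by
  rw [get_seq (nf_seq _)]; simp [get_nil]

theorem TreeOK.act_ren {b : Bool} {d : Term} (hb : b = false) (h : TreeOK E G b d) :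
    get (ren σ d) [8] = get d [8] := by
  cases h with
  | win => cases hb
  | doc _ _ _ h =>
    simp only [ren_seq, map_cons, map_nil, get_doc_active, nf_ren]
    rcases h with rfl | rfl <;> rfl

theorem Loc.nf_proto (L : Loc) : L.proto.nf = L.proto := by
  unfold Loc.proto; split_ifs <;> rfl

theorem Loc.cn_term {L : Loc} (h : CN L.path ∧ CN L.par) : CN L.term := by
  have h1 : CN L.proto := ⟨L.nf_proto, by unfold Loc.proto; split_ifs <;> simp⟩
  simp only [Loc.term, urlTerm, cn_seq, forall_mem_cons]
  exact ⟨⟨rfl, by simp⟩, h1, ⟨rfl, by simp⟩, h.1, h.2, by simp⟩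

namespace Tr
variable (h : Tr E G σ G')
include h

theorem treeOK {b : Bool} {t : Term} (ht : TreeOK E G b t) : TreeOK E G' b (ren σ t) := by
  induction ht with
  | win h1 h2 h3 h4 ih =>
    simp only [ren_seq, map_cons, map_nil]
    refine .win (h.compat.known h1) (h.safe h2) (by simpa using ih) ?_
    intro i j d d' hi hj hd hd'
    rw [List.getElem?_map] at hi hj
    simp only [Option.map_eq_some_iff] at hi hj
    obtain ⟨e, he, rfl⟩ := hi
    obtain ⟨e', he', rfl⟩ := hj
    rw [(h3 e (mem_of_getElem? he)).act_ren rfl] at hd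
    rw [(h3 e' (mem_of_getElem? he')).act_ren rfl] at hd'
    exact h4 _ _ _ _ he he' hd hd'
  | doc h1 h2 h3 h4 ih =>
    simp only [ren_seq, map_cons, map_nil]
    rw [(Loc.cn_term (h.closed _ _ h1)).ren_eq]
    refine .doc (h.doc h1) (h.docOK h2) (by simpa using ih) ?_
    rcases h4 with rfl | rfl <;> simp

theorem cookieOK {k : Str} {c : Term} (hc : CookieOK E G k c) : CookieOK E G' k (ren σ c) := by
  rcases hc with hc | ⟨h1, v, rfl, h2⟩
  · exact .inl (h.safe hc)
  · exact .inr ⟨h1, ren σ v, by simp, h.compat.named h2⟩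

theorem cookiesOK {e : Term} (he : CookiesOK E G e) : CookiesOK E G' (ren σ e) := by
  obtain ⟨k, cs, rfl, hc⟩ := he
  exact ⟨k, cs.map (ren σ), by simp, forall_map hc fun _ => h.cookieOK⟩

theorem xhrRef {ref : Term} {k : Str} {p q : Prop} (hx : XhrRef E G ref k p) (hpq : p → q) :
    XhrRef E G' (ren σ ref) k q := by
  obtain ⟨dn, x, L, rfl, h1, h2, h3, h4, h5⟩ := hx
  exact ⟨ren σ dn, ren σ x, L, by simp, h.safe h1, h.doc h2, h3, h4, h5.imp_left hpq⟩

theorem pending {ref M proto : Term} (hp : Pending E G ref M proto) :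
    Pending E G' (ren σ ref) (ren σ M) (ren σ proto) := by
  cases hp with
  | bad h1 h2 =>
    refine .bad (by simp only [h1, httpRequest, ren_seq, map_cons, map_nil, ren_str]; try rfl) ?_
    obtain ⟨ts, rfl⟩ := h2
    exact ⟨_, ren_seq _ _⟩
  | win h1 h2 h3 h4 =>
    exact .win (by simp only [h1, httpRequest, ren_seq, map_cons, map_nil, ren_str]; try rfl)
      (h.safe h2) (h.compat.known h3) (hdrOpen h4)
  | xhr h1 h2 h3 =>
    exact .xhr (by simp only [h1, httpRequest, ren_seq, map_cons, map_nil, ren_str]; try rfl)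
      (h.safe h2) (h.xhrRef h3 (by rintro rfl; rfl))
  | @prot q h1 h2 h3 h4 =>
    exact .prot (q := q.ren σ) (by rw [h1, ren_req]) (by simp [h2]) h3 (h.reqOK h4)

theorem sent {ref M key : Term} (hp : Sent E G ref M key) :
    Sent E G' (ren σ ref) (ren σ M) (ren σ key) := by
  cases hp with
  | adv h1 h2 h3 h4 =>
    refine .adv (by simp only [h1, httpRequest, ren_seq, map_cons, map_nil, ren_str]; try rfl)
      (h.safe h2) ?_ ?_
    · exact h3.imp h.compat.known fun h3 => h.xhrRef h3 (by rintro rfl; rfl)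
    · exact h4.imp (by rintro rfl; rfl) fun h4 => ⟨h.compat.known h4.1, h4.2⟩
  | prot h1 h2 =>
    have hcl := h.closed _ _ h2
    refine .prot (by rw [h1, hcl.2.ren_eq]) ?_
    rw [hcl.1.ren_eq]
    exact h.compat _ _ h2

theorem bComp (hE : EnvClosed E) {k : ℕ} {t : Term} (ht : BComp E G k t) :
    BComp E G' k (ren σ t) := by
  unfold BComp at ht ⊢
  split at ht
  · obtain ⟨l, rfl, hl⟩ := ht
    exact ⟨_, ren_seq _ _, forall_map hl fun _ => h.treeOK⟩
  · rw [ht, hE.ids.ren_eq]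
  · rw [ht, hE.sec.ren_eq]
  · obtain ⟨l, rfl, hl⟩ := ht
    exact ⟨_, ren_seq _ _, forall_map hl fun _ => h.cookiesOK⟩
  · exact h.safe ht
  · exact h.safe ht
  · rw [ht, hE.km.ren_eq]
  · obtain ⟨l, rfl, hl⟩ := ht
    refine ⟨_, ren_seq _ _, forall_map hl fun t ht => ?_⟩
    obtain ⟨k, rfl, hk⟩ := ht
    exact ⟨k, rfl, hk⟩
  · rw [ht, hE.da.ren_eq]
  · obtain ⟨l, rfl, hl⟩ := ht
    refine ⟨_, ren_seq _ _, forall_map hl fun t ht => ?_⟩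
    obtain ⟨k, ref, M, proto, rfl, hp⟩ := ht
    exact ⟨ren σ k, ren σ ref, ren σ M, ren σ proto, by simp, h.pending hp⟩
  · obtain ⟨l, rfl, hl⟩ := ht
    refine ⟨_, ren_seq _ _, forall_map hl fun t ht => ?_⟩
    obtain ⟨ref, M, k, a, rfl, hp⟩ := ht
    exact ⟨ren σ ref, ren σ M, ren σ k, ren σ a, by simp, h.sent hp⟩
  · rw [ht]; rfl
  · exact ht

theorem bInv (hE : EnvClosed E) {s : Term} (hs : BInv E G s) : BInv E G' (ren σ s) :=
  hs.imp σ fun _ _ => h.bComp hE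

end Tr

/-! # Positions of windows -/

/-- `setAt` at a position that is not a sequence has no effect. -/
theorem setAt_cons_of_not {t : Term} (h : ∀ ts, t.nf ≠ .seq ts) (i : ℕ) (p : Ptr) (v : Term) :
    setAt t (i :: p) v = t.nf := by
  rw [setAt]
  split
  · exact absurd ‹_› (h _)
  · rfl

theorem setAt_zero (t : Term) (p : Ptr) (v : Term) : setAt t (0 :: p) v = t.nf := by
  rw [setAt]
  split
  · simp [*]
  · rfl

theorem modify_congr {ts : List Term} {i : ℕ} {f g : Term → Term}
    (h : ∀ u, ts[i]? = some u → f u = g u) : ts.modify i f = ts.modify i g := by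
  apply List.ext_getElem?
  intro j
  rw [List.getElem?_modify, List.getElem?_modify]
  by_cases hij : i = j
  · subst hij
    cases hu : ts[i]? with
    | none => rfl
    | some u => simp [h u hu]
  · simp [hij]

theorem setAt_cases (t : Term) (i : ℕ) : (∃ ts j, t.nf = .seq ts ∧ i = j + 1) ∨
    (∀ p v, setAt t (i :: p) v = t.nf) := by
  by_cases h : ∃ ts, t.nf = .seq ts
  · obtain ⟨ts, h⟩ := h
    cases i with
    | zero => exact .inr (setAt_zero t)
    | succ j => exact .inl ⟨ts, j, h, rfl⟩
  · exact .inr (setAt_cons_of_not (by simpa using h) i)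

theorem nf_setAt_append (t : Term) (p q : Ptr) (v : Term) :
    (setAt t (p ++ q) v).nf = (setAt t p (setAt (get t p) q v)).nf := by
  induction p generalizing t with
  | nil =>
    rw [List.nil_append, setAt_nil]
    cases q with
    | nil => rw [setAt_nil, setAt_nil]
    | cons i q => rw [setAt_congr (t := get t []) (u := t) (by simp [get_nil]) (by simp)]
  | cons i p ih =>
    rcases setAt_cases t i with ⟨ts, j, ht, rfl⟩ | h'
    · rw [List.cons_append, nf_setAt_cons ht, nf_setAt_cons ht]
      congr 1
      apply modify_congr
      intro u hu
      rw [ih, get_seq_some ht hu]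
    · rw [List.cons_append, h', h']

theorem get_setAt_self {t v : Term} {ts : List Term} (h : t.nf = .seq ts) {j : ℕ} {u : Term}
    (hu : ts[j]? = some u) (p q : Ptr) :
    get (setAt t ((j + 1) :: p) v) ((j + 1) :: q) = get (setAt u p v) q := by
  rw [get_seq_some (nf_setAt_cons h j p v) (u := (setAt u p v).nf) (by simp [hu]), get_nf]

theorem get_setAt_ne {t v : Term} {i j : ℕ} (h : i ≠ j) (p q : Ptr) :
    get (setAt t (i :: p) v) (j :: q) = get t (j :: q) := by
  rcases setAt_cases t i with ⟨ts, k, ht, rfl⟩ | h'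
  · cases j with
    | zero =>
      rw [get_cons, get_cons]
      apply get_congr
      simp [Term.nf, ht, nf_setAt_cons ht, redProj]
    | succ j =>
      rw [get_seq (nf_setAt_cons ht k p v), get_seq ht]
      congr 1
      simp only [List.getD_eq_getElem?_getD, List.getElem?_modify]
      have h' : k ≠ j := fun e => h (by rw [e])
      simp [h']
  · rw [h', get_nf]

theorem isIndex_iff {i : ℕ} {t : Term} : IsIndex i t ↔ ∃ j u, i = j + 1 ∧ (items t)[j]? = some u := by
  unfold IsIndex
  constructor
  · rintro ⟨h1, h2⟩
    exact ⟨i - 1, (items t)[i - 1], by omega, List.getElem?_eq_getElem (by omega)⟩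
  · rintro ⟨j, u, rfl, hu⟩
    obtain ⟨h, -⟩ := List.getElem?_eq_some_iff.1 hu
    omega

/-- `p` points to a window, on any level. -/
inductive WinAt (s : Term) : Ptr → Prop
  | top {i} : IsIndex i (get s [1]) → WinAt s [1, i]
  | sub {w j i} : WinAt s w → IsIndex j (get s (w ++ [2])) → IsIndex i (get s (w ++ [2, j, 7])) →
      WinAt s (w ++ [2, j, 7, i])

theorem Subwindows.winAt {s : Term} {p : Ptr} (h : Subwindows s p) : WinAt s p := by
  induction h with
  | top h => exact .top h
  | sub _ h2 h3 ih =>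
    obtain ⟨j, hj, rfl, _⟩ := h2
    rw [List.append_assoc] at h3 ⊢
    exact .sub ih hj h3

theorem WinAt.congr {t t' : Term} {p : Ptr} (he : t.nf = t'.nf) (hp : WinAt t p) : WinAt t' p := by
  have hg : ∀ p, get t p = get t' p := get_congr he
  induction hp with
  | top h => exact .top (hg _ ▸ h)
  | sub _ h2 h3 ih => exact .sub ih (hg _ ▸ h2) (hg _ ▸ h3)

theorem WinAt.head {s : Term} {p : Ptr} (h : WinAt s p) : ∃ q, p = 1 :: q := by
  induction h with
  | top => exact ⟨_, rfl⟩
  | sub _ _ _ ih => obtain ⟨q, rfl⟩ := ih; exact ⟨_, rfl⟩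

/-- Windows and documents as terms in normal form. -/
theorem TreeOK.win_inv {t : Term} (h : TreeOK E G true t) : ∃ n docs op,
    t = .seq [n, .seq docs, op] ∧ G.Known n ∧ Safe E G op ∧
      (∀ d ∈ docs, TreeOK E G false d) ∧ UniqueAct docs := by
  cases h with
  | win h1 h2 h3 h4 => exact ⟨_, _, _, rfl, h1, h2, h3, h4⟩

theorem TreeOK.doc_inv {t : Term} (h : TreeOK E G false t) : ∃ n L rf sc st ins subs act,
    t = .seq [n, L.term, rf, sc, st, .seq ins, .seq subs, act] ∧ G.role n = some (.doc L) ∧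
      DocOK E G L rf sc st ins ∧ (∀ w ∈ subs, TreeOK E G true w) ∧ (act = .top ∨ act = .bot) := by
  cases h with
  | doc h1 h2 h3 h4 => exact ⟨_, _, _, _, _, _, _, _, rfl, h1, h2, h3, h4⟩

def WinsOK (E : Env) (G : Ghost) (s : Term) : Prop :=
  (∃ ts, s.nf = .seq ts ∧ ts ≠ []) ∧ BComp E G 1 (get s [1])

theorem getElem?_of_isIndex {j : ℕ} {t : Term} {ts : List Term} (h : IsIndex j t)
    (ht : t.nf = .seq ts) : ∃ k u, j = k + 1 ∧ ts[k]? = some u := by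
  rw [isIndex_iff, items_of_nf ht] at h
  exact h

/-- The components of a window term. -/
theorem get_win {t n op : Term} {docs : List Term} (h : t.nf = .seq [n, .seq docs, op]) :
    get t [1] = n ∧ get t [2] = .seq docs ∧ get t [3] = op := by
  have h1 : n.nf = n := nf_of_mem h (by simp)
  have h2 : (Term.seq docs).nf = .seq docs := nf_of_mem h (by simp)
  have h3 : op.nf = op := nf_of_mem h (by simp)
  refine ⟨?_, ?_, ?_⟩ <;> rw [get_seq h] <;> simp [get_nil, h1, h2, h3]

theorem get_docs {t n op : Term} {docs : List Term} (h : t.nf = .seq [n, .seq docs, op]) {j : ℕ}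
    {d : Term} (hd : docs[j]? = some d) (p : Ptr) : get t (2 :: (j + 1) :: p) = get d p := by
  have h2 : (Term.seq docs).nf = .seq docs := nf_of_mem h (by simp)
  rw [get_seq (i := 1) h, List.getD_cons_succ, List.getD_cons_zero, get_seq_some h2 hd]

theorem get_doc {t n l rf sc st ins act : Term} {subs : List Term}
    (h : t.nf = .seq [n, l, rf, sc, st, ins, .seq subs, act]) :
    get t [1] = n ∧ get t [2] = l ∧ get t [3] = rf ∧ get t [4] = sc ∧ get t [5] = st ∧
      get t [6] = ins ∧ get t [7] = .seq subs ∧ get t [8] = act := by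
  have hm : ∀ u ∈ [n, l, rf, sc, st, ins, .seq subs, act], u.nf = u := fun u => nf_of_mem h
  simp only [forall_mem_cons] at hm
  refine ⟨?_, ?_, ?_, ?_, ?_, ?_, ?_, ?_⟩ <;> rw [get_seq h] <;> simp [get_nil, hm]

theorem get_subs {t n l rf sc st ins act : Term} {subs : List Term}
    (h : t.nf = .seq [n, l, rf, sc, st, ins, .seq subs, act]) {j : ℕ} {w : Term}
    (hw : subs[j]? = some w) (p : Ptr) : get t (7 :: (j + 1) :: p) = get w p := by
  have h2 : (Term.seq subs).nf = .seq subs := nf_of_mem h (by simp)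
  rw [get_seq (i := 6) h]
  exact get_seq_some h2 hw p

theorem items_win {t n op : Term} {docs : List Term} (h : t.nf = .seq [n, .seq docs, op]) :
    items (get t [2]) = docs := by
  rw [(get_win h).2.1, items_of_nf (nf_of_mem h (by simp))]

/-- Replacing a document of a window. -/
theorem nf_setAt_win {t n op : Term} {docs : List Term} (h : t.nf = .seq [n, .seq docs, op])
    (j : ℕ) (p : Ptr) (v : Term) : (setAt t (2 :: (j + 1) :: p) v).nf =
      .seq [n, .seq (docs.modify j fun u => (setAt u p v).nf), op] := by
  have h2 : (Term.seq docs).nf = .seq docs := nf_of_mem h (by simp)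
  rw [nf_setAt_cons (i := 1) h]
  simp only [List.modify_succ_cons, List.modify_zero_cons]
  rw [nf_setAt_cons h2]

theorem nf_setAt_subs {t n l rf sc st ins act : Term} {subs : List Term}
    (h : t.nf = .seq [n, l, rf, sc, st, ins, .seq subs, act]) (j : ℕ) (p : Ptr) (v : Term) :
    (setAt t (7 :: (j + 1) :: p) v).nf = .seq [n, l, rf, sc, st, ins,
      .seq (subs.modify j fun u => (setAt u p v).nf), act] := by
  have h2 : (Term.seq subs).nf = .seq subs := nf_of_mem h (by simp)
  rw [nf_setAt_cons (i := 6) h]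
  simp only [List.modify_succ_cons, List.modify_zero_cons]
  rw [nf_setAt_cons h2]

theorem forall_modify {P : Term → Prop} {l : List Term} {j : ℕ} {f : Term → Term}
    (hl : ∀ t ∈ l, P t) (hf : ∀ u, l[j]? = some u → P (f u)) : ∀ t ∈ l.modify j f, P t := by
  intro t ht
  obtain ⟨i, hi⟩ := List.mem_iff_getElem?.1 ht
  rw [List.getElem?_modify] at hi
  cases hi' : l[i]? with
  | none => simp [hi'] at hi
  | some e' =>
    rw [hi'] at hi
    simp only [Option.map_eq_map, Option.map_some, Option.some.injEq] at hi
    split_ifs at hi with hij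
    · subst hij; exact hi ▸ hf _ hi'
    · exact hi ▸ hl _ (mem_of_getElem? hi')

theorem UniqueAct.modify {docs : List Term} (h : UniqueAct docs) {j : ℕ} {f : Term → Term}
    (hf : ∀ d, docs[j]? = some d → get (f d) [8] = .top → get d [8] = .top) :
    UniqueAct (docs.modify j f) := by
  have key : ∀ (i : ℕ) (e : Term), (docs.modify j f)[i]? = some e →
      get e [8] = .top → ∃ e', docs[i]? = some e' ∧ get e' [8] = .top := by
    intro i e hi he
    rw [List.getElem?_modify] at hi
    cases hi' : docs[i]? with
    | none => simp [hi'] at hi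
    | some e' =>
      rw [hi'] at hi
      simp only [Option.map_eq_map, Option.map_some, Option.some.injEq] at hi
      refine ⟨e', rfl, ?_⟩
      split_ifs at hi with hij
      · subst hij; exact hf _ hi' (hi ▸ he)
      · exact hi ▸ he
  intro i i' e e' hi hi' he he'
  obtain ⟨a, ha1, ha2⟩ := key i e hi he
  obtain ⟨b, hb1, hb2⟩ := key i' e' hi' he'
  exact h _ _ _ _ ha1 hb1 ha2 hb2

/-- Windows at valid positions satisfy the invariant, and can be replaced. -/
theorem WinAt.spec {s : Term} (hs : WinsOK E G s) {p : Ptr} (hp : WinAt s p) :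
    TreeOK E G true (get s p) ∧ ∀ X, TreeOK E G true X.nf →
      WinsOK E G (setAt s p X) ∧ WinAt (setAt s p X) p ∧ get (setAt s p X) p = X.nf := by
  induction hp with
  | @top i hi =>
    obtain ⟨⟨ts, hts, hne⟩, ws, hws, hw⟩ := hs
    obtain ⟨u, ts, rfl⟩ := List.exists_cons_of_ne_nil hne
    have hu : u = .seq ws := by
      have := get_seq (i := 0) hts []
      rw [hws] at this
      simp only [List.getD_cons_zero, get_nil] at this
      rw [this, nf_of_mem hts (by simp)]
    subst hu
    have hwn : (Term.seq ws).nf = .seq ws := nf_of_mem hts (by simp)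
    rw [hws] at hi
    obtain ⟨k, w, rfl, hk⟩ := getElem?_of_isIndex hi hwn
    have hwk := mem_of_getElem? hk
    refine ⟨?_, fun X hX => ?_⟩
    · rw [get_seq (i := 0) hts, List.getD_cons_zero, get_seq_some hwn hk, get_nil,
        nf_of_mem hwn hwk]
      exact hw _ hwk
    · have e1 := nf_setAt_cons (i := 0) hts [k + 1] X
      simp only [List.modify_zero_cons] at e1
      rw [nf_setAt_cons hwn] at e1
      have e2 : get (setAt s [1, k + 1] X) [1] = .seq (ws.modify k fun u => (setAt u [] X).nf) := by
        have := nf_of_mem e1 (u := .seq (ws.modify k fun u => (setAt u [] X).nf)) (by simp)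
        rw [get_seq (i := 0) e1, List.getD_cons_zero, get_nil, this]
      refine ⟨⟨⟨_, e1, by simp⟩, _, e2, ?_⟩, .top ?_, ?_⟩
      · refine forall_modify hw fun u _ => ?_
        rwa [setAt_nil]
      · rw [e2, isIndex_iff]
        refine ⟨k, X.nf, rfl, ?_⟩
        rw [items_of_nf (by rw [← e2, nf_get])]
        simp [hk, setAt_nil]
      · rw [show get (setAt s [1, k + 1] X) [1, k + 1] = get (get (setAt s [1, k + 1] X) [1]) [k + 1]
          from get_append _ [1] _, e2,
          get_seq_some (u := X.nf) (by rw [← e2, nf_get]) (by simp [hk, setAt_nil]), get_nil,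
          nf_nf]
  | @sub w j i hw hj hi ih =>
    obtain ⟨h1, h2⟩ := ih
    obtain ⟨n, docs, op, ht, hn, hop, hdocs, hact⟩ := h1.win_inv
    have ht' : (get s w).nf = .seq [n, .seq docs, op] := by rw [nf_get, ht]
    rw [get_append, (get_win ht').2.1] at hj
    obtain ⟨k, d, rfl, hd⟩ := getElem?_of_isIndex hj (nf_of_mem ht' (by simp))
    obtain ⟨dn, L, rf, sc, st, ins, subs, act, hde, hdn, hdok, hsubs, ha⟩ :=
      (hdocs d (mem_of_getElem? hd)).doc_inv
    have hd2 : (Term.seq docs).nf = .seq docs := nf_of_mem ht' (by simp)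
    have hde' : d.nf = .seq [dn, L.term, rf, sc, st, .seq ins, .seq subs, act] := by
      rw [nf_of_mem hd2 (mem_of_getElem? hd), hde]
    rw [get_append, get_docs ht' hd, (get_doc hde').2.2.2.2.2.2.1] at hi
    obtain ⟨l, x, rfl, hx⟩ := getElem?_of_isIndex hi (nf_of_mem hde' (by simp))
    have hs2 : (Term.seq subs).nf = .seq subs := nf_of_mem hde' (by simp)
    have hgx : get s (w ++ [2, k + 1, 7, l + 1]) = x := by
      rw [get_append, get_docs ht' hd, get_subs hde' hx, get_nil,
        nf_of_mem hs2 (mem_of_getElem? hx)]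
    refine ⟨by rw [hgx]; exact hsubs _ (mem_of_getElem? hx), fun X hX => ?_⟩
    have hnew : (setAt (get s w) [2, k + 1, 7, l + 1] X).nf = .seq [n, .seq (docs.modify k fun _ =>
        .seq [dn, L.term, rf, sc, st, .seq ins,
          .seq (subs.modify l fun _ => X.nf), act]), op] := by
      rw [nf_setAt_win ht']
      congr 4
      apply modify_congr
      intro u hu
      rw [hd] at hu
      cases hu
      rw [nf_setAt_subs hde']
      simp only [setAt_nil]
    have hact' : act.nf = act := nf_of_mem hde' (by simp)
    have hok : TreeOK E G true (setAt (get s w) [2, k + 1, 7, l + 1] X).nf := by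
      rw [hnew]
      refine .win hn hop (forall_modify hdocs fun u _ => ?_) (hact.modify fun u hu => ?_)
      · exact .doc hdn hdok (forall_modify hsubs fun u _ => hX) ha
      · rw [hd] at hu
        cases hu
        rw [(get_doc hde').2.2.2.2.2.2.2, get_doc_active, hact']
        exact id
    obtain ⟨a1, a2, a3⟩ := h2 _ hok
    have heq : (setAt s (w ++ [2, k + 1, 7, l + 1]) X).nf =
        (setAt s w (setAt (get s w) [2, k + 1, 7, l + 1] X)).nf := nf_setAt_append _ _ _ _
    rw [hnew] at a3
    have hg : ∀ p, get (setAt s (w ++ [2, k + 1, 7, l + 1]) X) p =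
      get (setAt s w (setAt (get s w) [2, k + 1, 7, l + 1] X)) p := get_congr heq
    have a3' : (get (setAt s w (setAt (get s w) [2, k + 1, 7, l + 1] X)) w).nf =
      .seq [n, .seq (docs.modify k fun _ => .seq [dn, L.term, rf, sc, st, .seq ins,
          .seq (subs.modify l fun _ => X.nf), act]), op] := by rw [nf_get, a3]
    have b1 : (docs.modify k fun _ => Term.seq [dn, L.term, rf, sc, st, .seq ins,
          .seq (subs.modify l fun _ => X.nf), act])[k]? = some (.seq [dn, L.term, rf, sc, st,
            .seq ins, .seq (subs.modify l fun _ => X.nf), act]) := by simp [hd]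
    have b2 : (Term.seq [dn, L.term, rf, sc, st, .seq ins, .seq (subs.modify l fun _ => X.nf),
        act]).nf = .seq [dn, L.term, rf, sc, st, .seq ins, .seq (subs.modify l fun _ => X.nf),
        act] := nf_of_mem (nf_of_mem (u := .seq _) a3' (by simp)) (mem_of_getElem? b1)
    have b3 : (subs.modify l fun _ => X.nf)[l]? = some X.nf := by simp [hx]
    refine ⟨?_, ?_, ?_⟩
    · refine ⟨⟨_, by rw [heq]; exact a1.1.choose_spec.1, a1.1.choose_spec.2⟩, ?_⟩
      rw [hg]; exact a1.2
    · refine .congr heq.symm (.sub a2 ?_ ?_)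
      · rw [get_append, (get_win a3').2.1, isIndex_iff]
        exact ⟨k, _, rfl, by rw [items_of_nf (nf_of_mem a3' (by simp))]; exact b1⟩
      · rw [get_append, get_docs a3' b1, (get_doc b2).2.2.2.2.2.2.1, isIndex_iff]
        exact ⟨l, _, rfl, by rw [items_of_nf (nf_of_mem b2 (by simp))]; exact b3⟩
    · rw [hg, get_append, get_docs a3' b1, get_subs b2 b3, get_nil, nf_nf]

/-! # Steps of the browser -/

/-- Facts about the static data. -/
structure EnvOK (E : Env) : Prop extends EnvClosed E where
  ids_seq : ∃ l, E.ids = .seq l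
  ids_own : ∀ e ∈ items E.ids, ∃ a c, e = .seq [.str a, .str c] ∧ E.own a c
  km_get : ∀ h, dictGet E.km (.str h) = .pub (.nonce (E.ssl h)) ∨
    E.cls h = .other ∧ dictGet E.km (.str h) = .seq []
  km_seq : ∃ l, E.km = .seq l
  km_pub : ∀ e ∈ items E.km, ∃ h n, e = .seq [.str h, .pub (.nonce n)]
  sec_get : ∀ L : Loc, L.cls E = .other → (∃ n, E.pubs n ∧ dictGet E.sec L.origin = .nonce n) ∨
    dictGet E.sec L.origin = .seq []
  da_addr : ∃ a, E.da = .addr a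
  cls_fd : (∃ h, E.cls h = .idp) → E.cls E.fd = .fwd
  ssl_inj : ∀ h h', E.cls h ≠ .other → dictGet E.km (.str h') ≠ .seq [] → E.ssl h = E.ssl h' → h = h'

theorem ren_var (t : Term) : ren .var t = t.nf := by rw [ren, subst_var]

theorem GWF.tr_self (h : GWF E G) : Tr E G .var G :=
  ⟨h.toGStat, h.closed, fun a ρ ha => by rw [ren_var, Ghost.Named.nf (G := G) ⟨ρ, ha⟩, ha]⟩

theorem Ghost.Known.nf_known {a : Term} (h : G.Known a) : G.Known a.nf := h.named.nf.symm ▸ h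

namespace BInv

theorem shape (hs : BInv E G s) : ∃ ts, s.nf = .seq ts ∧ ts ≠ [] := by
  obtain ⟨ts, h1, h2, _⟩ := hs
  exact ⟨ts, h1, by rintro rfl; simp at h2⟩

theorem winsOK (hs : BInv E G s) : WinsOK E G s :=
  ⟨hs.shape, Comps.get (k := 0) hs (by norm_num)⟩

theorem comp (hs : BInv E G s) {k : ℕ} (hk : k < 12) : BComp E G (k + 1) (get s [k + 1]) :=
  Comps.get hs hk

/-- Replacing a component. -/
theorem set1 (hs : BInv E G s) {k : ℕ} {v : Term} (hv : BComp E G (k + 1) v.nf) :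
    BInv E G (setAt s [k + 1] v) := Comps.set hs (by rwa [setAt_nil])

theorem set_window (hs : BInv E G s) {p : Ptr} (hp : WinAt s p) {X : Term}
    (hX : TreeOK E G true X.nf) :
    BInv E G (setAt s p X) ∧ WinAt (setAt s p X) p ∧ get (setAt s p X) p = X.nf := by
  obtain ⟨h1, h2, h3⟩ := (hp.spec hs.winsOK).2 X hX
  refine ⟨?_, h2, h3⟩
  obtain ⟨q, rfl⟩ := hp.head
  obtain ⟨ts, hts, hne⟩ := hs.shape
  obtain ⟨u, ts, rfl⟩ := List.exists_cons_of_ne_nil hne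
  refine Comps.set (k := 0) hs ?_
  have := get_setAt_self (v := X) hts (j := 0) (u := u) (by simp) q []
  have h4 := h1.2
  rw [Nat.zero_add] at *
  rw [this, get_nil] at h4
  cases q with
  | nil => rw [setAt_nil] at *; exact h4
  | cons i q =>
    rwa [setAt_congr (t := get s [1]) (u := u) _ (by simp)]
    rw [nf_get, get_seq (i := 0) hts, List.getD_cons_zero, get_nil]

theorem winTree (hs : BInv E G s) {p : Ptr} (hp : WinAt s p) : TreeOK E G true (get s p) :=
  (hp.spec hs.winsOK).1

theorem set_win (hs : BInv E G s) {p q : Ptr} (hp : WinAt s p) {v : Term}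
    (hX : TreeOK E G true (setAt (get s p) q v).nf) :
    BInv E G (setAt s (p ++ q) v) ∧ WinAt (setAt s (p ++ q) v) p ∧
      get (setAt s (p ++ q) v) p = (setAt (get s p) q v).nf := by
  obtain ⟨h1, h2, h3⟩ := hs.set_window hp hX
  have he := nf_setAt_append s p q v
  refine ⟨?_, h2.congr he.symm, by rw [get_congr he, h3]⟩
  obtain ⟨ts, h⟩ := h1
  exact ⟨ts, by rw [he]; exact h.1, h.2⟩

theorem window_known (hs : BInv E G s) {p : Ptr} (hp : WinAt s p) : G.Known (get s (p ++ [1])) := by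
  obtain ⟨n, docs, op, ht, hn, -⟩ := (hs.winTree hp).win_inv
  rwa [get_append, (get_win (by rw [nf_get, ht])).1]

/-- The documents of a window. -/
theorem docs_at (hs : BInv E G s) {w : Ptr} (hp : WinAt s w) : ∃ n docs op,
    (get s w).nf = .seq [n, .seq docs, op] ∧ G.Known n ∧ Safe E G op ∧
      (∀ d ∈ docs, TreeOK E G false d) ∧ UniqueAct docs ∧ ∀ j, IsIndex j (get s (w ++ [2])) →
        ∃ k d, j = k + 1 ∧ docs[k]? = some d ∧ get s (w ++ [2, k + 1]) = d ∧
          ∀ q, get s (w ++ [2, k + 1] ++ q) = get d q := by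
  obtain ⟨n, docs, op, ht, hn, hop, hd, hu⟩ := (hs.winTree hp).win_inv
  have ht' : (get s w).nf = .seq [n, .seq docs, op] := by rw [nf_get, ht]
  have h2 : (Term.seq docs).nf = .seq docs := nf_of_mem ht' (by simp)
  refine ⟨n, docs, op, ht', hn, hop, hd, hu, fun j hj => ?_⟩
  rw [get_append, (get_win ht').2.1] at hj
  obtain ⟨k, d, rfl, hk⟩ := getElem?_of_isIndex hj h2
  have hgd : get s (w ++ [2, k + 1]) = d := by
    rw [get_append, get_docs ht' hk, get_nil, nf_of_mem h2 (mem_of_getElem? hk)]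
  exact ⟨k, d, rfl, hk, hgd, fun q => by rw [get_append, hgd]⟩

theorem docTree (hs : BInv E G s) {w : Ptr} (hp : WinAt s w) {j : ℕ}
    (hj : IsIndex j (get s (w ++ [2]))) : TreeOK E G false (get s (w ++ [2, j])) := by
  obtain ⟨n, docs, op, ht, hn, hop, hd, hu, hx⟩ := hs.docs_at hp
  obtain ⟨k, d, rfl, hk, hgd, -⟩ := hx j hj
  exact hgd ▸ hd _ (mem_of_getElem? hk)

theorem active_unique (hs : BInv E G s) {w : Ptr} (hp : WinAt s w) {d d' : Ptr}
    (hd : IsActiveDoc s w d) (hd' : IsActiveDoc s w d') : d = d' := by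
  obtain ⟨j, hj, rfl, ha⟩ := hd
  obtain ⟨j', hj', rfl, ha'⟩ := hd'
  obtain ⟨n, docs, op, ht, hn, hop, hd, hu, hx⟩ := hs.docs_at hp
  obtain ⟨k, d, rfl, hk, -, hg⟩ := hx j hj
  obtain ⟨k', d', rfl, hk', -, hg'⟩ := hx j' hj'
  rw [hg, equiv_iff_nf, nf_get] at ha
  rw [hg', equiv_iff_nf, nf_get] at ha'
  rw [hu _ _ _ _ hk hk' ha ha']

/-- Changing a document. -/
theorem set_doc (hs : BInv E G s) {w q : Ptr} (hp : WinAt s w) {j : ℕ} {v : Term}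
    (hj : IsIndex j (get s (w ++ [2])))
    (hX : TreeOK E G false (setAt (get s (w ++ [2, j])) q v).nf)
    (ha : get (setAt (get s (w ++ [2, j])) q v) [8] = .top → get s (w ++ [2, j, 8]) = .top) :
    BInv E G (setAt s (w ++ [2, j] ++ q) v) ∧ WinAt (setAt s (w ++ [2, j] ++ q) v) w ∧
      IsIndex j (get (setAt s (w ++ [2, j] ++ q) v) (w ++ [2])) ∧
      get (setAt s (w ++ [2, j] ++ q) v) (w ++ [2, j]) = (setAt (get s (w ++ [2, j])) q v).nf := by
  obtain ⟨n, docs, op, ht', hn, hop, hd, hu, hx⟩ := hs.docs_at hp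
  obtain ⟨k, d, rfl, hk, hgd, hgq⟩ := hx j hj
  have hgd8 := hgq [8]
  rw [List.append_assoc] at hgd8
  change get s (w ++ [2, k + 1, 8]) = _ at hgd8
  rw [hgd] at hX ha ⊢
  rw [hgd8] at ha
  have hnew : (setAt (get s w) (2 :: (k + 1) :: q) v).nf =
      .seq [n, .seq (docs.modify k fun _ => (setAt d q v).nf), op] := by
    rw [nf_setAt_win ht']
    congr 4
    apply modify_congr
    intro u hu
    rw [hk] at hu
    cases hu
    rfl
  have hok : TreeOK E G true (setAt (get s w) (2 :: (k + 1) :: q) v).nf := by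
    rw [hnew]
    refine .win hn hop (forall_modify hd fun u _ => hX) (hu.modify fun u hu => ?_)
    rw [hk] at hu
    cases hu
    rwa [get_nf]
  obtain ⟨a1, a2, a3⟩ := hs.set_win hp hok
  rw [List.append_assoc, show [2, k + 1] ++ q = 2 :: (k + 1) :: q from rfl]
  rw [hnew] at a3
  have a3' : (get (setAt s (w ++ 2 :: (k + 1) :: q) v) w).nf =
      .seq [n, .seq (docs.modify k fun _ => (setAt d q v).nf), op] := by rw [nf_get, a3]
  have b1 : (docs.modify k fun _ => (setAt d q v).nf)[k]? = some (setAt d q v).nf := by simp [hk]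
  refine ⟨a1, a2, ?_, ?_⟩
  · rw [get_append, (get_win a3').2.1, isIndex_iff]
    exact ⟨k, _, rfl, by rw [items_of_nf (nf_of_mem a3' (by simp))]; exact b1⟩
  · rw [get_append, get_docs a3' b1, get_nil, nf_nf]

theorem filter10 (hs : BInv E G s) (p : Term → Bool) :
    BInv E G (setAt s [10] (.seq ((items (get s [10])).filter p))) := by
  refine hs.set1 (k := 9) ?_
  obtain ⟨l, h1, h2⟩ := hs.comp (k := 9) (by norm_num)
  have hi : items (get s [10]) = l := items_of_nf (by rw [nf_get, h1])
  have hl := map_nf_of_nf (t := get s [10]) (by rw [nf_get, h1])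
  refine ⟨l.filter p, ?_, fun e he => h2 e (List.mem_filter.1 he).1⟩
  rw [hi, nf_seq, (map_eq_self_iff (f := Term.nf)).2]
  exact fun x hx => (map_eq_self_iff (f := Term.nf)).1 hl x (List.mem_filter.1 hx).1

theorem filter11 (hs : BInv E G s) {l' : List Term} (hl' : ∀ e ∈ l', e ∈ items (get s [11])) :
    BInv E G (setAt s [11] (.seq l')) := by
  refine hs.set1 (k := 10) ?_
  obtain ⟨l, h1, h2⟩ := hs.comp (k := 10) (by norm_num)
  have hi : items (get s [11]) = l := items_of_nf (by rw [nf_get, h1])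
  refine ⟨l', ?_, fun e he => h2 e (hi ▸ hl' e he)⟩
  rw [nf_seq, (map_eq_self_iff (f := Term.nf)).2]
  exact fun x hx => nf_of_mem_items (hl' x hx)

theorem cancelNav (hs : BInv E G s) (n : Term) : BInv E G (cancelNav n s) :=
  (hs.filter11 fun _ he => (List.mem_filter.1 he).1).filter10 _

/-- Appending an element to a sequence component. -/
theorem append_items {t v : Term} {l : List Term} (h : t = .seq l) (hn : t.nf = t) :
    (Term.seq (items t ++ [v])).nf = .seq (l ++ [v.nf]) := by
  have ht : t.nf = .seq l := by rw [hn, h]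
  rw [items_of_nf ht, nf_seq, List.map_append, map_nf_of_nf ht]
  rfl

end BInv

theorem appendAt_eq (t : Term) (p : Ptr) (v : Term) :
    appendAt t p v = setAt t p (.seq (items (get t p) ++ [v])) := rfl

/-- Elements of an updated dictionary. -/
theorem mem_dictSet {z k v : Term} : ∃ l, (dictSet z k v).nf = .seq l ∧
    ∀ e ∈ l, e ∈ items z ∨ e = .seq [k.nf, v.nf] := by
  unfold dictSet
  split_ifs
  · refine ⟨_, nf_seq _, ?_⟩
    intro e he
    rw [List.map_map, mem_map] at he
    obtain ⟨x, hx, rfl⟩ := he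
    simp only [Function.comp]
    split_ifs
    · exact .inr (by simp [nf_seq])
    · exact .inl (by rw [nf_of_mem_items hx]; exact hx)
  · refine ⟨_, nf_seq _, ?_⟩
    intro e he
    rw [List.map_append, map_nf_items, mem_append] at he
    rcases he with he | he
    · exact .inl he
    · right
      simpa [nf_seq] using he

theorem dictSet_append {z k v : Term} (h : ∀ e ∈ items z, ¬ HasKey k e) :
    dictSet z k v = .seq (items z ++ [.seq [k, v]]) := by
  unfold dictSet
  rw [if_neg]
  rintro ⟨e, he, hk⟩
  exact h e he hk

/-- The headers added by the browser. -/
def hdrs (c o rf : Term) : List Term :=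
  .seq [K .hCookie, c] :: ((if o ≈ₜ .bot then [] else [.seq [K .hOrigin, o]]) ++
    if rf ≈ₜ .bot then [] else [.seq [K .hReferer, rf]])

theorem nf_httpRequest (n me h pa par hd bd : Term) : (httpRequest n me h pa par hd bd).nf =
    httpRequest n.nf me.nf h.nf pa.nf par.nf hd.nf bd.nf := by
  simp [httpRequest, nf_seq]; rfl

theorem get_req (n me h pa par hd bd : Term) :
    get (httpRequest n me h pa par hd bd) [2] = n.nf ∧
    get (httpRequest n me h pa par hd bd) [3] = me.nf ∧
    get (httpRequest n me h pa par hd bd) [4] = h.nf ∧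
    get (httpRequest n me h pa par hd bd) [5] = pa.nf ∧
    get (httpRequest n me h pa par hd bd) [6] = par.nf ∧
    get (httpRequest n me h pa par hd bd) [7] = hd.nf ∧
    get (httpRequest n me h pa par hd bd) [8] = bd.nf := by
  refine ⟨?_, ?_, ?_, ?_, ?_, ?_, ?_⟩ <;> rw [httpRequest, get_seq (nf_seq _)] <;> simp [get_nil]

theorem nf_setAt_hdr (n me h pa par hd bd v : Term) :
    (setAt (httpRequest n me h pa par hd bd) [7] v).nf = (httpRequest n me h pa par v bd).nf := by
  have hn : (httpRequest n me h pa par hd bd).nf = .seq _ := nf_seq _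
  rw [nf_setAt_cons (i := 6) hn, nf_httpRequest]
  simp [httpRequest, setAt_nil, Term.nf]

theorem addHdr_congr {m m' : Term} (h : m.nf = m'.nf) (k : Kw) (v : Term) :
    (addHdr m k v).nf = (addHdr m' k v).nf := by
  unfold addHdr
  split_ifs
  · exact h
  · rw [setAt_congr h (by simp), get_congr h]

theorem addHdr_httpRequest {n me h pa par bd v : Term} {l : List Term} {k : Kw}
    (hl : ∀ e ∈ l, ¬ HasKey (K k) e) :
    (addHdr (httpRequest n me h pa par (.seq l) bd) k v).nf = (httpRequest n me h pa par
      (.seq (l ++ if v ≈ₜ .bot then [] else [.seq [K k, v]])) bd).nf := by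
  unfold addHdr
  split_ifs
  · simp
  · rw [nf_setAt_hdr, dictSet_append, nf_httpRequest, nf_httpRequest, (get_req ..).2.2.2.2.2.1,
      items_nf, items_seq]
    · simp [nf_seq, Function.comp_def]
    · intro e he
      rw [(get_req ..).2.2.2.2.2.1, items_nf, items_seq, mem_map] at he
      obtain ⟨x, hx, rfl⟩ := he
      have := hl x hx
      rwa [hasKey_iff, nf_nf, ← hasKey_iff]

theorem not_hasKey {k k' : Kw} {v : Term} (h : k ≠ k') : ¬ HasKey (K k) (.seq [K k', v]) := by
  rw [hasKey_pair]
  simp only [Term.nf, Term.str.injEq, Str.kw.injEq]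
  exact fun h' => h h'.symm

theorem nf_sendMsg (n me h pa par bd proto o rf : Term) :
    (sendMsg s (httpRequest n me h pa par (.seq []) bd) proto o rf).nf =
      (httpRequest n me h pa par (.seq (hdrs (sendCookies s h.nf proto) o rf)) bd).nf := by
  have h1 : (setAt (httpRequest n me h pa par (.seq []) bd) [7]
      (dictSet (get (httpRequest n me h pa par (.seq []) bd) [7]) (K .hCookie)
        (sendCookies s h.nf proto))).nf =
      (httpRequest n me h pa par (.seq [.seq [K .hCookie, sendCookies s h.nf proto]]) bd).nf := by
    rw [nf_setAt_hdr, (get_req ..).2.2.2.2.2.1, dictSet_append (by simp [items_seq])]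
    simp [items_seq]
  rw [sendMsg, (get_req ..).2.2.1]
  rw [addHdr_congr ((addHdr_congr h1 _ _).trans (addHdr_httpRequest ?_))]
  · rw [addHdr_httpRequest]
    · simp [hdrs]
    · intro e he
      simp only [List.cons_append, List.nil_append, mem_cons] at he
      rcases he with rfl | he
      · exact not_hasKey (by simp)
      · split_ifs at he
        · simp at he
        · rw [mem_singleton] at he
          subst he
          exact not_hasKey (by simp)
  · intro e he
    rw [mem_singleton] at he
    subst he
    exact not_hasKey (by simp)

/-- Messages emitted by the honest browser. -/
def Emit (E : Env) (G : Ghost) (m : Term) : Prop :=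
  (∃ ts, m = .seq ts) ∨ (∃ y, m = .enca y (.seq [])) ∨ ∃ y h, m = .enca y (.pub (.nonce (E.ssl h))) ∧
    dictGet E.km (.str h) ≠ .seq [] ∧
    (E.cls h = .rp → ∃ κ ref q, y = .seq [Req.term q, κ] ∧ G.role κ = some (.key ref q))

def EmitEv (E : Env) (G : Ghost) (x : Term) : Prop :=
  Safe E G x ∧ ∃ a f m, x = .seq [a, f, m] ∧ Emit E G m.nf

/-- Outputs of the honest browser that preserve its invariant. -/
def BOut (E : Env) (G : Ghost) (o : Out) : Prop := (∀ x ∈ o.1, EmitEv E G x) ∧ BInv E G o.2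

theorem BInv.noOut (hs : BInv E G s) : BOut E G ([], s) := ⟨by simp, hs⟩

theorem known_nu {k : ℕ} (h : G.v (.nu k) = some .pub) : G.Known (ν k) := ⟨_, h, trivial⟩

namespace BInv

theorem sts (hs : BInv E G s) {host : Term} (h : Mem host (get s [8])) :
    ∃ d, host.nf = .str d ∧ E.cls d = .other := by
  obtain ⟨l, h1, h2⟩ := hs.comp (k := 7) (by norm_num)
  obtain ⟨y, hy, he⟩ := h
  rw [items_of_nf (by rw [nf_get, h1])] at hy
  obtain ⟨d, rfl, hd⟩ := h2 y hy
  exact ⟨d, (Equiv.nf_eq he).symm, hd⟩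

theorem sendProto_cases (hs : BInv E G s) (host proto : Term) :
    sendProto s host proto = proto ∨ sendProto s host proto = K .https ∧
      ∃ d, host.nf = .str d ∧ E.cls d = .other := by
  unfold sendProto
  split_ifs with h
  · exact .inr ⟨rfl, hs.sts h⟩
  · exact .inl rfl

theorem cookies_at (hs : BInv E G s) (host : Term) :
    dictGet (get s [4]) host = .seq [] ∨ ∃ d cs, host.nf = .str d ∧
      dictGet (get s [4]) host = .seq cs ∧ ∀ c ∈ cs, CookieOK E G d c := by
  obtain ⟨l, h1, h2⟩ := hs.comp (k := 3) (by norm_num)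
  rcases dictGet_mem (z := get s [4]) (k := host) rfl with h | ⟨e, he, h⟩
  · exact .inl h
  · right
    rw [items_of_nf (by rw [nf_get, h1])] at he
    obtain ⟨d, cs, h3, h4⟩ := h2 e he
    rw [h] at h3
    simp only [Term.seq.injEq, List.cons.injEq, and_true] at h3
    exact ⟨d, cs, h3.1, h3.2, h4⟩

theorem cookie_items (hs : BInv E G s) (host : Term) {c : Term}
    (hc : c ∈ items (dictGet (get s [4]) host)) : ∃ d, host.nf = .str d ∧ CookieOK E G d c := by
  rcases hs.cookies_at host with h | ⟨d, cs, h1, h2, h3⟩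
  · rw [h, items_seq] at hc; simp at hc
  · refine ⟨d, h1, h3 _ ?_⟩
    have := items_of_nf (t := dictGet (get s [4]) host) (ts := cs) (by rw [nf_dictGet, h2])
    rwa [this] at hc

theorem _root_.Spresso.get_session (v : Term) : 
    get (.seq [K .sessionid, .seq [v, .top, .top, .top]]) [2, 2] = .top ∧
    get (.seq [K .sessionid, .seq [v, .top, .top, .top]]) [2, 4] = .top := by
  constructor <;> rw [get_seq (nf_seq _)] <;>
    simp only [map_cons, List.getD_cons_succ, List.getD_cons_zero, nf_seq] <;>
    rw [get_seq (nf_seq _)] <;> simp [get_nil, Term.nf]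

theorem sendCookies_safe (hG : GWF E G) (hs : BInv E G s) {host proto : Term}
    (h : ∀ d, host.nf = .str d → E.cls d = .idp → ¬ sendProto s host proto ≈ₜ K .https) :
    Safe E G (sendCookies s host proto) := by
  have hd := hG.dy
  refine hd.seq fun u hu => ?_
  obtain ⟨c, hc, rfl⟩ := mem_map.1 hu
  rw [List.mem_filter] at hc
  obtain ⟨hc, hp⟩ := hc
  obtain ⟨d, h1, h2 | ⟨h2, v, rfl, _⟩⟩ := hs.cookie_items host hc
  · have : Safe E G c := h2
    exact hd.pair (hd.get this _) (hd.get this _)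
  · rw [decide_eq_true_eq, (get_session v).1] at hp
    exact absurd (hp (.refl _)) (h d h1 h2)

/-- Sending a request. -/
theorem send (hE : EnvOK E) (hG : GWF E G) (hs : BInv E G s) (hν : G.v (.nu 8) = some .pub)
    {a ref n me h pa par bd proto o rf : Term} (ha : Safe E G a) (hh : Safe E G h)
    (hp : Pending E G ref.nf (httpRequest n me h pa par
      (.seq (hdrs (sendCookies s h.nf proto) o rf)) bd).nf (sendProto s h.nf proto).nf)
    {x : Out} (hx : x ∈ send a ref (httpRequest n me h pa par (.seq []) bd) proto o rf s) :
    BOut E G x := by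
  have hd := hG.dy
  rw [send_eq, mem_singleton_iff] at hx
  subst hx
  rw [(get_req ..).2.2.1]
  constructor
  · rw [all_one]
    refine ⟨?_, _, _, _, rfl, .inl ⟨_, nf_seq _⟩⟩
    obtain ⟨da, hda⟩ : ∃ da, get s [9] = .addr da := by
      exact hE.da_addr.imp fun a ha => (hs.comp (k := 8) (by norm_num) : _ = E.da).trans ha
    rw [hda]
    refine hd.seq ?_
    simp [hd.addr, ha, hd.seq_iff, hd.str, hd.nf_iff.2 hh, (known_nu hν).safe]
  · refine hs.set1 (k := 9) ?_
    obtain ⟨l, h1, h2⟩ := hs.comp (k := 9) (by norm_num)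
    have hi : items (get s [10]) = l := items_of_nf (by rw [nf_get, h1])
    obtain ⟨l', e1, e2⟩ := mem_dictSet (z := get s [10]) (k := ν 8) (v := .seq [ref,
      sendMsg s (httpRequest n me h pa par (.seq []) bd) proto o rf, sendProto s h.nf proto])
    refine ⟨l', e1, fun e he => ?_⟩
    rcases e2 e he with he | rfl
    · exact h2 _ (hi ▸ he)
    · rw [nf_seq]
      refine ⟨_, _, _, _, rfl, ?_⟩
      rw [nf_sendMsg]
      exact hp

end BInv

theorem hdrOpen_hdrs (c : Term) {o rf : Term} (ho : o.nf = .bot ∨ OriginOpen E o.nf) :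
    HdrOpen E (Term.seq (hdrs c o rf)).nf := by
  rw [nf_seq]
  refine ⟨_, rfl, fun e he => ?_⟩
  obtain ⟨x, hx, rfl⟩ := mem_map.1 he
  simp only [hdrs, mem_cons, mem_append] at hx
  rcases hx with rfl | hx | hx
  · exact ⟨.hCookie, c.nf, by rw [nf_seq]; rfl, by simp⟩
  · split_ifs at hx with hb
    · simp at hx
    · rw [mem_singleton] at hx
      subst hx
      refine ⟨.hOrigin, o.nf, by rw [nf_seq]; rfl, fun _ => ho.resolve_left ?_⟩
      intro h
      exact hb (equiv_iff_nf.2 h)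
  · split_ifs at hx
    · simp at hx
    · rw [mem_singleton] at hx
      subst hx
      exact ⟨.hReferer, rf.nf, by rw [nf_seq]; rfl, by simp⟩

theorem safe_hdrs (hG : GWF E G) {c o rf : Term} (hc : Safe E G c) (ho : Safe E G o)
    (hr : Safe E G rf) : Safe E G (.seq (hdrs c o rf)) := by
  have hd := hG.dy
  refine hd.seq fun e he => ?_
  simp only [hdrs, mem_cons, mem_append] at he
  rcases he with rfl | he | he
  · exact hd.pair (hd.str _) hc
  · split_ifs at he
    · simp at he
    · rw [mem_singleton] at he
      subst he
      exact hd.pair (hd.str _) ho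
  · split_ifs at he
    · simp at he
    · rw [mem_singleton] at he
      subst he
      exact hd.pair (hd.str _) hr

namespace BInv

/-- Sending a request with known content that is to be processed in a window. -/
theorem send_win (hE : EnvOK E) (hG : GWF E G) (hs : BInv E G s) (hν : G.v (.nu 8) = some .pub)
    {a ref n me h pa par bd proto o rf : Term} (ha : Safe E G a) (hr : G.Known ref)
    (hn : Safe E G n) (hme : Safe E G me) (hh : Safe E G h) (hpa : Safe E G pa)
    (hpar : Safe E G par) (hbd : Safe E G bd) (ho : Safe E G o)
    (ho' : o.nf = .bot ∨ OriginOpen E o.nf) (hrf : Safe E G rf)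
    {x : Out} (hx : x ∈ Spresso.send a ref (httpRequest n me h pa par (.seq []) bd) proto o rf s) :
    BOut E G x := by
  have hd := hG.dy
  refine hs.send hE hG hν ha hh ?_ hx
  rw [nf_httpRequest]
  by_cases hc : ∃ d, h.nf = .str d ∧ E.cls d = .idp ∧ sendProto s h.nf proto ≈ₜ K .https
  · obtain ⟨d, h1, h2, h3⟩ := hc
    rw [h1]
    refine .prot (q := ⟨n.nf, me.nf, d, pa.nf, par.nf, _, bd.nf⟩) rfl ?_ ?_ ?_
    · rw [← h1]; exact Equiv.nf_eq h3
    · simp [h2]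
    · exact .idpWin h2 hr.nf_known.named (hd.nf_iff.2 hpa) (hd.nf_iff.2 hpar)
  · have hck : Safe E G (sendCookies s h.nf proto) := by
      refine sendCookies_safe hG hs fun d h1 h2 h3 => hc ⟨d, ?_, h2, h3⟩
      rwa [nf_nf] at h1
    refine .win rfl ?_ hr.nf_known (hdrOpen_hdrs _ ho')
    rw [← nf_httpRequest, hd.nf_iff]
    exact hd.httpRequest hn hme hh hpa hpar (safe_hdrs hG hck ho hrf) hbd

/-- Requests by `XMLHttpRequest` of adversarial documents. -/
theorem send_xhr (hE : EnvOK E) (hG : GWF E G) (hs : BInv E G s) (hν : G.v (.nu 8) = some .pub)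
    {a dn y n me h pa par bd proto o rf : Term} {L : Loc} (hL : L.cls E = .other)
    (ha : Safe E G a) (hdn : G.role dn = some (.doc L)) (hy : Safe E G y)
    (hn : Safe E G n) (hme : Safe E G me) (hh : h.nf = .str L.host) (hpa : Safe E G pa)
    (hpar : Safe E G par) (hbd : Safe E G bd) (ho : Safe E G o) (hpr : proto.nf = L.proto)
    (hrf : Safe E G rf) {x : Out}
    (hx : x ∈ Spresso.send a (.seq [dn, y]) (httpRequest n me h pa par (.seq []) bd) proto o rf s) :
    BOut E G x := by
  have hd := hG.dy
  have hsh : Safe E G h := by rw [← hd.nf_iff, hh]; exact hd.str _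
  have hpc : (sendProto s h.nf proto).nf = K .http ∨ E.cls L.host = .other := by
    rcases hs.sendProto_cases h.nf proto with h1 | ⟨h1, d, h2, h3⟩
    · rw [h1, hpr]
      unfold Loc.proto
      unfold Loc.cls at hL
      cases hb : L.https
      · exact .inl rfl
      · rw [hb] at hL; exact .inr hL
    · rw [nf_nf, hh] at h2
      cases h2
      exact .inr h3
  have hck : Safe E G (sendCookies s h.nf proto) := by
    refine sendCookies_safe hG hs fun d h1 h2 h3 => ?_
    rw [nf_nf, hh] at h1
    cases h1
    rcases hpc with hpc | hpc
    · rw [equiv_iff_nf, hpc] at h3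
      simp [Term.nf] at h3
    · rw [hpc] at h2; cases h2
  refine hs.send hE hG hν ha hsh ?_ hx
  have hM := hd.nf_iff.2 (hd.httpRequest hn hme hsh hpa hpar (safe_hdrs hG hck ho hrf) hbd)
  rw [nf_httpRequest] at hM ⊢
  rw [hh] at hM hpc ⊢
  refine .xhr rfl hM ⟨dn, y.nf, L, ?_, hd.nf_iff.2 hy, hdn, hL, rfl, hpc⟩
  rw [nf_seq]
  simp [Ghost.Named.nf (G := G) ⟨_, hdn⟩]

/-- Opening a new window. -/
theorem append_window (hs : BInv E G s) {n op : Term} (hn : G.Known n) (hop : Safe E G op.nf) :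
    BInv E G (appendAt s [1] (.seq [n, .seq [], op])) ∧
      WinAt (appendAt s [1] (.seq [n, .seq [], op])) [1, (items (get s [1])).length + 1] ∧
      get (appendAt s [1] (.seq [n, .seq [], op])) [1, (items (get s [1])).length + 1] =
        .seq [n, .seq [], op.nf] := by
  obtain ⟨ws, h1, h2⟩ := hs.comp (k := 0) (by norm_num)
  have hv : (Term.seq [n, .seq [], op]).nf = .seq [n, .seq [], op.nf] := by
    simp [nf_seq, hn.named.nf]
  have hnew : (Term.seq (items (get s [1]) ++ [.seq [n, .seq [], op]])).nf =
      .seq (ws ++ [.seq [n, .seq [], op.nf]]) := by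
    rw [append_items h1 (nf_get _ _), hv]
  have hi : items (get s [1]) = ws := items_of_nf (by rw [nf_get, h1])
  rw [appendAt_eq]
  have hg : get (setAt s [1] (.seq (items (get s [1]) ++ [.seq [n, .seq [], op]]))) [1] =
      .seq (ws ++ [.seq [n, .seq [], op.nf]]) := by
    obtain ⟨ts, hts, hne⟩ := hs.shape
    obtain ⟨u, ts, rfl⟩ := List.exists_cons_of_ne_nil hne
    rw [get_setAt_self hts (j := 0) (u := u) (by simp), setAt_nil, get_nil, hnew]
  refine ⟨hs.set1 (k := 0) ?_, .top ?_, ?_⟩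
  · refine ⟨_, hnew, fun w hw => ?_⟩
    rcases mem_append.1 hw with hw | hw
    · exact h2 w hw
    · rw [mem_singleton.1 hw]
      exact .win hn hop (by simp) (by intro i j d d' h; simp at h)
  · rw [hg, isIndex_iff, hi]
    have hwn : (Term.seq (ws ++ [Term.seq [n, .seq [], op.nf]])).nf =
        .seq (ws ++ [Term.seq [n, .seq [], op.nf]]) := by rw [← hnew, nf_nf]
    exact ⟨ws.length, _, rfl, by rw [items_of_nf hwn]; simp; rfl⟩
  · rw [show ∀ t k, get t [1, k] = get (get t [1]) [k] from fun t k => get_append t [1] [k], hg,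
      get_seq_some (u := .seq [n, .seq [], op.nf]) (by rw [← hg, nf_get]) (by simp [hi]), get_nil,
      ← hv, nf_nf]

/-- The navigated window. -/
theorem navigable (hG : GWF E G) (hs : BInv E G s) (hν : G.v (.nu 9) = some .pub) {w : Ptr}
    (hw : WinAt s w) {window nr : Term} {x : Ptr × Term}
    (hx : x ∈ getNavigableWindow w window nr s) : BInv E G x.2 ∧ WinAt x.2 x.1 := by
  have hd := hG.dy
  unfold getNavigableWindow at hx
  split_ifs at hx with h1 h2 h3
  · rw [mem_singleton_iff] at hx
    subst hx
    have := hs.append_window (known_nu hν) (op := get s (w ++ [1]))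
      (by rw [nf_get]; exact (hs.window_known hw).safe)
    exact ⟨this.1, this.2.1⟩
  · rw [mem_singleton_iff] at hx
    subst hx
    have := hs.append_window (known_nu hν) (op := .bot) hd.bot
    exact ⟨this.1, this.2.1⟩
  · refine ⟨hx.2.2 ▸ hs, ?_⟩
    have : Subwindows s x.1 := by
      cases hx.1 <;> assumption
    rw [hx.2.2]
    exact this.winAt
  · rw [mem_singleton_iff] at hx
    subst hx
    exact ⟨hs, hw⟩

end BInv

/-! # Window trees as visible to scripts -/

/-- Windows (`true`) and (limited) documents (`false`) visible to documents of the origin `o`. -/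
inductive CT (E : Env) (G : Ghost) (o : Term) : Bool → Term → Prop
  | win {n docs op} : G.Known n → Safe E G op → (∀ d ∈ docs, CT E G o false d) →
      CT E G o true (.seq [n, .seq docs, op])
  | full {n L rf sc st ins subs act} : G.role n = some (.doc L) → L.origin = o →
      DocOK E G L rf sc st ins → (∀ w ∈ subs, CT E G o true w) → act = .top ∨ act = .bot →
      CT E G o false (.seq [n, L.term, rf, sc, st, .seq ins, .seq subs, act])
  | lim {n L subs} : G.role n = some (.doc L) → L.origin ≠ o → (∀ w ∈ subs, CT E G o true w) →
      CT E G o false (.seq [n, .seq subs])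

theorem Loc.get_term (L : Loc) : get L.term [2] = L.proto ∧ get L.term [3] = .str L.host ∧
    get L.term [4] = L.path.nf ∧ get L.term [5] = L.par.nf := by
  refine ⟨?_, ?_, ?_, ?_⟩ <;> rw [Loc.term, urlTerm, get_seq (nf_seq _)] <;>
    simp [get_nil, L.nf_proto, Term.nf]

theorem Loc.docOrigin_eq {L : Loc} {d : Term} (h : get d [2] = L.term.nf) :
    docOrigin d = L.origin := by
  have h2 : ∀ k, get d [2, k] = get L.term [k] := fun k => by
    rw [show get d [2, k] = get (get d [2]) [k] from get_append d [2] [k], h, get_nf]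
  rw [docOrigin, h2, h2, L.get_term.1, L.get_term.2.1, Loc.origin]

theorem Loc.cn_origin (L : Loc) : CN L.origin := by
  have h1 : CN L.proto := ⟨L.nf_proto, by unfold Loc.proto; split_ifs <;> simp⟩
  rw [Loc.origin, cn_seq]
  exact All.mem ⟨⟨rfl, by simp⟩, h1⟩

theorem Loc.eq_of_origin {L L' : Loc} (h : L.origin = L'.origin) :
    L.host = L'.host ∧ L.https = L'.https := by
  simp only [Loc.origin, Term.seq.injEq, List.cons.injEq, Term.str.injEq, and_true] at h
  refine ⟨h.1, ?_⟩
  have := h.2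
  unfold Loc.proto at this
  cases h1 : L.https <;> cases h2 : L'.https <;> simp_all

theorem Loc.cls_of_origin {L L' : Loc} (h : L.origin = L'.origin) : L.cls E = L'.cls E := by
  obtain ⟨h1, h2⟩ := Loc.eq_of_origin h
  unfold Loc.cls
  rw [h1, h2]

theorem safe_proto (L : Loc) : Safe E G L.proto := by
  unfold Loc.proto; split_ifs <;> exact .str _

theorem GWF.loc_safe (hG : GWF E G) {n : Term} {L : Loc} (h : G.role n = some (.doc L))
    (hc : L.cls E ≠ .fwd) : Safe E G L.path ∧ Safe E G L.par ∧ Safe E G L.term := by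
  have h1 := (hG.ok _ _ h).1 hc
  exact ⟨h1.1, h1.2, hG.dy.urlTerm (safe_proto _) (hG.dy.str _) h1.1 h1.2⟩

theorem GWF.origin_safe (hG : GWF E G) (L : Loc) : Safe E G L.origin :=
  hG.dy.pair (hG.dy.str _) (safe_proto _)

theorem clean_ct (L₀ : Loc) :
    (∀ l : List Term, (∀ t ∈ l, TreeOK E G true t) → ∀ t ∈ cleanWindows L₀.origin l,
      CT E G L₀.origin true t) ∧
    (∀ l : List Term, (∀ t ∈ l, TreeOK E G false t) → ∀ t ∈ cleanDocs L₀.origin l,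
      CT E G L₀.origin false t) := by
  refine cleanWindows.mutual_induct L₀.origin
    (motive1 := fun l => (∀ t ∈ l, TreeOK E G true t) →
      ∀ t ∈ cleanWindows L₀.origin l, CT E G L₀.origin true t)
    (motive2 := fun l => (∀ t ∈ l, TreeOK E G false t) →
      ∀ t ∈ cleanDocs L₀.origin l, CT E G L₀.origin false t) ?_ ?_ ?_ ?_ ?_ ?_ ?_
  · intro _; simp [cleanWindows]
  · intro n docs op ws h1 h2 hl
    simp only [forall_mem_cons] at hl
    rw [cleanWindows]
    simp only [forall_mem_cons]
    obtain ⟨n', docs', op', he, hn, hop, hd, _⟩ := hl.1.win_inv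
    simp only [Term.seq.injEq, List.cons.injEq, and_true] at he
    obtain ⟨rfl, rfl, rfl⟩ := he
    exact ⟨.win hn hop (h1 hd), h2 hl.2⟩
  · intro w ws hn h2 hl
    simp only [forall_mem_cons] at hl
    obtain ⟨n', docs', op', he, -⟩ := hl.1.win_inv
    exact (hn _ _ _ he).elim
  · intro _; simp [cleanDocs]
  · intro n loc ref script state inputs subs active ds ha h1 h2 hl
    simp only [forall_mem_cons] at hl
    rw [cleanDocs]
    obtain ⟨n', L, rf, sc, st, ins, subs', act, he, hn, hd, hw, hact⟩ := hl.1.doc_inv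
    simp only [Term.seq.injEq, List.cons.injEq, and_true] at he
    obtain ⟨rfl, rfl, rfl, rfl, rfl, rfl, rfl, rfl⟩ := he
    simp only [ha, if_true, forall_mem_cons]
    refine ⟨?_, h2 hl.2⟩
    have ho := Loc.docOrigin_eq (L := L) (d := .seq [n, L.term, ref, script, state, .seq ins,
      .seq (cleanWindows L₀.origin subs), active]) (by rw [get_seq (nf_seq _)]; simp [get_nil])
    rw [ho, equiv_iff_nf, L.cn_origin.1, L₀.cn_origin.1]
    split_ifs with hoo
    · exact .full hn hoo hd (h1 hw) hact
    · exact .lim hn hoo (h1 hw)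
  · intro n loc ref script state inputs subs active ds ha h1 h2 hl
    simp only [forall_mem_cons] at hl
    rw [cleanDocs]
    simp only [ha, if_false]
    exact h2 hl.2
  · intro d ds hn h2 hl
    simp only [forall_mem_cons] at hl
    obtain ⟨n', L, rf, sc, st, ins, subs', act, he, -⟩ := hl.1.doc_inv
    exact (hn _ _ _ _ _ _ _ _ he).elim

theorem Tr.map_nf {P : Term → Prop} {l : List Term} (h : ∀ t ∈ l, P t.nf) :
    ∀ t ∈ l.map Term.nf, P t := by simpa using h

theorem CT.nf (hG : GWF E G) {o : Term} {b : Bool} {t : Term} (h : CT E G o b t) :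
    CT E G o b t.nf := by
  induction h with
  | win h1 h2 _ ih =>
    simp only [nf_seq, map_cons, map_nil]
    exact .win h1.nf_known (hG.dy.nf_iff.2 h2) (Tr.map_nf ih)
  | full h1 h2 h3 _ h5 ih =>
    simp only [nf_seq, map_cons, map_nil, Ghost.Named.nf (G := G) ⟨_, h1⟩,
      (Loc.cn_term (hG.closed _ _ h1)).1]
    have := hG.tr_self.docOK h3
    simp only [ren_var, show ren .var = Term.nf from funext ren_var] at this
    exact .full h1 h2 this (Tr.map_nf ih) (by rcases h5 with rfl | rfl <;> simp [Term.nf])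
  | lim h1 h2 _ ih =>
    simp only [nf_seq, map_cons, map_nil, Ghost.Named.nf (G := G) ⟨_, h1⟩]
    exact .lim h1 h2 (Tr.map_nf ih)

theorem CT.safe (hG : GWF E G) {L₀ : Loc} (hL : L₀.cls E = .other) {b : Bool} {t : Term}
    (h : CT E G L₀.origin b t) : Safe E G t := by
  have hd := hG.dy
  induction h with
  | win h1 h2 _ ih => exact hd.seq (by simp [h1.safe, h2, hd.seq ih])
  | @full n L rf sc st ins subs act h1 h2 h3 _ h5 ih =>
    have hc : L.cls E = .other := (Loc.cls_of_origin h2).trans hL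
    have hn : Safe E G n := (Ghost.known_of_role h1 trivial).safe
    have ha : Safe E G act := by rcases h5 with rfl | rfl; exacts [hd.top, hd.bot]
    have hl := (hG.loc_safe h1 (by simp [hc])).2.2
    cases h3 with
    | other _ h1 h2 h3 h4 => exact hd.seq (by simp [hn, hl, h1, h2, h3, hd.seq h4, hd.seq ih, ha])
    | _ => simp_all
  | lim h1 _ _ ih =>
    exact hd.pair (Ghost.known_of_role h1 trivial).safe (hd.seq ih)

theorem CT.win_inv {o t : Term} (h : CT E G o true t) : ∃ n docs op,
    t = .seq [n, .seq docs, op] ∧ ∀ d ∈ docs, CT E G o false d := by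
  cases h with
  | win _ _ h => exact ⟨_, _, _, rfl, h⟩

theorem CT.subwindows {o t : Term} (h : CT E G o false t) (hn : t.nf = t) :
    ∀ w ∈ items (docSubwindows t), CT E G o true w := by
  cases h with
  | full _ _ _ h =>
    have := items_of_nf hn
    rw [docSubwindows, this, if_neg (by simp), (get_doc hn).2.2.2.2.2.2.1,
      items_of_nf (nf_of_mem hn (by simp))]
    exact h
  | lim _ _ h =>
    have := items_of_nf hn
    rw [docSubwindows, this, if_pos (by simp), get_pair_two, items_nf,
      items_of_nf (nf_of_mem hn (by simp))]
    exact h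

theorem treeWindow_ct {o tree w : Term} (h : ∀ w ∈ items tree, CT E G o true w)
    (hw : TreeWindow tree w) : CT E G o true w ∧ w.nf = w := by
  induction hw with
  | top hw => exact ⟨h _ hw, nf_of_mem_items hw⟩
  | sub _ hd hw ih =>
    refine ⟨?_, nf_of_mem_items hw⟩
    obtain ⟨n, docs, op, he, hds⟩ := ih.1.win_inv
    rw [items_win (ih.2.trans he)] at hd
    have h2 := nf_of_mem (ih.2.trans he) (u := .seq docs) (by simp)
    exact (hds _ hd).subwindows (nf_of_mem h2 hd) _ hw

theorem treeDoc_ct {o tree n w d : Term} (h : ∀ w ∈ items tree, CT E G o true w)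
    (hw : TreeDoc tree n w d) : CT E G o false d ∧ d.nf = d ∧ get d [1] = n.nf := by
  obtain ⟨h1, h2, h3⟩ := hw
  obtain ⟨hc, hn⟩ := treeWindow_ct h h1
  obtain ⟨n', docs, op, he, hds⟩ := hc.win_inv
  rw [items_win (hn.trans he)] at h2
  have h4 := nf_of_mem (hn.trans he) (u := .seq docs) (by simp)
  refine ⟨hds _ h2, nf_of_mem h4 h2, ?_⟩
  rw [← Equiv.nf_eq h3, nf_get]

theorem treeDoc_loc {L : Loc} {tree n w d : Term}
    (h : ∀ w ∈ items tree, CT E G L.origin true w) (hn : G.role n = some (.doc L))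
    (hw : TreeDoc tree n w d) : get d [2] = L.term.nf := by
  obtain ⟨h1, h2, h3⟩ := treeDoc_ct h hw
  rw [Ghost.Named.nf (G := G) ⟨_, hn⟩] at h3
  cases h1 with
  | @full n' L' _ _ _ _ _ _ h4 h5 =>
    rw [(get_doc h2).1] at h3
    subst h3
    rw [hn] at h4
    cases h4
    rw [get_seq (nf_seq _)]
    simp [get_nil]
  | lim h4 h5 =>
    have : get _ [1] = _ := (get_seq (i := 0) h2 [])
    rw [this] at h3
    simp only [List.getD_cons_zero, get_nil, Ghost.Named.nf (G := G) ⟨_, h4⟩] at h3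
    subst h3
    rw [hn] at h4
    cases h4
    exact (h5 rfl).elim

theorem scrGetOrigin_cases {L : Loc} {tree n o : Term}
    (h : ∀ w ∈ items tree, CT E G L.origin true w) (hn : G.role n = some (.doc L))
    (ho : o ∈ scrGetOrigin tree n) : o = L.origin ∨ o = .undef := by
  rcases ho with ⟨w, d, hd, rfl⟩ | ⟨_, rfl⟩
  · exact .inl (Loc.docOrigin_eq (treeDoc_loc h hn hd))
  · exact .inr rfl

theorem scrGetParameters_cases {L : Loc} {tree n o : Term}
    (h : ∀ w ∈ items tree, CT E G L.origin true w) (hn : G.role n = some (.doc L))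
    (ho : o ∈ scrGetParameters tree n) : o = L.par.nf ∨ o = .undef := by
  rcases ho with ⟨w, d, hd, rfl⟩ | ⟨_, rfl⟩
  · left
    rw [show get d [2, 5] = get (get d [2]) [5] from get_append d [2] [5], treeDoc_loc h hn hd,
      get_nf, L.get_term.2.2.2]
  · exact .inr rfl

/-! # Outputs of scripts -/

theorem dy_not_varIn {ι} (f : ι → Var) : DY fun t => ∀ i, ¬ VarIn (f i) t.nf where
  congr he ht v := he ▸ ht v
  addr _ _ := id
  str _ _ := id
  top _ := id
  bot _ := id
  undef _ := id
  pub h := h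
  enca h1 h2 v := not_or.2 ⟨h1 v, h2 v⟩
  encs h1 h2 v := not_or.2 ⟨h1 v, h2 v⟩
  sig h1 h2 v := not_or.2 ⟨h1 v, h2 v⟩
  deca h1 h2 v hv := (varIn_redDeca hv).elim (h1 v) (h2 v)
  decs h1 h2 v hv := (varIn_redDecs hv).elim (h1 v) (h2 v)
  checksig h1 h2 h3 v hv := (varIn_redChecksig hv).elim (h1 v) (Or.rec (h2 v) (h3 v))
  seq h v := by rw [nf_seq]; simpa using fun t ht => h t ht v
  proj i h v hv := h v (varIn_redProj hv)

theorem Closed.dy : DY Closed := dy_not_varIn id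

/-- The commands of scripts in documents with location `L`. -/
inductive CmdOK (E : Env) (G : Ghost) (L : Loc) : Term → Prop
  | other {c} : L.cls E = .other → Safe E G c → CmdOK E G L c
  | nil : CmdOK E G L (.seq [])
  | href {u w nr} : L.cls E ≠ .fwd → Safe E G u → CmdOK E G L (.seq [K .href, u, w, nr])
  | iframe {h par w} : L.cls E ≠ .fwd → (Safe E G h ∧ Safe E G par) ∨ h = .seq [] ∨
        (∃ f, h = .str f ∧ E.cls f = .fwd ∧ FwdOK E G par) →
      CmdOK E G L (.seq [K .iframe, urlTerm (K .https) h (K .pRoot) par, w])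
  | post {tgt m t} : Safe E G m ∨ t ≠ .bot ∧ (∀ L' : Loc, t = L'.origin → L'.cls E = .rp) →
      CmdOK E G L (.seq [K .postMessage, tgt, m, t])
  | rpStart {o a c x} : L.cls E = .rp → E.own a c →
      CmdOK E G L (.seq [K .xhr, urlTerm (K .https) o (K .pStartLogin) (.seq []), K .post,
        .seq [.str a, .str c], x])
  | rpLogin {o y t x} : L.cls E = .rp → LstOK E G t →
      CmdOK E G L (.seq [K .xhr, urlTerm (K .https) o (K .pLogin) (.seq []), K .post,
        .seq [.seq [K .eia, y], .seq [K .loginSessionToken, t]], x])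
  | idpSign {o em pw T F x} : L.cls E = .idp → Safe E G em → Safe E G T → Safe E G F →
      (F = .seq [] ∨ T = dictGet L.par (K .tag) ∧ F = dictGet L.par (K .fwdDomain)) →
      CmdOK E G L (.seq [K .xhr, urlTerm (K .https) o (K .pSign) (.seq []), K .post,
        .seq [.seq [K .email, em], .seq [K .password, pw], .seq [K .tag, T],
        .seq [K .fwdDomain, F]], x])

theorem LstOK.safe (hG : GWF E G) {t : Term} (h : LstOK E G t) : Safe E G t := by
  rcases h with ⟨a, c, h, _⟩ | ⟨x, rfl⟩ | rfl | rfl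
  · exact (Ghost.known_of_role h trivial).safe
  · exact .str x
  · exact .bot
  · exact hG.dy.seq (by simp)

theorem chooseInput_cases (z : Term) (p : Term → Prop) :
    chooseInput z p ≈ₜ .bot ∨ chooseInput z p ∈ items z ∧ p (chooseInput z p) := by
  unfold chooseInput
  cases h : (items z).find? fun t => decide (p t) with
  | none => exact .inl (.refl _)
  | some u => exact .inr ⟨List.mem_of_find?_eq_some h, by simpa using List.find?_some h⟩

theorem nf_of_mem' {t : Term} {ts : List Term} (h : t.nf = .seq ts) : ∀ u ∈ ts, u.nf = u :=
  fun _ => nf_of_mem h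

theorem RpBody.get (hG : GWF E G) {bd : Term} (h : RpBody E G bd) :
    LstOK E G (dictGet bd (K .loginSessionToken)) ∧ Safe E G (dictGet bd (K .tagKey)) := by
  have h' := hG.tr_self.rpBody h
  rw [ren_var] at h'
  have e : ∀ k, dictGet bd k = dictGet bd.nf k := fun k => dictGet_congr (nf_nf _).symm rfl
  rw [e, e]
  have hn : bd.nf.nf = bd.nf := nf_nf _
  revert hn h'
  generalize bd.nf = bd
  rintro (⟨tk, l, f, rfl, h1, h2⟩ | ⟨n, a, c, rfl, hn⟩) hnf
  · have h3 := nf_of_mem' hnf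
    simp only [forall_mem_cons] at h3
    have h4 := nf_of_mem' h3.1
    have h5 := nf_of_mem' h3.2.1
    simp only [forall_mem_cons] at h4 h5
    simp [dictGet_cons, hasKey_pair, Term.nf, get_pair_two, h4, h5, h1, h2]
  · have hk : ∀ k, ¬ HasKey (K k) n := by
      intro k hk
      rw [hasKey_iff, hn.nf] at hk
      obtain ⟨v, hv⟩ := hk
      rcases hn.cases with ⟨m, rfl⟩ | ⟨m, rfl⟩ <;> simp at hv
    simp only [dictGet_cons, hk, if_false, hasKey_pair, get_pair_two, dictGet_nil]
    refine ⟨?_, ?_⟩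
    · split_ifs
      · exact .inr (.inl ⟨c, rfl⟩)
      · exact .inr (.inr (.inr rfl))
    · split_ifs
      · exact .str _
      · exact hG.dy.seq (by simp)

/-- The input of the script of a document with location `L`, nonce `n`, script state `st` and
script inputs `ins`. -/
structure ScrIn (E : Env) (G : Ghost) (L : Loc) (n st : Term) (ins : List Term) (i : Term) :
    Prop where
  tree : ∀ w ∈ items (get i [1]), CT E G L.origin true w
  nonce : get i [2] = n
  role : G.role n = some (.doc L)
  state : get i [3] = st
  inputs : items (get i [4]) = ins
  cookies : Safe E G (get i [5])
  localSt : Safe E G (get i [6])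
  sessionSt : Safe E G (get i [7])
  ids : get i [8] = E.ids
  secret : L.cls E = .other → Safe E G (get i [9])
  closed : Closed i

theorem nf_setAt_seq {t v : Term} {ts : List Term} (h : t.nf = .seq ts) (k : ℕ) :
    (setAt t [k + 1] v).nf = .seq (ts.modify k fun _ => v.nf) := by
  rw [nf_setAt_cons h]
  simp only [setAt_nil]

theorem IsScript.eq {k : Kw} {R : Term → Set Term} (h : IsScript (K k) R) :
    (k = .scriptRp → R = scriptRp) ∧ (k = .scriptRpRedir → R = scriptRpRedir) ∧
    (k = .scriptIdp → R = scriptIdp) ∧ (k = .scriptFwd → R = scriptFwd) := by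
  cases h <;> simp

variable {L : Loc} {n st : Term} {ins : List Term} {i : Term}

/-- Output of a script that preserves the invariant of its document. -/
def ScrOut (E : Env) (G : Ghost) (L : Loc) (rf sc : Term) (ins : List Term) (o : Term) : Prop :=
  ∀ st' ck ls ss cmd, o = .seq [st', ck, ls, ss, cmd] →
    Safe E G ck ∧ Safe E G ls ∧ Safe E G ss ∧ DocOK E G L rf sc st' ins ∧ CmdOK E G L cmd

namespace ScrIn
variable (hi : ScrIn E G L n st ins i)
include hi

omit hi in
theorem ren_closed {t : Term} (h : Closed t) : ren lamToNu t = t.nf := h.ren_eq _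

theorem out {rf sc s' cmd : Term} (h1 : DocOK E G L rf sc (ren lamToNu s') ins)
    (h2 : CmdOK E G L (ren lamToNu cmd)) :
    ScrOut E G L rf sc ins (ren lamToNu (scriptOut i s' cmd)) := by
  intro st' ck ls ss cmd' he
  have hg : ∀ p, ren lamToNu (get i p) = get i p := fun p => by
    rw [(Closed.dy.get hi.closed p).ren_eq, nf_get]
  simp only [scriptOut, ren_seq, map_cons, map_nil, hg, Term.seq.injEq,
    List.cons.injEq, and_true] at he
  obtain ⟨rfl, rfl, rfl, rfl, rfl⟩ := he
  exact ⟨hi.cookies, hi.localSt, hi.sessionSt, h1, h2⟩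

theorem origin_closed {o : Term} (ho : o ∈ scrGetOrigin (get i [1]) (get i [2])) : Closed o :=
  Closed.dy.scrGetOrigin (Closed.dy.get hi.closed _) ho

theorem params_closed {o : Term} (ho : o ∈ scrGetParameters (get i [1]) (get i [2])) : Closed o :=
  Closed.dy.scrGetParameters (Closed.dy.get hi.closed _) ho

theorem scriptOther (hG : GWF E G) (hν : ∀ k, G.v (.nu k) = some .pub)
    (hL : L.cls E = .other) {rf sc : Term} {R : Term → Set Term}
    (hR : IsScript sc R) (hrf : Safe E G rf)
    (hins : ∀ x ∈ ins, Safe E G x) (hsi : Safe E G i) {o : Term} (ho : o ∈ R i) :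
    ScrOut E G L rf sc ins (ren lamToNu o) := by
  have hd := hG.dy
  have hs : Safe E G (o.subst lamToNu) := by
    refine (hd.subst (σ := lamToNu)).script (fun k => (known_nu (hν _)).safe) hR (i := i) ?_ ho
    rw [← hd.nf_iff] at hsi ⊢
    have := ren_closed hi.closed
    unfold ren at this
    rwa [this]
  intro st' ck ls ss cmd he
  have h2 := hd.nf_iff.2 hs
  rw [show (o.subst lamToNu).nf = _ from he, hd.seq_iff] at h2
  simp only [forall_mem_cons] at h2
  have hsc : Safe E G sc := by cases hR <;> exact .str _
  exact ⟨h2.2.1, h2.2.2.1, h2.2.2.2.1, .other hL hrf hsc h2.1 hins, .other hL h2.2.2.2.2.1⟩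

theorem scriptRp (hG : GWF E G) (hE : EnvOK E) (hL : L.cls E = .rp) {rf q t x tk f em : Term}
    (hst : st = .seq [q, t, x, tk, f, em]) (ht : LstOK E G t) (htk : Safe E G tk)
    (hins : ∀ x ∈ ins, RpInput E G x) {o : Term} (ho : o ∈ Spresso.scriptRp i) :
    ScrOut E G L rf (K .scriptRp) ins (ren lamToNu o) := by
  have hc := Closed.dy
  obtain ⟨origin, horigin, ho⟩ := ho
  have hor := hi.origin_closed horigin
  have hs : get i [3] = .seq [q, t, x, tk, f, em] := by rw [hi.state, hst]
  have hsn : (get i [3]).nf = .seq [q, t, x, tk, f, em] := by rw [nf_get, hs]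
  have hnf := nf_of_mem' hsn
  simp only [forall_mem_cons] at hnf
  have hcl : ∀ u ∈ [q, t, x, tk, f, em], Closed u := fun u hu =>
    hc.of_seq (hs ▸ hc.get hi.closed [3]) hu
  simp only [forall_mem_cons] at hcl
  have hr : ∀ {u : Term}, Closed u → u.nf = u → ren lamToNu u = u := fun h1 h2 => by
    rw [h1.ren_eq, h2]
  have r1 := hr hcl.1 hnf.1
  have r2 := hr hcl.2.1 hnf.2.1
  have r4 := hr hcl.2.2.2.1 hnf.2.2.2.1
  have r5 := hr hcl.2.2.2.2.1 hnf.2.2.2.2.1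
  have r6 := hr hcl.2.2.2.2.2.1 hnf.2.2.2.2.2.1
  have g2 : get (get i [3]) [2] = t := by rw [get_seq hsn]; simp [get_nil, hnf]
  have g4 : get (get i [3]) [4] = tk := by rw [get_seq hsn]; simp [get_nil, hnf]
  have same : DocOK E G L rf (K .scriptRp) (ren lamToNu (get i [3])) ins := by
    rw [(hc.get hi.closed _).ren_eq, nf_get, hs]
    exact .rp hL rfl rfl ht htk hins
  -- states after an update
  have upd : ∀ {u : Term} {q' t' x' tk' f' em' : Term}, u.nf = .seq [q', t', x', tk', f', em'] →
      LstOK E G (ren lamToNu t') → Safe E G (ren lamToNu tk') →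
      DocOK E G L rf (K .scriptRp) (ren lamToNu u) ins := by
    intro u q' t' x' tk' f' em' hu h1 h2
    rw [← ren_nf, hu]
    simp only [ren_seq, map_cons, map_nil]
    exact .rp hL rfl rfl h1 h2 hins
  dsimp only at ho
  split_ifs at ho with h1 h2 h3 h4 h5
  · obtain ⟨email, hem, rfl⟩ := ho
    rw [hi.ids] at hem
    obtain ⟨a, c, rfl, hac⟩ := hE.ids_own _ hem
    refine hi.out (upd (nf_setAt_seq (nf_setAt_seq (nf_setAt_seq hsn 5) 2) 0) ?_ ?_) ?_
    · rwa [r2]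
    · rwa [r4]
    · simpa [urlTerm] using CmdOK.rpStart hL hac
  · subst ho
    exact hi.out same (by simpa using .nil)
  · subst ho
    obtain ⟨hin, y, hy⟩ := (chooseInput_cases (get i [4])
      fun t => ∃ y, t ≈ₜ .seq [K .xhr, y, get (get i [3]) [3]]).resolve_left h3
    revert hin hy
    generalize chooseInput (get i [4]) _ = input
    intro hin hy
    have hinn := nf_of_mem_items hin
    have hinc : Closed input := hc.items (hc.get hi.closed [4]) hin
    rw [hi.inputs] at hin
    obtain ⟨h8, h9⟩ : LstOK E G (dictGet (get input [2]) (K .loginSessionToken)) ∧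
        Safe E G (dictGet (get input [2]) (K .tagKey)) := by
      rcases hins _ hin with ⟨a, b, c, rfl⟩ | ⟨bd, z, rfl, hb⟩
      · rw [equiv_iff_nf, nf_seq, nf_seq] at hy
        simp [Term.nf] at hy
      · have : get (.seq [K .xhr, bd, z]) [2] = bd.nf := by rw [get_seq (nf_seq _)]; simp [get_nil]
        rw [this]
        have e : ∀ k, dictGet bd.nf k = dictGet bd k := fun k => dictGet_congr (nf_nf _) rfl
        rw [e, e]
        exact hb.get hG
    have hcd : ∀ k, ren lamToNu (dictGet (get input [2]) k) = dictGet (get input [2]) k :=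
      fun k => by rw [(hc.dictGet (hc.get hinc _) _).ren_eq, nf_dictGet]
    refine hi.out (upd (nf_setAt_seq (nf_setAt_seq (nf_setAt_seq (nf_setAt_seq hsn 1) 3) 4) 0)
      ?_ ?_) ?_
    · rwa [nf_dictGet, hcd]
    · rwa [nf_dictGet, hcd]
    · simp only [ren_seq, map_cons, map_nil, ren_str]
      refine .href (by simp [hL]) ?_
      have ho' : Safe E G (ren lamToNu (get origin [1])) := by
        rw [(hc.get hor _).ren_eq, nf_get]
        rcases scrGetOrigin_cases hi.tree (hi.nonce.symm ▸ hi.role) horigin with rfl | rfl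
        · exact hG.dy.get (hG.origin_safe L) _
        · exact hG.dy.get hG.dy.undef _
      simp only [urlTerm, ren_seq, map_cons, map_nil, ren_str, hcd]
      have h8 := h8.safe hG
      have hd := hG.dy
      simp [hd.seq_iff, hd.str, ho', h8]
  · obtain ⟨aux, haux, subs, hsubs, ho⟩ := ho
    split_ifs at ho
    · subst ho; exact hi.out same (by simpa using .nil)
    · subst ho
      refine hi.out (upd (nf_setAt_seq hsn 0) (by rwa [r2]) (by rwa [r4])) ?_
      simp only [ren_seq, map_cons, map_nil, ren_str, g4, r4]
      exact .post (.inl (hG.dy.pair (hG.dy.str _) htk))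
  · obtain ⟨aux, haux, subs, hsubs, ho⟩ := ho
    split_ifs at ho
    · subst ho; exact hi.out same (by simpa using .nil)
    · subst ho
      refine hi.out (upd (nf_setAt_seq (nf_setAt_seq hsn 2) 0) (by rwa [r2]) (by rwa [r4])) ?_
      simp only [ren_seq, map_cons, map_nil, ren_str, g2, r2, urlTerm]
      exact .rpLogin hL ht
  · subst ho; exact hi.out same (by simpa using .nil)

theorem scriptRpRedir (hL : L.cls E = .rp) {rf : Term} (hst : Safe E G st)
    (hins : ∀ x ∈ ins, RpInput E G x) {o : Term} (ho : o ∈ Spresso.scriptRpRedir i) :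
    ScrOut E G L rf (K .scriptRpRedir) ins (ren lamToNu o) := by
  rw [Spresso.scriptRpRedir, mem_singleton_iff] at ho
  subst ho
  have hg : ren lamToNu (get i [3]) = st := by
    rw [(Closed.dy.get hi.closed _).ren_eq, nf_get, hi.state]
  refine hi.out ?_ ?_
  · rw [hg]; exact .rpRedir hL rfl hst hins
  · simp only [ren_seq, map_cons, map_nil, ren_str, hg]
    exact .href (by simp [hL]) hst

theorem scriptIdp (hG : GWF E G) (hL : L.cls E = .idp) {rf : Term}
    (hins : ∀ x ∈ ins, IdpInput E G L x) {o : Term} (ho : o ∈ Spresso.scriptIdp i) :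
    ScrOut E G L rf (K .scriptIdp) ins (ren lamToNu o) := by
  have hc := Closed.dy
  have hd := hG.dy
  obtain ⟨origin, horigin, params, hparams, ho⟩ := ho
  have hpc := hi.params_closed hparams
  have hpar := (hG.loc_safe hi.role (by simp [hL])).2.1
  have hpr : ∀ k, ren lamToNu (dictGet params k) = dictGet params k := fun k => by
    rw [(hc.dictGet hpc _).ren_eq, nf_dictGet]
  have doc : ∀ st', DocOK E G L rf (K .scriptIdp) st' ins := fun st' => .idp hL rfl hins
  have hp : (∀ k, dictGet params k = dictGet L.par k) ∨ ∀ k, dictGet params k = .seq [] := by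
    rcases scrGetParameters_cases hi.tree (hi.nonce.symm ▸ hi.role) hparams with rfl | rfl
    · exact .inl fun k => dictGet_congr (nf_nf _) rfl
    · right
      intro k
      simp [dictGet, items, Term.nf]
  have hps : ∀ k, Safe E G (dictGet params k) := by
    intro k
    rcases hp with hp | hp
    · rw [hp]; exact hd.dictGet hpar _
    · rw [hp]; exact hd.seq (by simp)
  dsimp only at ho
  split_ifs at ho with h1 h2 h3
  · subst ho
    refine hi.out (doc _) ?_
    simp only [ren_seq, map_cons, map_nil, ren_str, hpr, urlTerm, ren_bot]
    refine .idpSign hL (hps _) (hps _) (hps _) ?_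
    rcases hp with hp | hp
    · exact .inr ⟨hp _, hp _⟩
    · exact .inl (hp _)
  · subst ho
    exact hi.out (doc _) (by simpa using .nil)
  · subst ho
    obtain ⟨hin, x, y, hy⟩ := (chooseInput_cases (get i [4])
      fun t => ∃ x y, t ≈ₜ .seq [K .xhr, x, y]).resolve_left h3
    revert hin hy
    generalize chooseInput (get i [4]) _ = input
    intro hin hy
    have hinc : Closed input := hc.items (hc.get hi.closed [4]) hin
    rw [hi.inputs] at hin
    refine hi.out (doc _) ?_
    simp only [ren_seq, map_cons, map_nil, ren_str, hpr, urlTerm, ren_encs,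
      (hc.get hinc [2]).ren_eq, nf_get]
    refine .iframe (by simp [hL]) ?_
    rcases hp with hp | hp
    · rcases hins _ hin with ⟨a, b, c, rfl⟩ | ⟨bd, z, rfl, hb⟩
      · rw [equiv_iff_nf, nf_seq, nf_seq] at hy
        simp [Term.nf] at hy
      have : get (.seq [K .xhr, bd, z]) [2] = bd.nf := by rw [get_seq (nf_seq _)]; simp [get_nil]
      rw [this]
      rcases hb with hb | ⟨f, d, u, κ, hf, hfc, ht, htc⟩
      · left
        refine ⟨hps _, ?_⟩
        have := hd.nf_iff.2 hb
        simp [hd.seq_iff, hd.str, hps, hd.encs, this]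
      · right; right
        refine ⟨f, (hp _).trans hf, hfc, .inr ⟨d, u, κ, .encs bd.nf (dictGet params (K .iaKey)), ?_,
          htc⟩⟩
        rw [hp (K .tag), ht]
    · exact .inr (.inl (hp _))
  · subst ho
    exact hi.out (doc _) (by simpa using .nil)

theorem scriptFwd (hG : GWF E G) (hL : L.cls E = .fwd) {rf : Term}
    {o : Term} (ho : o ∈ Spresso.scriptFwd i) :
    ScrOut E G L rf (K .scriptFwd) ins (ren lamToNu o) := by
  have hc := Closed.dy
  have hd := hG.dy
  obtain ⟨parent, hparent, target, htarget, params, hparams, ho⟩ := ho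
  have hpc := hi.params_closed hparams
  have hpr : ∀ k, ren lamToNu (dictGet params k) = dictGet params k := fun k => by
    rw [(hc.dictGet hpc _).ren_eq, nf_dictGet]
  have doc : ∀ st', DocOK E G L rf (K .scriptFwd) st' ins := fun st' => .fwd hL rfl
  have hps : Safe E G (dictGet params (K .eia)) ∨
      ∃ d u κ, dictGet params (K .tag) = .encs (.seq [.str d, u]) κ ∧ E.cls d = .rp := by
    rcases scrGetParameters_cases hi.tree (hi.nonce.symm ▸ hi.role) hparams with rfl | rfl
    · have hk : ∀ k, dictGet L.par.nf k = dictGet L.par k := fun k => dictGet_congr (nf_nf _) rfl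
      rw [hk, hk]
      rcases (hG.ok _ _ hi.role).2 hL with h | ⟨d, u, κ, x, h, hdc⟩
      · exact .inl (hd.dictGet h _)
      · right
        have hcl := (hG.closed _ _ hi.role).2.1
        rw [h] at hcl ⊢
        have h3 := nf_of_mem' hcl
        simp only [forall_mem_cons] at h3
        have h4 := nf_of_mem' h3.1
        simp only [forall_mem_cons] at h4
        refine ⟨d, u, κ, ?_, hdc⟩
        simp [dictGet_cons, hasKey_pair, get_pair_two, h4]
    · left
      have : dictGet .undef (K .eia) = .seq [] := by simp [dictGet, items, Term.nf]
      rw [this]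
      exact hd.seq (by simp)
  dsimp only at ho
  split_ifs at ho with h1 h2 h3
  · subst ho
    refine hi.out (doc _) ?_
    simp only [ren_seq, map_cons, map_nil, ren_str, ren_bot]
    exact .post (.inl (hd.str _))
  · subst ho
    exact hi.out (doc _) (by simpa using .nil)
  · subst ho
    obtain ⟨hin, -⟩ := (chooseInput_cases (get i [4]) _).resolve_left h3
    revert hin
    generalize chooseInput (get i [4]) _ = input
    intro hin
    have hinc : Closed input := hc.items (hc.get hi.closed [4]) hin
    refine hi.out (doc _) ?_
    have hcl : Closed (get (.decs (dictGet params (K .tag)) (get input [4, 2])) [1]) :=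
      hc.get (hc.decs (hc.dictGet hpc _) (hc.get hinc _)) _
    simp only [ren_seq, map_cons, map_nil, ren_str, hpr, hcl.ren_eq, nf_get]
    refine .post ?_
    rcases hps with hps | ⟨d, u, κ, ht, hdc⟩
    · exact .inl (hd.pair (hd.str _) hps)
    · right
      refine ⟨by simp, fun L' hL' => ?_⟩
      simp only [Loc.origin, Term.seq.injEq, List.cons.injEq, and_true] at hL'
      obtain ⟨h5, h6⟩ := hL'
      have h7 : L'.https = true := by
        unfold Loc.proto at h6
        by_contra h
        simp [h] at h6
      have h8 : (Term.seq [.str d, u]).nf = .seq [.str d, u] ∧ κ.nf = κ := by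
        have := nf_dictGet params (K .tag)
        rw [ht] at this
        simpa [Term.nf] using this
      rw [ht] at h5
      have h9 : L'.host = d := by
        rw [get_cons, get_nil, Term.nf, Term.nf, Term.nf, h8.1, h8.2] at h5
        unfold redDecs at h5
        simp only at h5
        split_ifs at h5 with hk
        · simpa [redProj, eq_comm] using h5
        · simp [redProj] at h5
      rw [Loc.cls, h7, h9, if_pos rfl, hdc]
  · subst ho
    exact hi.out (doc _) (by simpa using .nil)

theorem script (hG : GWF E G) (hE : EnvOK E) (hν : ∀ k, G.v (.nu k) = some .pub)
    {rf sc : Term} (hdoc : DocOK E G L rf sc st ins) {R : Term → Set Term} (hR : IsScript sc R)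
    (hsi : L.cls E = .other → Safe E G i) {o : Term} (ho : o ∈ R i) :
    ScrOut E G L rf sc ins (ren lamToNu o) := by
  cases hdoc with
  | other h1 h2 h3 h4 h5 => exact hi.scriptOther hG hν h1 hR h2 h5 (hsi h1) ho
  | rp h1 h2 h3 h4 h5 h6 =>
    subst h2
    rw [hR.eq.1 rfl] at ho
    exact hi.scriptRp hG hE h1 h3 h4 h5 h6 ho
  | rpRedir h1 h2 h3 h4 =>
    subst h2
    rw [hR.eq.2.1 rfl] at ho
    exact hi.scriptRpRedir h1 h3 h4 ho
  | rpDead h1 h2 =>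
    rcases h2.cases with ⟨m, rfl⟩ | ⟨m, rfl⟩ <;> cases hR
  | idp h1 h2 h3 =>
    subst h2
    rw [hR.eq.2.2.1 rfl] at ho
    exact hi.scriptIdp hG h1 h3 ho
  | fwd h1 h2 =>
    subst h2
    rw [hR.eq.2.2.2 rfl] at ho
    exact hi.scriptFwd hG h1 ho

end ScrIn

/-! # Commands of scripts -/

theorem kw_equiv {a b : Kw} : K a ≈ₜ K b ↔ a = b := by
  rw [equiv_iff_nf]; simp [Term.nf]

theorem get_url (p h pa par : Term) : get (urlTerm p h pa par) [2] = p.nf ∧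
    get (urlTerm p h pa par) [3] = h.nf ∧ get (urlTerm p h pa par) [4] = pa.nf ∧
    get (urlTerm p h pa par) [5] = par.nf := by
  refine ⟨?_, ?_, ?_, ?_⟩ <;> rw [urlTerm, get_seq (nf_seq _)] <;> simp [get_nil]

theorem get_origin (L : Loc) : get L.origin [1] = .str L.host ∧ get L.origin [2] = L.proto := by
  constructor <;> rw [Loc.origin, get_seq (nf_seq _)] <;> simp [get_nil, L.nf_proto, Term.nf]

theorem DocOK.append_input {L : Loc} {rf sc st i : Term} {ins : List Term}
    (h : DocOK E G L rf sc st ins) (ho : L.cls E = .other → Safe E G i)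
    (hr : L.cls E = .rp → RpInput E G i) (hi : L.cls E = .idp → IdpInput E G L i) :
    DocOK E G L rf sc st (ins ++ [i]) := by
  have app : ∀ {P : Term → Prop}, (∀ x ∈ ins, P x) → P i → ∀ x ∈ ins ++ [i], P x := by
    intro P h1 h2 x hx
    rcases mem_append.1 hx with hx | hx
    · exact h1 x hx
    · rwa [mem_singleton.1 hx]
  cases h with
  | other h1 h2 h3 h4 h5 => exact .other h1 h2 h3 h4 (app h5 (ho h1))
  | rp h1 h2 h3 h4 h5 h6 => exact .rp h1 h2 h3 h4 h5 (app h6 (hr h1))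
  | rpRedir h1 h2 h3 h4 => exact .rpRedir h1 h2 h3 (app h4 (hr h1))
  | rpDead h1 h2 h3 => exact .rpDead h1 h2 (app h3 (hr h1))
  | idp h1 h2 h3 => exact .idp h1 h2 (app h3 (hi h1))
  | fwd h1 h2 => exact .fwd h1 h2

/-- The term `t` is a document with the given components, satisfying the invariant. -/
structure IsDoc (E : Env) (G : Ghost) (t : Term) (L : Loc) (n rf sc st : Term)
    (ins subs : List Term) (act : Term) : Prop where
  eq : t = .seq [n, L.term, rf, sc, st, .seq ins, .seq subs, act]
  nf : t.nf = t
  role : G.role n = some (.doc L)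
  doc : DocOK E G L rf sc st ins
  subs : ∀ w ∈ subs, TreeOK E G true w
  act : act = .top ∨ act = .bot

namespace IsDoc
variable {t : Term} {L : Loc} {n rf sc st : Term} {ins subs : List Term} {act : Term}
  (h : IsDoc E G t L n rf sc st ins subs act)
include h

theorem gets : get t [1] = n ∧ get t [2] = L.term ∧ get t [3] = rf ∧ get t [4] = sc ∧
    get t [5] = st ∧ get t [6] = .seq ins ∧ get t [7] = .seq subs ∧ get t [8] = act :=
  get_doc (h.nf.trans h.eq)

theorem origin : docOrigin t = L.origin := by
  apply Loc.docOrigin_eq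
  rw [h.gets.2.1]
  have := nf_get t [2]
  rw [h.gets.2.1] at this
  exact this.symm

end IsDoc

namespace BInv

theorem isDoc (hs : BInv E G s) {w : Ptr} (hp : WinAt s w) {j : ℕ}
    (hj : IsIndex j (get s (w ++ [2]))) : ∃ L n rf sc st ins subs act,
      IsDoc E G (get s (w ++ [2, j])) L n rf sc st ins subs act := by
  obtain ⟨n, L, rf, sc, st, ins, subs, act, h1, h2, h3, h4, h5⟩ := (hs.docTree hp hj).doc_inv
  exact ⟨L, n, rf, sc, st, ins, subs, act, h1, nf_get _ _, h2, h3, h4, h5⟩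

/-- Replacing a component of a document. -/
theorem set_docc (hs : BInv E G s) {w : Ptr} (hp : WinAt s w) {j : ℕ}
    (hj : IsIndex j (get s (w ++ [2]))) {L n rf sc st ins subs act}
    (hd : IsDoc E G (get s (w ++ [2, j])) L n rf sc st ins subs act) {k : ℕ} {v : Term}
    (hX : TreeOK E G false (.seq ([n, L.term, rf, sc, st, .seq ins, .seq subs, act].modify k
      fun _ => v.nf))) (hk : k ≠ 7 ∨ v.nf ≠ .top) :
    BInv E G (setAt s (w ++ [2, j] ++ [k + 1]) v) ∧
      WinAt (setAt s (w ++ [2, j] ++ [k + 1]) v) w ∧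
      IsIndex j (get (setAt s (w ++ [2, j] ++ [k + 1]) v) (w ++ [2])) ∧
      get (setAt s (w ++ [2, j] ++ [k + 1]) v) (w ++ [2, j]) =
        .seq ([n, L.term, rf, sc, st, .seq ins, .seq subs, act].modify k fun _ => v.nf) := by
  have hnf := hd.nf.trans hd.eq
  have he := nf_setAt_seq (v := v) hnf k
  rw [← he]
  refine hs.set_doc hp hj (by rwa [he]) fun ha => ?_
  rw [show w ++ [2, j, 8] = w ++ [2, j] ++ [8] by simp, get_append]
  by_cases hk7 : k = 7
  · subst hk7
    have hv := hk.resolve_left (by simp)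
    rw [get_setAt_self (j := 7) hnf (by simp; rfl), setAt_nil, get_nil] at ha
    exact absurd ha hv
  · rwa [get_setAt_ne (by omega)] at ha

theorem append_input (hs : BInv E G s) {w : Ptr} (hp : WinAt s w) {j : ℕ}
    (hj : IsIndex j (get s (w ++ [2]))) {L n rf sc st ins subs act}
    (hd : IsDoc E G (get s (w ++ [2, j])) L n rf sc st ins subs act) {i : Term}
    (ho : L.cls E = .other → Safe E G i.nf)
    (hr : L.cls E = .rp → RpInput E G i.nf) (hi : L.cls E = .idp → IdpInput E G L i.nf) :
    BInv E G (appendAt s (w ++ [2, j] ++ [6]) i) := by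
  rw [appendAt_eq, get_append s (w ++ [2, j]), hd.gets.2.2.2.2.2.1]
  have h6 := nf_of_mem (hd.nf.trans hd.eq) (u := .seq ins) (by simp)
  refine (hs.set_docc hp hj hd (k := 5) ?_ (.inl (by simp))).1
  rw [append_items rfl h6]
  exact .doc hd.role (hd.doc.append_input ho hr hi) hd.subs hd.act

/-- The active document of a window. -/
theorem activeDoc_eq (hs : BInv E G s) {w : Ptr} (hp : WinAt s w) {d : Ptr}
    (hd : IsActiveDoc s w d) : activeDoc s w = get s d := by
  obtain ⟨j, hj, rfl, ha⟩ := hd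
  obtain ⟨n, docs, op, ht', hn, hop, hd, hu, hx⟩ := hs.docs_at hp
  obtain ⟨k, d, rfl, hk, hgd, hgq⟩ := hx j hj
  rw [hgq] at ha
  have ha8 : get d [8] = .top := by rw [← nf_get]; exact Equiv.nf_eq ha
  rw [hgd, activeDoc, get_append, items_win ht']
  cases hf : docs.find? fun d => decide (get d [8] ≈ₜ .top) with
  | none =>
    rw [List.find?_eq_none] at hf
    have := hf d (mem_of_getElem? hk)
    simp [ha8, Term.Equiv.refl] at this
  | some e =>
    obtain ⟨k', hk'⟩ := List.mem_iff_getElem?.1 (List.mem_of_find?_eq_some hf)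
    have he := List.find?_some hf
    rw [decide_eq_true_eq] at he
    have he8 : get e [8] = .top := by rw [← nf_get]; exact Equiv.nf_eq he
    have := hu _ _ _ _ hk hk' ha8 he8
    subst this
    rw [hk] at hk'
    simpa [eq_comm] using hk'

/-- The active documents of the windows found by `getWindow`. -/
theorem getWindow (hs : BInv E G s) {w : Ptr} (hw : WinAt s w) {d : Ptr} (hd : IsActiveDoc s w d)
    {L n rf sc st ins subs act} (hdoc : IsDoc E G (get s d) L n rf sc st ins subs act)
    {window : Term} {w' : Ptr} (hw' : w' ∈ getWindow w window s) {d' : Ptr}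
    (hd' : IsActiveDoc s w' d') : WinAt s w' ∧ ∃ j, IsIndex j (get s (w' ++ [2])) ∧
      d' = w' ++ [2, j] ∧ ∃ L' n' rf' sc' st' ins' subs' act',
        IsDoc E G (get s d') L' n' rf' sc' st' ins' subs' act' ∧ L'.cls E = L.cls E := by
  have key : w' = w ∨ WinAt s w' ∧ SameOrigin s w' w := by
    unfold Spresso.getWindow at hw'
    split_ifs at hw' with h1
    · obtain ⟨v, hv, -, rfl⟩ := hw'
      split_ifs with h2
      · exact .inr ⟨hv.winAt, h2⟩
      · exact .inl rfl
    · exact .inl hw'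
  rcases key with rfl | ⟨hv, ho⟩
  · refine ⟨hw, ?_⟩
    have := hs.active_unique hw hd hd'
    subst this
    obtain ⟨j, hj, rfl, _⟩ := hd
    exact ⟨j, hj, rfl, _, _, _, _, _, _, _, _, hdoc, rfl⟩
  · refine ⟨hv, ?_⟩
    rw [SameOrigin, hs.activeDoc_eq hv hd', hs.activeDoc_eq hw hd, hdoc.origin] at ho
    obtain ⟨j, hj, rfl, _⟩ := hd'
    obtain ⟨L', n', rf', sc', st', ins', subs', act', hdoc'⟩ := hs.isDoc hv hj
    refine ⟨j, hj, rfl, _, _, _, _, _, _, _, _, hdoc', ?_⟩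
    rw [hdoc'.origin, equiv_iff_nf, L'.cn_origin.1, L.cn_origin.1] at ho
    exact Loc.cls_of_origin ho

/-- Deactivating the active document. -/
theorem deactivate (hs : BInv E G s) {w : Ptr} (hw : WinAt s w) {i : ℕ}
    (hd : IsActiveDoc s w (w ++ [2, i])) : BInv E G (setAt s (w ++ [2, i, 8]) .bot) ∧
      WinAt (setAt s (w ++ [2, i, 8]) .bot) w ∧ ∃ n docs op,
        get (setAt s (w ++ [2, i, 8]) .bot) w = .seq [n, .seq docs, op] ∧ G.Known n ∧
        Safe E G op ∧ ∀ d ∈ docs, TreeOK E G false d ∧ get d [8] ≠ .top := by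
  obtain ⟨i', hi, he, ha⟩ := hd
  simp only [List.append_cancel_left_eq, List.cons.injEq, and_true, true_and] at he
  subst he
  obtain ⟨L, m, rf, sc, st, ins, subs, act, hdoc⟩ := hs.isDoc hw hi
  obtain ⟨n, docs, op, ht', hn, hop, hdc, hu, hx⟩ := hs.docs_at hw
  obtain ⟨k, d, rfl, hk, hgd, hgq⟩ := hx _ hi
  have ha8 : get d [8] = .top := by
    rw [hgq] at ha
    rw [← nf_get]
    exact Equiv.nf_eq ha
  rw [hgd] at hdoc
  have hnd := nf_setAt_seq (v := .bot) (hdoc.nf.trans hdoc.eq) 7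
  have hdT : TreeOK E G false (setAt d [8] .bot).nf := by
    rw [hnd]
    exact .doc hdoc.role hdoc.doc hdoc.subs (.inr rfl)
  have hd8 : get (setAt d [8] .bot).nf [8] ≠ .top := by
    rw [hnd]
    show get (.seq [m, L.term, rf, sc, st, .seq ins, .seq subs, .bot]) [8] ≠ .top
    rw [get_doc_active]
    simp [Term.nf]
  have hnew : (setAt (get s w) [2, k + 1, 8] .bot).nf =
      .seq [n, .seq (docs.modify k fun _ => (setAt d [8] .bot).nf), op] := by
    rw [nf_setAt_win ht']
    congr 4
    apply modify_congr
    intro u hu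
    rw [hk] at hu
    cases hu
    rfl
  have hall : ∀ e ∈ docs.modify k fun _ => (setAt d [8] .bot).nf,
      TreeOK E G false e ∧ get e [8] ≠ .top := by
    intro e he
    obtain ⟨l, hl⟩ := List.mem_iff_getElem?.1 he
    rw [List.getElem?_modify] at hl
    by_cases hkl : k = l
    · subst hkl
      simp only [hk, if_true, Option.map_eq_map, Option.map_some, Option.some.injEq] at hl
      subst hl
      exact ⟨hdT, hd8⟩
    · simp only [hkl, if_false, Option.map_eq_map, Option.map_id'] at hl
      refine ⟨hdc e (mem_of_getElem? hl), fun he8 => hkl (hu _ _ _ _ hk hl ha8 he8)⟩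
  have hok : TreeOK E G true (setAt (get s w) [2, k + 1, 8] .bot).nf := by
    rw [hnew]
    refine .win hn hop (fun e he => (hall e he).1) fun i j e e' hi hj he => ?_
    exact absurd he (hall e (mem_of_getElem? hi)).2
  obtain ⟨a1, a2, a3⟩ := hs.set_win hw hok
  exact ⟨a1, a2, n, _, op, a3.trans hnew, hn, hop, hall⟩

theorem moveActive (hs : BInv E G s) {w : Ptr} (hw : WinAt s w) {i j : ℕ} (hj : 1 ≤ j)
    (hd : IsActiveDoc s w (w ++ [2, i])) : BInv E G (moveActive s w i j) := by
  obtain ⟨h1, h2, n, docs, op, ht, hn, hop, hall⟩ := hs.deactivate hw hd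
  obtain ⟨k, rfl⟩ : ∃ k, j = k + 1 := ⟨j - 1, by omega⟩
  refine BInv.cancelNav (h1.set_win h2 ?_).1 _
  have ht' : (get (setAt s (w ++ [2, i, 8]) .bot) w).nf = .seq [n, .seq docs, op] := by
    rw [nf_get, ht]
  rw [nf_setAt_win ht']
  refine .win hn hop (forall_modify (fun d hd => (hall d hd).1) fun u hu => ?_) ?_
  · have hu' := mem_of_getElem? hu
    obtain ⟨m, L, rf, sc, st, ins, subs, act, he, g1, g2, g3, g4⟩ := (hall u hu').1.doc_inv
    have hun := nf_of_mem (nf_of_mem (u := .seq docs) ht' (by simp)) hu'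
    rw [nf_setAt_seq (hun.trans he) 7]
    exact .doc g1 g2 g3 (.inl rfl)
  · have key : ∀ (i : ℕ) e, (docs.modify k fun u => (setAt u [8] .top).nf)[i]? = some e →
        get e [8] = .top → i = k := by
      intro i e hi he
      by_contra hne
      have hki : ¬ k = i := fun h => hne h.symm
      rw [List.getElem?_modify] at hi
      simp only [hki, if_false, Option.map_eq_map, Option.map_id'] at hi
      exact (hall e (mem_of_getElem? hi)).2 he
    intro i i' e e' hi hi' he he'
    rw [key i e hi he, key i' e' hi' he']

/-- Closing a window. -/
theorem close (hs : BInv E G s) {p : Ptr} {i : ℕ} (hw : WinAt s (p ++ [i])) :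
    BInv E G (setAt s p (.seq ((items (get s p)).eraseIdx (i - 1)))) := by
  generalize hq : p ++ [i] = q at hw
  cases hw with
  | @top i' h =>
    have hp : p = [1] := by
      rw [show ([1, i'] : Ptr) = [1] ++ [i'] from rfl] at hq
      exact (List.append_inj' hq rfl).1
    subst hp
    refine hs.set1 (k := 0) ?_
    obtain ⟨ws, h1, h2⟩ := hs.comp (k := 0) (by norm_num)
    have hn : (get s [1]).nf = .seq ws := by rw [nf_get, h1]
    rw [items_of_nf hn]
    refine ⟨ws.eraseIdx (i - 1), ?_, fun w hw => h2 w (List.mem_of_mem_eraseIdx hw)⟩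
    rw [nf_seq, (map_eq_self_iff (f := Term.nf)).2]
    exact fun x hx => nf_of_mem hn (List.mem_of_mem_eraseIdx hx)
  | @sub w j i' hw hj _ =>
    have hp : p = w ++ [2, j] ++ [7] := by
      rw [show w ++ [2, j, 7, i'] = (w ++ [2, j] ++ [7]) ++ [i'] by simp] at hq
      exact (List.append_inj' hq rfl).1
    subst hp
    obtain ⟨L, m, rf, sc, st, ins, subs, act, hdoc⟩ := hs.isDoc hw hj
    refine (hs.set_docc hw hj hdoc (k := 6) ?_ (.inl (by simp))).1
    have h7 := nf_of_mem (hdoc.nf.trans hdoc.eq) (u := .seq subs) (by simp)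
    rw [get_append s (w ++ [2, j]), hdoc.gets.2.2.2.2.2.2.1, items_of_nf h7, nf_seq,
      (map_eq_self_iff (f := Term.nf)).2
        fun x hx => nf_of_mem h7 (List.mem_of_mem_eraseIdx hx)]
    exact .doc hdoc.role hdoc.doc (fun w hw => hdoc.subs w (List.mem_of_mem_eraseIdx hw)) hdoc.act

end BInv

namespace BInv

theorem sendProto_https (hs : BInv E G s) (h : Term) : sendProto s h (K .https) = K .https := by
  rcases hs.sendProto_cases h (K .https) with h | h
  · exact h
  · exact h.1

theorem _root_.Spresso.Loc.cls_host {L : Loc} (h : L.cls E ≠ .other) : L.cls E = E.cls L.host := by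
  unfold Loc.cls at h ⊢
  split_ifs at h ⊢
  · rfl
  · exact absurd rfl h

/-- Requests by `XMLHttpRequest` of honest scripts. -/
theorem send_own (hE : EnvOK E) (hG : GWF E G) (hs : BInv E G s)
    (hν : ∀ k, G.v (.nu k) = some .pub) {a n x h pa par proto body o rf : Term} {L : Loc}
    (ha : Safe E G a) (hn : G.role n = some (.doc L)) (hL : L.cls E ≠ .other)
    (hh : h.nf = .str L.host) (hpr : proto = K .https)
    (hR : ∀ hdr, ReqOK E G (.seq [n, x.nf])
      ⟨ν 4, K .post, L.host, pa.nf, par.nf, hdr, body.nf⟩) {out : Out}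
    (ho : out ∈ Spresso.send a (.seq [n, x]) (httpRequest (ν 4) (K .post) h pa par (.seq []) body)
      proto o rf s) : BOut E G out := by
  subst hpr
  have hc : E.cls L.host ≠ .other := Loc.cls_host hL ▸ hL
  refine hs.send hE hG (hν 8) ha (hG.dy.nf_iff.1 (hh ▸ hG.dy.str _)) ?_ ho
  rw [nf_httpRequest, hh, hs.sendProto_https]
  refine .prot (q := ⟨ν 4, K .post, L.host, pa.nf, par.nf, _, body.nf⟩) rfl rfl hc ?_
  have := hR (Term.seq (hdrs (sendCookies s (.str L.host) (K .https)) o rf)).nf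
  rwa [nf_seq, map_cons, map_cons, map_nil, Ghost.Named.nf (G := G) ⟨_, hn⟩]

/-- Navigation of an inner frame. -/
theorem send_frame (hE : EnvOK E) (hG : GWF E G) (hs : BInv E G s)
    (hν : ∀ k, G.v (.nu k) = some .pub) {a h par rf : Term} (ha : Safe E G a)
    (hc : (Safe E G h ∧ Safe E G par) ∨ h = .seq [] ∨
        (∃ f, h = .str f ∧ E.cls f = .fwd ∧ FwdOK E G par)) (hrf : Safe E G rf) {out : Out}
    (ho : out ∈ Spresso.send a (ν 5) (httpRequest (ν 4) (K .get) h (K .pRoot) par (.seq [])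
      (.seq [])) (K .https) .bot rf s) : BOut E G out := by
  have hd := hG.dy
  have hnil : Safe E G (.seq []) := hd.nil
  have hk : ∀ k, Safe E G (ν k) := fun k => (known_nu (hν k)).safe
  rcases hc with ⟨h1, h2⟩ | rfl | ⟨f, rfl, hf, hp⟩
  · exact hs.send_win hE hG (hν 8) ha (known_nu (hν 5)) (hk _) (hd.str _) h1 (hd.str _) h2 hnil
      hd.bot (.inl rfl) hrf ho
  · refine hs.send hE hG (hν 8) ha hnil ?_ ho
    rw [nf_httpRequest]
    exact .bad rfl ⟨_, nf_seq _⟩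
  · refine hs.send hE hG (hν 8) ha (hd.str _) ?_ ho
    rw [nf_httpRequest, hs.sendProto_https]
    refine .prot (q := ⟨(ν 4).nf, (K .get).nf, f, (K .pRoot).nf, par.nf, _, _⟩) rfl rfl
      (by simp [hf]) ?_
    refine .fwdWin hf (known_nu (hν 5)).nf_known.named ?_
    have := hG.tr_self.fwdOK hp
    rwa [ren_var] at this

theorem runCommand (hE : EnvOK E) (hG : GWF E G) (hs : BInv E G s)
    (hν : ∀ k, G.v (.nu k) = some .pub) {a cmd : Term} {w d : Ptr} (ha : Safe E G a)
    (hw : WinAt s w) (hd : IsActiveDoc s w d) {L n rf sc st ins subs act}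
    (hdoc : IsDoc E G (get s d) L n rf sc st ins subs act) (hc : CmdOK E G L cmd.nf) {o : Out}
    (ho : o ∈ runCommand a w d s cmd) : BOut E G o := by
  have dy := hG.dy
  have hnil : Safe E G (.seq []) := dy.nil
  have hk : ∀ k, Safe E G (ν k) := fun k => (known_nu (hν k)).safe
  have hloc : get s (d ++ [2]) = L.term := by rw [get_append, hdoc.gets.2.1]
  have hno : get s (d ++ [1]) = n := by rw [get_append, hdoc.gets.1]
  have hls : L.cls E ≠ .fwd → Safe E G L.term := fun h => (hG.loc_safe hdoc.role h).2.2
  have hos := hG.origin_safe L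
  have hoo : L.cls E = .other → OriginOpen E L.origin.nf := by
    intro h
    rw [L.cn_origin.1]
    refine ⟨_, _, rfl, .inr ?_⟩
    unfold Loc.cls at h
    unfold Loc.proto
    split_ifs at h ⊢ with hb
    · exact .inr ⟨rfl, _, rfl, by simp [h]⟩
    · exact .inl rfl
  have hh : L.cls E ≠ .other → E.cls L.host = L.cls E := fun h => (Loc.cls_host h).symm
  have hnav : ∀ {window nr x}, x ∈ getNavigableWindow w window nr s →
      BInv E G (Spresso.cancelNav (get x.2 (x.1 ++ [1])) x.2) ∧
        G.Known (get x.2 (x.1 ++ [1])) := fun hx => by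
    obtain ⟨h1, h2⟩ := hs.navigable hG (hν 9) hw hx
    exact ⟨h1.cancelNav _, h1.window_known h2⟩
  unfold Spresso.runCommand at ho
  dsimp only at ho
  rw [hdoc.origin, hloc, hno] at ho
  split at ho <;> (try rename_i heq; rw [heq] at hc)
  · obtain ⟨x, hx, ho⟩ := ho
    rename_i url window nr
    obtain ⟨hu, hL⟩ : Safe E G url ∧ L.cls E ≠ .fwd := by
      cases hc with
      | other h1 h2 =>
        simp only [dy.seq_iff, forall_mem_cons] at h2
        exact ⟨h2.2.1, by simp [h1]⟩
      | href h1 h2 => exact ⟨h2, h1⟩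
    exact (hnav hx).1.send_win hE hG (hν 8) ha (hnav hx).2 (hk _) (dy.str _) (dy.get hu _)
      (dy.get hu _) (dy.get hu _) hnil dy.bot (.inl rfl) (DY.ite (hls hL) dy.bot) ho
  · rename_i url window
    obtain ⟨w', hw', d', hd', ho⟩ := ho
    obtain ⟨hv, j, hj, rfl, L', n', rf', sc', st', ins', subs', act', hdoc', hcl⟩ :=
      hs.getWindow hw hd hdoc hw' hd'
    have hb : BInv E G (appendAt s (w' ++ [2, j] ++ [7]) (.seq [ν 5, .seq [], .bot])) := by
      rw [appendAt_eq, get_append s (w' ++ [2, j]), hdoc'.gets.2.2.2.2.2.2.1]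
      have h7 := nf_of_mem (hdoc'.nf.trans hdoc'.eq) (u := .seq subs') (by simp)
      refine (hs.set_docc hv hj hdoc' (k := 6) ?_ (.inl (by simp))).1
      rw [append_items rfl h7]
      refine .doc hdoc'.role hdoc'.doc (fun x hx => ?_) hdoc'.act
      rcases mem_append.1 hx with hx | hx
      · exact hdoc'.subs x hx
      · rw [mem_singleton.1 hx]
        simp only [nf_seq, map_cons, map_nil]
        exact .win (known_nu (hν 5)).nf_known dy.bot (by simp) (by intro i j d d' h; simp at h)
    have hl' : L.cls E ≠ .fwd → Safe E G (get s (w' ++ [2, j] ++ [2])) := fun h => by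
      rw [get_append, hdoc'.gets.2.1]
      exact (hG.loc_safe hdoc'.role (hcl ▸ h)).2.2
    cases hc with
    | other h1 h2 =>
      simp only [dy.seq_iff, forall_mem_cons] at h2
      exact hb.send_win hE hG (hν 8) ha (known_nu (hν 5)) (hk _) (dy.str _) (dy.get h2.2.1 _)
        (dy.get h2.2.1 _) (dy.get h2.2.1 _) hnil dy.bot (.inl rfl) (hl' (by simp [h1])) ho
    | @iframe h par _ h1 h2 =>
      have hg := get_url (K .https) h (K .pRoot) par
      rw [hg.1, hg.2.1, hg.2.2.1, hg.2.2.2] at ho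
      refine hb.send_frame hE hG hν ha ?_ (hl' h1) ho
      rcases h2 with ⟨h3, h4⟩ | rfl | ⟨f, rfl, hf, hp⟩
      · exact .inl ⟨dy.nf_iff.2 h3, dy.nf_iff.2 h4⟩
      · exact .inr (.inl (nf_seq _))
      · refine .inr (.inr ⟨f, rfl, hf, ?_⟩)
        have := hG.tr_self.fwdOK hp
        rwa [ren_var] at this
  · rename_i url method data window
    cases hc with
    | other h1 h2 =>
    simp only [dy.seq_iff, forall_mem_cons] at h2
    by_cases hm : ¬ (method ≈ₜ K .get ∨ method ≈ₜ K .post)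
    · rw [if_pos hm] at ho
      exact ho ▸ hs.noOut
    · rw [if_neg hm] at ho
      obtain ⟨x, hx, ho⟩ := ho
      refine (hnav hx).1.send_win hE hG (hν 8) ha (hnav hx).2 (hk _) h2.2.2.1 (dy.get h2.2.1 _)
        (dy.get h2.2.1 _) (DY.ite h2.2.2.2.1 (dy.get h2.2.1 _)) (DY.ite hnil h2.2.2.2.1)
        (DY.ite dy.bot hos) ?_ (hls (by simp [h1])) ho
      split_ifs
      · exact .inl rfl
      · exact .inr (hoo h1)
  · rename_i window script
    cases hc with
    | other h1 h2 =>
    simp only [dy.seq_iff, forall_mem_cons] at h2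
    obtain ⟨w', hw', d', hd', rfl⟩ := ho
    obtain ⟨hv, j, hj, rfl, L', n', rf', sc', st', ins', subs', act', hdoc', hcl⟩ :=
      hs.getWindow hw hd hdoc hw' hd'
    refine noOut (hs.set_docc hv hj hdoc' (k := 3) ?_ (.inl (by simp))).1
    have hdd := hdoc'.doc
    have hL' := hcl.trans h1
    cases hdd with
    | other _ g1 g2 g3 g4 =>
      exact .doc hdoc'.role (.other hL' g1 (dy.nf_iff.2 h2.2.2.1) g3 g4) hdoc'.subs hdoc'.act
    | _ => simp_all
  · rename_i window script
    cases hc with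
    | other h1 h2 =>
    simp only [dy.seq_iff, forall_mem_cons] at h2
    obtain ⟨w', hw', d', hd', rfl⟩ := ho
    obtain ⟨hv, j, hj, rfl, L', n', rf', sc', st', ins', subs', act', hdoc', hcl⟩ :=
      hs.getWindow hw hd hdoc hw' hd'
    refine noOut (hs.set_docc hv hj hdoc' (k := 4) ?_ (.inl (by simp))).1
    have hdd := hdoc'.doc
    have hL' := hcl.trans h1
    cases hdd with
    | other _ g1 g2 g3 g4 =>
      exact .doc hdoc'.role (.other hL' g1 g2 (dy.nf_iff.2 h2.2.2.1) g4) hdoc'.subs hdoc'.act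
    | _ => simp_all
  · rename_i url method data xref
    rw [(get_origin L).1, (get_origin L).2] at ho
    by_cases hm : ((method ≈ₜ K .connect ∨ method ≈ₜ K .traceMethod ∨ method ≈ₜ K .trackMethod) ∧
        ¬ (xref ≈ₜ .bot ∨ ∃ n, xref ≈ₜ .nonce n))
    · rw [if_pos hm] at ho
      exact ho ▸ hs.noOut
    rw [if_neg hm] at ho
    by_cases hq : ¬ get url [3] ≈ₜ .str L.host ∨ ¬ get url [2] ≈ₜ L.proto
    · rw [if_pos hq] at ho
      exact ho ▸ hs.noOut
    rw [if_neg hq] at ho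
    push Not at hq
    obtain ⟨hq1, hq2⟩ := hq
    have hq1 := Equiv.nf_eq hq1
    have hq2 := Equiv.nf_eq hq2
    have hpost : ¬ (K .post ≈ₜ K .get ∨ K .post ≈ₜ K .head) := by simp [kw_equiv]
    cases hc with
    | other h1 h2 =>
      simp only [dy.seq_iff, forall_mem_cons] at h2
      exact hs.send_xhr hE hG (hν 8) h1 ha hdoc.role h2.2.2.2.2.1 (hk _) h2.2.2.1 hq1
        (dy.get h2.2.1 _) (dy.get h2.2.1 _) (DY.ite hnil h2.2.2.2.1) (DY.ite dy.bot hos)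
        (by rw [hq2, L.nf_proto]) (hls (by simp [h1])) ho
    | @rpStart o a c x h1 h2 =>
      have hg := get_url (K .https) o (K .pStartLogin) (.seq [])
      rw [if_neg hpost, if_neg hpost, hg.2.2.1, hg.2.2.2] at ho
      exact hs.send_own hE hG hν ha hdoc.role (by simp [h1]) hq1 hg.1
        (fun hdr => .rpStart ((hh (by simp [h1])).trans h1) rfl hdoc.role h1 rfl (nf_seq _) h2) ho
    | @rpLogin o y t x h1 h2 =>
      have hg := get_url (K .https) o (K .pLogin) (.seq [])
      rw [if_neg hpost, if_neg hpost, hg.2.2.1, hg.2.2.2] at ho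
      have h2' := hG.tr_self.lstOK h2
      rw [ren_var] at h2'
      exact hs.send_own hE hG hν ha hdoc.role (by simp [h1]) hq1 hg.1
        (fun hdr => .rpLogin ((hh (by simp [h1])).trans h1) rfl hdoc.role h1 rfl (nf_seq _) h2') ho
    | @idpSign o em pw T F x h1 h2 h3 h4 h5 =>
      have hg := get_url (K .https) o (K .pSign) (.seq [])
      rw [if_neg hpost, if_neg hpost, hg.2.2.1, hg.2.2.2] at ho
      refine hs.send_own hE hG hν ha hdoc.role (by simp [h1]) hq1 hg.1
        (fun hdr => .idpSign ((hh (by simp [h1])).trans h1) rfl hdoc.role h1 rfl (nf_seq _) (dy.nf_iff.2 h2) (dy.nf_iff.2 h3) (dy.nf_iff.2 h4) ?_) ho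
      rcases h5 with rfl | ⟨rfl, rfl⟩
      · exact .inl (nf_seq _)
      · exact .inr ⟨nf_dictGet _ _, nf_dictGet _ _⟩
  · obtain ⟨x, hx, ho⟩ := ho
    obtain ⟨hx1, hx2⟩ := hs.navigable hG (hν 9) hw hx
    split_ifs at ho
    · obtain ⟨j, hj, hj', rfl⟩ := ho
      exact noOut (hx1.moveActive hx2 (by omega) hj')
    · exact ho ▸ hx1.noOut
  · obtain ⟨x, hx, ho⟩ := ho
    obtain ⟨hx1, hx2⟩ := hs.navigable hG (hν 9) hw hx
    split_ifs at ho
    · obtain ⟨j, hj, hj', rfl⟩ := ho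
      exact noOut (hx1.moveActive hx2 (by omega) hj)
    · exact ho ▸ hx1.noOut
  · obtain ⟨x, hx, p, i, hp, rfl⟩ := ho
    obtain ⟨hx1, hx2⟩ := hs.navigable hG (hν 9) hw hx
    rw [hp] at hx2
    exact noOut (hx1.close hx2)
  · rename_i window message target
    obtain ⟨w', hw', _, ho⟩ := ho
    by_cases hr : ∃ d', IsActiveDoc s w' d' ∧
          (target ≈ₜ .bot ∨ docOrigin (get s d') ≈ₜ target)
    · rw [if_pos hr] at ho
      obtain ⟨d', hd', ht, rfl⟩ := ho
      obtain ⟨j, hj, rfl, _⟩ := hd'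
      obtain ⟨L', n', rf', sc', st', ins', subs', act', hdoc'⟩ := hs.isDoc hw'.winAt hj
      rw [hdoc'.origin, equiv_iff_nf, equiv_iff_nf, L'.cn_origin.1,
        nf_of_mem heq (u := target) (by simp)] at ht
      refine noOut (hs.append_input hw'.winAt hj hdoc' (fun h1 => ?_) (fun _ => ?_) fun _ => ?_)
      · have hm : Safe E G message := by
          cases hc with
          | other g1 g2 =>
            simp only [dy.seq_iff, forall_mem_cons] at g2
            exact g2.2.2.1
          | post h =>
            rcases h with h | ⟨g1, g2⟩
            · exact h
            · rcases ht with ht | ht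
              · exact absurd ht g1
              · have := g2 L' ht.symm
                rw [h1] at this
                cases this
        rw [dy.nf_iff]
        refine dy.seq ?_
        simp [dy.str, hos, hm, (hs.window_known hw).safe]
      · rw [nf_seq]
        exact .inl ⟨_, _, _, rfl⟩
      · rw [nf_seq]
        exact .inl ⟨_, _, _, rfl⟩
    · rw [if_neg hr] at ho
      exact ho ▸ hs.noOut
  · exact ho ▸ hs.noOut

end BInv

theorem get_cons_of_eq {s s' : Term} (h : get s [1] = get s' [1]) (q : Ptr) :
    get s (1 :: q) = get s' (1 :: q) := by
  rw [show ∀ t, get t (1 :: q) = get (get t [1]) q from fun t => get_append t [1] q, h,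
    ← show get s' (1 :: q) = get (get s' [1]) q from get_append s' [1] q]

theorem WinAt.get_append {s s' : Term} (h : get s [1] = get s' [1]) {w : Ptr} (hw : WinAt s w)
    (q : Ptr) : get s (w ++ q) = get s' (w ++ q) := by
  obtain ⟨p, rfl⟩ := hw.head
  exact get_cons_of_eq h _

theorem WinAt.of_eq {s s' : Term} (h : get s [1] = get s' [1]) {w : Ptr} (hw : WinAt s w) :
    WinAt s' w := by
  induction hw with
  | top hi => exact .top (h ▸ hi)
  | sub hw h1 h2 ih =>
    refine .sub ih ?_ ?_
    · rwa [← hw.get_append h]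
    · rwa [← hw.get_append h]

namespace BInv

theorem set_cookies (hs : BInv E G s) {host v : Term} {h : Str} {cs : List Term}
    (hh : host.nf = .str h) (hv : v.nf = .seq cs) (hc : ∀ c ∈ cs, CookieOK E G h c) :
    BInv E G (setAt s [4] (dictSet (get s [4]) host v)) := by
  obtain ⟨l, h1, h2⟩ := hs.comp (k := 3) (by norm_num)
  refine hs.set1 (k := 3) ?_
  obtain ⟨l', e1, e2⟩ := mem_dictSet (z := get s [4]) (k := host) (v := v)
  refine ⟨l', e1, fun e he => ?_⟩
  rcases e2 e he with he | rfl
  · rw [items_of_nf (by rw [nf_get, h1])] at he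
    exact h2 e he
  · exact ⟨h, cs, by rw [hh, hv], hc⟩

theorem set_safe5 (hG : GWF E G) (hs : BInv E G s) {k v : Term} (hk : Safe E G k)
    (hv : Safe E G v) : BInv E G (setAt s [5] (dictSet (get s [5]) k v)) :=
  hs.set1 (k := 4) (hG.dy.nf_iff.2 (hG.dy.dictSet (hs.comp (k := 4) (by norm_num)) hk hv))

theorem set_safe6 (hG : GWF E G) (hs : BInv E G s) {k v : Term} (hk : Safe E G k)
    (hv : Safe E G v) : BInv E G (setAt s [6] (dictSet (get s [6]) k v)) :=
  hs.set1 (k := 5) (hG.dy.nf_iff.2 (hG.dy.dictSet (hs.comp (k := 5) (by norm_num)) hk hv))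

end BInv

theorem cookieMerge_cases (hG : GWF E G) (a : Term) {b : Term} (hb : Safe E G b) :
    ∃ l, (cookieMerge a b).nf = .seq l ∧ ∀ c ∈ l, c ∈ items a ∨ Safe E G c := by
  have hd := hG.dy
  unfold cookieMerge
  have hn : ∀ t ∈ ((items b).filter fun c => ¬ get c [2, 4] ≈ₜ .top), Safe E G t :=
    fun _ hu => hd.items hb (List.mem_filter.1 hu).1
  have hn := DY.foldr_cookies (fun c acc => ∃ c' ∈ acc, get c' [1] ≈ₜ get c [1]) hn
  refine ⟨_, nf_seq _, fun c hc => ?_⟩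
  obtain ⟨u, hu, rfl⟩ := mem_map.1 hc
  rcases mem_append.1 hu with hu | hu
  · obtain ⟨c₀, hc₀, rfl⟩ := mem_map.1 hu
    have hci : c₀.nf = c₀ := nf_of_mem_items hc₀
    split
    · rename_i c' hf
      split_ifs
      · exact .inr (hd.nf_iff.2 (hn _ (List.mem_of_find?_eq_some hf)))
      · exact .inl (hci.symm ▸ hc₀)
    · exact .inl (hci.symm ▸ hc₀)
  · exact .inr (hd.nf_iff.2 (hn _ (List.mem_filter.1 hu).1))

theorem safe_ids (hE : EnvOK E) (hG : GWF E G) : Safe E G E.ids := by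
  obtain ⟨l, hl⟩ := hE.ids_seq
  have hd := hG.dy
  have hn : E.ids.nf = .seq l := by rw [hE.ids.1, hl]
  rw [hl]
  refine hd.seq fun t ht => ?_
  rw [← items_of_nf hn] at ht
  obtain ⟨a, c, rfl, _⟩ := hE.ids_own t ht
  exact hd.pair (hd.str _) (hd.str _)

namespace BInv

theorem runScript (hE : EnvOK E) (hG : GWF E G) (hs : BInv E G s) (hcl : Closed s)
    (hν : ∀ k, G.v (.nu k) = some .pub) {a : Term} {w d : Ptr} (ha : Safe E G a)
    (hw : WinAt s w) (hd : IsActiveDoc s w d) {o : Out} (ho : o ∈ runScript a w d s) :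
    BOut E G o := by
  have dy := hG.dy
  obtain ⟨j, hj, rfl, hact⟩ := hd
  obtain ⟨L, n, rf, sc, st, ins, subs, act, hdoc⟩ := hs.isDoc hw hj
  obtain ⟨R, out, state', cookies', ls', ss', cmd, hR, hout, heq, -, ho⟩ := ho
  dsimp only at ho hR hout
  rw [hdoc.origin] at ho hout
  rw [hdoc.gets.2.2.2.1] at hR
  rw [(get_origin L).1, (get_origin L).2, hdoc.gets.1, hdoc.gets.2.2.2.2.1,
    hdoc.gets.2.2.2.2.2.1] at hout
  rw [(get_origin L).1] at ho
  revert hout ho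
  generalize hck : Term.seq (List.map _ _) = ck
  intro hout ho
  have hos := hG.origin_safe L
  have hsk : Safe E G (.seq [L.origin, get s (w.take 2 ++ [1])]) := by
    refine dy.pair hos ?_
    have h1 : w.take 2 = w ∨ WinAt s (w.take 2) := by
      clear hj hact hdoc hout ho
      induction hw with
      | top => exact .inl rfl
      | sub hw _ _ ih =>
        right
        have h2 : ∀ w : Ptr, WinAt s w → 2 ≤ w.length := by
          intro w hw
          induction hw with
          | top => simp
          | sub => simp
        rw [List.take_append_of_le_length (h2 _ hw)]
        rcases ih with ih | ih
        · rwa [ih]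
        · exact ih
    have h1 : WinAt s (w.take 2) := by
      rcases h1 with h1 | h1
      · rwa [h1]
      · exact h1
    exact (hs.window_known h1).safe
  have hcks : Safe E G ck := by
    subst hck
    refine dy.seq fun u hu => ?_
    obtain ⟨c, hc, rfl⟩ := mem_map.1 hu
    rw [List.mem_filter, decide_eq_true_eq] at hc
    obtain ⟨hc, hp, -⟩ := hc
    obtain ⟨d, h1, h2 | ⟨h2, v, rfl, _⟩⟩ := hs.cookie_items _ hc
    · have : Safe E G c := h2
      exact dy.pair (dy.get this _) (dy.get this _)
    · rw [(get_session v).2, equiv_iff_nf] at hp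
      simp [Term.nf] at hp
  have h5 : Safe E G (get s [5]) := hs.comp (k := 4) (by norm_num)
  have h6 : Safe E G (get s [6]) := hs.comp (k := 5) (by norm_num)
  have h2 : get s [2] = E.ids := hs.comp (k := 1) (by norm_num)
  have h3 : get s [3] = E.sec := hs.comp (k := 2) (by norm_num)
  have hclean : ∀ t ∈ cleanWindows L.origin (items (get s [1])), CT E G L.origin true t := by
    refine (clean_ct L).1 _ ?_
    obtain ⟨ws, e1, e2⟩ := hs.comp (k := 0) (by norm_num)
    rw [items_of_nf (by rw [nf_get, e1])]
    exact e2
  have hcle : clean s (get s (w ++ [2, j])) = .seq (cleanWindows L.origin (items (get s [1]))) := by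
    rw [clean, hdoc.origin]
  rw [hcle] at hout
  revert hout
  generalize hin : Term.seq (_ :: _) = i
  intro hout
  have hgc : get s [4] = get s [4] := rfl
  have hst : st.nf = st := nf_of_mem (hdoc.nf.trans hdoc.eq) (by simp)
  have hinn : (Term.seq ins).nf = .seq ins := nf_of_mem (hdoc.nf.trans hdoc.eq) (by simp)
  have hl5 : Safe E G (dictGet (get s [5]) L.origin) := dy.dictGet h5 _
  have hl6 : Safe E G (dictGet (get s [6]) (.seq [L.origin, get s (w.take 2 ++ [1])])) :=
    dy.dictGet h6 _
  have hsec : L.cls E = .other → Safe E G (dictGet (get s [3]) L.origin) := fun hL => by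
    rw [h3]
    rcases hE.sec_get L hL with ⟨m, hm, h⟩ | h
    · rw [h]; exact (G.known_of_role (a := .nonce m) (hG.pubs m hm) trivial).safe
    · rw [h]; exact dy.seq (by simp)
  have hici : Closed i := by
    have cd := Closed.dy
    rw [← hin, ← hcle]
    rw [← hck]
    refine cd.seq ?_
    simp only [all_cons, all_one]
    have hg : ∀ p, Closed (get s p) := cd.get hcl
    have hdg : ∀ k, Closed (get (get s (w ++ [2, j])) k) := cd.get (hg _)
    have hlo : Closed L.origin := L.cn_origin.closed
    refine ⟨cd.clean hcl _, hdoc.gets.1 ▸ hdg _, hdoc.gets.2.2.2.2.1 ▸ hdg _,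
      hdoc.gets.2.2.2.2.2.1 ▸ hdg _, ?_, cd.dictGet (hg _) _, cd.dictGet (hg _) _, hg _,
      cd.dictGet (hg _) _⟩
    simpa using cd.cookiePairs (cd.dictGet (hg _) _) _
  have hscr : ScrIn E G L n st ins i := by
    subst hin
    constructor <;> (try rw [get_seq (nf_seq _)]) <;>
      (try simp only [map_cons, List.getD_cons_zero, List.getD_cons_succ, get_nil, nf_nf])
    · rw [nf_seq, items_seq]
      intro w hw
      simp only [mem_map] at hw
      obtain ⟨_, ⟨u, hu, rfl⟩, rfl⟩ := hw
      exact ((hclean u hu).nf hG).nf hG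
    · exact Ghost.Named.nf (G := G) ⟨_, hdoc.role⟩
    · exact hdoc.role
    · exact hst
    · rw [hinn, items_of_nf hinn]
    · exact dy.nf_iff.2 hcks
    · exact dy.nf_iff.2 hl5
    · exact dy.nf_iff.2 hl6
    · rw [nf_get, h2]
    · exact fun h => dy.nf_iff.2 (hsec h)
    · exact hici
  have hsi : L.cls E = .other → Safe E G i := fun hL => by
    subst hin
    have hD := hdoc.doc
    cases hD with
    | other _ a1 a2 a3 a4 =>
      exact dy.list ⟨dy.seq fun t ht => (hclean t ht).safe hG hL,
        (G.known_of_role hdoc.role trivial).safe, a3, dy.seq a4, hcks, hl5, hl6,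
        h2 ▸ safe_ids hE hG, hsec hL⟩
    | _ => simp_all
  have hout' := hscr.script hG hE hν hdoc.doc hR hsi hout
  obtain ⟨c1, c2, c3, c4, c5⟩ := hout' _ _ _ _ _ heq
  have hnn : ∀ t ∈ [state', .seq cookies', ls', ss', cmd], t.nf = t := fun t ht =>
    nf_of_mem ((nf_nf (out.subst lamToNu)).trans heq) ht
  obtain ⟨l, e1, e2⟩ := cookieMerge_cases hG (dictGet (get s [4]) (.str L.host)) c1
  have b1 := hs.set_cookies (host := .str L.host) rfl e1 fun c hc => (e2 c hc).elim
    (fun hc => by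
      obtain ⟨d, h, hc⟩ := hs.cookie_items _ hc
      cases h
      exact hc) .inl
  have b2 := b1.set_safe5 hG hos c2
  have b3 := b2.set_safe6 hG hsk c3
  revert ho
  generalize hS1 : setAt s [4] _ = s1 at *
  generalize hS2 : setAt s1 [5] _ = s2 at *
  generalize hS3 : setAt s2 [6] _ = s3 at *
  intro ho
  have hwin : get s3 [1] = get s [1] := by
    rw [← hS3, get_setAt_ne (by norm_num), ← hS2, get_setAt_ne (by norm_num), ← hS1,
      get_setAt_ne (by norm_num)]
  have hw3 : WinAt s3 w := hw.of_eq hwin.symm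
  have hj3 : IsIndex j (get s3 (w ++ [2])) := by rwa [hw.get_append hwin.symm] at hj
  have hg3 : get s3 (w ++ [2, j]) = get s (w ++ [2, j]) := (hw.get_append hwin.symm _).symm
  have hdoc3 := hg3.symm ▸ hdoc
  have hd4 : state'.nf = state' := hnn _ (by simp)
  obtain ⟨b4, w4, j4, g4⟩ := b3.set_docc hw3 hj3 hdoc3 (k := 4) (v := state')
    (by rw [hd4]; exact .doc hdoc.role c4 hdoc.subs hdoc.act) (.inl (by norm_num))
  rw [hd4] at g4
  have hd5 : IsDoc E G (get (setAt s3 (w ++ [2, j] ++ [4 + 1]) state') (w ++ [2, j])) L n rf sc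
      state' ins subs act := ⟨g4, nf_get _ _, hdoc.role, c4, hdoc.subs, hdoc.act⟩
  refine runCommand hE hG b4 hν ha w4 ⟨j, j4, rfl, ?_⟩ hd5 ?_ ho
  · rw [get_append, hd5.gets.2.2.2.2.2.2.2]
    rwa [get_append, hdoc.gets.2.2.2.2.2.2.2] at hact
  · rw [hnn _ (by simp)]
    exact c5

end BInv

theorem uniqueAct_single (D : Term) : UniqueAct [D] := by
  intro i j d d' hi hj _ _
  have h1 := (List.getElem?_eq_some_iff.1 hi).1
  have h2 := (List.getElem?_eq_some_iff.1 hj).1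
  simp at h1 h2
  omega

theorem uniqueAct_concat {l : List Term} (h : ∀ d ∈ l, get d [8] ≠ .top) (D : Term) :
    UniqueAct (l ++ [D]) := by
  have key : ∀ (i : ℕ) d, (l ++ [D])[i]? = some d → get d [8] = .top → i = l.length := by
    intro i d hi ha
    rcases lt_trichotomy i l.length with hl | hl | hl
    · rw [List.getElem?_append_left hl] at hi
      exact absurd ha (h d (mem_of_getElem? hi))
    · exact hl
    · rw [List.getElem?_eq_none (by simp; omega)] at hi
      cases hi
  intro i j d d' hi hj ha ha'
  rw [key i d hi ha, key j d' hj ha']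

namespace BInv

/-- Loading a document into an empty window. -/
theorem load_empty (hs : BInv E G s) {w : Ptr} (hw : WinAt s w) {D : Term}
    (hD : TreeOK E G false D.nf) : BInv E G (setAt s (w ++ [2]) (.seq [D])) := by
  obtain ⟨n, docs, op, ht, hn, hop, hd, hu⟩ := (hs.winTree hw).win_inv
  have ht' : (get s w).nf = .seq [n, .seq docs, op] := by rw [nf_get, ht]
  refine (hs.set_win hw ?_).1
  rw [nf_setAt_seq ht' 1]
  simp only [List.modify_succ_cons, List.modify_zero_cons, nf_seq, map_cons, map_nil]
  exact .win hn hop (by simpa using hD) (uniqueAct_single _)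

/-- Loading a document into a window after its active document has been deactivated. -/
theorem load_after (hs : BInv E G s) {w : Ptr} (hw : WinAt s w) {i : ℕ}
    (hd : IsActiveDoc s w (w ++ [2, i])) {D : Term} (hD : TreeOK E G false D.nf) :
    BInv E G (setAt (setAt s (w ++ [2, i, 8]) .bot) (w ++ [2])
      (.seq ((items (get (setAt s (w ++ [2, i, 8]) .bot) (w ++ [2]))).take i ++ [D]))) := by
  obtain ⟨h1, h2, n, docs, op, ht, hn, hop, hdc⟩ := hs.deactivate hw hd
  generalize setAt s (w ++ [2, i, 8]) .bot = s' at *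
  have ht' : (get s' w).nf = .seq [n, .seq docs, op] := by rw [nf_get, ht]
  have h3 : (Term.seq docs).nf = .seq docs := nf_of_mem ht' (by simp)
  refine (h1.set_win h2 ?_).1
  rw [nf_setAt_seq ht' 1, get_append, (get_win ht').2.1, items_of_nf h3]
  simp only [List.modify_succ_cons, List.modify_zero_cons, nf_seq, List.map_append, map_cons,
    map_nil]
  have hm : (docs.take i).map Term.nf = docs.take i := by
    rw [map_eq_self_iff]
    exact fun d hd => nf_of_mem h3 (List.mem_of_mem_take hd)
  rw [hm]
  refine .win hn hop ?_ (uniqueAct_concat (fun d hd => (hdc d (List.mem_of_mem_take hd)).2) _)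
  intro d hd
  rcases mem_append.1 hd with hd | hd
  · exact (hdc d (List.mem_of_mem_take hd)).1
  · rw [mem_singleton] at hd; exact hd ▸ hD

theorem storeCookies (hs : BInv E G s) {h : Str} {cs : List Term}
    (hcs : ∀ c ∈ cs, CookieOK E G h c.nf) : BInv E G (storeCookies (.str h) cs s) := by
  unfold Spresso.storeCookies
  induction cs generalizing s with
  | nil => exact hs
  | cons c cs ih =>
    rw [List.foldl_cons]
    refine ih ?_ fun c hc => hcs c (List.mem_cons_of_mem _ hc)
    split_ifs
    · refine hs.set_cookies rfl (nf_seq _) fun u hu => ?_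
      obtain ⟨x, hx, rfl⟩ := mem_map.1 hu
      rcases mem_append.1 hx with hx | hx
      · have hx := (List.mem_filter.1 hx).1
        obtain ⟨d, h1, h2⟩ := hs.cookie_items _ hx
        cases h1
        rwa [nf_of_mem_items hx]
      · rw [mem_singleton] at hx
        exact hx ▸ hcs c (by simp)
    · exact hs

theorem storeSts (hs : BInv E G s) {resp proto : Term} {h : Str}
    (hh : dictMem (get resp [4]) (K .hSts) → proto ≈ₜ K .https → E.cls h = .other) :
    BInv E G (storeSts resp (.str h) proto s) := by
  unfold Spresso.storeSts
  split_ifs with hc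
  · obtain ⟨l, h1, h2⟩ := hs.comp (k := 7) (by norm_num)
    rw [appendAt_eq]
    refine hs.set1 (k := 7) ?_
    rw [h1, append_items rfl (by rw [← h1, nf_get])]
    refine ⟨_, rfl, fun e he => ?_⟩
    rcases mem_append.1 he with he | he
    · exact h2 e he
    · rw [mem_singleton] at he
      exact ⟨h, he, hh hc.1 hc.2⟩
  · exact hs

/-- The effect of a response, in terms of its parts. -/
theorem processResponse (hE : EnvOK E) (hG : GWF E G) {s₀ : Term} (hs₀ : BInv E G s₀)
    (hs : BInv E G s) (h6 : G.v (.nu 6) = some .pub) (h8 : G.v (.nu 8) = some .pub)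
    {a resp ref req proto : Term} {h : Str} (ha : Safe E G a) (href : ref.nf = ref)
    (hh : get req [4] = .str h)
    (hck : ∀ c ∈ items (dictGet (get resp [4]) (K .hSetCookie)), CookieOK E G h c)
    (hst : dictMem (get resp [4]) (K .hSts) → proto ≈ₜ K .https → E.cls h = .other)
    (hloc : dictMem (get resp [4]) (K .hLocation) →
      Safe E G resp ∧ Safe E G req ∧ Safe E G proto)
    (hdoc : G.Named ref → (∃ x y, get resp [5] ≈ₜ .seq [x, y]) →
      TreeOK E G false (respDoc resp req proto).nf)
    (hxhr : ∀ L, G.role (.proj 1 ref : Term).nf = some (.doc L) →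
      (L.cls E = .other → Safe E G (.seq [K .xhr, get resp [5], get ref [2]])) ∧
      (L.cls E = .rp → RpInput E G (.seq [K .xhr, get resp [5], get ref [2]])) ∧
      (L.cls E = .idp → IdpInput E G L (.seq [K .xhr, get resp [5], get ref [2]])))
    {o : Out} (ho : o ∈ Spresso.processResponse a resp ref req proto s₀ s) : BOut E G o := by
  have dy := hG.dy
  obtain ⟨cs, hcs, s', hs', ho⟩ := processResponse_cases ho
  rw [hh] at hs'
  have b : BInv E G s' := by
    subst hs'
    refine (hs.storeCookies fun c hc => ?_).storeSts hst
    have := hcs.mem_iff.1 hc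
    rw [nf_of_mem_items this]
    exact hck c this
  have known : ∀ w, Subwindows s' w → get s' (w ++ [1]) ≈ₜ ref → G.Known ref := by
    intro w hw he
    have := b.window_known hw.winAt
    rw [equiv_iff_nf, nf_get, href] at he
    rwa [he] at this
  rcases ho with ⟨hl, rfl | ⟨⟨w, hw, he⟩, meth, body, hm, hb, ho⟩⟩ | ⟨w, hw, he, ho⟩ |
    ⟨w, d, hw, hd, he, rfl⟩ | rfl
  · exact hs₀.noOut
  · obtain ⟨l1, l2, l3⟩ := hloc hl
    have hnil : Safe E G (.seq []) := dy.nil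
    have hu : Safe E G (dictGet (get resp [4]) (K .hLocation)) := dy.dictGet (dy.get l1 _) _
    refine b.send_win hE hG h8 ha (known w hw he) (known_nu h6).safe ?_ (dy.get hu _)
      (dy.get hu _) (dy.get hu _) ?_ ?_ ?_ ?_ ho
    · rcases hm with rfl | rfl
      · exact dy.str _
      · exact dy.get l2 _
    · rcases hb with rfl | rfl
      · exact hnil
      · exact dy.get l2 _
    · unfold reqOrigin
      split_ifs
      · exact dy.pair (dy.dictGet (dy.get l2 _) _) (dy.pair (dy.get l2 _) l3)
      · exact dy.bot
    · unfold reqOrigin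
      split_ifs
      · exact .inr ⟨_, _, nf_seq _, .inl ⟨_, nf_seq _⟩⟩
      · exact .inl rfl
    · unfold reqReferrer
      split_ifs
      · exact dy.dictGet (dy.get l2 _) _
      · exact dy.bot
  · rcases ho with rfl | ⟨hx, ⟨-, rfl⟩ | ⟨i, hi, rfl⟩⟩
    · exact b.noOut
    · exact (b.load_empty hw.winAt (hdoc (known w hw he).named hx)).noOut
    · exact (b.load_after hw.winAt hi (hdoc (known w hw he).named hx)).noOut
  · obtain ⟨j, hj, rfl, -⟩ := hd
    obtain ⟨L, n, rf, sc, st, ins, subs, act, hd⟩ := b.isDoc hw.winAt hj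
    have hr : G.role (.proj 1 ref : Term).nf = some (.doc L) := by
      rw [equiv_iff_nf, nf_get, get_append, hd.gets.1] at he
      rw [← he, hd.role]
    have hx := hxhr L hr
    have hn : (Term.seq [K .xhr, get resp [5], get ref [2]]).nf =
        .seq [K .xhr, get resp [5], get ref [2]] := by
      simp only [nf_seq, map_cons, map_nil, nf_get]; rfl
    refine (b.append_input hw.winAt hj hd ?_ ?_ ?_).noOut <;> rw [hn]
    exacts [hx.1, hx.2.1, hx.2.2]
  · exact b.noOut

end BInv

theorem get_resp {n st hd bd t : Term} (h : t.nf = httpResponse n st hd bd) :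
    get t [2] = n ∧ get t [3] = st ∧ get t [4] = hd ∧ get t [5] = bd :=
  ⟨get_one h (k := 1) rfl, get_one h (k := 2) rfl, get_one h (k := 3) rfl,
    get_one h (k := 4) rfl⟩

theorem nf_respDoc {resp req : Term} {L : Loc} {n me hd bd : Term}
    (hreq : req = httpRequest n me (.str L.host) L.path L.par hd bd) (hreqn : req.nf = req) :
    (respDoc resp req L.proto).nf = .seq [ν 7, L.term, (reqReferrer req).nf, get resp [5, 1],
      get resp [5, 2], .seq [], .seq [], .top] := by
  have h := get_req n me (.str L.host) L.path L.par hd bd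
  rw [hreq] at hreqn
  have hn : L.path.nf = L.path ∧ L.par.nf = L.par :=
    ⟨nf_of_mem hreqn (by simp), nf_of_mem hreqn (by simp)⟩
  unfold respDoc
  rw [← hreq, hn.1, hn.2] at h
  simp only [nf_seq, map_cons, map_nil, urlTerm, nf_get, Loc.term, L.nf_proto]
  rw [h.2.2.1, h.2.2.2.1, h.2.2.2.2.1]
  rfl

namespace BInv

/-- Responses to requests of adversarial documents or to other hosts. -/
theorem response_adv (hE : EnvOK E) (hG : GWF E G) {s₀ : Term} (hs₀ : BInv E G s₀)
    (hs : BInv E G s) (h6 : G.v (.nu 6) = some .pub) (h8 : G.v (.nu 8) = some .pub)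
    {a resp ref req n me hd bd : Term} {L : Loc} (ha : Safe E G a) (href : ref.nf = ref)
    (hreq : req = httpRequest n me (.str L.host) L.path L.par hd bd) (hreqn : req.nf = req)
    (hreqs : Safe E G req) (hresp : Safe E G resp) (hL : L.cls E = .other)
    (hr : G.Known ref ∨ XhrRef E G ref L.host (L.https = false))
    (h7 : G.Named ref → G.v (.nu 7) = some (.doc L))
    {o : Out} (ho : o ∈ Spresso.processResponse a resp ref req L.proto s₀ s) : BOut E G o := by
  have dy := hG.dy
  have hg := get_req n me (.str L.host) L.path L.par hd bd
  rw [← hreq] at hg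
  have hpr : Safe E G L.proto := by unfold Loc.proto; split_ifs <;> exact dy.str _
  refine hs₀.processResponse hE hG hs h6 h8 ha href (h := L.host) hg.2.2.1 ?_ ?_ ?_ ?_ ?_ ho
  · exact fun c hc => .inl (dy.items (dy.dictGet (dy.get hresp _) _) hc)
  · intro _ h
    unfold Loc.cls at hL
    split_ifs at hL with hs
    · exact hL
    · rw [Loc.proto, if_neg hs, equiv_iff_nf] at h
      cases h
  · exact fun _ => ⟨hresp, hreqs, hpr⟩
  · intro hn _
    rw [nf_respDoc hreq hreqn]
    refine .doc (h7 hn) (.other hL ?_ (dy.get hresp _) (dy.get hresp _) (by simp)) (by simp)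
      (.inl rfl)
    refine dy.nf_iff.2 ?_
    unfold reqReferrer
    split_ifs
    · exact dy.dictGet (dy.get hreqs _) _
    · exact dy.bot
  · intro L' hL'
    rcases hr with hr | ⟨dn, x, L₁, rfl, hx, hd, hc, -, -⟩
    · exfalso
      rcases hr.named.cases with ⟨m, rfl⟩ | ⟨v, rfl⟩ <;> simp [Term.nf, redProj, Ghost.role] at hL'
    · have h1 : (Term.proj 1 (.seq [dn, x])).nf = dn := by
        simp [Term.nf, redProj, nfList_eq_map, Ghost.Named.nf (G := G) ⟨_, hd⟩]
      rw [h1, hd] at hL'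
      cases hL'
      refine ⟨fun _ => ?_, by simp [hc], by simp [hc]⟩
      exact dy.list ⟨dy.str _, dy.get hresp _, get_pair_two _ _ ▸ dy.nf_iff.2 hx⟩

/-- Responses of honest servers. -/
theorem response_prot (hE : EnvOK E) (hG : GWF E G) {s₀ : Term} (hs₀ : BInv E G s₀)
    (hs : BInv E G s) (h6 : G.v (.nu 6) = some .pub) (h8 : G.v (.nu 8) = some .pub)
    {a resp ref hd bd : Term} {q : Req} {parts : List Term} (ha : Safe E G a)
    (href : ref.nf = ref) (hq : CN q.term) (hok : ReqOK E G ref q)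
    (hresp : resp.nf = httpResponse q.n (K .s200) hd bd) (hR : Resp E G q hd bd parts)
    (hparts : ∀ p ∈ parts, SafeN E G p)
    (h7 : G.Named ref → G.v (.nu 7) = some (.doc ⟨true, q.host, q.path, q.par⟩))
    {o : Out} (ho : o ∈ Spresso.processResponse a resp ref q.term (K .https) s₀ s) :
    BOut E G o := by
  have dy := hG.dy
  obtain ⟨-, -, g4, g5⟩ := get_resp hresp
  have hbd : bd.nf = bd := by rw [← g5, nf_get]
  have nomem : ∀ k, k ≠ .hSetCookie → ¬ dictMem (get resp [4]) (K k) := by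
    rintro k hk ⟨e, he, hke⟩
    rw [g4] at he
    cases hR <;> simp only [items_seq, map_nil, map_cons, mem_singleton,
      not_mem_nil] at he
    subst he
    rw [hasKey_iff] at hke
    obtain ⟨v, hv⟩ := hke
    simp [Term.nf, nfList_eq_map] at hv
    exact hk hv.1.symm
  have hcl : (⟨true, q.host, q.path, q.par⟩ : Loc).cls E = E.cls q.host := rfl
  refine hs₀.processResponse hE hG hs h6 h8 ha href (h := q.host) (get_req _ _ _ _ _ _ _).2.2.1
    ?_ (fun h => absurd h (nomem _ (by simp))) (fun h => absurd h (nomem _ (by simp))) ?_ ?_ ho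
  · intro c hcc
    rw [g4] at hcc
    cases hR with
    | idpSign h1 h2 h3 =>
      rw [dictGet_cons, if_pos (hasKey_pair.2 rfl), get_pair_two, nf_seq, items_seq] at hcc
      refine .inr ⟨h1, _, ?_, h3⟩
      simpa [nfList_eq_map, Term.nf, h3.nf] using hcc
    | _ => simp [dictGet_nil, items_seq] at hcc
  · intro hn hxy
    have hnr : ∀ x y, ref ≠ .seq [x, y] := by
      rintro x y rfl
      obtain ⟨_, h⟩ := hn
      simp [Ghost.role] at h
    have e := nf_respDoc (resp := resp) (req := q.term) (L := ⟨true, q.host, q.path, q.par⟩)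
      (n := q.n) (me := q.meth) (hd := q.hdr) (bd := q.body) rfl hq.1
    rw [show (⟨true, q.host, q.path, q.par⟩ : Loc).proto = K .https from rfl] at e
    rw [e]
    obtain ⟨x, y, hxy⟩ := hxy
    rw [g5, equiv_iff_nf, hbd, nf_seq] at hxy
    have e1 : get resp [5, 1] = x.nf ∧ get resp [5, 2] = y.nf := by
      rw [show ∀ k, get resp [5, k] = get (get resp [5]) [k] from fun k => get_append resp [5] [k],
        show ∀ k, get resp [5, k] = get (get resp [5]) [k] from fun k => get_append resp [5] [k],
        g5, hxy]
      constructor <;> rw [get_seq (nf_seq _)] <;> simp [get_nil]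
    rw [e1.1, e1.2]
    refine .doc (h7 hn) ?_ (by simp) (.inl rfl)
    cases hR with
    | rpRoot h1 h2 =>
      simp only [Term.seq.injEq, map_cons, map_nil, List.cons.injEq, and_true] at hxy
      exact .rp h1 hxy.1.symm hxy.2.symm (.inr (.inr (.inl rfl))) dy.bot (by simp)
    | rpRedir h1 h2 =>
      simp only [Term.seq.injEq, map_cons, map_nil, List.cons.injEq, and_true] at hxy
      refine .rpRedir h1 hxy.1.symm ?_ (by simp)
      rw [← hxy.2]
      have h := hparts _ (List.mem_singleton_self _)
      rw [hxy.2] at h ⊢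
      rwa [Safe, nf_nf]
    | rpLogin h1 h2 h3 =>
      simp only [Term.seq.injEq, map_cons, map_nil, List.cons.injEq, and_true] at hxy
      exact .rpDead h1 (hxy.1 ▸ h3) (by simp)
    | idpLogin h1 h2 =>
      simp only [Term.seq.injEq, map_cons, map_nil, List.cons.injEq, and_true] at hxy
      exact .idp h1 hxy.1.symm (by simp)
    | fwd h1 =>
      simp only [Term.seq.injEq, map_cons, map_nil, List.cons.injEq, and_true] at hxy
      exact .fwd h1 hxy.1.symm
    | _ => simp at hxy
  · intro L' hL'
    have key : ∀ dn x L, ref = .seq [dn, x] → G.role dn = some (.doc L) →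
        L' = L ∧ get ref [2] = x := by
      rintro dn x L rfl hd
      have h1 : (Term.proj 1 (.seq [dn, x])).nf = dn := by
        simp [Term.nf, redProj, nfList_eq_map, Ghost.Named.nf (G := G) ⟨_, hd⟩]
      rw [h1, hd] at hL'
      cases hL'
      exact ⟨rfl, by rw [get_pair_two, nf_of_mem href (by simp)]⟩
    have nokey : ¬ G.Named ref := by
      intro h
      rcases h.cases with ⟨m, rfl⟩ | ⟨v, rfl⟩ <;> simp [Term.nf, redProj, Ghost.role] at hL'
    rw [g5]
    cases hok with
    | rpWin _ h => exact absurd h nokey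
    | idpWin _ h => exact absurd h nokey
    | fwdWin _ h => exact absurd h nokey
    | idpInfo _ h => subst h; simp [Term.nf, redProj, Ghost.role] at hL'
    | rpStart h1 h2 h3 h4 h5 h6 h7 =>
      obtain ⟨rfl, k2⟩ := key _ _ _ h2 h3
      refine ⟨by simp [h4], fun _ => .inr ⟨_, _, rfl, ?_⟩, by simp [h4]⟩
      cases hR with
      | rpStart r1 r2 r3 =>
        rw [h6] at r3
        refine .inl ⟨_, _, _, rfl, ?_, .inl ⟨_, _, r3, h7⟩⟩
        have := hparts _ (List.mem_cons_self ..)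
        simp only [nf_seq, map_cons, map_nil, Term.seq.injEq, List.cons.injEq, and_true] at hbd
        rw [Safe, hbd.1.2]
        exact this
      | _ => simp_all
    | rpLogin h1 h2 h3 h4 h5 h6 h7 =>
      obtain ⟨rfl, k2⟩ := key _ _ _ h2 h3
      refine ⟨by simp [h4], fun _ => .inr ⟨_, _, rfl, ?_⟩, by simp [h4]⟩
      cases hR with
      | rpLogin r1 r2 r3 => exact .inr ⟨_, _, _, rfl, r3⟩
      | _ => simp_all
    | @idpSign dn x L em pw T F h1 h2 h3 h4 h5 h6 h7 h8 h9 h10 =>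
      obtain ⟨rfl, k2⟩ := key _ _ _ h2 h3
      refine ⟨by simp [h4], by simp [h4], fun _ => .inr ⟨_, _, rfl, ?_⟩⟩
      cases hR with
      | idpSign r1 r2 r3 =>
        have hb := (Req.cn hq).2.2.2.2.2
        have cn : CN (.seq [dictGet q.body (K .tag), dictGet q.body (K .email),
            dictGet q.body (K .fwdDomain)]) := by
          simp [cn_seq, hb.dictGet]
        have d1 : dictGet q.body (K .tag) = T ∧ dictGet q.body (K .email) = em ∧
            dictGet q.body (K .fwdDomain) = F := by
          have hcn := hb
          rw [h6] at hcn ⊢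
          simp only [cn_seq, mem_cons, not_mem_nil, or_false, forall_eq_or_imp,
            forall_eq] at hcn
          refine ⟨?_, ?_, ?_⟩ <;> simp [dictGet_cons, hasKey_pair, get_pair_two, Term.nf]
          exacts [hcn.2.2.1.2.1, hcn.1.2.1, hcn.2.2.2.2.1]
        rw [d1.1, d1.2.1, d1.2.2] at cn hbd ⊢
        have cn' := cn_seq.1 cn
        by_cases hp : ProtSig E (.seq [T, em, F])
        · obtain ⟨d, u, κ, a, c, he, hd, -⟩ := hp
          simp only [Term.seq.injEq, List.cons.injEq, and_true] at he
          obtain ⟨rfl, rfl, rfl⟩ := he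
          rcases h10 with h | ⟨ht, hf⟩
          · cases h
          · exact .inr ⟨_, _, _, _, hf.symm, hE.cls_fd ⟨_, h1⟩, ht.symm, hd⟩
        · refine .inl ?_
          rw [Safe, hbd]
          refine .sigY ?_ cn hp
          rw [← cn.1]
          exact dy.seq (by simp [h7, h8, h9])
      | _ => simp_all

end BInv

theorem Comps.mono_set {n : ℕ} {C C' : ℕ → Term → Prop} {s v : Term} (h : Comps n C s) {k : ℕ}
    (hC : ∀ j u, j ≠ k + 1 → C j u → C' j u) (hv : C' (k + 1) v.nf) :
    Comps n C' (setAt s [k + 1] v) := by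
  obtain ⟨ts, h1, rfl, h2⟩ := h
  refine ⟨_, nf_setAt_seq h1 k, by simp, fun j u hj => ?_⟩
  rw [List.getElem?_modify] at hj
  cases hj' : ts[j]? with
  | none => simp [hj'] at hj
  | some w =>
    rw [hj'] at hj
    by_cases hkj : k = j
    · subst hkj
      simp only [if_true, Option.map_eq_map, Option.map_some, Option.some.injEq] at hj
      exact hj ▸ hv
    · simp only [hkj, if_false, Option.map_eq_map, Option.map_some, Option.some.injEq] at hj
      exact hj ▸ hC _ _ (by omega) (h2 _ _ hj')

/-- The components with indices in `S` are known. -/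
def SafeOn (E : Env) (G : Ghost) (S : List ℕ) : Term → Prop :=
  Comps 12 fun k u => k ∈ S → Safe E G u

theorem SafeOn.set {S : List ℕ} (h : SafeOn E G S s) {k : ℕ} {v : Term} (hG : GWF E G)
    (hv : Safe E G v) : SafeOn E G (k :: S) (setAt s [k] v) := by
  cases k with
  | zero =>
    have : (setAt s [0] v).nf = s.nf := by
      obtain ⟨ts, h1, h2⟩ := h
      rw [show setAt s [0] v = .seq ts by simp [setAt, h1], ← h1, nf_nf]
    obtain ⟨ts, h1, h2, h3⟩ := h
    exact ⟨ts, this.trans h1, h2, fun k u hu hk => h3 k u hu (by simpa using hk)⟩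
  | succ k =>
    refine h.mono_set (fun j u hj hu hjS => hu ?_) fun _ => hG.dy.nf_iff.2 hv
    simpa [hj] using hjS

theorem safe_km (hE : EnvOK E) (hG : GWF E G) : Safe E G E.km := by
  obtain ⟨l, hl⟩ := hE.km_seq
  have hn : E.km.nf = .seq l := by rw [hE.km.1, hl]
  rw [hl]
  refine hG.dy.seq fun t ht => ?_
  rw [← items_of_nf hn] at ht
  obtain ⟨h, n, rfl⟩ := hE.km_pub t ht
  exact hG.dy.pair (hG.dy.str _) (.pubn _)

namespace BInv

theorem closeCorrupt_safe (hE : EnvOK E) (hG : GWF E G) (hs : BInv E G s) :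
    Safe E G (closeCorrupt s) := by
  have dy := hG.dy
  have h0 : SafeOn E G [2, 5, 7, 8, 9] s := by
    obtain ⟨ts, h1, h2, h3⟩ := hs
    refine ⟨ts, h1, h2, fun k u hu hk => ?_⟩
    have h := h3 k u hu
    simp only [mem_cons, not_mem_nil, or_false] at hk
    rcases hk with hk | hk | hk | hk | hk <;> rw [hk] at h
    · exact (h : u = E.ids) ▸ safe_ids hE hG
    · exact h
    · exact (h : u = E.km) ▸ safe_km hE hG
    · obtain ⟨l, rfl, hl⟩ := h
      exact dy.seq fun t ht => by obtain ⟨d, rfl, -⟩ := hl t ht; exact dy.str _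
    · obtain ⟨a, ha⟩ := hE.da_addr
      rw [(h : u = E.da), ha]
      exact dy.addr _
  have hnil : Safe E G (.seq []) := dy.nil
  have h5 := ((((h0.set (k := 3) hG hnil).set (k := 1) hG hnil).set (k := 10) hG hnil).set
    (k := 11) hG hnil).set (k := 6) hG hnil
  have h12 := (h5.set (k := 4) (v := .seq ((items (get s [4])).map fun e =>
    .seq [get e [1], .seq ((items (get e [2])).filter fun c => get c [2, 3] ≈ₜ .bot)])) hG
    ?_).set (k := 12) hG (dy.str (.kw .closecorrupt))
  · unfold closeCorrupt
    simp only
    rw [show get (setAt (setAt (setAt (setAt (setAt s [3] (.seq [])) [1] (.seq [])) [10] (.seq []))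
      [11] (.seq [])) [6] (.seq [])) [4] = get s [4] by
        simp only [get_setAt_ne (show 6 ≠ 4 by norm_num), get_setAt_ne (show 11 ≠ 4 by norm_num),
          get_setAt_ne (show 10 ≠ 4 by norm_num), get_setAt_ne (show 1 ≠ 4 by norm_num),
          get_setAt_ne (show 3 ≠ 4 by norm_num)]]
    refine dy.nf_iff.1 ?_
    obtain ⟨ts, h1, h2, h3⟩ := h12
    rw [h1]
    refine dy.seq fun t ht => ?_
    obtain ⟨k, hk, rfl⟩ := List.mem_iff_getElem.1 ht
    refine h3 k _ (List.getElem?_eq_getElem hk) ?_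
    rw [h2] at hk
    interval_cases k <;> simp
  · obtain ⟨l, h1, h2⟩ := hs.comp (k := 3) (by norm_num)
    refine dy.seq fun e he => ?_
    obtain ⟨e', he', rfl⟩ := mem_map.1 he
    clear he
    have hen := nf_of_mem_items he'
    rw [items_of_nf (by rw [nf_get, h1])] at he'
    obtain ⟨d, cs, rfl, hc⟩ := h2 e' he'
    have hcn : (Term.seq cs).nf = .seq cs := nf_of_mem hen (by simp)
    rw [get_one hen (k := 0) rfl, get_one hen (k := 1) rfl, items_of_nf hcn]
    refine dy.pair (dy.str _) (dy.seq fun c hcc => ?_)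
    rw [List.mem_filter, decide_eq_true_eq] at hcc
    rcases hc c hcc.1 with h | ⟨-, v, rfl, -⟩
    · exact h
    · have h := hcc.2
      rw [equiv_iff_nf, nf_get, show ∀ t, get t [2, 3] = get (get t [2]) [3] from
        fun t => get_append t [2] [3], get_pair_two, get_nf, get_seq (nf_seq _)] at h
      simp [get_nil, Term.nf] at h

theorem trigger (hE : EnvOK E) (hG : GWF E G) (hs : BInv E G s) (hcl : Closed s)
    (hν : ∀ k, G.v (.nu k) = some .pub) {domains : Finset Str} {a : Term} (ha : Safe E G a)
    {o : Out} (ho : o ∈ browserTrigger domains a s) : BOut E G o := by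
  have dy := hG.dy
  have hnil : Safe E G (.seq []) := dy.nil
  have hk : ∀ k, Safe E G (ν k) := fun k => (known_nu (hν k)).safe
  rcases ho with (ho | ⟨proto, host, path, params, hp, -, -, ho⟩) | ho
  · rw [mem_ofPred_eq] at ho
    split_ifs at ho with hc
    · obtain ⟨w, d, hw, -, hd, ho⟩ := ho
      exact hs.runScript hE hG hcl hν ha hw.winAt hd ho
    · exact ho ▸ hs.noOut
  · have b := (hs.append_window (op := .bot) (known_nu (hν 1)) dy.bot).1
    refine b.send_win hE hG (hν 8) ha (known_nu (hν 1)) (hk 2) (dy.str _) (dy.str _) (dy.str _) ?_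
      hnil dy.bot (.inl rfl) dy.bot ho
    refine dy.seq fun t ht => ?_
    obtain ⟨x, -, rfl⟩ := mem_map.1 ht
    exact dy.pair (dy.str _) (dy.str _)
  · rw [mem_ofPred_eq] at ho
    split_ifs at ho with hc
    · obtain ⟨w, d, hw, -, ⟨j, hj, rfl, -⟩, ho⟩ := ho
      obtain ⟨L, n, rf, sc, st, ins, subs, act, hd⟩ := hs.isDoc hw.winAt hj
      have b := hs.cancelNav (get s (w ++ [1]))
      have hw' := hs.window_known hw.winAt
      simp only at ho
      rw [get_append s (w ++ [2, j]) [2], hd.gets.2.1, get_append s (w ++ [2, j]) [3],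
        hd.gets.2.2.1, L.get_term.1, L.get_term.2.1, L.get_term.2.2.1, L.get_term.2.2.2] at ho
      by_cases hL : L.cls E = .other
      · have hl := hG.loc_safe hd.role (by simp [hL])
        have hrf : Safe E G rf := by
          have hD := hd.doc
          cases hD with
          | other _ h => exact h
          | _ => simp_all
        exact b.send_win hE hG (hν 8) ha hw' (hk 2) (dy.str _) (dy.str _) (dy.nf_iff.2 hl.1)
          (dy.nf_iff.2 hl.2.1) hnil dy.bot (.inl rfl) hrf ho
      · have hpr : L.proto = K .https := by
          unfold Loc.cls at hL
          unfold Loc.proto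
          split_ifs at hL ⊢
          · rfl
          · exact absurd rfl hL
        have hh : L.cls E = E.cls L.host := Loc.cls_host hL
        rw [hpr] at ho
        refine b.send hE hG (hν 8) ha (dy.str _) ?_ ho
        rw [nf_httpRequest, b.sendProto_https, nf_nf, nf_nf]
        refine .prot (q := ⟨(ν 2).nf, (K .get).nf, L.host, L.path.nf, L.par.nf, _, _⟩) rfl rfl
          (hh ▸ hL) ?_
        have hok := hG.ok _ _ hd.role
        have hpp := hG.closed _ _ hd.role
        rw [hpp.1.1, hpp.2.1]
        cases hc' : E.cls L.host with
        | other => exact absurd (hh.trans hc') hL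
        | rp =>
          have hl := hok.1 (by rw [hh, hc']; simp)
          exact .rpWin hc' hw'.nf_known.named hl.1 hl.2 (hdrOpen_hdrs _ (.inl rfl))
        | idp =>
          have hl := hok.1 (by rw [hh, hc']; simp)
          exact .idpWin hc' hw'.nf_known.named hl.1 hl.2
        | fwd => exact .fwdWin hc' hw'.nf_known.named (hok.2 (by rw [hh, hc']))
    · exact ho ▸ hs.noOut

end BInv

/-! # Roles of the placeholders of a step -/

/-- The role assignment in which the placeholder `ν k` has the role `ρ` and all other placeholders
of processes are public. -/
def Ghost.upd (G : Ghost) (k : ℕ) (ρ : Role) : Ghost where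
  n := G.n
  v
    | .nu j => some (if j = k then ρ else .pub)
    | .lam j => G.v (.lam j)

structure NuOK (E : Env) (G : Ghost) (ρ : Role) : Prop where
  closed : ρ.Closed
  ok : RoleOK E G ρ
  key : ∀ ref q, ρ = .key ref q → E.cls q.host ≠ .other

theorem nuOK_pub : NuOK E G .pub := ⟨trivial, trivial, by simp⟩
theorem nuOK_priv : NuOK E G .priv := ⟨trivial, trivial, by simp⟩

theorem Ghost.upd_self (G : Ghost) (k : ℕ) (ρ : Role) : (G.upd k ρ).v (.nu k) = some ρ := by
  simp [Ghost.upd]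

theorem Ghost.upd_ne (G : Ghost) {k j : ℕ} (ρ : Role) (h : j ≠ k) :
    (G.upd k ρ).v (.nu j) = some .pub := by
  simp [Ghost.upd, h]

/-- The placeholders of processes have no roles. -/
def Ghost.NoNu (G : Ghost) : Prop := ∀ k, G.v (.nu k) = none

theorem Ghost.upd_role {a : Term} {k : ℕ} {ρ ρ' : Role} (h : (G.upd k ρ).role a = some ρ') :
    G.role a = some ρ' ∨ (∃ j, a = ν j) ∧ (ρ' = ρ ∨ ρ' = .pub) := by
  rcases Ghost.Named.cases (G := G.upd k ρ) ⟨_, h⟩ with ⟨m, rfl⟩ | ⟨j | j, rfl⟩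
  · exact .inl h
  · right
    simp only [Ghost.role, Ghost.upd, Option.some.injEq] at h
    refine ⟨⟨j, rfl⟩, ?_⟩
    split_ifs at h
    · exact .inl h.symm
    · exact .inr h.symm
  · exact .inl h

theorem GWF.upd (hG : GWF E G) (h0 : G.NoNu) {k : ℕ} {ρ : Role} (hρ : NuOK E G ρ) :
    GWF E (G.upd k ρ) ∧ Tr E G .var (G.upd k ρ) := by
  have hst : GStat E (G.upd k ρ) := ⟨hG.ssl, fun a ref q h => by
    rcases Ghost.upd_role h with h | ⟨-, h | h⟩
    · exact hG.key a ref q h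
    · exact hρ.key _ _ h.symm
    · cases h⟩
  have hT : Tr E G .var (G.upd k ρ) := by
    refine ⟨hst, hG.closed, fun a ρ' ha => ?_⟩
    rw [ren_var, Ghost.Named.nf (G := G) ⟨ρ', ha⟩]
    rcases Ghost.Named.cases (G := G) ⟨_, ha⟩ with ⟨m, rfl⟩ | ⟨j | j, rfl⟩
    · exact ha
    · exact absurd ha (by simp [Ghost.role, h0 j])
    · exact ha
  refine ⟨⟨hst, fun a ρ' h => ?_, fun a ρ' h => ?_, hG.sk, hG.pubs⟩, hT⟩
  · rcases Ghost.upd_role h with h | ⟨-, rfl | rfl⟩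
    · exact hG.closed _ _ h
    · exact hρ.closed
    · trivial
  · rcases Ghost.upd_role h with h | ⟨-, rfl | rfl⟩
    · exact hT.roleOK (hG.closed _ _ h) (hG.ok _ _ h)
    · exact hT.roleOK hρ.closed hρ.ok
    · trivial

theorem Tr.safe_var {G' : Ghost} (h : Tr E G .var G') {t : Term} (ht : Safe E G t) :
    Safe E G' t := h.stat.dy.nf_iff.1 (ren_var t ▸ h.safe ht)

theorem Comps.of_nf {n : ℕ} {C : ℕ → Term → Prop} (h : Comps n C s.nf) : Comps n C s := by
  rwa [Comps, nf_nf] at h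

theorem Tr.bInv_var {G' : Ghost} (h : Tr E G .var G') (hE : EnvOK E) (hs : BInv E G s) :
    BInv E G' s := .of_nf (ren_var s ▸ h.bInv hE.toEnvClosed hs)

namespace BInv

theorem pending_mem (hs : BInv E G s) {n : Term} (h : dictMem (get s [10]) n) :
    ∃ ref M proto, dictGet (get s [10]) n = .seq [ref, M, proto] ∧ Pending E G ref M proto ∧
      ref.nf = ref ∧ M.nf = M ∧ proto.nf = proto := by
  obtain ⟨l, h1, h2⟩ := hs.comp (k := 9) (by norm_num)
  obtain ⟨e, hm, he⟩ := dictGet_of_mem h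
  have hen := nf_of_mem_items hm
  rw [items_of_nf (by rw [nf_get, h1])] at hm
  obtain ⟨k, ref, M, proto, rfl, hp⟩ := h2 _ hm
  have h3 := nf_of_mem hen (u := .seq [ref, M, proto]) (by simp)
  rw [get_pair_two, h3] at he
  exact ⟨ref, M, proto, he, hp, nf_of_mem h3 (by simp), nf_of_mem h3 (by simp),
    nf_of_mem h3 (by simp)⟩

theorem sent_mem (hs : BInv E G s) {ref M key f : Term}
    (h : .seq [ref, M, key, f] ∈ items (get s [11])) :
    Sent E G ref M key ∧ ref.nf = ref ∧ M.nf = M ∧ key.nf = key := by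
  obtain ⟨l, h1, h2⟩ := hs.comp (k := 10) (by norm_num)
  have hn := nf_of_mem_items h
  rw [items_of_nf (by rw [nf_get, h1])] at h
  obtain ⟨_, _, _, _, he, hp⟩ := h2 _ h
  simp only [Term.seq.injEq, List.cons.injEq, and_true] at he
  obtain ⟨rfl, rfl, rfl, rfl⟩ := he
  exact ⟨hp, nf_of_mem hn (by simp), nf_of_mem hn (by simp), nf_of_mem hn (by simp)⟩

theorem removeElem (hs : BInv E G s) (e : Term) :
    BInv E G (setAt s [11] (removeElem (get s [11]) e)) :=
  hs.filter11 fun _ h => List.mem_of_mem_erase h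

/-- Moving a request from the list of requests waiting for name resolution to the list of requests
waiting for a response. -/
theorem resolve (hs : BInv E G s) (n : Term) {ref M key a : Term}
    (h : Sent E G ref.nf M.nf key.nf) :
    BInv E G (appendAt (setAt s [10] (dictDel (get s [10]) n)) [11] (.seq [ref, M, key, a])) := by
  have b : BInv E G (setAt s [10] (dictDel (get s [10]) n)) := by
    exact hs.filter10 fun e => decide ¬ HasKey n e
  obtain ⟨l, h1, h2⟩ := b.comp (k := 10) (by norm_num)
  rw [appendAt_eq]
  refine b.set1 (k := 10) ?_
  rw [h1, append_items rfl (by rw [← h1, nf_get])]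
  refine ⟨_, rfl, fun e he => ?_⟩
  rcases mem_append.1 he with he | he
  · exact h2 e he
  · rw [mem_singleton] at he
    exact ⟨_, _, _, _, by rw [he, nf_seq]; rfl, h⟩

end BInv

theorem get_triple {t a b c : Term} (h : t = .seq [a, b, c]) :
    get t [1] = a.nf ∧ get t [2] = b.nf ∧ get t [3] = c.nf := by
  subst h
  refine ⟨?_, ?_, ?_⟩ <;> rw [get_seq (nf_seq _)] <;> simp [get_nil]

theorem get_quad {t a b c d : Term} (h : t.nf = .seq [a, b, c, d]) :
    get t [1] = a ∧ get t [2] = b ∧ get t [3] = c ∧ get t [4] = d :=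
  ⟨get_one h (k := 0) rfl, get_one h (k := 1) rfl, get_one h (k := 2) rfl,
    get_one h (k := 3) rfl⟩

theorem decs_cases {m k : Term} {w : Kw} (h : .proj 1 (.decs m k) ≈ₜ K w) :
    m.nf = .encs (Term.decs m k).nf k.nf := by
  rw [equiv_iff_nf] at h
  change redProj 1 (Term.decs m k).nf = K w at h
  have : (Term.decs m k).nf = redDecs m.nf k.nf := rfl
  rw [this] at h ⊢
  unfold redDecs at h ⊢
  split
  · rename_i y k' hm
    simp only [hm] at h
    split_ifs at h ⊢ with hk
    · rw [hm, hk]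
    · cases h
  · rename_i hm
    split at h
    · rename_i y k' hm'
      exact absurd hm' (hm _ _)
    · cases h

/-- The outcome of a step of the browser. -/
def BStep (E : Env) (G : Ghost) (s : Term) (o : Out) : Prop :=
  o = ([], setAt s [12] (K .fullcorrupt)) ∨ ∃ k ρ, NuOK E G ρ ∧
    (BOut E (G.upd k ρ) o ∨ o.1 = [] ∧ Safe E (G.upd k ρ) o.2 ∧ o.2 = closeCorrupt s)

theorem BStep.noOut (hE : EnvOK E) (hG : GWF E G) (h0 : G.NoNu) (hs : BInv E G s) :
    BStep E G s ([], s) :=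
  .inr ⟨0, .pub, nuOK_pub, .inl ((hG.upd h0 nuOK_pub).2.bInv_var hE hs).noOut⟩

theorem Pending.not_bad {ref M proto : Term} {d : Str} (h : Pending E G ref M proto)
    (hM : M.nf = M) (hd : get M [4] = .str d) : (∃ n me pa par hd bd, M = httpRequest n me (.str d) pa par hd bd ∧
      Safe E G M ∧ (G.Known ref ∧ HdrOpen E hd ∨ XhrRef E G ref d (proto = K .http))) ∨
    (∃ q : Req, q.host = d ∧ M = q.term ∧ proto = K .https ∧ E.cls d ≠ .other ∧
      ReqOK E G ref q) := by
  cases h with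
  | bad h1 h2 =>
    obtain ⟨ts, rfl⟩ := h2
    rw [h1, (get_req ..).2.2.1, nf_seq] at hd
    cases hd
  | @win n me h pa par _ bd h1 h2 h3 h4 =>
    rw [h1, (get_req ..).2.2.1, nf_of_mem (hM.trans h1) (u := h) (by simp)] at hd
    subst hd
    exact .inl ⟨_, _, _, _, _, _, h1, h2, .inl ⟨h3, h4⟩⟩
  | xhr h1 h2 h3 =>
    rw [h1, (get_req ..).2.2.1] at hd
    cases hd
    exact .inl ⟨_, _, _, _, _, _, h1, h2, .inr h3⟩
  | @prot q h1 h2 h3 h4 =>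
    rw [h1, Req.term, (get_req ..).2.2.1] at hd
    cases hd
    exact .inr ⟨q, rfl, h1, h2, h3, h4⟩

namespace BInv

theorem step_encrypted (hE : EnvOK E) (hG : GWF E G) (h0 : G.NoNu) (hs : BInv E G s)
    (hcl : Closed s) {a f m e : Term} (ha : Safe E G a) (hm : Safe E G m)
    (he : MatchesEncrypted (get s [11]) m f e) {o : Out}
    (ho : if ¬ get (get (.decs m (get e [3])) []) [2] ≈ₜ get e [2, 2] then o = ([], s)
      else o ∈ Spresso.processResponse a (get (.decs m (get e [3])) []) (get e [1]) (get e [2])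
        (K .https) s (setAt s [11] (Spresso.removeElem (get s [11]) e))) : BStep E G s o := by
  obtain ⟨ref, M, key, rfl, hmem, hbot, hresp⟩ := he
  obtain ⟨hsent, hrn, hMn, hkn⟩ := hs.sent_mem hmem
  have hen := nf_of_mem_items hmem
  obtain ⟨g1, g2, g3, -⟩ := get_quad hen
  rw [show ∀ t, get t [2, 2] = get (get t [2]) [2] from fun t => get_append t [2] [2], g1, g2, g3,
    get_nil] at ho
  have hcM : Closed M := by
    have := Closed.dy.get (Closed.dy.items (Closed.dy.get hcl [11]) hmem) [2]
    rwa [g2] at this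
  have hb := hs.removeElem (.seq [ref, M, key, f.nf])
  split_ifs at ho with hc
  · cases hsent with
    | @adv n me h pa par hd bd h1 h2 h3 h4 =>
      rcases h4 with h4 | ⟨h4, h5⟩
      · exact absurd h4 hbot
      have hL : (⟨true, h, pa, par⟩ : Loc).cls E = .other := h5
      have hcn := hcM.cn
      rw [hMn, h1] at hcn
      have hcq := Req.cn (q := ⟨n, me, h, pa, par, hd, bd⟩) hcn
      have hsM := h2
      rw [Safe, hMn, h1] at hsM
      have hρ : NuOK E G (.doc ⟨true, h, pa, par⟩) := by
        refine ⟨⟨hcq.2.2.1, hcq.2.2.2.1⟩, ⟨fun _ => ⟨?_, ?_⟩, fun h => by simp [hL] at h⟩, by simp⟩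
        · rw [Safe, hcq.2.2.1.1]; exact hsM.of_seq _ (by simp)
        · rw [Safe, hcq.2.2.2.1.1]; exact hsM.of_seq _ (by simp)
      refine .inr ⟨7, _, hρ, .inl ?_⟩
      obtain ⟨hG', hT⟩ := hG.upd (k := 7) h0 hρ
      have hS := (hG.dy.decs hm h4.safe)
      have key := (hT.bInv_var hE hs).response_adv hE hG' (hT.bInv_var hE hb)
        (G.upd_ne _ (by norm_num)) (G.upd_ne _ (by norm_num)) (L := ⟨true, h, pa, par⟩)
        (hT.safe_var ha) hrn h1 hMn (hT.safe_var h2) (hT.safe_var (hG.dy.nf_iff.2 hS)) hL ?_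
        (fun _ => G.upd_self _ _) (o := o)
      · exact key ho
      · rcases h3 with h3 | h3
        · have := hT.compat.known h3
          rw [ren_var, hrn] at this
          exact .inl this
        · have := hT.xhrRef h3 (q := False) (fun h => hbot h)
          rw [ren_var, hrn] at this
          obtain ⟨dn, x, L, z1, z2, z3, z4, z5, z6⟩ := this
          exact .inr ⟨dn, x, L, z1, z2, z3, z4, z5, z6.imp_left False.elim⟩
    | @prot q h1 h2 =>
      have hok : ReqOK E G ref q := hG.ok _ _ h2
      have hcq : CN q.term := (hG.closed _ _ h2).2
      have hcls := hG.key _ _ _ h2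
      have hdec := decs_cases hresp
      rw [Safe, hdec, hkn] at hm
      rcases hm.of_encs with ⟨-, h⟩ | ⟨ref', q', hd, bd, parts, r1, r2, r3, r4⟩
      · exact absurd h (not_safeN h2 id)
      rw [h2] at r1
      cases r1
      have hcq' := Req.cn hcq
      have hρ : NuOK E G (if G.Named ref then .doc ⟨true, q.host, q.path, q.par⟩ else .pub) := by
        split_ifs with hn
        · refine ⟨⟨hcq'.2.2.1, hcq'.2.2.2.1⟩, ?_, by simp⟩
          have hnr : ∀ x y, ref ≠ .seq [x, y] := by
            rintro x y rfl
            obtain ⟨_, h⟩ := hn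
            simp [Ghost.role] at h
          have hcl' : (⟨true, q.host, q.path, q.par⟩ : Loc).cls E = E.cls q.host := rfl
          cases hok with
          | rpWin z1 _ z3 z4 => exact ⟨fun _ => ⟨z3, z4⟩, fun h => by simp [hcl', z1] at h⟩
          | idpWin z1 _ z3 z4 => exact ⟨fun _ => ⟨z3, z4⟩, fun h => by simp [hcl', z1] at h⟩
          | fwdWin z1 _ z3 => exact ⟨fun h => absurd (hcl'.trans z1) h, fun _ => z3⟩
          | idpInfo _ z =>
            subst z
            obtain ⟨_, h⟩ := hn
            simp [Ghost.role] at h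
          | rpStart _ z => exact absurd z (hnr _ _)
          | rpLogin _ z => exact absurd z (hnr _ _)
          | idpSign _ z => exact absurd z (hnr _ _)
        · exact nuOK_pub
      refine .inr ⟨7, _, hρ, .inl ?_⟩
      obtain ⟨hG', hT⟩ := hG.upd (k := 7) h0 hρ
      have hok' := hT.reqOK hok
      have hR' := r2.ren hT.compat hcq
      have hq : q.ren .var = q := Req.term_inj (by rw [← ren_req, hcq.ren_eq])
      rw [ren_var, hrn, hq] at hok'
      subst h1
      refine (hT.bInv_var hE hs).response_prot hE hG' (hT.bInv_var hE hb)
        (G.upd_ne _ (by norm_num)) (G.upd_ne _ (by norm_num)) (hT.safe_var ha) hrn hcq hok'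
        ?_ hR' ?_ ?_ ho
      · rw [nf_nf, ← nf_nf (Term.decs m key), r4]
        simp only [httpResponse, nf_seq, map_cons, map_nil, ren_var]
        rw [hcq'.1.1]
        rfl
      · simp only [mem_map, forall_exists_index, and_imp, forall_apply_eq_imp_iff₂]
        intro p hp
        exact SafeN.ren hT.stat hT.closed hT.compat (r3 p hp)
      · rintro ⟨ρ', hn⟩
        rw [G.upd_self, if_pos]
        rcases Ghost.upd_role hn with h | ⟨⟨j, rfl⟩, -⟩
        · exact ⟨_, h⟩
        · exfalso
          have := (hG.closed _ _ h2).1.2 (.nu j)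
          simp at this
  · exact ho ▸ BStep.noOut hE hG h0 hs

theorem step_plain (hE : EnvOK E) (hG : GWF E G) (h0 : G.NoNu) (hs : BInv E G s)
    (hcl : Closed s) {a f m e : Term} (ha : Safe E G a) (hm : Safe E G m)
    (he : MatchesPlain (get s [11]) m f e) {o : Out}
    (ho : o ∈ Spresso.processResponse a (get m []) (get e [1]) (get e [2])
        (K .http) s (setAt s [11] (Spresso.removeElem (get s [11]) e))) : BStep E G s o := by
  obtain ⟨ref, M, rfl, hmem, -, -⟩ := he
  obtain ⟨hsent, hrn, hMn, -⟩ := hs.sent_mem hmem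
  have hen := nf_of_mem_items hmem
  obtain ⟨g1, g2, -, -⟩ := get_quad hen
  rw [g1, g2, get_nil] at ho
  have hcM : Closed M := by
    have := Closed.dy.get (Closed.dy.items (Closed.dy.get hcl [11]) hmem) [2]
    rwa [g2] at this
  have hb := hs.removeElem (.seq [ref, M, .bot, f.nf])
  cases hsent with
  | @adv n me h pa par hd bd h1 h2 h3 _ =>
    have hL : (⟨false, h, pa, par⟩ : Loc).cls E = .other := rfl
    have hcn := hcM.cn
    rw [hMn, h1] at hcn
    have hcq := Req.cn (q := ⟨n, me, h, pa, par, hd, bd⟩) hcn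
    have hsM := h2
    rw [Safe, hMn, h1] at hsM
    have hρ : NuOK E G (.doc ⟨false, h, pa, par⟩) := by
      refine ⟨⟨hcq.2.2.1, hcq.2.2.2.1⟩, ⟨fun _ => ⟨?_, ?_⟩, fun h => by simp [hL] at h⟩, by simp⟩
      · rw [Safe, hcq.2.2.1.1]; exact hsM.of_seq _ (by simp)
      · rw [Safe, hcq.2.2.2.1.1]; exact hsM.of_seq _ (by simp)
    refine .inr ⟨7, _, hρ, .inl ?_⟩
    obtain ⟨hG', hT⟩ := hG.upd (k := 7) h0 hρ
    refine (hT.bInv_var hE hs).response_adv hE hG' (hT.bInv_var hE hb)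
      (G.upd_ne _ (by norm_num)) (G.upd_ne _ (by norm_num)) (L := ⟨false, h, pa, par⟩)
      (hT.safe_var ha) hrn h1 hMn (hT.safe_var h2) (hT.safe_var (hG.dy.nf_iff.2 hm)) hL ?_
      (fun _ => G.upd_self _ _) ho
    rcases h3 with h3 | h3
    · have := hT.compat.known h3
      rw [ren_var, hrn] at this
      exact .inl this
    · have := hT.xhrRef h3 (q := True) (fun _ => trivial)
      rw [ren_var, hrn] at this
      obtain ⟨dn, x, L, z1, z2, z3, z4, z5, z6⟩ := this
      exact .inr ⟨dn, x, L, z1, z2, z3, z4, z5, .inl rfl⟩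
  | prot _ h => simp [Ghost.role] at h

theorem step_dns (hE : EnvOK E) (hG : GWF E G) (h0 : G.NoNu) (hs : BInv E G s)
    (hcl : Closed s) {domains : Finset Str} {a m : Term} (ha : Safe E G a) (hm : Safe E G m)
    (hd : IsDNSResponse domains m) (hmem : dictMem (get s [10]) (get m [4]))
    (hdom : get m [2] ≈ₜ get (get (dictGet (get s [10]) (get m [4])) [2]) [4]) {o : Out}
    (ho : o ∈ (let pending := dictGet (get s [10]) (get m [4])
      let message := get pending [2]
      let s' := setAt s [10] (dictDel (get s [10]) (get m [4]))
      if get pending [3] ≈ₜ K .https then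
        ({([.seq [get m [3], a,
            .enca (.seq [message, ν 3]) (dictGet (get s [7]) (get message [4]))]],
          appendAt s' [11] (.seq [get pending [1], message, ν 3, get m [3]]))} : Set Out)
      else
        {([.seq [get m [3], a, message]],
          appendAt s' [11] (.seq [get pending [1], message, .bot, get m [3]]))})) :
    BStep E G s o := by
  obtain ⟨ref, M, proto, hp, hpend, hrn, hMn, hpn⟩ := hs.pending_mem hmem
  obtain ⟨d, -, r, n₀, hd⟩ := hd
  have hm2 : get m [2] = .str d := by
    rw [← get_nf, equiv_iff_nf.1 hd, get_nf, get_seq (nf_seq _)]; simp [get_nil, Term.nf]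
  obtain ⟨g1, g2, g3⟩ := get_triple hp
  rw [hrn] at g1
  rw [hMn] at g2
  rw [hpn] at g3
  rw [g2, hm2] at hdom
  simp only [g1, g2, g3] at ho
  have hdom : get M [4] = .str d := by
    rw [equiv_iff_nf, nf_get] at hdom
    exact hdom.symm
  rw [hdom] at ho
  have h7 : get s [7] = E.km := hs.comp (k := 6) (by norm_num)
  rw [h7] at ho
  have hcM : CN M := by
    have := Closed.dy.get (Closed.dy.dictGet (Closed.dy.get hcl [10]) (get m [4])) [2]
    rw [g2] at this
    exact ⟨hMn, by have := this.cn; rw [hMn] at this; exact this.2⟩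
  have hcr : CN ref := by
    have := Closed.dy.get (Closed.dy.dictGet (Closed.dy.get hcl [10]) (get m [4])) [1]
    rw [g1] at this
    exact ⟨hrn, by have := this.cn; rw [hrn] at this; exact this.2⟩
  have hm3 : Safe E G (get m [3]) := hG.dy.get hm _
  have hkm : Safe E G (dictGet E.km (.str d)) := hG.dy.dictGet (safe_km hE hG) _
  -- requests to honest servers
  have secret : ∀ q : Req, M = q.term → q.host = d → E.cls d ≠ .other → ReqOK E G ref q →
      proto = K .https → BStep E G s o := by
    rintro q rfl rfl hc hok rfl
    rw [if_pos (.refl _), mem_singleton_iff] at ho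
    have hρ : NuOK E G (.key ref q) := ⟨⟨hcr, hcM⟩, hok, by rintro _ _ ⟨⟩; exact hc⟩
    refine .inr ⟨3, _, hρ, .inl ?_⟩
    obtain ⟨hG', hT⟩ := hG.upd (k := 3) h0 hρ
    subst ho
    have hk : dictGet E.km (.str q.host) = .pub (.nonce (E.ssl q.host)) :=
      (hE.km_get q.host).resolve_right fun h => hc h.1
    have hr : (G.upd 3 (.key ref q)).role (ν 3) = some (.key ref q) := G.upd_self _ _
    have hn : (Term.enca (.seq [q.term, ν 3]) (.pub (.nonce (E.ssl q.host)))).nf =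
        .enca (.seq [q.term, ν 3]) (.pub (.nonce (E.ssl q.host))) := by
      change Term.enca (Term.seq _).nf _ = _
      rw [nf_seq, map_cons, map_cons, map_nil, hcM.1]
      rfl
    constructor
    · rw [all_one]
      rw [hk]
      refine ⟨?_, _, _, _, rfl, .inr (.inr ⟨_, q.host, hn, by simp [hk], fun _ => ⟨_, _, _, rfl, hr⟩⟩)⟩
      refine hG'.dy.event (hT.safe_var hm3) (hT.safe_var ha) ?_
      rw [Safe, hn]
      exact .req hr
    · refine (hT.bInv_var hE hs).resolve _ ?_
      rw [hcr.1, hcM.1]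
      exact .prot rfl hr
  rcases hpend.not_bad hMn hdom with ⟨n, me, pa, par, hd, bd, h1, h2, h3⟩ |
    ⟨q, h1, h2, h3, h4, h5⟩
  swap
  · exact secret q h2 h1 h4 h5 h3
  have h1' := h1
  rw [h1] at hcM
  have hcq := Req.cn (q := ⟨n, me, d, pa, par, hd, bd⟩) hcM
  have hsM := h2
  rw [Safe, hMn, h1] at hsM
  by_cases hpr : proto ≈ₜ K .https
  · have hpr' : proto = K .https := by rwa [equiv_iff_nf, hpn] at hpr
    by_cases hc : E.cls d = .other
    · rw [if_pos hpr, mem_singleton_iff] at ho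
      refine .inr ⟨3, .pub, nuOK_pub, .inl ?_⟩
      obtain ⟨hG', hT⟩ := hG.upd (k := 3) h0 nuOK_pub
      have hk3 : (G.upd 3 .pub).Known (ν 3) := known_nu (G.upd_self _ _)
      subst ho
      constructor
      · rw [all_one]
        constructor
        · exact hG'.dy.list ⟨hT.safe_var hm3, hT.safe_var ha,
            hG'.dy.enca (hG'.dy.pair (hT.safe_var h2) hk3.safe) (hT.safe_var hkm)⟩
        · refine ⟨_, _, _, rfl, .inr ?_⟩
          rcases hE.km_get d with h | ⟨-, h⟩
          · exact .inr ⟨(Term.seq [M, ν 3]).nf, d, by rw [h]; rfl, by simp [h], by simp [hc]⟩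
          · exact .inl ⟨(Term.seq [M, ν 3]).nf, by rw [h]; rfl⟩
      · refine (hT.bInv_var hE hs).resolve _ ?_
        rw [hrn, hMn]
        refine .adv h1 (hT.safe_var h2) ?_ (.inr ⟨hk3, hc⟩)
        rcases h3 with h3 | h3
        · have := hT.compat.known h3.1
          rw [ren_var, hrn] at this
          exact .inl this
        · have := hT.xhrRef h3 (q := (ν 3 : Term) = .bot) (by rw [hpr']; simp)
          rw [ren_var, hrn] at this
          exact .inr this
    · refine secret ⟨n, me, d, pa, par, hd, bd⟩ h1 rfl hc ?_ hpr'
      rcases h3 with ⟨h3, h4⟩ | ⟨_, _, _, -, -, -, -, -, z⟩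
      · have s1 : Safe E G pa := by rw [Safe, hcq.2.2.1.1]; exact hsM.of_seq _ (by simp)
        have s2 : Safe E G par := by rw [Safe, hcq.2.2.2.1.1]; exact hsM.of_seq _ (by simp)
        cases hc' : E.cls d with
        | other => exact absurd hc' hc
        | rp => exact .rpWin hc' h3.named s1 s2 h4
        | idp => exact .idpWin hc' h3.named s1 s2
        | fwd => exact .fwdWin hc' h3.named (.inl s2)
      · rw [hpr'] at z
        exact absurd (z.resolve_left (by simp)) hc
  · rw [if_neg hpr, mem_singleton_iff] at ho
    refine .inr ⟨3, .pub, nuOK_pub, .inl ?_⟩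
    obtain ⟨hG', hT⟩ := hG.upd (k := 3) h0 nuOK_pub
    subst ho
    constructor
    · rw [all_one]
      constructor
      · exact hG'.dy.list ⟨hT.safe_var hm3, hT.safe_var ha, hT.safe_var h2⟩
      · exact ⟨_, _, _, rfl, .inl ⟨_, hMn.trans h1⟩⟩
    · refine (hT.bInv_var hE hs).resolve _ ?_
      rw [hrn, hMn]
      refine .adv h1 (hT.safe_var h2) ?_ (.inl rfl)
      rcases h3 with h3 | h3
      · have := hT.compat.known h3.1
        rw [ren_var, hrn] at this
        exact .inl this
      · have := hT.xhrRef h3 (q := Term.bot.nf = .bot) (fun _ => rfl)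
        rw [ren_var, hrn] at this
        exact .inr this

theorem step (hE : EnvOK E) (hG : GWF E G) (h0 : G.NoNu) (hs : BInv E G s) (hcl : Closed s)
    {domains : Finset Str} {a f m : Term} (ha : Safe E G a) (hm : Safe E G m) {o : Out}
    (ho : o ∈ browserAlg domains a f m s) : BStep E G s o := by
  have h12 : get s [12] = .bot := hs.comp (k := 11) (by norm_num)
  unfold browserAlg at ho
  rw [h12, if_neg (not_not.2 (.refl _))] at ho
  split_ifs at ho with c1 c2 c3 c4 c5 c6
  · obtain ⟨hG', hT⟩ := hG.upd (k := 0) h0 nuOK_pub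
    refine .inr ⟨0, .pub, nuOK_pub, .inl ((hT.bInv_var hE hs).trigger hE hG' hcl ?_
      (hT.safe_var ha) ho)⟩
    intro k
    simp [Ghost.upd]
  · exact .inl ho
  · obtain ⟨hG', hT⟩ := hG.upd (k := 0) h0 nuOK_pub
    rw [mem_singleton_iff] at ho
    subst ho
    exact .inr ⟨0, .pub, nuOK_pub, .inr ⟨rfl, (hT.bInv_var hE hs).closeCorrupt_safe hE hG', rfl⟩⟩
  · obtain ⟨e, he, ho⟩ := ho
    exact hs.step_encrypted hE hG h0 hcl ha hm he ho
  · obtain ⟨e, he, ho⟩ := ho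
    exact hs.step_plain hE hG h0 hcl ha hm he ho
  · simp only at ho
    split_ifs at ho with c7
    · exact ho ▸ BStep.noOut hE hG h0 hs
    · rw [not_or, not_not, not_not] at c7
      refine hs.step_dns hE hG h0 hcl ha hm c6 c7.1 c7.2 ?_
      simp only
      split_ifs
      assumption
    · rw [not_or, not_not, not_not] at c7
      refine hs.step_dns hE hG h0 hcl ha hm c6 c7.1 c7.2 ?_
      simp only
      split_ifs
      assumption
  · exact ho ▸ BStep.noOut hE hG h0 hs

end BInv

/-! # Honest servers -/

/-- Lists of the private SSL keys of hosts of the class `C`. -/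
def KeysOK (E : Env) (C : Cls) (t : Term) : Prop :=
  ∃ l, t = .seq l ∧ ∀ e ∈ l, ∃ h, e = .seq [.str h, .nonce (E.ssl h)] ∧ E.cls h = C

theorem KeysOK.cn {C : Cls} {t : Term} (h : KeysOK E C t) : CN t := by
  obtain ⟨l, rfl, hl⟩ := h
  rw [cn_seq]
  intro e he
  obtain ⟨h, rfl, -⟩ := hl e he
  exact ⟨rfl, by simp⟩

theorem deca_cases {m k : Term} {ts : List Term} (h : (Term.deca m k).nf = .seq ts) :
    m.nf = .enca (.seq ts) (.pub k.nf) := by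
  have : (Term.deca m k).nf = redDeca m.nf k.nf := rfl
  rw [this] at h
  unfold redDeca at h
  split at h
  · rename_i y k' hm
    split_ifs at h with hk
    rw [hm, hk, h]
  · cases h

/-- The form of requests to honest servers: all their parts are known, or they have been sent by
an honest party. -/
theorem HttpsRequest.cases {C : Cls} {sslk m inD k n me pa par hd bd : Term}
    (h : HttpsRequest sslk m inD k n me pa par hd bd) (hk : KeysOK E C sslk) (hm : Safe E G m) :
    ∃ d, inD = .str d ∧ E.cls d = C ∧
      m.nf = .enca (.seq [(⟨n, me, d, pa, par, hd, bd⟩ : Req).term, k])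
        (.pub (.nonce (E.ssl d))) ∧
      (∀ t ∈ [k, n, me, pa, par, hd, bd], t.nf = t) ∧
      ((∀ t ∈ [k, n, me, pa, par, hd, bd], Safe E G t) ∨
        ∃ ref, G.role k = some (.key ref ⟨n, me, d, pa, par, hd, bd⟩)) := by
  obtain ⟨k', h1, h2⟩ := h
  have hcn := hk.cn
  obtain ⟨l, rfl, hl⟩ := hk
  rw [items_of_nf hcn.1] at h1
  obtain ⟨d, he, hd'⟩ := hl _ h1
  simp only [Term.seq.injEq, List.cons.injEq, and_true] at he
  obtain ⟨rfl, rfl⟩ := he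
  have h3 := deca_cases h2
  have hnf : ∀ t ∈ [k, n, me, pa, par, hd, bd], t.nf = t := by
    have e1 := nf_of_mem ((nf_nf _).trans h2)
      (u := httpRequest n me (.str d) pa par hd bd) (by simp)
    have e2 := nf_of_mem ((nf_nf _).trans h2) (u := k) (by simp)
    have e3 : ∀ u ∈ [K .httpReq, n, me, .str d, pa, par, hd, bd], u.nf = u :=
      fun u hu => nf_of_mem e1 hu
    simp only [forall_mem_cons, not_mem_nil, false_imp_iff, implies_true, and_true]
    exact ⟨e2, e3 _ (by simp), e3 _ (by simp), e3 _ (by simp), e3 _ (by simp), e3 _ (by simp),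
      e3 _ (by simp)⟩
  refine ⟨d, rfl, hd', h3, hnf, ?_⟩
  rw [Safe, h3] at hm
  rcases hm.of_enca with ⟨h4, -⟩ | ⟨κ, ref, q, h5, h6, h7⟩
  · left
    have h5 := h4.of_seq _ (List.mem_cons_self ..)
    have h6 := h4.of_seq k (by simp)
    have h7 := h5.of_seq
    intro t ht
    rw [Safe, hnf t ht]
    simp only [mem_cons, not_mem_nil, or_false] at ht
    rcases ht with rfl | rfl | rfl | rfl | rfl | rfl | rfl
    · exact h6
    all_goals exact h7 _ (by simp)
  · right
    simp only [Term.seq.injEq, List.cons.injEq, and_true] at h6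
    obtain ⟨h6, rfl⟩ := h6
    have : q = ⟨n, me, d, pa, par, hd, bd⟩ := Req.term_inj h6.symm
    exact ⟨ref, this ▸ h5⟩

theorem cn_of_enca {m x k : Term} {ts : List Term} (h : m.nf = .enca (.seq ts) k)
    (hcl : Closed m) (hx : x ∈ ts) : CN x := by
  constructor
  · have h1 := nf_nf m
    rw [h] at h1
    injection h1 with h1
    exact nf_of_mem h1 hx
  · intro v hv
    refine hcl v ?_
    rw [h, VarIn, varIn_seq]
    exact .inl ⟨x, hx, hv⟩

theorem safe_okResponse_key {k ref hd bd : Term} {q : Req} {parts : List Term}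
    (hk : G.role k = some (.key ref q)) (hn : q.n.nf = q.n) (hhd : hd.nf = hd) (hbd : bd.nf = bd)
    (hR : Resp E G q hd bd parts) (hp : ∀ p ∈ parts, SafeN E G p) :
    Safe E G (okResponse k q.n hd bd) := by
  have : (okResponse k q.n hd bd).nf = okResponse k q.n hd bd := by
    have hk := Ghost.Named.nf (G := G) ⟨_, hk⟩
    change Term.encs (Term.seq _).nf k.nf = _
    rw [nf_seq, hk]
    simp only [map_cons, map_nil, hn, hhd, hbd]
    rfl
  rw [Safe, this]
  exact .resp hk hR hp

/-! ## Forwarders -/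

abbrev FInv (E : Env) : Term → Prop :=
  Comps 2 fun k t => match k with
    | 1 => KeysOK E .fwd t
    | _ => t = .bot

theorem corruptOut_state {a s' : Term} {o : Out} (h : o ∈ corruptOut a s') : o.2 = s' := by
  obtain ⟨_, _, _, rfl⟩ := h
  rfl

theorem get_setAt_seq {k : ℕ} {ts : List Term} (h : ∃ us, s.nf = .seq us ∧ k < us.length) :
    ∃ l, get (setAt s [k + 1] (.seq ts)) [k + 1] = .seq l := by
  obtain ⟨us, h1, h2⟩ := h
  have := get_setAt_self (v := .seq ts) h1 (List.getElem?_eq_getElem h2) [] []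
  rw [setAt_nil] at this
  exact ⟨_, this.trans (nf_seq ts)⟩

theorem shape_of_get {k : ℕ} {u : Term} (h : get s [k + 1] = u) (h1 : u ≠ .undef)
    (h2 : ∀ i t, u ≠ .proj i t) : ∃ us, s.nf = .seq us ∧ k < us.length := by
  change redProj (k + 1) s.nf = u at h
  unfold redProj at h
  split at h
  · rename_i us hus
    refine ⟨us, hus, ?_⟩
    by_contra hk
    simp [List.getElem?_eq_none (not_lt.1 hk)] at h
    exact h1 h.symm
  · exact absurd h.symm (h2 _ _)

theorem Comps.shape {n : ℕ} {C : ℕ → Term → Prop} (h : Comps n C s) {k : ℕ} (hk : k < n) :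
    ∃ us, s.nf = .seq us ∧ k < us.length := by
  obtain ⟨us, h1, rfl, -⟩ := h
  exact ⟨us, h1, hk⟩

theorem FInv.ren (h : FInv E s) : FInv E (ren σ s) := by
  refine Comps.imp h σ fun k u hu => ?_
  split at hu
  · rwa [hu.cn.ren_eq]
  · rw [hu]; rfl

theorem FInv.step (hG : GWF E G) (hs : FInv E s) {a f m : Term} (ha : Safe E G a)
    (hf : Safe E G f) (hm : Safe E G m) {o : Out} (ho : o ∈ fwdAlg a f m s) :
    (∃ l, get o.2 [2] = .seq l) ∨ (∀ x ∈ o.1, Safe E G x) ∧ FInv E o.2 := by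
  have dy := hG.dy
  have hnil : Safe E G (.seq []) := dy.nil
  have h2 : get s [2] = .bot := Comps.get (k := 1) hs (by norm_num)
  have h1 : KeysOK E .fwd (get s [1]) := Comps.get (k := 0) hs (by norm_num)
  unfold fwdAlg at ho
  rw [h2] at ho
  split_ifs at ho with c c2
  · rw [corruptOut_state ho]
    exact .inl (get_setAt_seq (hs.shape (by norm_num)))
  all_goals
    right
  · obtain ⟨inD, k, n, me, pa, par, hd, bd, hreq, rfl⟩ := ho
    refine ⟨?_, hs⟩
    refine hG.dy.one hf ha ?_
    obtain ⟨d, rfl, hc, -, hnf, hsafe | ⟨ref, hr⟩⟩ := hreq.cases h1 hm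
    · exact hG.dy.okResponse (hsafe _ (by simp)) (hsafe _ (by simp)) hnil
        (dy.pair (dy.str _) (dy.str _))
    · exact safe_okResponse_key hr (hnf n (by simp)) rfl rfl (.fwd hc) (by simp)
  · rw [mem_ofPred_eq] at ho
    subst ho
    exact ⟨by simp, hs⟩

/-! ## Identity providers -/

/-- Entries of the list of sessions. -/
def IdpSession (E : Env) (G : Ghost) (e : Term) : Prop :=
  ∃ v em, e = .seq [v, em] ∧ (G.role v = some .priv ∨
    Safe E G em ∧ CN em ∧ ∀ a c, em = .seq [.str a, .str c] → ¬ E.me a c)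

/-- The components of the state of the identity provider; `U` is the list of users. -/
def IComp (E : Env) (G : Ghost) (U : Term) (k : ℕ) (t : Term) : Prop :=
  match k with
  | 1 => KeysOK E .idp t
  | 2 => t = U
  | 3 => t = .nonce E.sk
  | 4 => ∃ l, t = .seq l ∧ ∀ e ∈ l, IdpSession E G e
  | _ => t = .bot

abbrev IInv (E : Env) (G : Ghost) (U : Term) : Term → Prop := Comps 5 (IComp E G U)

/-- The secrets of the protected identities are private. -/
def UsersOK (E : Env) (G : Ghost) (U : Term) : Prop :=
  ∀ a c, E.me a c → ∃ n, dictGet U (.seq [.str a, .str c]) = .nonce n ∧ G.n n = some .priv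

theorem Tr.idpSession (h : Tr E G σ G') {e : Term} (he : IdpSession E G e) :
    IdpSession E G' (ren σ e) := by
  obtain ⟨v, em, rfl, h1⟩ := he
  rcases h1 with h1 | ⟨h1, h2, h3⟩
  · exact ⟨ren σ v, ren σ em, by simp, .inl (h.compat _ _ h1)⟩
  · refine ⟨ren σ v, ren σ em, by simp, .inr ⟨h.safe h1, ?_⟩⟩
    rw [h2.ren_eq]
    exact ⟨h2, h3⟩

theorem IInv.ren {U : Term} (hU : CN U) (h : Tr E G σ G') (hs : IInv E G U s) :
    IInv E G' U (ren σ s) := by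
  refine Comps.imp hs σ fun k u hu => ?_
  unfold IComp at hu ⊢
  split at hu
  · rwa [hu.cn.ren_eq]
  · rw [hu, hU.ren_eq]
  · rw [hu]; rfl
  · obtain ⟨l, rfl, hl⟩ := hu
    exact ⟨_, ren_seq _ _, Tr.forall_map hl fun _ => h.idpSession⟩
  · rw [hu]; rfl

theorem IInv.var {U : Term} (hU : CN U) (h : Tr E G .var G') (hs : IInv E G U s) :
    IInv E G' U s := .of_nf (ren_var s ▸ IInv.ren hU h hs)

/-- The outcome of a step of the identity provider. -/
def IStep (E : Env) (G : Ghost) (U : Term) (o : Out) : Prop :=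
  ∃ k ρ, NuOK E G ρ ∧ (∀ x ∈ o.1, Safe E (G.upd k ρ) x) ∧ IInv E (G.upd k ρ) U o.2

namespace IInv
variable {U : Term}

theorem set_session (hs : IInv E G U s) {v em : Term}
    (he : IdpSession E G (.seq [v.nf, em.nf])) :
    IInv E G U (setAt s [4] (dictSet (get s [4]) v em)) := by
  obtain ⟨l, h1, h2⟩ : ∃ l, get s [4] = .seq l ∧ ∀ e ∈ l, IdpSession E G e :=
    Comps.get (k := 3) hs (by norm_num)
  refine Comps.set (k := 3) hs ?_
  rw [setAt_nil]
  obtain ⟨l', e1, e2⟩ := mem_dictSet (z := get s [4]) (k := v) (v := em)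
  refine ⟨l', e1, fun e hm => ?_⟩
  rcases e2 e hm with hm | rfl
  · rw [items_of_nf (by rw [nf_get, h1])] at hm
    exact h2 e hm
  · exact he

theorem noOut (hG : GWF E G) (h0 : G.NoNu) (hU : CN U) (hs : IInv E G U s) :
    IStep E G U ([], s) :=
  ⟨0, .pub, nuOK_pub, by simp, hs.var hU (hG.upd h0 nuOK_pub).2⟩

theorem request (hG : GWF E G) (h0 : G.NoNu) (hU : CN U) (hUs : UsersOK E G U)
    (hs : IInv E G U s) {a f m inD k n me pa par hd bd : Term} (ha : Safe E G a)
    (hf : Safe E G f) (hm : Safe E G m) (hcl : Closed m)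
    (hreq : HttpsRequest (get s [1]) m inD k n me pa par hd bd) {o : Out}
    (ho : o ∈ idpRequest a f k n me pa hd bd s) : IStep E G U o := by
  have dy := hG.dy
  have hnil : Safe E G (.seq []) := dy.nil
  have h1 : KeysOK E .idp (get s [1]) := Comps.get (k := 0) hs (by norm_num)
  have h2 : get s [2] = U := Comps.get (k := 1) hs (by norm_num)
  have h3 : get s [3] = .nonce E.sk := Comps.get (k := 2) hs (by norm_num)
  obtain ⟨l, h4, h5⟩ : ∃ l, get s [4] = .seq l ∧ ∀ e ∈ l, IdpSession E G e :=
    Comps.get (k := 3) hs (by norm_num)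
  obtain ⟨d, rfl, hc, hmn, hnf, hcase⟩ := hreq.cases h1 hm
  have hcq : CN (⟨n, me, d, pa, par, hd, bd⟩ : Req).term := cn_of_enca hmn hcl (by simp)
  have hcq' := Req.cn hcq
  have hlo : Safe E G (dictGet (dictGet hd (K .hCookie)) (K .sessionid)) →
      Safe E G (dictGet (get s [4]) (dictGet (dictGet hd (K .hCookie)) (K .sessionid))) ∧
      ∀ a c, dictGet (get s [4]) (dictGet (dictGet hd (K .hCookie)) (K .sessionid)) =
        .seq [.str a, .str c] → ¬ E.me a c := by
    intro hsess
    rcases dictGet_mem (z := get s [4])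
      (k := dictGet (dictGet hd (K .hCookie)) (K .sessionid)) rfl with h | ⟨e, he, h⟩
    · rw [h]; exact ⟨hnil, by simp⟩
    · rw [items_of_nf (by rw [nf_get, h4])] at he
      obtain ⟨v, em, he', hp⟩ := h5 e he
      rw [he', Term.seq.injEq, List.cons.injEq, List.cons.injEq] at h
      obtain ⟨rfl, h, -⟩ := h
      rw [← h]
      rcases hp with hp | hp
      · rw [nf_dictGet] at hp
        exact absurd hsess (not_safe hp id)
      · exact ⟨hp.1, hp.2.2⟩
  rcases hcase with hsafe | ⟨ref, hr⟩
  · have sk : Safe E G k := hsafe _ (by simp)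
    have sn : Safe E G n := hsafe _ (by simp)
    have sb : Safe E G bd := hsafe _ (by simp)
    have shd : Safe E G hd := hsafe _ (by simp)
    have hlo := hlo (dy.dictGet (dy.dictGet shd _) _)
    have quiet : ∀ hd' bd' : Term, Safe E G hd' → Safe E G bd' →
        o = ([.seq [f, a, okResponse k n hd' bd']], s) → IStep E G U o := by
      rintro hd' bd' h1 h2 rfl
      obtain ⟨hG', hT⟩ := hG.upd (k := 0) h0 nuOK_pub
      refine ⟨0, .pub, nuOK_pub, ?_, hs.var hU hT⟩
      rw [all_one]
      exact hT.safe_var (hG.dy.event hf ha (hG.dy.okResponse sk sn h1 h2))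
    unfold idpRequest at ho
    simp only at ho
    split_ifs at ho with c1 c2 c3 c4
    · rw [h3] at ho
      exact quiet _ _ hnil (dy.seq (by
        rw [all_one]; exact dy.pair (dy.str _) (.pubn _))) ho
    · refine quiet _ _ hnil (dy.pair (dy.str _) (dy.seq ?_)) ho
      exact All.mem ⟨dy.str _, hlo.1, hnil⟩
    · exact ho ▸ hs.noOut hG h0 hU
    · rw [mem_singleton_iff] at ho
      subst ho
      obtain ⟨hG', hT⟩ := hG.upd (k := 8) h0 nuOK_pub
      have h8 : (G.upd 8 .pub).Known (ν 8) := known_nu (G.upd_self _ _)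
      have nome : ∀ a c, dictGet bd (K .email) = .seq [.str a, .str c] → ¬ E.me a c := by
        intro a c he hme
        rw [not_and_or, not_not, not_not] at c4
        rcases c4 with c4 | c4
        · rw [equiv_iff_nf, nf_dictGet, nf_dictGet, he] at c4
          exact hlo.2 a c c4.symm hme
        · obtain ⟨j, hj, hp⟩ := hUs a c hme
          rw [equiv_iff_nf, nf_dictGet, nf_dictGet, he, h2, hj] at c4
          have : Safe E G (dictGet bd (K .password)) := dy.dictGet sb _
          rw [c4] at this
          exact not_safe (G := G) (a := .nonce j) hp id this
      have sem : Safe E G (dictGet bd (K .email)) := dy.dictGet sb _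
      refine ⟨8, .pub, nuOK_pub, ?_, (hs.var hU hT).set_session ?_⟩
      · refine hG'.dy.one (hT.safe_var hf) (hT.safe_var ha)
          (hG'.dy.okResponse (hT.safe_var sk) (hT.safe_var sn) ?_ ?_)
        · have dy' := hG'.dy
          refine dy'.seq ?_
          rw [all_one]
          refine dy'.pair (dy'.str _) (dy'.seq ?_)
          rw [all_one]
          refine dy'.pair (dy'.str _) (dy'.seq ?_)
          exact All.mem ⟨h8.safe, dy'.top, dy'.top, dy'.top⟩
        · refine hT.safe_var ?_
          rw [h3]
          have cn : CN (.seq [dictGet bd (K .tag), dictGet bd (K .email),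
              dictGet bd (K .fwdDomain)]) := by
            simp [cn_seq, hcq'.2.2.2.2.2.dictGet]
          change SafeN E G (.sig (Term.nf _) _)
          rw [cn.1]
          refine .sigY ?_ cn ?_
          · rw [← cn.1]
            exact dy.seq (by simp [dy.dictGet sb])
          · rintro ⟨d', u, κ, a, c, he, -, hme⟩
            simp only [Term.seq.injEq, List.cons.injEq] at he
            exact nome a c he.2.1 hme
      · rw [nf_dictGet]
        exact ⟨_, _, rfl, .inr ⟨hT.safe_var sem, hcq'.2.2.2.2.2.dictGet _, nome⟩⟩
    · exact ho ▸ hs.noOut hG h0 hU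
  · have quiet : ∀ hd' bd' : Term, hd'.nf = hd' → bd'.nf = bd' →
        Resp E G ⟨n, me, d, pa, par, hd, bd⟩ hd' bd' [] →
        o = ([.seq [f, a, okResponse k n hd' bd']], s) → IStep E G U o := by
      rintro hd' bd' h1 h2 h3 rfl
      obtain ⟨hG', hT⟩ := hG.upd (k := 0) h0 nuOK_pub
      refine ⟨0, .pub, nuOK_pub, ?_, hs.var hU hT⟩
      rw [all_one]
      exact hT.safe_var (hG.dy.event hf ha
        (safe_okResponse_key hr hcq'.1.1 h1 h2 h3 (by simp)))
    unfold idpRequest at ho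
    simp only at ho
    split_ifs at ho with c1 c2 c3 c4
    · rw [h3] at ho
      have : pa = K .pWkInfo := by rwa [equiv_iff_nf, hcq'.2.2.1.1] at c1
      exact quiet _ _ rfl rfl (.idpInfo hc this) ho
    · have : pa = K .pWkLogin := by rwa [equiv_iff_nf, hcq'.2.2.1.1] at c2
      refine quiet _ _ rfl ?_ (.idpLogin hc this) ho
      simp only [nf_seq, map_cons, map_nil, nf_dictGet]
      rfl
    · exact ho ▸ hs.noOut hG h0 hU
    · have hpa : pa = K .pSign := hcq'.2.2.1.1.symm.trans (equiv_iff_nf.1 c3.1)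
      rw [mem_singleton_iff] at ho
      subst ho
      obtain ⟨hG', hT⟩ := hG.upd (k := 8) h0 nuOK_priv
      have h8 : (G.upd 8 .priv).role (ν 8) = some .priv := G.upd_self _ _
      have hr' := hT.compat _ _ hr
      rw [ren_var, Ghost.Named.nf (G := G) ⟨_, hr⟩] at hr'
      refine ⟨8, .priv, nuOK_priv, ?_, (hs.var hU hT).set_session ⟨_, _, rfl, .inl h8⟩⟩
      rw [all_one]
      rw [h3]
      refine hG'.dy.event (hT.safe_var hf) (hT.safe_var ha)
        (safe_okResponse_key hr' hcq'.1.1 rfl ?_ (.idpSign hc hpa ⟨_, h8⟩) (by simp))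
      change Term.sig (Term.nf _) _ = _
      rw [nf_seq]
      simp only [map_cons, map_nil, nf_dictGet]
      rfl
    · exact ho ▸ hs.noOut hG h0 hU

theorem step (hG : GWF E G) (h0 : G.NoNu) (hU : CN U) (hUs : UsersOK E G U)
    (hs : IInv E G U s) {a f m : Term} (ha : Safe E G a)
    (hf : Safe E G f) (hm : Safe E G m) (hcl : Closed m) {o : Out} (ho : o ∈ idpAlg a f m s) :
    (∃ l, get o.2 [5] = .seq l) ∨ IStep E G U o := by
  have h5 : get s [5] = .bot := Comps.get (k := 4) hs (by norm_num)
  unfold idpAlg at ho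
  rw [h5] at ho
  split_ifs at ho with c c2
  · rw [corruptOut_state ho]
    exact .inl (get_setAt_seq (Comps.shape hs (by norm_num)))
  all_goals
    right
  · obtain ⟨inD, k, n, me, pa, par, hd, bd, hreq, ho⟩ := ho
    exact hs.request hG h0 hU hUs ha hf hm hcl hreq ho
  · exact ho ▸ hs.noOut hG h0 hU

end IInv

/-! ## Relying parties -/

/-- References to the requests in which login sessions are started. -/
def StartRef (E : Env) (G : Ghost) (t : Term) : Prop :=
  ∃ a f k n i j d, t = .seq [a, f, k, n, .seq [.str i, .str j], .str d] ∧ E.cls d = .rp ∧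
    Safe E G a ∧ Safe E G f ∧ (Safe E G k ∧ Safe E G n ∨ ∃ ref q, G.role k = some (.key ref q) ∧
      q.path = K .pStartLogin ∧ q.n = n ∧ q.body = .seq [.str i, .str j] ∧ q.host = d)

/-- The requests for the public key of an identity provider. -/
def infoReq (n : Term) (c : Str) : Req :=
  ⟨n, K .get, c, K .pWkInfo, .seq [], .seq [], .seq []⟩

def RpDns (E : Env) (G : Ghost) (e : Term) : Prop :=
  ∃ k ref n c, e = .seq [k, .seq [ref, (infoReq n c).term]] ∧ StartRef E G ref ∧ G.Known n

def RpPending (E : Env) (G : Ghost) (e : Term) : Prop :=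
  ∃ ref n c key a, e = .seq [ref, (infoReq n c).term, key, a] ∧ StartRef E G ref ∧
    (E.cls c = .idp → G.role key = some (.key .bot (infoReq n c)))

def RpSession (E : Env) (G : Ghost) (e : Term) : Prop :=
  ∃ l i j u ia d tk, e = .seq [l, .seq [.seq [.str i, .str j], u, ia, .encs (.seq [.str d, u]) tk]] ∧
    G.role l = some (.lst (.seq [.str i, .str j])) ∧ G.Known u ∧ G.Known ia ∧ G.Known tk ∧
    E.cls d = .rp

def RpToken (E : Env) (G : Ghost) (e : Term) : Prop :=
  ∃ n i j, e = .seq [n, .seq [.str i, .str j]] ∧ (E.me i j → G.role n = some .priv)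

def RpWk (E : Env) (e : Term) : Prop :=
  ∃ c v, e = .seq [.str c, v] ∧
    (E.cls c = .idp → v = .seq [.seq [K .signkey, .pub (.nonce E.sk)]])

/-- Sequences of terms with the property `P`. -/
def SeqOf (P : Term → Prop) (t : Term) : Prop := ∃ l, t = .seq l ∧ ∀ e ∈ l, P e

def RComp (E : Env) (G : Ghost) (k : ℕ) (t : Term) : Prop :=
  match k with
  | 1 => ∃ a, t = .addr a
  | 2 => t = .str E.fd
  | 3 => t = E.km
  | 4 => KeysOK E .rp t
  | 5 => SeqOf (RpDns E G) t
  | 6 => SeqOf (RpPending E G) t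
  | 7 => SeqOf (RpSession E G) t
  | 8 => SeqOf (RpToken E G) t
  | 9 => SeqOf (RpWk E) t
  | _ => t = .bot

abbrev RInv (E : Env) (G : Ghost) : Term → Prop := Comps 10 (RComp E G)

theorem SeqOf.ren {P Q : Term → Prop} {t : Term} (h : SeqOf P t)
    (hPQ : ∀ e, P e → Q (ren σ e)) : SeqOf Q (ren σ t) := by
  obtain ⟨l, rfl, hl⟩ := h
  exact ⟨_, ren_seq _ _, Tr.forall_map hl hPQ⟩

theorem SeqOf.append {P : Term → Prop} {t v : Term} (h : SeqOf P t) (ht : t.nf = t)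
    (hv : P v.nf) : SeqOf P (Term.seq (items t ++ [v])).nf := by
  obtain ⟨l, rfl, hl⟩ := h
  rw [BInv.append_items rfl ht]
  refine ⟨_, rfl, fun e he => ?_⟩
  rcases mem_append.1 he with he | he
  · exact hl e he
  · rw [mem_singleton] at he; exact he ▸ hv

theorem SeqOf.dictSet {P : Term → Prop} {t k v : Term} (h : SeqOf P t) (ht : t.nf = t)
    (hv : P (.seq [k.nf, v.nf])) : SeqOf P (dictSet t k v).nf := by
  obtain ⟨l, rfl, hl⟩ := h
  obtain ⟨l', e1, e2⟩ := mem_dictSet (z := .seq l) (k := k) (v := v)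
  refine ⟨l', e1, fun e he => ?_⟩
  rcases e2 e he with he | rfl
  · rw [items_of_nf ht] at he
    exact hl e he
  · exact hv

theorem SeqOf.sub {P : Term → Prop} {t : Term} (h : SeqOf P t) (ht : t.nf = t) {l' : List Term}
    (hl' : ∀ e ∈ l', e ∈ items t) : SeqOf P (Term.seq l').nf := by
  obtain ⟨l, rfl, hl⟩ := h
  rw [items_of_nf ht] at hl'
  refine ⟨l', ?_, fun e he => hl e (hl' e he)⟩
  rw [nf_seq, (map_eq_self_iff (f := Term.nf)).2]
  exact fun e he => nf_of_mem ht (hl' e he)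

theorem SeqOf.mem {P : Term → Prop} {t e : Term} (h : SeqOf P t) (ht : t.nf = t)
    (he : e ∈ items t) : P e := by
  obtain ⟨l, rfl, hl⟩ := h
  rw [items_of_nf ht] at he
  exact hl e he

@[simp] theorem infoReq_ren (n : Term) (c : Str) :
    (infoReq n c).ren σ = infoReq (ren σ n) c := by
  simp [Req.ren, infoReq]

namespace Tr
variable (h : Tr E G σ G')
include h

theorem startRef {t : Term} (ht : StartRef E G t) : StartRef E G' (ren σ t) := by
  obtain ⟨a, f, k, n, i, j, d, rfl, hd, ha, hf, h1⟩ := ht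
  refine ⟨ren σ a, ren σ f, ren σ k, ren σ n, i, j, d, by simp, hd,
    h.safe ha, h.safe hf, ?_⟩
  rcases h1 with ⟨h1, h2⟩ | ⟨ref, q, h1, h2, rfl, h3, h4⟩
  · exact .inl ⟨h.safe h1, h.safe h2⟩
  · exact .inr ⟨ref, q, h.compat _ _ h1, h2, ((Req.cn (h.closed _ _ h1).2).1.ren_eq _).symm, h3, h4⟩

theorem rpComp (hE : EnvClosed E) {k : ℕ} {t : Term} (ht : RComp E G k t) :
    RComp E G' k (ren σ t) := by
  unfold RComp at ht ⊢
  split at ht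
  · obtain ⟨a, rfl⟩ := ht; exact ⟨a, rfl⟩
  · rw [ht]; rfl
  · rw [ht, hE.km.ren_eq]
  · rwa [ht.cn.ren_eq]
  · refine ht.ren fun e he => ?_
    obtain ⟨k, ref, n, c, rfl, h1, h2⟩ := he
    exact ⟨ren σ k, ren σ ref, ren σ n, c, by simp, h.startRef h1, h.compat.known h2⟩
  · refine ht.ren fun e he => ?_
    obtain ⟨ref, n, c, key, a, rfl, h1, h2⟩ := he
    refine ⟨ren σ ref, ren σ n, c, ren σ key, ren σ a, by simp,
      h.startRef h1, fun hc => ?_⟩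
    have h3 := h2 hc
    have hn : ren σ n = n := (Req.cn (h.closed _ _ h3).2).1.ren_eq σ
    rw [hn]
    exact h.compat _ _ h3
  · refine ht.ren fun e he => ?_
    obtain ⟨l, i, j, u, ia, d, tk, rfl, h1, h2, h3, h4, h5⟩ := he
    exact ⟨ren σ l, i, j, ren σ u, ren σ ia, d, ren σ tk, by simp,
      h.compat _ _ h1, h.compat.known h2, h.compat.known h3, h.compat.known h4, h5⟩
  · refine ht.ren fun e he => ?_
    obtain ⟨n, i, j, rfl, h1⟩ := he
    exact ⟨ren σ n, i, j, by simp, fun hm => h.compat _ _ (h1 hm)⟩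
  · refine ht.ren fun e he => ?_
    obtain ⟨c, v, rfl, h1⟩ := he
    exact ⟨c, ren σ v, by simp, fun hc => by rw [h1 hc]; simp⟩
  · rw [ht]; rfl

theorem rInv (hE : EnvClosed E) (hs : RInv E G s) : RInv E G' (ren σ s) :=
  hs.imp σ fun _ _ => h.rpComp hE

end Tr

theorem Tr.rInv_var (h : Tr E G .var G') (hE : EnvClosed E) (hs : RInv E G s) : RInv E G' s :=
  .of_nf (ren_var s ▸ h.rInv hE hs)

/-- Tokens created upon receipt of the message `m`. -/
def NewToken (E : Env) (G : Ghost) (m t : Term) : Prop :=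
  ∃ n i j, t = .seq [n, .seq [.str i, .str j]] ∧ ∃ d x κ, E.cls d = .rp ∧
    m.nf = .enca (.seq [x, κ]) (.pub (.nonce (E.ssl d))) ∧
    ((∃ ref q, G.role κ = some (.key ref q)) → E.own i j)

/-- The outcome of a step of the relying party. -/
def RStep (E : Env) (G : Ghost) (m s : Term) (o : Out) : Prop :=
  ∃ k ρ, NuOK E G ρ ∧ (∀ x ∈ o.1, Safe E (G.upd k ρ) x) ∧ RInv E (G.upd k ρ) o.2 ∧
    ∀ t ∈ items (get o.2 [8]), t ∈ items (get s [8]) ∨ NewToken E G m t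

namespace RInv

theorem comp (hs : RInv E G s) {k : ℕ} (hk : k < 10) : RComp E G (k + 1) (get s [k + 1]) :=
  Comps.get hs hk

theorem set1 (hs : RInv E G s) {k : ℕ} {v : Term} (hv : RComp E G (k + 1) v.nf) :
    RInv E G (setAt s [k + 1] v) := Comps.set hs (by rwa [setAt_nil])

theorem quiet (hE : EnvOK E) (hG : GWF E G) (h0 : G.NoNu) (hs : RInv E G s) (m : Term)
    {l : List Term} (hl : ∀ x ∈ l, Safe E G x) : RStep E G m s (l, s) := by
  obtain ⟨hG', hT⟩ := hG.upd (k := 0) h0 nuOK_pub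
  exact ⟨0, .pub, nuOK_pub, fun x hx => hT.safe_var (hl x hx), hT.rInv_var hE.toEnvClosed hs,
    fun t ht => .inl ht⟩

/-- Creating a login session. -/
theorem start (hE : EnvOK E) (hG : GWF E G) (h0 : G.NoNu) (hs : RInv E G s)
    {a f k n em inD : Term} (hr : StartRef E G (.seq [a, f, k, n, em, inD]))
    (hk : ∀ ref q, G.role k = some (.key ref q) → q.n.nf = q.n) {o : Out} {m : Term}
    (ho : o ∈ sendStartLoginResponse a f k n em inD s) : RStep E G m s o := by
  obtain ⟨a, f, k, n, i, j, d, he, hd, ha, hf, hkn⟩ := hr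
  simp only [Term.seq.injEq, List.cons.injEq, and_true] at he
  obtain ⟨rfl, rfl, rfl, rfl, rfl, rfl⟩ := he
  have hρ : NuOK E G (.lst (.seq [.str i, .str j])) :=
    ⟨⟨rfl, by simp⟩, trivial, by simp⟩
  obtain ⟨hG', hT⟩ := hG.upd (k := 4) h0 hρ
  have dy := hG'.dy
  have hs' := hT.rInv_var hE.toEnvClosed hs
  have k4 : (G.upd 4 (.lst (.seq [.str i, .str j]))).role (ν 4) =
    some (.lst (.seq [.str i, .str j])) := G.upd_self _ _
  have kn : ∀ x, x ≠ 4 → (G.upd 4 (.lst (.seq [.str i, .str j]))).Known (ν x) :=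
    fun x hx => known_nu (G.upd_ne _ hx)
  have h2 : get s [2] = .str E.fd := hs.comp (k := 1) (by norm_num)
  unfold sendStartLoginResponse at ho
  simp only [h2, mem_singleton_iff] at ho
  subst ho
  refine ⟨4, _, hρ, ?_, ?_, ?_⟩
  · refine hG'.dy.one (hT.safe_var hf) (hT.safe_var ha) ?_
    rcases hkn with ⟨h1, h2⟩ | ⟨ref, q, h1, h3, rfl, h5, rfl⟩
    · refine hG'.dy.okResponse (hT.safe_var h1) (hT.safe_var h2) (dy.seq (by simp))
        (dy.seq ?_)
      exact All.mem ⟨dy.pair (dy.str _) (kn 2 (by norm_num)).safe, dy.pair (dy.str _)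
        (Ghost.known_of_role k4 trivial).safe, dy.pair (dy.str _) (dy.str _)⟩
    · have hr' := hT.compat _ _ h1
      rw [ren_var, Ghost.Named.nf (G := G) ⟨_, h1⟩] at hr'
      refine safe_okResponse_key hr' (hk _ _ h1) rfl rfl (.rpStart hd h3 (h5 ▸ k4)) ?_
      exact All.mem ⟨.name (kn 2 (by norm_num)), .str _⟩
  · refine hs'.set1 (k := 6) (SeqOf.dictSet (hs'.comp (k := 6) (by norm_num)) (nf_get _ _) ?_)
    exact ⟨ν 4, i, j, ν 1, ν 3, d, ν 2, rfl, k4, kn 1 (by norm_num), kn 3 (by norm_num),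
      kn 2 (by norm_num), hd⟩
  · intro t ht
    rw [get_setAt_ne (by norm_num)] at ht
    exact .inl ht

end RInv

theorem checksig_cases {t x k : Term} (h : .checksig t x k ≈ₜ .top) :
    ∃ k', t.nf = .sig x.nf k' ∧ k.nf = .pub k' := by
  rw [equiv_iff_nf] at h
  change redChecksig t.nf x.nf k.nf = .top at h
  unfold redChecksig at h
  split at h
  · rename_i y k' ht
    split_ifs at h with hk
    exact ⟨k', by rw [ht, hk.1], hk.2⟩
  · cases h

namespace RInv

theorem session (hs : RInv E G s) {l : Term} (h : ¬ dictGet (get s [7]) l ≈ₜ .seq []) :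
    RpSession E G (.seq [l.nf, dictGet (get s [7]) l]) := by
  have h7 : SeqOf (RpSession E G) (get s [7]) := hs.comp (k := 6) (by norm_num)
  rcases dictGet_mem (z := get s [7]) (k := l) rfl with h' | ⟨e, he, h'⟩
  · rw [h'] at h; exact absurd (.refl _) h
  · exact h' ▸ h7.mem (nf_get _ _) he

theorem wk (hs : RInv E G s) {c : Str} (hc : E.cls c = .idp) :
    dictGet (get s [9]) (.str c) = .seq [] ∨
      dictGet (get s [9]) (.str c) = .seq [.seq [K .signkey, .pub (.nonce E.sk)]] := by
  have h9 : SeqOf (RpWk E) (get s [9]) := hs.comp (k := 8) (by norm_num)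
  rcases dictGet_mem (z := get s [9]) (k := .str c) rfl with h' | ⟨e, he, h'⟩
  · exact .inl h'
  · obtain ⟨c', v, h1, h2⟩ := h9.mem (nf_get _ _) he
    rw [h'] at h1
    simp only [Term.seq.injEq, List.cons.injEq, and_true] at h1
    obtain ⟨h1, rfl⟩ := h1
    cases h1
    exact .inr (h2 hc)

/-- Creating a service token. -/
theorem login (hE : EnvOK E) (hme : ∀ i j, E.me i j → E.cls j = .idp) (hG : GWF E G)
    (h0 : G.NoNu) (hs : RInv E G s) {a f m k n me pa par hd bd : Term} {d : Str}
    (ha : Safe E G a) (hf : Safe E G f) (hc : E.cls d = .rp)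
    (hmn : m.nf = .enca (.seq [(⟨n, me, d, pa, par, hd, bd⟩ : Req).term, k])
        (.pub (.nonce (E.ssl d))))
    (hnf : ∀ t ∈ [k, n, me, pa, par, hd, bd], t.nf = t)
    (hcase : (∀ t ∈ [k, n, me, pa, par, hd, bd], Safe E G t) ∨
        ∃ ref, G.role k = some (.key ref ⟨n, me, d, pa, par, hd, bd⟩))
    (hpa : pa = K .pLogin) {token ls : Term} (htok : dictGet bd (K .loginSessionToken) = token)
    (hls : dictGet (get s [7]) token = ls)
    (hor : dictGet hd (K .hOrigin) ≈ₜ .seq [.str d, K .https]) (h1 : ¬ ls ≈ₜ .seq [])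
    (h2 : .checksig (.decs (dictGet bd (K .eia)) (get ls [3]))
      (.seq [get ls [4], get ls [1], get s [2]])
      (dictGet (dictGet (get s [9]) (get ls [1, 2])) (K .signkey)) ≈ₜ .top) :
    RStep E G m s ([.seq [f, a, okResponse k n (.seq []) (.seq [ν 7, get ls [1]])]],
      appendAt (setAt s [7] (dictDel (get s [7]) token)) [8] (.seq [ν 7, get ls [1]])) := by
  have dy := hG.dy
  have htn : token.nf = token := by rw [← htok, nf_dictGet]
  obtain ⟨l, i, j, u, ia, d', tk, he, hl, hu, hia, htk, hd'⟩ := hs.session (hls ▸ h1)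
  have hfd : get s [2] = .str E.fd := hs.comp (k := 1) (by norm_num)
  rw [hls, htn] at he
  have hlsn : ls.nf = ls := by rw [← hls, nf_dictGet]
  simp only [Term.seq.injEq, List.cons.injEq, and_true] at he
  obtain ⟨rfl, he⟩ := he
  obtain ⟨g1, -, g3, g4⟩ := get_quad (hlsn.trans he)
  have g12 : get ls [1, 2] = .str j := by
    rw [show get ls [1, 2] = get (get ls [1]) [2] from get_append ls [1] [2], g1, get_pair_two]
    rfl
  rw [g1, g3, g4, g12, hfd] at h2
  rw [g1]
  -- the effect on the state
  have fin : ∀ ρ, NuOK E G ρ → (E.me i j → ρ = .priv) →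
      ((∃ ref q, G.role k = some (.key ref q)) → E.own i j) →
      (Safe E (G.upd 7 ρ) (okResponse k n (.seq []) (.seq [ν 7, .seq [.str i, .str j]]))) →
      RStep E G m s ([.seq [f, a, okResponse k n (.seq []) (.seq [ν 7, .seq [.str i, .str j]])]],
        appendAt (setAt s [7] (dictDel (get s [7]) token)) [8]
          (.seq [ν 7, .seq [.str i, .str j]])) := by
    intro ρ hρ hm hown hsafe
    obtain ⟨hG', hT⟩ := hG.upd (k := 7) h0 hρ
    have hs' := hT.rInv_var hE.toEnvClosed hs
    have b : RInv E (G.upd 7 ρ) (setAt s [7] (dictDel (get s [7]) token)) := by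
      refine hs'.set1 (k := 6) ?_
      exact SeqOf.sub (hs'.comp (k := 6) (by norm_num)) (nf_get _ _)
        fun e he => (List.mem_filter.1 he).1
    have b8 : SeqOf (RpToken E (G.upd 7 ρ))
      (get (setAt s [7] (dictDel (get s [7]) token)) [8]) := b.comp (k := 7) (by norm_num)
    have hn8 : get (setAt s [7] (dictDel (get s [7]) token)) [8] = get s [8] :=
      get_setAt_ne (by norm_num) _ _
    refine ⟨7, ρ, hρ, ?_, ?_, ?_⟩
    · exact hG'.dy.one (hT.safe_var hf) (hT.safe_var ha) hsafe
    · rw [appendAt_eq]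
      refine b.set1 (k := 7) (b8.append (nf_get _ _) ?_)
      exact ⟨ν 7, i, j, rfl, fun h => (G.upd_self _ _).trans (congrArg some (hm h))⟩
    · intro t ht
      simp only [appendAt] at ht
      rw [hn8] at ht
      obtain ⟨us, e1, e2⟩ := Comps.shape b (k := 7) (by norm_num)
      have e3 := get_setAt_self
        (v := .seq (items (get s [8]) ++ [.seq [ν 7, .seq [.str i, .str j]]]))
        e1 (List.getElem?_eq_getElem e2) [] []
      rw [setAt_nil, get_nil, nf_seq, List.map_append, map_nf_items] at e3
      rw [e3, ] at ht
      rw [items_of_nf (by rw [← e3, nf_get])] at ht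
      rcases mem_append.1 ht with ht | ht
      · exact .inl ht
      · right
        simp only [map_cons, map_nil, mem_singleton] at ht
        refine ⟨ν 7, i, j, ht, d, _, k, hc, hmn, hown⟩
  rcases hcase with hsafe | ⟨ref, hr⟩
  · have hk : Safe E G k := hsafe _ (by simp)
    have hnm : ¬ E.me i j := by
      intro hme'
      have hj := hme _ _ hme'
      obtain ⟨k', e1, e2⟩ := checksig_cases h2
      have hkk : k' = .nonce E.sk := by
        rcases hs.wk hj with h | h
        · rw [h, dictGet_nil] at e2; cases e2
        · rw [h, dictGet_cons, if_pos (hasKey_pair.2 rfl), get_pair_two] at e2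
          cases e2; rfl
      have hS : Safe E G (.decs (dictGet bd (K .eia)) ia) :=
        dy.decs (dy.dictGet (hsafe bd (by simp)) _) hia.safe
      rw [Safe, e1, hkk] at hS
      rcases hS.of_sig.2 with h | h
      · exact not_safeN (G := G) (a := .nonce E.sk) (hG.sk ⟨_, hj⟩) id h
      · refine h ⟨d', u, tk, i, j, ?_, hd', hme'⟩
        have hn := nf_of_mem (hlsn.trans he) (u := .encs (.seq [.str d', u]) tk) (by simp)
        rw [nf_seq]
        simp only [map_cons, map_nil, hn]
        rfl
    refine fin .pub nuOK_pub (fun h => absurd h hnm) ?_ ?_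
    · rintro ⟨ref, q, h⟩
      exact absurd hk (not_safe h id)
    · obtain ⟨hG', hT⟩ := hG.upd (k := 7) h0 nuOK_pub
      have dy' := hG'.dy
      exact hG'.dy.okResponse (hT.safe_var hk) (hT.safe_var (hsafe _ (by simp)))
        (dy'.seq (by simp)) (dy'.pair (known_nu (G.upd_self _ _)).safe
          (dy'.pair (dy'.str _) (dy'.str _)))
  · have hown : E.own i j := by
      have hok : ReqOK E G ref ⟨n, me, d, pa, par, hd, bd⟩ := hG.ok _ _ hr
      have hdn : hd.nf = hd := hnf _ (by simp)
      cases hok with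
      | rpWin _ _ _ _ z =>
        exfalso
        obtain ⟨l, z1, z2⟩ := z
        simp only at z1
        rw [equiv_iff_nf, nf_dictGet] at hor
        rcases dictGet_mem (z := hd) (k := K .hOrigin) rfl with h | ⟨e, he', h⟩
        · rw [h] at hor; simp [nf_seq] at hor
        · rw [items_of_nf (hdn.trans z1)] at he'
          obtain ⟨w, v, h3, h4⟩ := z2 e he'
          rw [h] at h3
          simp only [Term.seq.injEq, List.cons.injEq, and_true] at h3
          obtain ⟨h3, h5⟩ := h3
          have hw : w = .hOrigin := by
            change K .hOrigin = K w at h3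
            simpa using h3.symm
          obtain ⟨x, y, h6, h7⟩ := h4 hw
          rw [← h5, hor, nf_seq] at h6
          simp only [map_cons, map_nil, Term.seq.injEq, List.cons.injEq, and_true] at h6
          obtain ⟨rfl, rfl⟩ := h6
          rcases h7 with ⟨ts, h7⟩ | h7 | ⟨-, h, h8, h9⟩
          · cases h7
          · cases h7
          · cases h8
            exact h9 hc
      | @rpLogin dn x L y t _ _ _ _ _ z6 z7 =>
        simp only at z6
        have hbn : bd.nf = bd := hnf _ (by simp)
        have : token = t.nf := by
          rw [← htok, z6, dictGet_cons, if_neg, dictGet_cons, if_pos (hasKey_pair.2 rfl),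
            get_pair_two]
          rw [hasKey_pair]
          simp [Term.nf]
        rw [nf_of_mem (nf_of_mem (hbn.trans z6) (u := .seq [K .loginSessionToken, t])
          (by simp)) (by simp)] at this
        subst this
        rcases z7 with ⟨i', j', z8, z9⟩ | ⟨x, z8⟩ | z8 | z8
        · rw [hl] at z8
          simp only [Option.some.injEq, Role.lst.injEq, Term.seq.injEq, List.cons.injEq,
            Term.str.injEq, and_true] at z8
          rw [z8.1, z8.2]; exact z9
        all_goals
          rw [z8] at hl
          simp [Ghost.role] at hl
      | rpStart _ _ _ _ z => simp only at z; rw [hpa] at z; simp at z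
      | idpWin z => simp [hc] at z
      | idpSign z => simp [hc] at z
      | idpInfo z => simp [hc] at z
      | fwdWin z => simp [hc] at z
    refine fin .priv nuOK_priv (fun _ => rfl) (fun _ => hown) ?_
    obtain ⟨hG', hT⟩ := hG.upd (k := 7) h0 nuOK_priv
    have hr' := hT.compat _ _ hr
    rw [ren_var, Ghost.Named.nf (G := G) ⟨_, hr⟩] at hr'
    exact safe_okResponse_key hr' (hnf n (by simp)) rfl rfl
      (.rpLogin hc hpa ⟨_, G.upd_self _ _⟩) (by simp)

end RInv

namespace RInv

theorem pending_mem (hs : RInv E G s) {n : Term} (h : dictMem (get s [5]) n) :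
    ∃ ref n' c, dictGet (get s [5]) n = .seq [ref, (infoReq n' c).term] ∧ StartRef E G ref ∧
      G.Known n' ∧ ref.nf = ref ∧ (infoReq n' c).term.nf = (infoReq n' c).term := by
  obtain ⟨l, h1, h2⟩ : SeqOf (RpDns E G) (get s [5]) := hs.comp (k := 4) (by norm_num)
  obtain ⟨e, hm, he⟩ := dictGet_of_mem h
  have hen := nf_of_mem_items hm
  rw [items_of_nf (by rw [nf_get, h1])] at hm
  obtain ⟨k, ref, n', c, rfl, hp, hkn⟩ := h2 _ hm
  have h3 := nf_of_mem hen (u := .seq [ref, (infoReq n' c).term]) (by simp)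
  rw [get_pair_two, h3] at he
  exact ⟨ref, n', c, he, hp, hkn, nf_of_mem h3 (by simp), nf_of_mem h3 (by simp)⟩

theorem request (hE : EnvOK E) (hme : ∀ i j, E.me i j → E.cls j = .idp) (hG : GWF E G)
    (h0 : G.NoNu) (hs : RInv E G s) {ids : Finset Identity}
    {a f m inD k n me pa par hd bd : Term} (ha : Safe E G a) (hf : Safe E G f) (hm : Safe E G m)
    (hreq : HttpsRequest (get s [4]) m inD k n me pa par hd bd) {o : Out}
    (ho : o ∈ rpRequest ids a f inD k n me pa par hd bd s) : RStep E G m s o := by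
  have dy := hG.dy
  have hnil : Safe E G (.seq []) := dy.nil
  have h2 : get s [2] = .str E.fd := hs.comp (k := 1) (by norm_num)
  have h4 : KeysOK E .rp (get s [4]) := hs.comp (k := 3) (by norm_num)
  obtain ⟨d, rfl, hc, hmn, hnf, hcase⟩ := hreq.cases h4 hm
  have hkn : ∀ {k} ref q, G.role k = some (.key ref q) → q.n.nf = q.n :=
    fun _ _ h => (Req.cn (hG.closed _ _ h).2).1.1
  have hpn : pa.nf = pa := hnf _ (by simp)
  have hbn : bd.nf = bd := hnf _ (by simp)
  have idle : o = ([], s) → RStep E G m s o := by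
    rintro rfl
    exact hs.quiet hE hG h0 m (by simp)
  have resp : ∀ bd', bd'.nf = bd' → Safe E G bd' →
      (∃ parts, Resp E G ⟨n, me, d, pa, par, hd, bd⟩ (.seq []) bd' parts ∧
        ∀ p ∈ parts, SafeN E G p) →
      o = ([.seq [f, a, okResponse k n (.seq []) bd']], s) → RStep E G m s o := by
    rintro bd' e1 e2 ⟨parts, e3, e4⟩ rfl
    refine hs.quiet hE hG h0 m ?_
    refine hG.dy.one hf ha ?_
    rcases hcase with hsafe | ⟨ref, hr⟩
    · exact hG.dy.okResponse (hsafe _ (by simp)) (hsafe _ (by simp)) hnil e2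
    · exact safe_okResponse_key hr (hnf n (by simp)) rfl e1 e3 e4
  have hst : pa ≈ₜ K .pStartLogin → (∃ i ∈ ids, bd ≈ₜ i.term) → ∃ e : Identity,
      bd = .seq [.str e.name, .str e.domain] ∧ StartRef E G (.seq [a, f, k, n, bd, .str d]) := by
    rintro c ⟨e, -, he⟩
    have hpa : pa = K .pStartLogin := hpn.symm.trans (equiv_iff_nf.1 c)
    rw [equiv_iff_nf, hbn] at he
    have hbd : bd = .seq [.str e.name, .str e.domain] := he
    refine ⟨e, hbd, a, f, k, n, e.name, e.domain, d, by rw [hbd], hc, ha, hf, ?_⟩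
    rcases hcase with hsafe | ⟨ref, hr⟩
    · exact .inl ⟨hsafe _ (by simp), hsafe _ (by simp)⟩
    · exact .inr ⟨ref, _, hr, hpa, rfl, hbd, rfl⟩
  unfold rpRequest at ho
  simp only [ite_not] at ho
  split_ifs at ho with c1 c2 c3 c4 c5 c6 c7 c8 c9
  · rw [equiv_iff_nf, hpn] at c1
    refine resp _ rfl (dy.pair (dy.str _) (dy.seq ?_)) ⟨_, .rpRoot hc c1, by simp⟩ ho
    exact All.mem ⟨dy.str _, dy.bot, dy.bot, dy.bot, dy.bot, dy.bot⟩
  · obtain ⟨e, hbd, href⟩ := hst c2.1 c3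
    exact hs.start hE hG h0 href (fun _ _ => hkn _ _) ho
  · obtain ⟨e, hbd, href⟩ := hst c2.1 c3
    have hdom : get bd [2] = .str e.domain := by rw [hbd, get_pair_two]; rfl
    obtain ⟨ad, h1⟩ : ∃ a, get s [1] = .addr a := hs.comp (k := 0) (by norm_num)
    rw [hdom, h1, mem_singleton_iff] at ho
    subst ho
    obtain ⟨hG', hT⟩ := hG.upd (k := 6) h0 nuOK_pub
    have dy' := hG'.dy
    have k6 : (G.upd 6 .pub).Known (ν 6) := known_nu (G.upd_self _ _)
    have hs' := hT.rInv_var hE.toEnvClosed hs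
    refine ⟨6, .pub, nuOK_pub, ?_, ?_, ?_⟩
    · refine hG'.dy.one (dy'.addr _) (hT.safe_var ha) (dy'.seq ?_)
      exact All.mem ⟨dy'.str _, dy'.str _, k6.safe⟩
    · refine hs'.set1 (k := 4) (SeqOf.dictSet (hs'.comp (k := 4) (by norm_num)) (nf_get _ _) ?_)
      have := hT.startRef href
      rw [ren_var] at this
      exact ⟨ν 6, _, ν 6, e.domain, rfl, this, k6⟩
    · intro t ht
      rw [get_setAt_ne (by norm_num)] at ht
      exact .inl ht
  · exact idle ho
  · exact idle ho
  · -- a request for the redirection to the login dialog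
    have hpa : pa = K .pRedir := hpn.symm.trans (equiv_iff_nf.1 c5.1)
    set ls := dictGet (get s [7]) (dictGet par (K .loginSessionToken)) with hls
    obtain ⟨l, i, j, u, ia, d', tk, he, hl, hu, hia, htk, hd'⟩ := hs.session c6
    rw [← hls] at he
    simp only [Term.seq.injEq, List.cons.injEq, and_true] at he
    have sls : Safe E G ls := by
      rw [he.2]
      exact dy.list ⟨dy.pair (dy.str _) (dy.str _), hu.safe, hia.safe,
        dy.encs (dy.pair (dy.str _) hu.safe) htk.safe⟩
    set url := urlTerm (K .https) (get ls [1, 2]) (K .pWkLogin) (.seq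
      [.seq [K .email, get ls [1]], .seq [K .tag, get ls [4]], .seq [K .iaKey, get ls [3]],
        .seq [K .fwdDomain, get s [2]]]) with hurl
    have hun : url.nf = url := by
      simp only [hurl, urlTerm, nf_seq, map_cons, map_nil, nf_get]
      rfl
    have sun : Safe E G url := by
      refine dy.urlTerm (dy.str _) (dy.get sls _) (dy.str _) (dy.seq ?_)
      rw [h2]
      exact All.mem ⟨dy.pair (dy.str _) (dy.get sls _), dy.pair (dy.str _) (dy.get sls _),
        dy.pair (dy.str _) (dy.get sls _), dy.pair (dy.str _) (dy.str _)⟩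
    refine resp _ ?_ (dy.pair (dy.str _) sun) ⟨_, .rpRedir hc hpa, ?_⟩ ho
    · rw [nf_seq, map_cons, map_cons, map_nil, hun]
      rfl
    · rw [all_one]
      rwa [Safe, hun] at sun
  · exact idle ho
  · rw [mem_singleton_iff] at ho
    rw [ho]
    simp only [not_or, not_not] at c8
    exact hs.login hE hme hG h0 ha hf hc hmn hnf hcase
      (hpn.symm.trans (equiv_iff_nf.1 c7.1)) rfl rfl c8.1 c8.2.2 c9
  · exact idle ho
  · exact idle ho

/-- The response to a request for the public key of an identity provider. -/
theorem response (hE : EnvOK E) (hG : GWF E G) (h0 : G.NoNu) (hs : RInv E G s) {f m e : Term}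
    (hm : Safe E G m) (he : MatchesEncrypted (get s [6]) m f e) {o : Out}
    (ho : let m' := get (.decs m (get e [3])) []
      if ¬ get m' [2] ≈ₜ get e [2, 2] then o = ([], s)
      else if ¬ ∃ a' f' k n email inDomain, get e [1] = .seq [a', f', k, n, email, inDomain] then
        o = ([], s)
      else
        let s' := setAt s [6] (removeElem (get s [6]) e)
        let s' := setAt s' [9] (dictSet (get s' [9]) (get e [2, 4]) (get m' [5]))
        o ∈ sendStartLoginResponse (get e [1, 1]) (get e [1, 2]) (get e [1, 3]) (get e [1, 4])
          (get e [1, 5]) (get e [1, 6]) s') : RStep E G m s o := by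
  have idle : o = ([], s) → RStep E G m s o := by
    rintro rfl
    exact hs.quiet hE hG h0 m (by simp)
  have h6 : SeqOf (RpPending E G) (get s [6]) := hs.comp (k := 5) (by norm_num)
  obtain ⟨ref, req, key, rfl, hmem, -, hresp⟩ := he
  obtain ⟨ref', n, c, key', a', he, hr, hkey⟩ := h6.mem (nf_get _ _) hmem
  simp only [Term.seq.injEq, List.cons.injEq, and_true] at he
  obtain ⟨rfl, rfl, rfl, -⟩ := he
  have hn := nf_of_mem_items hmem
  have hrn : ref.nf = ref := nf_of_mem hn (by simp)
  have hqn : (infoReq n c).term.nf = (infoReq n c).term := nf_of_mem hn (by simp)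
  have hkn : key.nf = key := nf_of_mem hn (by simp)
  obtain ⟨g1, g2, g3, -⟩ := get_quad hn
  have g24 : get (.seq [ref, (infoReq n c).term, key, f.nf]) [2, 4] = .str c := by
    rw [show get (.seq [ref, (infoReq n c).term, key, f.nf]) [2, 4] =
      get (get (.seq [ref, (infoReq n c).term, key, f.nf]) [2]) [4] from get_append _ [2] [4], g2]
    exact get_one hqn (k := 3) rfl
  simp only [ite_not] at ho
  split_ifs at ho with c1 c2
  rotate_left
  · exact idle ho
  · exact idle ho
  · obtain ⟨a, f', k, m₀, i, j, d, rfl, hd, ha, hf, h1⟩ := hr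
    have gg : ∀ x, get (.seq [.seq [a, f', k, m₀, .seq [.str i, .str j], .str d],
        (infoReq n c).term, key, f.nf]) [1, x] =
        get (.seq [a, f', k, m₀, .seq [.str i, .str j], .str d]) [x] := fun x => by
      rw [show get _ [1, x] = get (get _ [1]) [x] from get_append _ [1] [x], g1]
    rw [g24, g3, gg, gg, gg, gg, gg, gg, get_one hrn (k := 0) rfl, get_one hrn (k := 1) rfl,
      get_one hrn (k := 2) rfl, get_one hrn (k := 3) rfl, get_one hrn (k := 4) rfl,
      get_one hrn (k := 5) rfl] at ho
    have b6 : RInv E G (setAt s [6] (removeElem (get s [6])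
        (.seq [.seq [a, f', k, m₀, .seq [.str i, .str j], .str d], (infoReq n c).term, key,
          f.nf]))) := by
      refine hs.set1 (k := 5) (SeqOf.sub h6 (nf_get _ _) fun e he => List.mem_of_mem_erase he)
    have hwk : RpWk E (.seq [(Term.str c).nf, (get (get (.decs m key) []) [5]).nf]) := by
      refine ⟨c, _, rfl, fun hc => ?_⟩
      have hk := hkey hc
      have h2 := decs_cases hresp
      rw [hkn] at h2
      have h3 := hm
      rw [Safe, h2] at h3
      rw [nf_get, get_nil]
      rcases h3.of_encs with ⟨-, h3⟩ | ⟨ref, q, hd, bd, parts, h3, h4, -, h5⟩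
      · exact absurd h3 (not_safeN hk id)
      · rw [hk] at h3
        simp only [Option.some.injEq, Role.key.injEq] at h3
        obtain ⟨-, rfl⟩ := h3
        have h6 : (Term.decs m key).nf.nf = httpResponse (infoReq n c).n (K .s200) hd bd := by
          rw [nf_nf, h5]
        rw [get_one h6 (k := 4) rfl]
        cases h4 with
        | idpInfo => rfl
        | rpRoot h => simp [infoReq, hc] at h
        | rpStart h => simp [infoReq, hc] at h
        | rpRedir h => simp [infoReq, hc] at h
        | rpLogin h => simp [infoReq, hc] at h
        | fwd h => simp [infoReq, hc] at h
        | idpLogin _ h => simp [infoReq] at h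
        | idpSign _ h => simp [infoReq] at h
    have b9 := b6.set1 (k := 8) (SeqOf.dictSet (b6.comp (k := 8) (by norm_num)) (nf_get _ _) hwk)
    obtain ⟨x, ρ, e1, e2, e3, e4⟩ := b9.start hE hG h0 (m := m)
      ⟨a, f', k, m₀, i, j, d, rfl, hd, ha, hf, h1⟩
      (fun ref q h => (Req.cn (hG.closed _ _ h).2).1.1) ho
    refine ⟨x, ρ, e1, e2, e3, fun t ht => ?_⟩
    have := e4 t ht
    rwa [get_setAt_ne (by norm_num), get_setAt_ne (by norm_num)] at this

theorem dns (hE : EnvOK E) (hG : GWF E G) (h0 : G.NoNu) (hs : RInv E G s) (hcl : Closed s)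
    {a m : Term} (ha : Safe E G a) (hm : Safe E G m) (hmem : dictMem (get s [5]) (get m [4]))
    {o : Out} (ho : o ∈ (let pending := dictGet (get s [5]) (get m [4])
      let message := get pending [2]
      let s' := appendAt s [6] (.seq [get pending [1], message, ν 5, get m [3]])
      {([.seq [get m [3], a, .enca (.seq [message, ν 5]) (dictGet (get s [3]) (get message [4]))]],
        setAt s' [5] (dictDel (get s [5]) (get m [4])))} : Set Out)) : RStep E G m s o := by
  obtain ⟨ref, n, c, hp, hr, hkn, hrn, hqn⟩ := hs.pending_mem hmem
  have hpn : (dictGet (get s [5]) (get m [4])).nf = .seq [ref, (infoReq n c).term] := by rw [nf_dictGet, hp]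
  have g1 := get_one hpn (k := 0) rfl
  have g2 := get_one hpn (k := 1) rfl
  have g4 : get (infoReq n c).term [4] = .str c := get_one hqn (k := 3) rfl
  have h3 : get s [3] = E.km := hs.comp (k := 2) (by norm_num)
  have hcq : CN (infoReq n c).term := by
    have := Closed.dy.get (Closed.dy.dictGet (Closed.dy.get hcl [5]) (get m [4])) [2]
    rw [g2] at this
    exact hqn ▸ this.cn
  simp only [g1, g2, g4, h3, mem_singleton_iff] at ho
  have hm3 : Safe E G (get m [3]) := hG.dy.get hm _
  suffices ∃ ρ, NuOK E G ρ ∧ Safe E (G.upd 5 ρ) (.enca (.seq [(infoReq n c).term, ν 5])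
      (dictGet E.km (.str c))) ∧
      (E.cls c = .idp → (G.upd 5 ρ).role (ν 5) = some (.key .bot (infoReq n c))) by
    obtain ⟨ρ, hρ, h5, h6⟩ := this
    obtain ⟨hG', hT⟩ := hG.upd (k := 5) h0 hρ
    have hs' := hT.rInv_var hE.toEnvClosed hs
    subst ho
    refine ⟨5, ρ, hρ, ?_, ?_, ?_⟩
    · exact hG'.dy.one (hT.safe_var hm3) (hT.safe_var ha) h5
    · rw [appendAt_eq]
      have b6 := hs'.set1 (k := 5) (SeqOf.append
        (v := .seq [ref, (infoReq n c).term, ν 5, get m [3]]) (hs'.comp (k := 5) (by norm_num))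
        (nf_get _ _) ?_)
      · refine b6.set1 (k := 4) (SeqOf.sub (hs'.comp (k := 4) (by norm_num)) (nf_get _ _)
          fun e he => (List.mem_filter.1 he).1)
      · refine ⟨ref, n, c, ν 5, get m [3], ?_, ?_, h6⟩
        · rw [nf_seq]
          simp only [map_cons, map_nil, hrn, hqn, nf_get]
          rfl
        · have := hT.startRef hr
          rwa [ren_var, hrn] at this
    · intro t ht
      rw [get_setAt_ne (by norm_num), appendAt_eq, get_setAt_ne (by norm_num)] at ht
      exact .inl ht
  by_cases hc : E.cls c = .idp
  · have hρ : NuOK E G (.key .bot (infoReq n c)) :=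
      ⟨⟨⟨rfl, by simp⟩, hcq⟩, .idpInfo hc rfl rfl, by rintro _ _ ⟨⟩; simp [infoReq, hc]⟩
    have hr : (G.upd 5 (.key .bot (infoReq n c))).role (ν 5) = some (.key .bot (infoReq n c)) :=
      G.upd_self _ _
    refine ⟨_, hρ, ?_, fun _ => hr⟩
    rw [(hE.km_get c).resolve_right fun h => by simp [hc] at h]
    have hn : (Term.enca (.seq [(infoReq n c).term, ν 5]) (.pub (.nonce (E.ssl c)))).nf =
        .enca (.seq [(infoReq n c).term, ν 5]) (.pub (.nonce (E.ssl c))) := by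
      change Term.enca (Term.seq _).nf _ = _
      rw [nf_seq, map_cons, map_cons, map_nil, hqn]
      rfl
    rw [Safe, hn]
    exact .req hr
  · refine ⟨.pub, nuOK_pub, ?_, fun h => absurd h hc⟩
    obtain ⟨hG', hT⟩ := hG.upd (k := 5) h0 nuOK_pub
    have dy := hG.dy
    have dy' := hG'.dy
    refine dy'.enca (dy'.pair (hT.safe_var (dy.seq ?_)) (known_nu (G.upd_self _ _)).safe)
      (hT.safe_var (dy.dictGet (safe_km hE hG) _))
    have hnil : Safe E G (.seq []) := dy.nil
    simp only [infoReq, mem_cons, not_mem_nil, or_false, forall_eq_or_imp, forall_eq]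
    exact ⟨dy.str _, hkn.safe, dy.str _, dy.str _, dy.str _, hnil, hnil, hnil⟩

theorem step (hE : EnvOK E) (hme : ∀ i j, E.me i j → E.cls j = .idp) (hG : GWF E G)
    (h0 : G.NoNu) (hs : RInv E G s) (hcl : Closed s) {domains : Finset Str}
    {ids : Finset Identity} {a f m : Term} (ha : Safe E G a) (hf : Safe E G f) (hm : Safe E G m)
    {o : Out} (ho : o ∈ rpAlg domains ids a f m s) :
    (∃ l, get o.2 [10] = .seq l) ∨ RStep E G m s o := by
  have h10 : get s [10] = .bot := hs.comp (k := 9) (by norm_num)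
  have idle : o = ([], s) → RStep E G m s o := by
    rintro rfl
    exact hs.quiet hE hG h0 m (by simp)
  unfold rpAlg at ho
  rw [h10] at ho
  split_ifs at ho with c c1 c2 c3
  · rw [corruptOut_state ho]
    exact .inl (get_setAt_seq (Comps.shape hs (by norm_num)))
  all_goals right
  · obtain ⟨e, he, ho⟩ := ho
    exact hs.response hE hG h0 hm he ho
  · simp only at ho
    split_ifs at ho with c5
    · exact idle ho
    · rw [not_or, not_not, not_not] at c5
      exact hs.dns hE hG h0 hcl ha hm c5.1 ho
  · obtain ⟨inD, k, n, me, pa, par, hd, bd, hreq, ho⟩ := ho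
    exact hs.request hE hme hG h0 ha hf hm hreq ho
  · exact idle ho

end RInv

section

/-! # Processing steps -/

/-- Terms without placeholders of scripts. -/
def NoLam (t : Term) : Prop := ∀ n, ¬ VarIn (.lam n) t.nf

theorem NoLam.dy : DY NoLam := dy_not_varIn .lam

theorem Closed.noLam {t : Term} (h : Closed t) : NoLam t := fun _ => h _

theorem noLam_nu (k : ℕ) : NoLam (ν k) := by intro n; simp [Term.nf]

/-- The number of elements of `V` below `k`. -/
def rank (V : Finset ℕ) (k : ℕ) : ℕ := (V.filter (· < k)).card

theorem rank_lt {V : Finset ℕ} {k : ℕ} (hk : k ∈ V) : rank V k < V.card :=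
  Finset.card_lt_card ((Finset.filter_ssubset).2 ⟨k, hk, lt_irrefl k⟩)

theorem rank_inj {V : Finset ℕ} {k l : ℕ} (hk : k ∈ V) (hl : l ∈ V) (h : rank V k = rank V l) :
    k = l := by
  have : ∀ {k l}, k ∈ V → k < l → rank V k < rank V l := by
    intro k l hk hkl
    refine Finset.card_lt_card ⟨fun x hx => ?_, fun hs => ?_⟩
    · rw [Finset.mem_filter] at hx ⊢
      exact ⟨hx.1, hx.2.trans hkl⟩
    · have := hs (Finset.mem_filter.2 ⟨hk, hkl⟩)
      exact lt_irrefl k (Finset.mem_filter.1 this).2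
  rcases lt_trichotomy k l with h' | h' | h'
  · exact absurd h (this hk h').ne
  · exact h'
  · exact absurd h (this hl h').ne'

/-- Replaces the placeholders in `V` by the nonces in `N`, and renames all others. -/
def stepSubst (V : Finset ℕ) (N : ℕ → ℕ) (i : ℕ) : Var → Term
  | .nu v => if v ∈ V then .nonce (N (rank V v)) else .var (.lam (Nat.pair i v))
  | .lam n => .var (.lam n)

/-- The roles after the `i`-th step. -/
def Ghost.after (G : Ghost) (k : ℕ) (ρ : Role) (V : Finset ℕ) (N : ℕ → ℕ) (i : ℕ) : Ghost where
  n x := if k ∈ V ∧ x = N (rank V k) then some ρ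
    else if ∃ v ∈ V, x = N (rank V v) then some .pub else G.n x
  v
    | .nu _ => none
    | .lam m => if m.unpair.1 = i then (G.upd k ρ).v (.nu m.unpair.2) else G.v (.lam m)

/-- Before the `i`-th step, the nonces in `N` and the placeholders reserved for later steps have
no roles. -/
structure Ghost.Fresh (G : Ghost) (N : ℕ → ℕ) (i : ℕ) : Prop where
  inj : Function.Injective N
  n : ∀ m, G.n (N m) = none
  nu : G.NoNu
  lam : ∀ m : ℕ, i ≤ m.unpair.1 → G.v (.lam m) = none

section After
variable {N : ℕ → ℕ} {i k : ℕ} {ρ : Role} {V : Finset ℕ}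

theorem Ghost.after_n (hF : G.Fresh N i) {x : ℕ} {ρ' : Role} (h : G.n x = some ρ') :
    (G.after k ρ V N i).n x = some ρ' := by
  have : ∀ m, x ≠ N m := by
    rintro m rfl
    rw [hF.n] at h
    cases h
  simp [Ghost.after, this, h]

theorem Ghost.after_role (hF : G.Fresh N i) {a : Term} {ρ' : Role}
    (h : (G.upd k ρ).role a = some ρ') :
    (G.after k ρ V N i).role (ren (stepSubst V N i) a) = some ρ' := by
  rcases Ghost.Named.cases (G := G.upd k ρ) ⟨_, h⟩ with ⟨x, rfl⟩ | ⟨j | m, rfl⟩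
  · exact Ghost.after_n hF h
  · change (G.after k ρ V N i).role
      (if j ∈ V then Term.nonce (N (rank V j)) else .var (.lam (Nat.pair i j))).nf = _
    simp only [Ghost.role, Ghost.upd, Option.some.injEq] at h
    split_ifs with hj
    · change (G.after k ρ V N i).n _ = _
      unfold Ghost.after
      by_cases hjk : j = k
      · subst hjk
        simp only [if_true] at h
        simp [hj, h]
      · rw [if_neg hjk] at h
        have : ¬ (k ∈ V ∧ N (rank V j) = N (rank V k)) :=
          fun ⟨h1, h2⟩ => hjk (rank_inj hj h1 (hF.inj h2))
        simp only [if_neg this]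
        rw [if_pos ⟨j, hj, rfl⟩, h]
    · simp [Ghost.role, Ghost.after, Term.nf, Ghost.upd, h]
  · change (G.after k ρ V N i).v (.lam m) = some ρ'
    have h' : G.v (.lam m) = some ρ' := h
    have : m.unpair.1 ≠ i := by
      intro hm
      rw [hF.lam m hm.ge] at h'
      cases h'
    simp [Ghost.after, this, h']

theorem Ghost.role_after {a : Term} {ρ' : Role} (h : (G.after k ρ V N i).role a = some ρ') :
    G.role a = some ρ' ∨ ρ' = ρ ∨ ρ' = .pub := by
  rcases Ghost.Named.cases (G := G.after k ρ V N i) ⟨_, h⟩ with ⟨x, rfl⟩ | ⟨j | m, rfl⟩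
  · simp only [Ghost.role, Ghost.after] at h ⊢
    split_ifs at h <;> grind
  · simp [Ghost.role, Ghost.after] at h
  · simp only [Ghost.role, Ghost.after, Ghost.upd] at h ⊢
    split_ifs at h <;> grind

theorem GWF.after (hG : GWF E G) (hF : G.Fresh N i) (hρ : NuOK E G ρ) :
    GWF E (G.after k ρ V N i) ∧ Tr E (G.upd k ρ) (stepSubst V N i) (G.after k ρ V N i) ∧
      (G.after k ρ V N i).Fresh (fun n => N (n + V.card)) (i + 1) := by
  obtain ⟨hG', -⟩ := hG.upd (k := k) hF.nu hρ
  have hst : GStat E (G.after k ρ V N i) := ⟨fun h hh => Ghost.after_n hF (hG.ssl h hh),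
    fun a ref q h => by
      rcases Ghost.role_after h with h | h | h
      · exact hG.key _ _ _ h
      · exact hρ.key _ _ h.symm
      · cases h⟩
  have hT : Tr E (G.upd k ρ) (stepSubst V N i) (G.after k ρ V N i) :=
    ⟨hst, hG'.closed, fun a ρ' h => Ghost.after_role hF h⟩
  have hup : ∀ {a ρ'}, G.role a = some ρ' → RoleOK E (G.after k ρ V N i) ρ' := by
    intro a ρ' h
    have h1 := hG.upd (k := k) hF.nu hρ
    exact hT.roleOK (hG.closed _ _ h) (h1.2.roleOK (hG.closed _ _ h) (hG.ok _ _ h))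
  refine ⟨⟨hst, fun a ρ' h => ?_, fun a ρ' h => ?_, fun h => Ghost.after_n hF (hG.sk h),
    fun n h => Ghost.after_n hF (hG.pubs n h)⟩, hT, fun a b h => ?_, fun m => ?_, fun _ => rfl,
    fun m hm => ?_⟩
  · rcases Ghost.role_after h with h | rfl | rfl
    · exact hG.closed _ _ h
    · exact hρ.closed
    · trivial
  · rcases Ghost.role_after h with h | rfl | rfl
    · exact hup h
    · exact hT.roleOK hρ.closed ((hG.upd (k := k) hF.nu hρ).2.roleOK hρ.closed hρ.ok)
    · trivial
  · have := hF.inj h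
    omega
  · have : ∀ v ∈ V, N (m + V.card) ≠ N (rank V v) := fun v hv h => by
      have := hF.inj h
      have := rank_lt hv
      omega
    have h1 : ¬ ∃ v ∈ V, N (m + V.card) = N (rank V v) := fun ⟨v, hv, h⟩ => this v hv h
    have h2 : ¬ (k ∈ V ∧ N (m + V.card) = N (rank V k)) := fun h => this k h.1 h.2
    simp only [Ghost.after, if_neg h1, if_neg h2, hF.n]
  · have : m.unpair.1 ≠ i := by omega
    simp only [Ghost.after, if_neg this]
    exact hF.lam m (by omega)

theorem ren_freshSubst {t : Term} (ht : NoLam t) (hV : t.nus ⊆ V) :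
    ren (freshSubst V N) t = ren (stepSubst V N i) t := by
  rw [← ren_nf, ← ren_nf _ t, ren, ren]
  congr 1
  refine subst_congr fun v hv => ?_
  cases v with
  | nu k =>
    have : k ∈ V := hV (mem_nus.2 (varIn_nf hv))
    simp only [freshSubst, stepSubst, this, if_true]
    rfl
  | lam n => exact absurd hv (ht n)

theorem closed_freshSubst {t : Term} (ht : NoLam t) : Closed (t.subst (freshSubst V N)) := by
  intro v hv
  obtain ⟨w, h1, h2⟩ := varIn_ren _ hv
  cases w with
  | nu k => simp [freshSubst] at h2
  | lam n => exact ht n h1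

end After

/-! ### Invariants of runs -/

/-- Invariants `I` of the states of processes and `Ev` of the emitted events, which are preserved
as long as the states do not satisfy `bad`. -/
structure Simulation {P : Type*} (E : Env) (sys : P → AtomicProc) (I Ev : Ghost → P → Term → Prop)
    (bad : P → Term → Prop) : Prop where
  tr : ∀ {G σ G' p t}, Tr E G σ G' → I G p t → I G' p (ren σ t)
  nf : ∀ {G p t}, I G p t.nf → I G p t
  trEv : ∀ {G σ G' p t}, Tr E G σ G' → Ev G p t → Ev G' p (ren σ t)
  nfEv : ∀ {G p t}, Ev G p t.nf → Ev G p t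
  noLam : ∀ {p a f m s l s'}, (sys p).rel (.seq [.addr a, .addr f, m]) s l s' → NoLam m → NoLam s →
    (∀ x ∈ l, NoLam x) ∧ NoLam s'
  step : ∀ {G p a f m s l s'}, GWF E G → G.NoNu → I G p s → Closed s → Safe E G m → Closed m →
    (sys p).rel (.seq [.addr a, .addr f, m]) s l s' → (∀ σ, bad p (s'.subst σ)) ∨
    ∃ k ρ, NuOK E G ρ ∧ (∀ x ∈ l, Safe E (G.upd k ρ) x ∧ Ev (G.upd k ρ) p x) ∧ I (G.upd k ρ) p s'

/-- The invariants hold in the `i`-th configuration. -/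
structure Holds {P : Type*} {sys : P → AtomicProc} {E0 : ℕ → Term} {fresh : Set ℕ}
    (r : Run sys E0 fresh) (E : Env) (I Ev : Ghost → P → Term → Prop) (i : ℕ) (G : Ghost) :
    Prop where
  wf : GWF E G
  fresh : G.Fresh (r.conf i).N i
  st : ∀ p, I G p ((r.conf i).S p) ∧ Closed ((r.conf i).S p)
  ev : ∀ k, Safe E G ((r.conf i).E k) ∧ Closed ((r.conf i).E k)
  sent : ∀ l < i, ∀ x ∈ r.eout l, Ev G (r.proc l) x ∧ Closed x

section Runs
variable {P : Type*} {sys : P → AtomicProc} {E0 : ℕ → Term} {fresh : Set ℕ}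
  {r : Run sys E0 fresh} {I Ev : Ghost → P → Term → Prop} {bad : P → Term → Prop}

theorem Simulation.holds_succ (hS : Simulation E sys I Ev bad) {i : ℕ}
    (hi : ((i + 1 : ℕ) : ℕ∞) ≤ r.len) (h : Holds r E I Ev i G)
    (hb : ∀ p, ¬ bad p ((r.conf (i + 1)).S p)) : ∃ G', Holds r E I Ev (i + 1) G' := by
  obtain ⟨k, a, f, m, l, s', hk, he, -, hrel, ho, hs', hq, hE', hN⟩ := r.step i hi
  have hdy := h.wf.dy
  have hm : Safe E G m := hdy.of_seq (by rw [← he, ← hk]; exact (h.ev k).1) (by simp)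
  have hmc : Closed m := Closed.dy.of_seq (by rw [← he, ← hk]; exact (h.ev k).2) (by simp)
  rw [he] at hrel
  obtain ⟨hI, hc⟩ := h.st (r.proc i)
  obtain ⟨nl, ns⟩ := hS.noLam hrel hmc.noLam hc.noLam
  rcases hS.step h.wf h.fresh.nu hI hc hm hmc hrel with h' | ⟨k', ρ, hρ, hl, hI'⟩
  · exact absurd (hs' ▸ h' _) (hb _)
  set V := s'.nus ∪ Term.nusList l with hV
  set N := (r.conf i).N with hNd
  obtain ⟨w1, w2, w3⟩ := h.wf.after (k := k') (V := V) h.fresh hρ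
  have hT := (h.wf.upd (k := k') h.fresh.nu hρ).2
  have old : ∀ {t}, Safe E G t → Closed t → Safe E (G.after k' ρ V N i) t := by
    intro t h1 h2
    have := w2.safe (hT.safe_var h1)
    rw [h2.ren_eq] at this
    exact w1.dy.nf_iff.1 this
  have sub : ∀ x ∈ l, x.nus ⊆ V := fun x hx k hk =>
    Finset.mem_union_right _ (mem_nusList.2 ⟨x, hx, hk⟩)
  have out : ∀ x ∈ r.eout i, Safe E (G.after k' ρ V N i) x ∧
      Ev (G.after k' ρ V N i) (r.proc i) x ∧ Closed x := by
    intro x hx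
    rw [ho] at hx
    obtain ⟨y, hy, rfl⟩ := mem_map.1 hx
    have e : (y.subst (freshSubst V N)).nf = ren (stepSubst V N i) y :=
      ren_freshSubst (nl y hy) (sub y hy)
    refine ⟨w1.dy.nf_iff.1 ?_, hS.nfEv ?_, closed_freshSubst (nl y hy)⟩
    · rw [e]; exact w2.safe (hl y hy).1
    · rw [e]; exact hS.trEv w2 (hl y hy).2
  refine ⟨_, w1, ?_, fun p => ?_, fun n => ?_, fun l' hl' x hx => ?_⟩
  · rw [hN]; exact w3
  · by_cases hp : p = r.proc i
    · subst hp
      rw [hs']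
      refine ⟨hS.nf ?_, closed_freshSubst ns⟩
      have e : (s'.subst (freshSubst V N)).nf = ren (stepSubst V N i) s' :=
        ren_freshSubst ns Finset.subset_union_left
      rw [e]
      exact hS.tr w2 hI'
    · rw [hq p hp]
      refine ⟨hS.nf ?_, (h.st p).2⟩
      have := hS.tr w2 (hS.nf (hS.tr hT (h.st p).1 |> fun h => by rwa [ren_var] at h))
      rwa [(h.st p).2.ren_eq] at this
  · rw [hE']
    have hrem : ∀ n, Safe E (G.after k' ρ V N i) (removeAt (r.conf i).E k n) ∧
        Closed (removeAt (r.conf i).E k n) := by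
      intro n
      unfold removeAt
      split_ifs
      · exact ⟨old (h.ev _).1 (h.ev _).2, (h.ev _).2⟩
      · exact ⟨old (h.ev _).1 (h.ev _).2, (h.ev _).2⟩
    unfold prepend
    rw [List.getD_eq_getElem?_getD]
    cases hx : (r.eout i)[n]? with
    | none => exact hrem _
    | some x =>
      have := out x (mem_of_getElem? hx)
      exact ⟨this.1, this.2.2⟩
  · rcases Nat.lt_succ_iff_lt_or_eq.1 hl' with hl' | rfl
    · obtain ⟨h1, h2⟩ := h.sent l' hl' x hx
      refine ⟨hS.nfEv ?_, h2⟩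
      have := hS.trEv w2 (hS.nfEv (hS.trEv hT h1 |> fun h => by rwa [ren_var] at h))
      rwa [h2.ren_eq] at this
    · exact (out x hx).2

theorem Simulation.holds (hS : Simulation E sys I Ev bad) (h0 : Holds r E I Ev 0 G) {j : ℕ}
    (hj : (j : ℕ∞) ≤ r.len) (hb : ∀ i ≤ j, ∀ p, ¬ bad p ((r.conf i).S p)) :
    ∀ i ≤ j, ∃ G', Holds r E I Ev i G' := by
  intro i hi
  induction i with
  | zero => exact ⟨G, h0⟩
  | succ i ih =>
    obtain ⟨G', h⟩ := ih (by omega)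
    exact hS.holds_succ (le_trans (by exact_mod_cast hi) hj) h (hb _ hi)

end Runs

end

section

/-! # The roles in the initial configuration -/

theorem dictGet_alist_mem {α : Type*} {l : List α} {f g : α → Term}
    (hf : ∀ d ∈ l, CN (.seq [f d, g d])) (k : Term) :
    dictGet (.seq (l.map fun d => .seq [f d, g d])) k = .seq [] ∨
      ∃ d ∈ l, f d = k.nf ∧ dictGet (.seq (l.map fun d => .seq [f d, g d])) k = g d := by
  refine (dictGet_mem rfl).imp_right ?_
  rintro ⟨e, he, h⟩
  rw [items_seq, List.map_map] at he
  obtain ⟨d, hd, rfl⟩ := mem_map.1 he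
  rw [Function.comp, (hf d hd).1] at h
  simp only [Term.seq.injEq, List.cons.injEq, and_true] at h
  exact ⟨d, hd, h.1, h.2.symm⟩

theorem dictGet_alist {α : Type*} {l : List α} {f g : α → Term}
    (hf : ∀ d ∈ l, CN (.seq [f d, g d])) (hi : ∀ d ∈ l, ∀ d' ∈ l, f d = f d' → d = d') {d : α}
    (hd : d ∈ l) : dictGet (.seq (l.map fun d => .seq [f d, g d])) (f d) = g d := by
  have hcn := fun d hd => cn_seq.1 (hf d hd)
  rw [dictGet, items_seq, List.map_map]
  cases h : List.find? (fun e => decide (HasKey (f d) e))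
      (l.map (Term.nf ∘ fun d => .seq [f d, g d])) with
  | none =>
    have := List.find?_eq_none.1 h _ (List.mem_map_of_mem hd)
    simp only [Function.comp, nf_seq, map_cons, map_nil, decide_eq_true_eq,
      hasKey_pair, nf_nf, not_true_eq_false] at this
  | some e =>
    obtain ⟨d', hd', rfl⟩ := mem_map.1 (List.mem_of_find?_eq_some h)
    have hk := List.find?_some h
    simp only [Function.comp, nf_seq, map_cons, map_nil, decide_eq_true_eq,
      hasKey_pair, nf_nf] at hk ⊢
    rw [(hcn d' hd' _ (by simp)).1, (hcn d hd _ (by simp)).1] at hk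
    rw [get_pair_two, nf_nf, (hcn d' hd' _ (by simp)).1, hi d' hd' d hd (by rw [hk])]

variable {B RP IDP FWD : Type*} {W : AuthSystem B RP IDP FWD}

namespace AuthSystem

/-- The parties that are assumed to be honest: a browser, a relying party, and identity providers
and forwarders that protect some identities of the browser. -/
structure Focus (W : AuthSystem B RP IDP FWD) where
  b : B
  r : RP
  isY : IDP → Prop
  isG : FWD → Prop
  me : Identity → Prop
  /-- The browser may be close-corrupted. -/
  cc : Prop
  sk : ℕ
  sk_eq : ∀ y, isY y → sk = W.signkey y
  fd : ∀ y, isY y → ∃ g, isG g ∧ W.fwdDomain r ∈ W.dom (.fwd g)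
  me_mem : ∀ i, me i → ∃ hi : i ∈ W.ids, W.owner ⟨i, hi⟩ = b ∧ ∃ y, isY y ∧ i.domain ∈ W.dom (.idp y)

namespace Focus
variable (F : W.Focus)

def partyCls : Party B RP IDP FWD → Cls
  | .rp r => if r = F.r then .rp else .other
  | .idp y => if F.isY y then .idp else .other
  | .fwd g => if F.isG g then .fwd else .other
  | _ => .other

def cls (h : Str) : Cls := if H : ∃ p, h ∈ W.dom p then F.partyCls H.choose else .other

/-- The private keys of the honest servers and the secrets of the protected identities. -/
def priv (n : ℕ) : Prop :=
  (∃ h, F.cls h ≠ .other ∧ n = W.sslkey h) ∨ (∃ y, F.isY y ∧ n = W.signkey y) ∨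
    ∃ i, F.me i ∧ n = W.secret i

def env : Env where
  cls := F.cls
  ssl := W.sslkey
  sk := F.sk
  fd := W.fwdDomain F.r
  own a c := ∃ hi : ⟨a, c⟩ ∈ W.ids, W.owner ⟨⟨a, c⟩, hi⟩ = F.b
  me a c := F.me ⟨a, c⟩
  pubs n := n ∉ W.freshNonces ∧ ¬ F.priv n
  ids := .seq ((W.idsOf F.b).toList.map Identity.term)
  sec := .seq (((W.idsOf F.b).image Identity.domain).toList.map fun d =>
    .seq [.seq [.str d, K .https], .nonce (W.secret (W.stored F.b d))])
  km := W.keyMapping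
  da := .addr (W.dnsBrowser F.b)

def ghost : Ghost where
  n n := if F.priv n then some .priv else if n ∈ W.freshNonces then none else some .pub
  v _ := none

variable {F}

theorem cls_of_mem {h : Str} {p : Party B RP IDP FWD} (hp : h ∈ W.dom p) :
    F.cls h = F.partyCls p := by
  have H : ∃ p, h ∈ W.dom p := ⟨p, hp⟩
  rw [cls, dif_pos H]
  congr 1
  by_contra hne
  exact Finset.disjoint_left.1 (W.dom_disjoint _ _ hne) H.choose_spec hp

theorem exists_of_cls {h : Str} (hc : F.cls h ≠ .other) :
    ∃ p, h ∈ W.dom p ∧ F.partyCls p = F.cls h := by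
  by_cases H : ∃ p, h ∈ W.dom p
  · obtain ⟨p, hp⟩ := H
    exact ⟨p, hp, (cls_of_mem hp).symm⟩
  · rw [cls, dif_neg H] at hc
    exact absurd rfl hc

theorem mem_domains {h : Str} (hc : F.cls h ≠ .other) : h ∈ W.domains :=
  let ⟨p, hp, _⟩ := exists_of_cls hc
  W.dom_subset p hp

theorem cls_me {i : Identity} (hi : F.me i) : F.cls i.domain = .idp := by
  obtain ⟨-, -, y, hy, hd⟩ := F.me_mem i hi
  rw [cls_of_mem hd]
  simp [partyCls, hy]

theorem exists_isY {h : Str} (hc : F.cls h = .idp) : ∃ y, F.isY y := by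
  obtain ⟨p, -, hp⟩ := exists_of_cls (F := F) (h := h) (by simp [hc])
  rw [hc] at hp
  cases p <;> simp only [partyCls] at hp
  case idp y => exact ⟨y, by by_contra h; simp [h] at hp⟩
  all_goals first | cases hp | split_ifs at hp

theorem priv.not_fresh {n : ℕ} (h : F.priv n) : n ∉ W.freshNonces := by
  rintro ⟨h1, h2, h3⟩
  rcases h with ⟨d, hd, rfl⟩ | ⟨y, -, rfl⟩ | ⟨i, hi, rfl⟩
  · exact h1 d (mem_domains hd) rfl
  · exact h2 y rfl
  · exact h3 i (F.me_mem i hi).1 rfl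

theorem pubs_ssl {h : Str} (hd : h ∈ W.domains) (hc : F.cls h = .other) :
    F.env.pubs (W.sslkey h) := by
  refine ⟨fun hf => hf.1 h hd rfl, ?_⟩
  rintro (⟨d, hd', he⟩ | ⟨y, -, he⟩ | ⟨i, hi, he⟩)
  · rw [W.sslkey_inj hd (mem_domains hd') he] at hc
    exact hd' hc
  · exact W.ssl_ne_sign h hd y he
  · exact W.ssl_ne_secret h hd i (F.me_mem i hi).1 he

theorem pubs_sign {y : IDP} (hy : ¬ F.isY y) : F.env.pubs (W.signkey y) := by
  refine ⟨fun hf => hf.2.1 y rfl, ?_⟩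
  rintro (⟨d, hd', he⟩ | ⟨y', hy', he⟩ | ⟨i, hi, he⟩)
  · exact W.ssl_ne_sign d (mem_domains hd') y he.symm
  · exact hy (W.signkey_inj he ▸ hy')
  · exact W.sign_ne_secret y i (F.me_mem i hi).1 he

theorem pubs_secret {i : Identity} (hi : i ∈ W.ids) (hm : ¬ F.me i) : F.env.pubs (W.secret i) := by
  refine ⟨fun hf => hf.2.2 i hi rfl, ?_⟩
  rintro (⟨d, hd', he⟩ | ⟨y', hy', he⟩ | ⟨i', hi', he⟩)
  · exact W.ssl_ne_secret d (mem_domains hd') i hi he.symm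
  · exact W.sign_ne_secret y' i hi he.symm
  · exact hm (W.secret_inj hi (F.me_mem i' hi').1 he ▸ hi')

theorem mem_idsOf {b : B} {i : Identity} :
    i ∈ W.idsOf b ↔ ∃ hi : i ∈ W.ids, W.owner ⟨i, hi⟩ = b := by
  simp [idsOf]

/-- The identities whose secrets are stored in a browser. -/
theorem stored_mem {b : B} {d : Str} (h : d ∈ (W.idsOf b).image Identity.domain) :
    ∃ hi : W.stored b d ∈ W.ids, W.owner ⟨_, hi⟩ = b ∧ (W.stored b d).domain = d := by
  obtain ⟨i, hi, rfl⟩ := Finset.mem_image.1 h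
  obtain ⟨hm, rfl⟩ := mem_idsOf.1 hi
  obtain ⟨i', h1, h2, h3⟩ := W.stored_spec ⟨i, hm⟩
  rw [h3]
  exact ⟨i'.2, h1, h2⟩

theorem cn_pair {a b : Term} (ha : CN a) (hb : CN b) : CN (.seq [a, b]) := by
  simp [cn_seq, ha, hb]

theorem cn_list {α : Type*} {l : List α} {f : α → Term} (h : ∀ d ∈ l, CN (f d)) :
    CN (.seq (l.map f)) := by
  simpa [cn_seq] using h

theorem cn_str (a : Str) : CN (.str a) := ⟨rfl, by simp⟩
theorem cn_addr (a : ℕ) : CN (.addr a) := ⟨rfl, by simp⟩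
theorem cn_nonce (n : ℕ) : CN (.nonce n) := ⟨rfl, by simp⟩
theorem cn_pub (n : ℕ) : CN (.pub (.nonce n)) := ⟨rfl, by simp⟩
theorem cn_bot : CN .bot := ⟨rfl, by simp⟩
theorem cn_id (i : Identity) : CN i.term := cn_pair (cn_str _) (cn_str _)

theorem cn_keyMapping : CN W.keyMapping := cn_list fun _ _ => cn_pair (cn_str _) (cn_pub _)
theorem cn_sslkeys (D : Finset Str) : CN (W.sslkeys D) :=
  cn_list fun _ _ => cn_pair (cn_str _) (cn_nonce _)

theorem cn_ids (b : B) : CN (.seq ((W.idsOf b).toList.map Identity.term)) :=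
  cn_list fun i _ => cn_id i

theorem cn_sec (b : B) : CN (.seq (((W.idsOf b).image Identity.domain).toList.map fun d =>
    .seq [.seq [.str d, K .https], .nonce (W.secret (W.stored b d))])) :=
  cn_list fun _ _ => cn_pair (cn_pair (cn_str _) (cn_str _)) (cn_nonce _)

theorem envOK : EnvOK F.env where
  ids := cn_ids _
  sec := cn_sec _
  km := cn_keyMapping
  da := cn_addr _
  ids_seq := ⟨_, rfl⟩
  ids_own e he := by
    rw [show F.env.ids = .seq ((W.idsOf F.b).toList.map Identity.term) from rfl,
      items_of_nf (cn_ids F.b).1] at he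
    obtain ⟨i, hi, rfl⟩ := mem_map.1 he
    exact ⟨i.name, i.domain, rfl, mem_idsOf.1 (Finset.mem_toList.1 hi)⟩
  km_get h := by
    by_cases hd : h ∈ W.domains
    · left
      exact dictGet_alist (f := fun d => .str d) (g := fun d => .pub (.nonce (W.sslkey d)))
        (fun _ _ => cn_pair (cn_str _) (cn_pub _)) (fun d _ d' _ h => by simpa using h)
        (Finset.mem_toList.2 hd)
    · right
      refine ⟨not_not.1 fun hc => hd (mem_domains hc), ?_⟩
      refine (dictGet_alist_mem (f := fun d => .str d) (g := fun d => .pub (.nonce (W.sslkey d)))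
        (fun _ _ => cn_pair (cn_str _) (cn_pub _)) (.str h)).resolve_right ?_
      rintro ⟨d, h1, h2, -⟩
      cases h2
      exact hd (Finset.mem_toList.1 h1)
  km_seq := ⟨_, rfl⟩
  km_pub e he := by
    rw [show F.env.km = W.keyMapping from rfl, items_of_nf (cn_keyMapping (W := W)).1] at he
    obtain ⟨d, -, rfl⟩ := mem_map.1 he
    exact ⟨_, _, rfl⟩
  sec_get L hL := by
    refine (dictGet_alist_mem (f := fun d => .seq [.str d, K .https])
      (g := fun d => .nonce (W.secret (W.stored F.b d)))
      (fun _ _ => cn_pair (cn_pair (cn_str _) (cn_str _)) (cn_nonce _)) L.origin).symm.imp_left ?_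
    rintro ⟨d, h1, h2, h3⟩
    refine ⟨_, ?_, h3⟩
    obtain ⟨hi, -, hdom⟩ := stored_mem (Finset.mem_toList.1 h1)
    refine pubs_secret hi fun hm => ?_
    have hc := cls_me hm
    rw [hdom] at hc
    have h4 : (L.origin).nf = .seq [.str L.host, L.proto.nf] := by
      simp [Loc.origin, nf_seq, Term.nf]
    rw [h4] at h2
    simp only [Term.seq.injEq, List.cons.injEq, Term.str.injEq, and_true] at h2
    obtain ⟨rfl, h2⟩ := h2
    have hL' : L.https = true := by
      by_contra h
      simp [Loc.proto, h, Term.nf] at h2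
    simp only [Loc.cls, hL', if_true] at hL
    exact absurd (hL.symm.trans hc) (by simp)
  da_addr := ⟨_, rfl⟩
  cls_fd := by
    rintro ⟨h, hh⟩
    obtain ⟨y, hy⟩ := exists_isY hh
    obtain ⟨g, hg, hd⟩ := F.fd y hy
    exact (cls_of_mem hd).trans (by simp [partyCls, hg])
  ssl_inj h h' hc hk he := by
    refine W.sslkey_inj (mem_domains hc) ?_ he
    rcases dictGet_alist_mem (l := W.domains.toList) (f := fun d => .str d)
      (g := fun d => .pub (.nonce (W.sslkey d)))
      (fun _ _ => cn_pair (cn_str _) (cn_pub _)) (.str h') with h1 | ⟨d, h1, h2, -⟩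
    · exact absurd h1 hk
    · cases h2
      exact Finset.mem_toList.1 h1

theorem ghost_priv {n : ℕ} (h : F.priv n) : F.ghost.n n = some .priv := by simp [ghost, h]

theorem ghost_pub {n : ℕ} (h : F.env.pubs n) : F.ghost.n n = some .pub := by
  simp [ghost, h.1, h.2]

theorem gwf : GWF F.env F.ghost := by
  have hr : ∀ a ρ, F.ghost.role a = some ρ → ρ = .priv ∨ ρ = .pub := by
    intro a ρ h
    rcases Ghost.Named.cases ⟨_, h⟩ with ⟨n, rfl⟩ | ⟨v, rfl⟩ <;>
      simp only [Ghost.role, ghost] at h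
    · split_ifs at h <;> simp_all
    · cases h
  refine ⟨⟨fun h hc => ghost_priv (.inl ⟨h, hc, rfl⟩), fun a ref q h => ?_⟩, fun a ρ h => ?_,
    fun a ρ h => ?_, ?_, fun n hn => ghost_pub hn⟩
  · rcases hr _ _ h with h | h <;> cases h
  · rcases hr _ _ h with rfl | rfl <;> trivial
  · rcases hr _ _ h with rfl | rfl <;> trivial
  · rintro ⟨h, hh⟩
    obtain ⟨y, hy⟩ := exists_isY hh
    exact ghost_priv (.inr (.inl ⟨y, hy, F.sk_eq y hy⟩))

end Focus
end AuthSystem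

end

section

theorem get_subst (σ : Var → Term) (t : Term) (p : Ptr) :
    get (t.subst σ) p = ren σ (get t p) := by
  induction p generalizing t with
  | nil => exact (ren_nf σ t).symm
  | cons i p ih => exact ih (.proj i t)

theorem Emit.tr {E : Env} {G G' : Ghost} {σ : Var → Term} (hT : Tr E G σ G') {m : Term}
    (h : Emit E G m) : Emit E G' (ren σ m) := by
  rcases h with ⟨ts, rfl⟩ | ⟨y, rfl⟩ | ⟨y, h, rfl, h1, h2⟩
  · exact .inl ⟨_, ren_seq _ _⟩
  · exact .inr (.inl ⟨ren σ y, by simp⟩)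
  · refine .inr (.inr ⟨ren σ y, h, by simp, h1, fun hc => ?_⟩)
    obtain ⟨κ, ref, q, rfl, hκ⟩ := h2 hc
    exact ⟨ren σ κ, ref, q, by simp [(hT.closed _ _ hκ).2.ren_eq], hT.compat _ _ hκ⟩

variable {B RP IDP FWD : Type*} {W : AuthSystem B RP IDP FWD}

namespace AuthSystem

/-- The identities governed by an identity provider with their secrets. -/
def users (W : AuthSystem B RP IDP FWD) (y : IDP) : Term :=
  .seq ((W.ids.filter fun i => i.domain ∈ W.dom (.idp y)).toList.map
    fun i => .seq [i.term, .nonce (W.secret i)])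

namespace Focus
variable {F : W.Focus}

theorem cn_users (y : IDP) : CN (W.users y) := cn_list fun _ _ => cn_pair (cn_id _) (cn_nonce _)

theorem keysOK {p : Party B RP IDP FWD} {C : Cls} (h : F.partyCls p = C) :
    KeysOK F.env C (W.sslkeys (W.dom p)) := by
  refine ⟨_, rfl, fun e he => ?_⟩
  obtain ⟨d, hd, rfl⟩ := mem_map.1 he
  exact ⟨d, rfl, (cls_of_mem (Finset.mem_toList.1 hd)).trans h⟩

theorem safe_pubs {n : ℕ} (h : F.env.pubs n) : Safe F.env F.ghost (.nonce n) :=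
  .name ⟨.pub, ghost_pub h, trivial⟩

theorem safe_sslkeys {p : Party B RP IDP FWD} (h : F.partyCls p = .other) :
    Safe F.env F.ghost (W.sslkeys (W.dom p)) := by
  have dy := (gwf (F := F)).dy
  refine dy.seq fun e he => ?_
  obtain ⟨d, hd, rfl⟩ := mem_map.1 he
  have hd := Finset.mem_toList.1 hd
  exact dy.pair (dy.str _) (safe_pubs (pubs_ssl (W.dom_subset p hd) ((cls_of_mem hd).trans h)))

/-- The parties whose states need not be known. -/
def IsTracked (F : W.Focus) : Party B RP IDP FWD → Prop
  | .attacker => False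
  | .browser b => b = F.b
  | .rp r => r = F.r
  | .idp y => F.isY y
  | .fwd g => F.isG g

/-- The invariants of the states of the honest parties. -/
def TrackedInv (F : W.Focus) (G : Ghost) : Party B RP IDP FWD → Term → Prop
  | .attacker, _ => True
  | .browser _, t => BInv F.env G t ∨ F.cc ∧ Safe F.env G t ∧ get t [12] = K .closecorrupt
  | .rp _, t => RInv F.env G t
  | .idp y, t => IInv F.env G (W.users y) t ∧ UsersOK F.env G (W.users y)
  | .fwd _, t => FInv F.env t

/-- The invariants of the states. -/
def Inv (F : W.Focus) (G : Ghost) (p : Party B RP IDP FWD) (t : Term) : Prop :=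
  if F.IsTracked p then F.TrackedInv G p t else Safe F.env G t

/-- The invariant of the events sent by the browser. -/
def EvInv (F : W.Focus) (G : Ghost) (p : Party B RP IDP FWD) (x : Term) : Prop :=
  p = .browser F.b → ¬ F.cc → ∃ a f m, x.nf = .seq [a, f, m] ∧ Emit F.env G m

/-- The states of corrupted processes. -/
def Corrupted (F : W.Focus) : Party B RP IDP FWD → Term → Prop
  | .attacker, _ => False
  | .browser _, t => get t [12] = K .fullcorrupt ∨ ¬ F.cc ∧ get t [12] = K .closecorrupt
  | .rp _, t => ∃ l, get t [10] = .seq l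
  | .idp _, t => ∃ l, get t [5] = .seq l
  | .fwd _, t => ∃ l, get t [2] = .seq l

/-- The states of honest parties that have become corrupted. -/
def Bad (F : W.Focus) (p : Party B RP IDP FWD) (t : Term) : Prop :=
  F.IsTracked p ∧ F.Corrupted p t

theorem usersOK {y : IDP} (hy : F.isY y) : UsersOK F.env F.ghost (W.users y) := by
  intro a c hm
  obtain ⟨hi, -, y', hy', hd⟩ := F.me_mem _ hm
  have : y' = y := W.signkey_inj ((F.sk_eq y' hy').symm.trans (F.sk_eq y hy))
  subst this
  refine ⟨_, dictGet_alist (f := Identity.term) (g := fun i => .nonce (W.secret i))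
    (d := ⟨a, c⟩) (fun _ _ => cn_pair (cn_id _) (cn_nonce _)) ?_
    (Finset.mem_toList.2 (Finset.mem_filter.2 ⟨hi, hd⟩)),
    ghost_priv (.inr (.inr ⟨_, hm, rfl⟩))⟩
  rintro ⟨a, b⟩ - ⟨a', b'⟩ - h
  simpa [Identity.term] using h

end Focus

variable [Fintype IDP]

theorem rel_of_relOf {alg : Term → Term → Term → Term → Set Out} {a f m s s' : Term}
    {l : List Term} (h : relOf alg (.seq [a, f, m]) s l s') : (l, s') ∈ alg a f m s := by
  obtain ⟨_, _, _, he, h⟩ := h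
  simp only [Term.seq.injEq, List.cons.injEq, and_true] at he
  obtain ⟨rfl, rfl, rfl⟩ := he
  exact h

/-- Processes only output terms that can be derived from their input and their state. -/
theorem system_dy {p : Party B RP IDP FWD} {a f : ℕ} {m s s' : Term} {l : List Term}
    (hr : (W.system p).rel (.seq [.addr a, .addr f, m]) s l s') {P : Term → Prop} (h : DY P)
    (hν : ∀ k, P (ν k)) (hNL : ∀ t, P t → NoLam t) (hm : P m) (hs : P s) :
    OutP P (l, s') := by
  have ha := h.addr
  cases p with
  | attacker =>
    refine h.attackerRel hν (h.seq ?_) hs hr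
    exact All.mem ⟨ha _, ha _, hm⟩
  | browser b => exact h.browserAlg hν hNL (ha _) hm hs (rel_of_relOf hr)
  | rp r => exact h.rpAlg hν (ha _) (ha _) hm hs (rel_of_relOf hr)
  | idp y => exact h.idpAlg hν (ha _) (ha _) hm hs (rel_of_relOf hr)
  | fwd g => exact h.fwdAlg hν (ha _) (ha _) hm hs (rel_of_relOf hr)

namespace Focus
variable {F : W.Focus}

theorem cn_init (p : Party B RP IDP FWD) : CN (W.system p).init := by
  have hnil : CN (.seq []) := by simp [cn_seq]
  have hk := cn_keyMapping (W := W)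
  cases p with
  | attacker =>
    simp only [system, attackerInit]
    exact cn_seq.2 <| All.mem ⟨cn_sslkeys _, hk, cn_list fun _ _ => cn_pub _⟩
  | browser b =>
    simp only [system, browserInit]
    exact cn_seq.2 <| All.mem ⟨hnil, cn_ids b, cn_sec b, hnil, hnil, hnil, hk, hnil, cn_addr _, hnil, hnil, cn_bot⟩
  | rp r =>
    simp only [system, rpInit]
    exact cn_seq.2 <| All.mem ⟨cn_addr _, cn_str _, hk, cn_sslkeys _, hnil, hnil, hnil, hnil, hnil, cn_bot⟩
  | idp y =>
    simp only [system, idpInit]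
    exact cn_seq.2 <| All.mem ⟨cn_sslkeys _, cn_users y, cn_nonce _, hnil, cn_bot⟩
  | fwd g =>
    simp only [system, fwdInit]
    exact cn_seq.2 <| All.mem ⟨cn_sslkeys _, cn_bot⟩

theorem safe_init {p : Party B RP IDP FWD} (hp : ¬ F.IsTracked p) :
    Safe F.env F.ghost (W.system p).init := by
  have dy := (gwf (F := F)).dy
  have hnil : Safe F.env F.ghost (.seq []) := dy.seq (by simp)
  have hk : Safe F.env F.ghost W.keyMapping := safe_km envOK gwf
  have hid : ∀ i : Identity, Safe F.env F.ghost i.term := fun i => dy.pair (dy.str _) (dy.str _)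
  have ho : F.partyCls p = .other := by
    cases p <;> simp only [IsTracked] at hp <;> simp [partyCls, hp]
  cases p with
  | attacker =>
    refine dy.list ⟨safe_sslkeys ho, hk, dy.seq fun e he => ?_⟩
    obtain ⟨y, -, rfl⟩ := mem_map.1 he
    exact .pubn _
  | browser b =>
    refine dy.list ⟨hnil, dy.seq fun e he => ?_, dy.seq fun e he => ?_, hnil, hnil, hnil, hk, hnil,
      dy.addr _, hnil, hnil, dy.bot⟩
    · obtain ⟨i, -, rfl⟩ := mem_map.1 he
      exact hid i
    · obtain ⟨d, hd, rfl⟩ := mem_map.1 he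
      obtain ⟨hi, hb, -⟩ := stored_mem (Finset.mem_toList.1 hd)
      refine dy.pair (dy.pair (dy.str _) (dy.str _)) (safe_pubs (pubs_secret hi fun hm => hp ?_))
      obtain ⟨hi', h, -⟩ := F.me_mem _ hm
      exact hb.symm.trans h
  | rp r =>
    exact dy.list ⟨dy.addr _, dy.str _, hk, safe_sslkeys ho, hnil, hnil, hnil, hnil, hnil, dy.bot⟩
  | idp y =>
    refine dy.list ⟨safe_sslkeys ho, dy.seq fun e he => ?_, safe_pubs (pubs_sign hp), hnil, dy.bot⟩
    obtain ⟨i, hi, rfl⟩ := mem_map.1 he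
    obtain ⟨hi, hd⟩ := Finset.mem_filter.1 (Finset.mem_toList.1 hi)
    refine dy.pair (hid i) (safe_pubs (pubs_secret hi fun hm => ?_))
    have h1 := cls_me hm
    rw [cls_of_mem hd, ho] at h1
    cases h1
  | fwd g =>
    exact dy.list ⟨safe_sslkeys ho, dy.bot⟩

theorem inv_init (p : Party B RP IDP FWD) : F.Inv F.ghost p (W.system p).init := by
  have hcn := (cn_init (W := W) p).1
  by_cases hp : F.IsTracked p
  swap
  · rw [Inv, if_neg hp]; exact safe_init hp
  rw [Inv, if_pos hp]
  have hnil : Safe F.env F.ghost (.seq []) := gwf.dy.seq (by simp)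
  cases p with
  | attacker => trivial
  | browser b =>
    obtain rfl : b = F.b := hp
    refine .inl ⟨_, hcn, rfl, fun k u hu => ?_⟩
    obtain ⟨hk, rfl⟩ := List.getElem?_eq_some_iff.1 hu
    simp only [List.length_cons, List.length_nil] at hk
    interval_cases k
    · exact ⟨[], rfl, by simp⟩
    · rfl
    · rfl
    · exact ⟨[], rfl, by simp⟩
    · exact hnil
    · exact hnil
    · rfl
    · exact ⟨[], rfl, by simp⟩
    · rfl
    · exact ⟨[], rfl, by simp⟩
    · exact ⟨[], rfl, by simp⟩
    · rfl
  | rp r =>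
    obtain rfl : r = F.r := hp
    refine ⟨_, hcn, rfl, fun k u hu => ?_⟩
    obtain ⟨hk, rfl⟩ := List.getElem?_eq_some_iff.1 hu
    simp only [List.length_cons, List.length_nil] at hk
    interval_cases k
    · exact ⟨_, rfl⟩
    · rfl
    · rfl
    · exact keysOK (by simp [partyCls])
    · exact ⟨[], rfl, by simp⟩
    · exact ⟨[], rfl, by simp⟩
    · exact ⟨[], rfl, by simp⟩
    · exact ⟨[], rfl, by simp⟩
    · exact ⟨[], rfl, by simp⟩
    · rfl
  | idp y =>
    have hy : F.isY y := hp
    refine ⟨⟨_, hcn, rfl, fun k u hu => ?_⟩, usersOK hy⟩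
    obtain ⟨hk, rfl⟩ := List.getElem?_eq_some_iff.1 hu
    simp only [List.length_cons, List.length_nil] at hk
    interval_cases k
    · exact keysOK (by simp [partyCls, hy])
    · rfl
    · exact congrArg Term.nonce (F.sk_eq y hy).symm
    · exact ⟨[], rfl, by simp⟩
    · rfl
  | fwd g =>
    have hg : F.isG g := hp
    refine ⟨_, hcn, rfl, fun k u hu => ?_⟩
    obtain ⟨hk, rfl⟩ := List.getElem?_eq_some_iff.1 hu
    simp only [List.length_cons, List.length_nil] at hk
    interval_cases k
    · exact keysOK (by simp [partyCls, hg])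
    · rfl

theorem holds_init (r : Run W.system W.E0 W.freshNonces) :
    Holds r F.env F.Inv F.EvInv 0 F.ghost where
  wf := gwf
  fresh := by
    refine ⟨r.init_N.1, fun m => ?_, fun _ => rfl, fun _ _ => rfl⟩
    have h := r.init_N.2 m
    simp only [ghost]
    rw [if_neg fun hp => hp.not_fresh h, if_pos h]
  st p := by
    rw [r.init_S]
    exact ⟨inv_init p, (cn_init p).closed⟩
  ev k := by
    rw [r.init_E]
    obtain ⟨a, h⟩ := W.E0_trigger k
    rw [h]
    refine ⟨gwf.dy.event (gwf.dy.addr _) (gwf.dy.addr _) (gwf.dy.str _), ?_⟩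
    refine CN.closed (cn_seq.2 ?_)
    exact All.mem ⟨cn_addr _, cn_addr _, cn_str _⟩
  sent := by simp

end Focus
end AuthSystem

end

section

theorem DY.and {P Q : Term → Prop} (h : DY P) (h' : DY Q) : DY fun t => P t ∧ Q t where
  congr he ht := ⟨h.congr he ht.1, h'.congr he ht.2⟩
  addr a := ⟨h.addr a, h'.addr a⟩
  str a := ⟨h.str a, h'.str a⟩
  top := ⟨h.top, h'.top⟩
  bot := ⟨h.bot, h'.bot⟩
  undef := ⟨h.undef, h'.undef⟩
  pub a := ⟨h.pub a.1, h'.pub a.2⟩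
  enca a b := ⟨h.enca a.1 b.1, h'.enca a.2 b.2⟩
  deca a b := ⟨h.deca a.1 b.1, h'.deca a.2 b.2⟩
  encs a b := ⟨h.encs a.1 b.1, h'.encs a.2 b.2⟩
  decs a b := ⟨h.decs a.1 b.1, h'.decs a.2 b.2⟩
  sig a b := ⟨h.sig a.1 b.1, h'.sig a.2 b.2⟩
  checksig a b c := ⟨h.checksig a.1 b.1 c.1, h'.checksig a.2 b.2 c.2⟩
  seq a := ⟨h.seq fun t ht => (a t ht).1, h'.seq fun t ht => (a t ht).2⟩
  proj i a := ⟨h.proj i a.1, h'.proj i a.2⟩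

theorem UsersOK.tr {E : Env} {G G' : Ghost} {σ : Var → Term} {U : Term} (hT : Tr E G σ G')
    (h : UsersOK E G U) : UsersOK E G' U := fun a c hm =>
  (h a c hm).imp fun n hn => ⟨hn.1, hT.compat (.nonce n) _ hn.2⟩

theorem get_closeCorrupt {s : Term} (h : get s [12] = .bot) :
    get (closeCorrupt s) [12] = K .closecorrupt := by
  unfold closeCorrupt
  simp only
  generalize hX : setAt (setAt (setAt (setAt (setAt (setAt s [3] _) [1] _) [10] _) [11] _) [6] _)
    [4] _ = X
  have h12 : get X [12] = .bot := by
    rw [← hX]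
    iterate 6 rw [get_setAt_ne (by norm_num)]
    exact h
  obtain ⟨us, e1, e2⟩ := shape_of_get (k := 11) h12 (by simp) (by simp)
  have := get_setAt_self (v := K .closecorrupt) e1 (List.getElem?_eq_getElem e2) [] []
  rwa [setAt_nil] at this

variable {B RP IDP FWD : Type*} [Fintype IDP] {W : AuthSystem B RP IDP FWD}

namespace AuthSystem
namespace Focus
variable {F : W.Focus}

theorem Bad.step {p : Party B RP IDP FWD} {a f m s s' : Term} {l : List Term}
    (hr : (W.system p).rel (.seq [a, f, m]) s l s') (hb : F.Bad p s) (σ : Var → Term) :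
    F.Bad p (s'.subst σ) := by
  obtain ⟨ht, hc⟩ := hb
  refine ⟨ht, ?_⟩
  have key : ∀ {k us ts}, get s [k + 1] = .seq us → s' = setAt s [k + 1] (.seq ts) →
      ∃ l, get (s'.subst σ) [k + 1] = .seq l := by
    rintro k us ts h rfl
    obtain ⟨l, h⟩ := get_setAt_seq (ts := ts) (shape_of_get h (by simp) (by simp))
    exact ⟨_, by rw [get_subst, h, ren_seq]⟩
  have ne : ∀ l, ¬ Term.seq l ≈ₜ .bot := fun l h => by
    rw [equiv_iff_nf, nf_seq] at h; cases h
  cases p with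
  | attacker => exact hc
  | browser b =>
    have ho := rel_of_relOf hr
    have hn : ∃ k, get s [12] = K k := hc.elim (fun h => ⟨_, h⟩) fun h => ⟨_, h.2⟩
    obtain ⟨k, hk⟩ := hn
    unfold browserAlg at ho
    rw [if_pos (by rw [hk, equiv_iff_nf]; simp [Term.nf])] at ho
    have : s' = _ := corruptOut_state ho
    have h12 : get (s'.subst σ) [12] = get s [12] := by
      rw [get_subst, this, get_setAt_ne (by norm_num), hk]; rfl
    simpa only [Corrupted, h12] using hc
  | rp r =>
    obtain ⟨us, hc⟩ := hc
    have ho := rel_of_relOf hr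
    unfold rpAlg at ho
    rw [if_pos (.inl (by rw [hc]; exact ne _))] at ho
    exact key hc (corruptOut_state ho)
  | idp y =>
    obtain ⟨us, hc⟩ := hc
    have ho := rel_of_relOf hr
    unfold idpAlg at ho
    rw [if_pos (.inl (by rw [hc]; exact ne _))] at ho
    exact key hc (corruptOut_state ho)
  | fwd g =>
    obtain ⟨us, hc⟩ := hc
    have ho := rel_of_relOf hr
    unfold fwdAlg at ho
    rw [if_pos (.inl (by rw [hc]; exact ne _))] at ho
    exact key hc (corruptOut_state ho)

theorem Bad.mono {r : Run W.system W.E0 W.freshNonces} {j : ℕ} (hj : (j : ℕ∞) ≤ r.len)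
    {p : Party B RP IDP FWD} {i : ℕ} (hi : i ≤ j) (hb : F.Bad p ((r.conf i).S p)) :
    F.Bad p ((r.conf j).S p) := by
  induction j, hi using Nat.le_induction with
  | base => exact hb
  | succ j hij ih =>
    have ih := ih (le_trans (by exact_mod_cast j.le_succ) hj)
    obtain ⟨k, a, f, m, l, s', -, he, -, hrel, -, hs', hq, -⟩ := r.step j hj
    by_cases hp : p = r.proc j
    · subst hp
      rw [he] at hrel
      rw [hs']
      exact ih.step hrel _
    · rwa [hq p hp]

omit [Fintype IDP] in
theorem Inv.tr {G G' : Ghost} {σ : Var → Term} {p : Party B RP IDP FWD} {t : Term}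
    (hT : Tr F.env G σ G') (h : F.Inv G p t) : F.Inv G' p (ren σ t) := by
  unfold Inv at h ⊢
  split_ifs at h ⊢ with hp
  · cases p with
    | attacker => trivial
    | browser b =>
      refine h.imp (hT.bInv envOK.toEnvClosed) fun ⟨h1, h2, h3⟩ => ⟨h1, hT.safe h2, ?_⟩
      change get (t.subst σ).nf [12] = _
      rw [get_nf, get_subst, h3]; rfl
    | rp r => exact hT.rInv envOK.toEnvClosed h
    | idp y => exact ⟨h.1.ren (cn_users y) hT, h.2.tr hT⟩
    | fwd g => exact FInv.ren h
  · exact hT.safe h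

omit [Fintype IDP] in
theorem Inv.of_nf {G : Ghost} {p : Party B RP IDP FWD} {t : Term} (h : F.Inv G p t.nf) :
    F.Inv G p t := by
  unfold Inv at h ⊢
  split_ifs at h ⊢ with hp
  · cases p with
    | attacker => trivial
    | browser b => exact h.imp Comps.of_nf fun ⟨h1, h2, h3⟩ =>
        ⟨h1, by rwa [Safe, nf_nf] at h2, by rwa [get_nf] at h3⟩
    | rp r => exact Comps.of_nf h
    | idp y => exact ⟨Comps.of_nf h.1, h.2⟩
    | fwd g =>
      have h : FInv F.env t.nf := h
      exact Comps.of_nf h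
  · rwa [Safe, nf_nf] at h

theorem Inv.step {G : Ghost} {p : Party B RP IDP FWD} {a f : ℕ} {m s s' : Term} {l : List Term}
    (hG : GWF F.env G) (h0 : G.NoNu) (hI : F.Inv G p s) (hs : Closed s) (hm : Safe F.env G m)
    (hmc : Closed m) (hr : (W.system p).rel (.seq [.addr a, .addr f, m]) s l s') :
    (∀ σ, F.Bad p (s'.subst σ)) ∨ ∃ k ρ, NuOK F.env G ρ ∧
      (∀ x ∈ l, Safe F.env (G.upd k ρ) x ∧ F.EvInv (G.upd k ρ) p x) ∧
      F.Inv (G.upd k ρ) p s' := by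
  have ha := hG.dy.addr
  obtain ⟨hG', hT⟩ := hG.upd (k := 0) h0 nuOK_pub
  -- the adversary
  have dy : Safe F.env G s → (∀ x ∈ l, Safe F.env (G.upd 0 .pub) x) ∧
      Safe F.env (G.upd 0 .pub) s' := by
    intro hss
    have := system_dy hr (hG'.dy.and NoLam.dy) (fun k => ⟨(known_nu (by simp [Ghost.upd])).safe,
      noLam_nu k⟩) (fun t ht => ht.2) ⟨hT.safe_var hm, hmc.noLam⟩ ⟨hT.safe_var hss, hs.noLam⟩
    exact ⟨fun x hx => (this.1 x hx).1, this.2.1⟩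
  have noEv : ∀ {G' : Ghost} {x}, p ≠ .browser F.b → F.EvInv G' p x :=
    fun h h' => absurd h' h
  unfold Inv at hI ⊢
  by_cases hp : F.IsTracked p
  swap
  · rw [if_neg hp] at hI
    obtain ⟨h1, h2⟩ := dy hI
    refine .inr ⟨0, .pub, nuOK_pub, fun x hx => ⟨h1 x hx, noEv ?_⟩, by rwa [if_neg hp]⟩
    rintro rfl
    exact hp rfl
  rw [if_pos hp] at hI
  have bad : ∀ {k}, (∃ l, get s' [k] = .seq l) → ∀ σ, ∃ l, get (s'.subst σ) [k] = .seq l := by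
    rintro k ⟨l, h⟩ σ
    exact ⟨_, by rw [get_subst, h, ren_seq]⟩
  cases p with
  | attacker => exact hp.elim
  | browser b =>
    have hb : b = F.b := hp
    subst hb
    have ho := rel_of_relOf hr
    rcases hI with hI | ⟨h1, h2, h3⟩
    · have h12 : get s [12] = .bot := hI.comp (k := 11) (by norm_num)
      rcases hI.step envOK hG h0 hs (ha a) hm ho with h | ⟨k, ρ, hρ, h | ⟨h4, h5, h6⟩⟩
      · obtain ⟨rfl, rfl⟩ := Prod.mk.inj h
        refine .inl fun σ => ⟨hp, .inl ?_⟩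
        obtain ⟨us, e1, e2⟩ := Comps.shape hI (k := 11) (by norm_num)
        have := get_setAt_self (v := K .fullcorrupt) e1 (List.getElem?_eq_getElem e2) [] []
        rw [setAt_nil] at this
        rw [get_subst, this]; rfl
      · refine .inr ⟨k, ρ, hρ, fun x hx => ⟨(h.1 x hx).1, fun _ _ => ?_⟩, ?_⟩
        · obtain ⟨-, a, f, m, rfl, he⟩ := h.1 x hx
          exact ⟨_, _, _, nf_seq _, he⟩
        · rw [if_pos hp]
          exact .inl h.2
      · have h7 : get s' [12] = K .closecorrupt := by
          rw [show s' = _ from h6]; exact get_closeCorrupt h12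
        by_cases hcc : F.cc
        · refine .inr ⟨k, ρ, hρ, ?_, ?_⟩
          · rw [show l = [] from h4]; simp
          · rw [if_pos hp]
            exact .inr ⟨hcc, h5, h7⟩
        · refine .inl fun σ => ⟨hp, .inr ⟨hcc, ?_⟩⟩
          rw [get_subst, h7]; rfl
    · obtain ⟨h4, h5⟩ := dy h2
      refine .inr ⟨0, .pub, nuOK_pub, fun x hx => ⟨h4 x hx, fun _ h => absurd h1 h⟩, ?_⟩
      rw [if_pos hp]
      refine .inr ⟨h1, h5, ?_⟩
      unfold browserAlg at ho
      rw [if_pos (by rw [h3, equiv_iff_nf]; simp [Term.nf])] at ho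
      have : s' = _ := corruptOut_state ho
      rw [this, get_setAt_ne (by norm_num), h3]
  | rp r =>
    refine (hI.step envOK (fun i j h => cls_me h) hG h0 hs (ha a) (ha f) hm
      (rel_of_relOf hr)).imp (fun h σ => ⟨hp, bad h σ⟩) ?_
    rintro ⟨k, ρ, hρ, h1, h2, -⟩
    exact ⟨k, ρ, hρ, fun x hx => ⟨h1 x hx, noEv (by simp)⟩, by rwa [if_pos hp]⟩
  | idp y =>
    refine (hI.1.step hG h0 (cn_users y) hI.2 (ha a) (ha f) hm hmc
      (rel_of_relOf hr)).imp (fun h σ => ⟨hp, bad h σ⟩) ?_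
    rintro ⟨k, ρ, hρ, h1, h2⟩
    exact ⟨k, ρ, hρ, fun x hx => ⟨h1 x hx, noEv (by simp)⟩, by rw [if_pos hp]; exact ⟨h2, hI.2⟩⟩
  | fwd g =>
    refine (FInv.step hG hI (ha a) (ha f) hm
      (rel_of_relOf hr)).imp (fun h σ => ⟨hp, bad h σ⟩) ?_
    rintro ⟨h1, h2⟩
    exact ⟨0, .pub, nuOK_pub, fun x hx => ⟨hT.safe_var (h1 x hx), noEv (by simp)⟩,
      by rwa [if_pos hp]⟩

theorem simulation : Simulation F.env W.system F.Inv F.EvInv F.Bad where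
  tr := Inv.tr
  nf := Inv.of_nf
  trEv {G σ G' p t} hT h hp hcc := by
    obtain ⟨a, f, m, h1, h2⟩ := h hp hcc
    refine ⟨ren σ a, ren σ f, ren σ m, ?_, h2.tr hT⟩
    rw [nf_ren, ← ren_nf, h1]
    simp
  nfEv h hp hcc := by simpa only [nf_nf] using h hp hcc
  noLam hr hm hs := system_dy hr NoLam.dy noLam_nu (fun _ h => h) hm hs
  step := Inv.step

/-- The invariants hold in all configurations up to one in which no honest party has become
corrupted. -/
theorem exists_holds {r : Run W.system W.E0 W.freshNonces} {j : ℕ} (hj : (j : ℕ∞) ≤ r.len)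
    (hb : ∀ p, ¬ F.Bad p ((r.conf j).S p)) {i : ℕ} (hi : i ≤ j) :
    ∃ G, Holds r F.env F.Inv F.EvInv i G :=
  simulation.holds (holds_init r) hj (fun _ hi p h => hb p (h.mono hj hi)) i hi

end Focus
end AuthSystem

end

section

variable {B RP IDP FWD : Type*} [Fintype IDP] {W : AuthSystem B RP IDP FWD}

namespace AuthSystem
namespace Focus

omit [Fintype IDP] in
theorem not_bad {F : W.Focus} {c : Config (Party B RP IDP FWD)}
    (hb : ¬ get (c.S (.browser F.b)) [12] = K .fullcorrupt)
    (hcc : ¬ F.cc → HonestBrowser c F.b) (hr : HonestRP c F.r)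
    (hy : ∀ y, F.isY y → HonestIDP c y) (hg : ∀ g, F.isG g → HonestFWD c g)
    (p : Party B RP IDP FWD) : ¬ F.Bad p (c.S p) := by
  have ne : ∀ {t}, t ≈ₜ .bot → ¬ ∃ l, t = .seq l := by
    rintro _ h ⟨l, rfl⟩
    rw [equiv_iff_nf, nf_seq] at h
    cases h
  rintro ⟨hp, hc⟩
  cases p with
  | attacker => exact hc
  | browser b =>
    have hb' : b = F.b := hp
    subst hb'
    rcases hc with hc | ⟨h, hc⟩
    · exact hb hc
    · have := hcc h
      rw [HonestBrowser, hc, equiv_iff_nf] at this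
      cases this
  | rp r =>
    have hr' : r = F.r := hp
    subst hr'
    exact ne hr hc
  | idp y => exact ne (hy y hp) hc
  | fwd g => exact ne (hg g hp) hc

/-- Service tokens for protected identities are not derivable for the adversary. -/
theorem not_derivable {F : W.Focus} {r : Run W.system W.E0 W.freshNonces} {j : ℕ}
    (hj : (j : ℕ∞) ≤ r.len) (hb : ∀ p, ¬ F.Bad p ((r.conf j).S p)) {n : Term} {i : Identity}
    (hi : F.me i) (htok : HasToken (r.conf j) F.r (.seq [n, i.term])) :
    .seq [n, i.term] ∉ derivable ∅ {(r.conf j).S .attacker} := by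
  intro hd
  obtain ⟨G, h⟩ := exists_holds hj hb le_rfl
  have dy := h.wf.dy
  have hI : RInv F.env G ((r.conf j).S (.rp F.r)) := by
    have := (h.st (.rp F.r)).1
    rwa [Inv, if_pos (show F.IsTracked (.rp F.r) from rfl)] at this
  have hA : Safe F.env G ((r.conf j).S .attacker) := by
    have := (h.st .attacker).1
    rwa [Inv, if_neg (show ¬ F.IsTracked .attacker from id)] at this
  have hS : Safe F.env G n := dy.of_seq
    (dy.derivable (by simp) (by rintro _ rfl; exact hA) hd) (u := n) (by simp)
  obtain ⟨t, ht, he⟩ := htok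
  have h8 : SeqOf (RpToken F.env G) (get ((r.conf j).S (.rp F.r)) [8]) :=
    hI.comp (k := 7) (by norm_num)
  obtain ⟨n', a, c, rfl, hp⟩ := h8.mem (nf_get _ _) ht
  rw [equiv_iff_nf, nf_of_mem_items ht, nf_seq] at he
  simp only [map_cons, map_nil, Term.seq.injEq, List.cons.injEq, and_true] at he
  obtain ⟨rfl, he⟩ := he
  have he : Term.seq [.str a, .str c] = .seq [.str i.name, .str i.domain] := he
  simp only [Term.seq.injEq, List.cons.injEq, Term.str.injEq, and_true] at he
  obtain ⟨rfl, rfl⟩ := he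
  exact not_safe (hp hi) id (dy.nf_iff.2 hS)

/-- Tokens that are created on requests of the honest browser are tokens for its identities. -/
theorem own_of_createsToken {F : W.Focus} (hcc : ¬ F.cc) {r : Run W.system W.E0 W.freshNonces}
    {j l : ℕ} (hj : (j : ℕ∞) ≤ r.len) (hb : ∀ p, ¬ F.Bad p ((r.conf j).S p)) (hl : l < j)
    {m n : Term} {i : Identity} (hc : r.CreatesToken l F.r m (.seq [n, i.term]))
    (hs : r.SentBefore l F.b m) : F.env.own i.name i.domain := by
  obtain ⟨G, h⟩ := exists_holds hj hb hl.le
  have hl' : ((l + 1 : ℕ) : ℕ∞) ≤ r.len := le_trans (by exact_mod_cast hl) hj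
  obtain ⟨hpr, ⟨a₀, f₀, he⟩, hold, hnew⟩ := hc
  obtain ⟨k, a, f, m', out, s', hk, he', -, hrel, -, hs', -, -⟩ := r.step l hl'
  rw [he] at he' hk
  simp only [Term.seq.injEq, List.cons.injEq, and_true] at he'
  obtain ⟨rfl, rfl, rfl⟩ := he'
  have hm : Safe F.env G m := h.wf.dy.of_seq (by rw [← hk]; exact (h.ev k).1) (by simp)
  rw [hpr] at hrel hs'
  rw [he] at hrel
  obtain ⟨hI, hcl⟩ := h.st (.rp F.r)
  rw [Inv, if_pos (show F.IsTracked (.rp F.r) from rfl)] at hI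
  have hI : RInv F.env G ((r.conf l).S (.rp F.r)) := hI
  rcases hI.step envOK (fun i j h => cls_me h) h.wf h.fresh.nu hcl (h.wf.dy.addr _)
    (h.wf.dy.addr _) hm (rel_of_relOf hrel) with ⟨u, hu⟩ | ⟨k', ρ, -, -, hI', htok⟩
  · refine absurd (Bad.mono hj hl (p := .rp F.r) ⟨rfl, ?_⟩) (hb _)
    exact ⟨_, by rw [hs', get_subst, hu, ren_seq]⟩
  obtain ⟨t, ht, hte⟩ := hnew
  rw [hs', get_subst] at ht
  obtain ⟨ts, h8, -⟩ : SeqOf (RpToken F.env (G.upd k' ρ)) (get s' [8]) :=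
    hI'.comp (k := 7) (by norm_num)
  rw [h8, ren_seq, items_seq, List.map_map] at ht
  obtain ⟨t₀, ht₀, rfl⟩ := mem_map.1 ht
  rw [Function.comp, nf_ren] at hte
  have hmem : t₀ ∈ items (get s' [8]) := by
    rwa [items_of_nf (by rw [nf_get, h8])]
  rcases htok t₀ hmem with ho | ⟨n', a', c', rfl, d, x, κ, hd, hmn, hown⟩
  · have hc₀ : Closed t₀ := Closed.dy.items (Closed.dy.get hcl [8]) ho
    rw [hc₀.ren_eq, nf_of_mem_items ho] at hte
    exact absurd ⟨t₀, ho, hte⟩ hold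
  · rw [equiv_iff_nf, nf_ren, nf_seq, ren_seq] at hte
    simp only [map_cons, map_nil, Term.seq.injEq, List.cons.injEq, and_true] at hte
    have he := hte.2
    have he : Term.seq [.str a', .str c'] = .seq [.str i.name, .str i.domain] := he
    simp only [Term.seq.injEq, List.cons.injEq, Term.str.injEq, and_true] at he
    obtain ⟨rfl, rfl⟩ := he
    refine hown ?_
    obtain ⟨l', hl'', hp', a₁, f₁, m₁, hx, hme⟩ := hs
    obtain ⟨a₂, f₂, m₂, h1, h2⟩ := (h.sent l' hl'' _ hx).1 hp' hcc
    rw [nf_seq] at h1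
    simp only [map_cons, map_nil, Term.seq.injEq, List.cons.injEq, and_true] at h1
    rw [← h1.2.2, equiv_iff_nf.1 hme, hmn] at h2
    rcases h2 with ⟨_, h2⟩ | ⟨_, h2⟩ | ⟨y, h', h2, h3, h4⟩
    · cases h2
    · cases h2
    · simp only [Term.enca.injEq, Term.pub.injEq, Term.nonce.injEq] at h2
      obtain ⟨rfl, h2⟩ := h2
      have := envOK.ssl_inj d h' (by rw [hd]; simp) h3 h2
      subst this
      obtain ⟨κ', ref, q, h5, h6⟩ := h4 hd
      simp only [Term.seq.injEq, List.cons.injEq, and_true] at h5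
      exact ⟨ref, q, h5.2 ▸ h6⟩

end Focus
end AuthSystem

end

end
end Spresso

theorem theorem2 {B RP IDP FWD : Type*} [Fintype IDP] (W : Spresso.AuthSystem B RP IDP FWD)
    (ρ : Spresso.Run W.system W.E0 W.freshNonces) (j : ℕ) (hj : (j : ℕ∞) ≤ ρ.len)
    (r : RP) (hr : Spresso.HonestRP (ρ.conf j) r)
    (g : FWD) (hg : W.fwdDomain r ∈ W.dom (.fwd g)) (hgh : Spresso.HonestFWD (ρ.conf j) g)
    (n : Spresso.Term) (i : Spresso.Identity) (hi : i ∈ W.ids)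
    (htok : Spresso.HasToken (ρ.conf j) r (.seq [n, i.term])) :
    -- (A)
    (Spresso.Term.seq [n, i.term] ∈ Spresso.derivable ∅ {(ρ.conf j).S .attacker} →
      Spresso.FullyCorrupted (ρ.conf j) (W.owner ⟨i, hi⟩) ∨
      ¬ ∃ y, i.domain ∈ W.dom (.idp y) ∧ Spresso.HonestIDP (ρ.conf j) y) ∧
    -- (B)
    (∀ (l : ℕ) (m : Spresso.Term) (b : B), l < j → ρ.CreatesToken l r m (.seq [n, i.term]) →
      ρ.SentBefore l b m → Spresso.HonestBrowser (ρ.conf j) b → W.owner ⟨i, hi⟩ = b) := by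
  classical
  constructor
  · intro hd
    by_contra hcon
    rw [not_or, not_not] at hcon
    obtain ⟨hb, y, hy, hyh⟩ := hcon
    let F : W.Focus :=
      { b := W.owner ⟨i, hi⟩
        r := r
        isY := (· = y)
        isG := (· = g)
        me := (· = i)
        cc := True
        sk := W.signkey y
        sk_eq := by rintro _ rfl; rfl
        fd := fun _ _ => ⟨g, rfl, hg⟩
        me_mem := by rintro _ rfl; exact ⟨hi, rfl, y, rfl, hy⟩ }
    refine Spresso.AuthSystem.Focus.not_derivable (F := F) hj ?_ rfl htok hd
    refine Spresso.AuthSystem.Focus.not_bad (fun h => hb ?_) (fun h => absurd trivial h) hr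
      (fun y' (h : y' = y) => h ▸ hyh) (fun g' (h : g' = g) => h ▸ hgh)
    rw [Spresso.FullyCorrupted, h]
    exact .refl _
  · intro l m b hl hc hs hb
    let F : W.Focus :=
      { b := b
        r := r
        isY := fun _ => False
        isG := fun _ => False
        me := fun _ => False
        cc := False
        sk := 0
        sk_eq := fun _ h => h.elim
        fd := fun _ h => h.elim
        me_mem := fun _ h => h.elim }
    refine (Spresso.AuthSystem.Focus.own_of_createsToken (F := F) id hj ?_ hl hc hs).2
    refine Spresso.AuthSystem.Focus.not_bad (fun h => ?_) (fun _ => hb) hr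
      (fun _ h => h.elim) (fun _ h => h.elim)
    rw [Spresso.HonestBrowser, h, Spresso.equiv_iff_nf] at hb
    cases hb
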